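/- Let $G$ be an infinite bipartite isoradial graph filling the plane, given by its rhombus graph: a locally finite edge-to-edge tiling of $\mathbb{C}$ by rhombi of side length $1$, one rhombus for each edge of $G$, whose corners are in cyclic order a white vertex, a face (dual vertex), a black vertex and a face. Assume that the rhombus angles are bounded away from $0$ and $\pi$. Orient the edges of the rhombus graph away from white and towards black vertices. For adjacent $b$ (black) and $w$ (white), let $e^{i\varphi}, e^{i\vartheta}$ with $\vartheta-\pi<\varphi<\vartheta$ be the two sides at $w$ of the rhombus of the edge $bw$, as vectors pointing away from $w$. Put $\bar\partial(b,w)=i(e^{i\vartheta}-e^{i\varphi})$, and $\bar\partial(b,w)=0$ if $b,w$ are not adjacent. Let $\bar\partial^{-1}$ be the inverse of $\bar\partial$: a matrix $\bar\partial^{-1}(w,b)$ with $\sum_w\bar\partial(b,w)\bar\partial^{-1}(w,b')=\delta_{b,b'}$, $\sum_b\bar\partial^{-1}(w,b)\bar\partial(b,w')=\delta_{w,w'}$, and, for every $w$, $\bar\partial^{-1}(w,b)\to0$ as $b\to\infty$. Let $\theta_0\in\mathbb{R}$, let $F,F'$ be faces, and let $F=v_0\to v_1\to\dots\to v_{2P}=F'$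 ($P\ge1$) be a path on the rhombus graph with $v_{j+1}-v_j=e^{i\phi_j}$, $\theta_0-\frac{\pi}{2}<\phi_j<\theta_0+\frac{\pi}{2}$ (for example with $\theta_0=\arg(F'-F)$, when there is such a path). The straight-line zipper along this path is the following set of edges: for every white $v_{2j-1}$, the edges to those of its black neighbours that lie to the left of the path, and for every black $v_{2j-1}$, the edges to those of its white neighbours that lie to the right of the path. Let $\bar\partial_{\mathrm{zip}}$ be the restriction of $\bar\partial$ to these edges (all other entries are replaced by $0$), and let $K=\bar\partial_{\mathrm{zip}}\,\bar\partial^{-1}$, a matrix indexed by the black vertices with finitely many nonzero rows. Let $g(z)=g_{F\to F'}(z)$ be the discrete exponential: for any path from $F$ to $F'$ on the rhombus graph, $g(z)$ is the product over the steps $u\to v$ of the path of $\frac{1}{z-(v-u)}$ if the step follows the orientation, and of $z-(u-v)$ if it goes against it. Then for every integer $n\ge1$ $$\mathcal I_{2n}:=\mathrm{tr}\big[(K(1-K))^n\big]=\sum_{j=0}^{n}(-1)^{n-j}\binom nj\,\mathrm{tr}\big[K^{2n-j}\big]$$ and $$\mathcal I_{2n}=\frac{1}{(2\pi)^{2n}}\int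 dz_1\cdots\int dz_{2n}\;\frac{\prod_{j=1}^{2n}\Big(1-\frac{g(z_j)}{g(z_{j+1})}\Big)}{(z_1-z_2)(z_2-z_3)\cdots(z_{2n}-z_1)},\qquad z_{2n+1}:=z_1,$$ where $z_j$ runs along the ray $0\to-ie^{i\theta_0}\infty$ for odd $j$ and along the ray $0\to+ie^{i\theta_0}\infty$ for even $j$, and the multiple integral converges absolutely. -/

import Mathlib

/-- A non-degenerate rhombus with unit sides, cut along its diagonal by an edge joining a white
vertex `w` to a black vertex `b = r + l - w`.  The other two corners `r`, `l` are the dual vertices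
(faces) to the right and to the left of the edge directed from `w` to `b`. -/
@[ext] structure Rhombus where
  w : ℂ
  r : ℂ
  l : ℂ
  norm_r : ‖r - w‖ = 1
  norm_l : ‖l - w‖ = 1
  ccw : 0 < ((starRingEnd ℂ) (r - w) * (l - w)).im

namespace Rhombus

/-- The black corner. -/
def b (t : Rhombus) : ℂ := t.r + t.l - t.w

/-- The four corners. -/
def corners (t : Rhombus) : Set ℂ := {t.w, t.r, t.b, t.l}

/-- The closed rhombus as a region of the plane. -/
def carrier (t : Rhombus) : Set ℂ := convexHull ℝ t.corners

end Rhombus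

/-- A bipartite isoradial graph filling the plane, given by its rhombus graph: a locally finite
edge-to-edge tiling of the plane by unit rhombi, one for each edge of the isoradial graph, where the
white vertices, the black vertices and the dual vertices are three disjoint sets. -/
structure IsoradialGraph where
  tiles : Set Rhombus
  cover : ∀ z : ℂ, ∃ t ∈ tiles, z ∈ t.carrier
  interior_disjoint : ∀ t ∈ tiles, ∀ t' ∈ tiles, t ≠ t' →
    Disjoint (interior t.carrier) (interior t'.carrier)
  edge_to_edge : ∀ t ∈ tiles, ∀ t' ∈ tiles, ∀ x ∈ t.corners, x ∈ t'.carrier → x ∈ t'.corners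
  locally_finite : ∀ R : ℝ, {t ∈ tiles | (t.carrier ∩ Metric.closedBall 0 R).Nonempty}.Finite
  white_ne_black : ∀ t ∈ tiles, ∀ t' ∈ tiles, t.w ≠ t'.b
  white_ne_face : ∀ t ∈ tiles, ∀ t' ∈ tiles, t.w ≠ t'.r ∧ t.w ≠ t'.l
  black_ne_face : ∀ t ∈ tiles, ∀ t' ∈ tiles, t.b ≠ t'.r ∧ t.b ≠ t'.l

namespace IsoradialGraph

variable (G : IsoradialGraph)

/-- The white vertices. -/
def white : Set ℂ := {x | ∃ t ∈ G.tiles, t.w = x}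

/-- The black vertices. -/
def black : Set ℂ := {x | ∃ t ∈ G.tiles, t.b = x}

/-- The dual vertices, that is, the (centres of the) faces of the isoradial graph. -/
def face : Set ℂ := {x | ∃ t ∈ G.tiles, t.r = x ∨ t.l = x}

/-- The rhombus angles are bounded away from `0` and `π`: their sines are bounded below. -/
def Regular : Prop :=
  ∃ ε : ℝ, 0 < ε ∧ ∀ t ∈ G.tiles, ε ≤ ((starRingEnd ℂ) (t.r - t.w) * (t.l - t.w)).im

/-- The edges of the rhombus graph, oriented away from white vertices and towards black ones. -/
def Arrow (x y : ℂ) : Prop :=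
  ∃ t ∈ G.tiles, (x = t.w ∧ (y = t.r ∨ y = t.l)) ∨ ((x = t.r ∨ x = t.l) ∧ y = t.b)

/-- Paths from `x` on the rhombus graph, whose steps go along or against the orientation. -/
inductive LatticePath (x : ℂ) : ℂ → Type
  | refl : LatticePath x x
  | along {u v : ℂ} (p : LatticePath x u) (h : G.Arrow u v) : LatticePath x v
  | against {u v : ℂ} (p : LatticePath x u) (h : G.Arrow v u) : LatticePath x v

variable {G}

/-- The discrete exponential `g_{x → y}(z)`, computed along a path from `x` to `y`: a step from `u`
to `v` along the orientation divides by `z - (v - u)`, and a step against it multiplies by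
`z - (u - v)`. -/
noncomputable def LatticePath.discreteExp {x : ℂ} : {y : ℂ} → G.LatticePath x y → ℂ → ℂ
  | _, .refl, _ => 1
  | _, .along (u := u) (v := v) p _, z => p.discreteExp z * (1 / (z - (v - u)))
  | _, .against (u := u) (v := v) p _, z => p.discreteExp z * (z - (u - v))

variable (G)

open Classical in
/-- The matrix of the discrete operator from black to white vertices: its entry at an edge with
rhombus vectors `e^{iϑ} = l - w`, `e^{iφ} = r - w` is `i (e^{iϑ} - e^{iφ})`.
(The edge determines its rhombus.) -/
noncomputable def dbar (b : G.black) (w : G.white) : ℂ :=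
  if h : ∃ t ∈ G.tiles, t.b = b ∧ t.w = w then
    Complex.I * ((h.choose.l - h.choose.w) - (h.choose.r - h.choose.w))
  else 0

open Classical in
/-- `C` is the inverse of `dbar`: a two-sided inverse whose entries `C w b` tend to `0` as `b` tends
to infinity.  The sums have finitely many nonzero terms. -/
structure IsInverse (C : G.white → G.black → ℂ) : Prop where
  dbar_mul : ∀ b b' : G.black, ∑ᶠ w : G.white, G.dbar b w * C w b' = if b = b' then 1 else 0
  mul_dbar : ∀ w w' : G.white, ∑ᶠ b : G.black, C w b * G.dbar b w' = if w = w' then 1 else 0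
  decay : ∀ w : G.white, Filter.Tendsto (C w)
    (Filter.comap (fun b : G.black => (b : ℂ)) (Filter.cocompact ℂ)) (nhds 0)

/-- A path `F = v 0, v 1, …, v (2 P) = F'` on the rhombus graph between two faces whose step
directions `e^{i φ j}` all satisfy `θ₀ - π/2 < φ j < θ₀ + π/2`. -/
structure StraightPath (θ₀ : ℝ) (F F' : ℂ) where
  P : ℕ
  v : ℕ → ℂ
  φ : ℕ → ℝ
  pos : 0 < P
  start : v 0 = F
  finish : v (2 * P) = F'
  isFace : ∀ j ≤ P, v (2 * j) ∈ G.face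
  adj : ∀ j < 2 * P, G.Arrow (v j) (v (j + 1)) ∨ G.Arrow (v (j + 1)) (v j)
  step : ∀ j < 2 * P, v (j + 1) - v j = Complex.exp (φ j * Complex.I)
  angle : ∀ j < 2 * P, θ₀ - Real.pi / 2 < φ j ∧ φ j < θ₀ + Real.pi / 2

variable {G}

namespace StraightPath

variable {θ₀ : ℝ} {F F' : ℂ} (γ : G.StraightPath θ₀ F F')

/-- The edges of the straight-line zipper.  At a white vertex `v (2 j + 1)` of the path these are
the edges to its black neighbours on the left of the path: the rhombi between the outgoing step and
the reversed incoming step, counterclockwise.  At a black vertex `v (2 j + 1)` these are the edges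
to its white neighbours on the right of the path: the rhombi whose sides, directed towards the black
vertex, lie between the incoming step and the reversed outgoing step, counterclockwise. -/
def zipper : Set Rhombus :=
  {t | t ∈ G.tiles ∧ ∃ j < γ.P, ∃ a c : ℝ, a < c ∧
    t.r - t.w = Complex.exp (a * Complex.I) ∧ t.l - t.w = Complex.exp (c * Complex.I) ∧
    ((t.w = γ.v (2 * j + 1) ∧ γ.φ (2 * j + 1) ≤ a ∧ c ≤ γ.φ (2 * j) + Real.pi) ∨
     (t.b = γ.v (2 * j + 1) ∧ γ.φ (2 * j) ≤ a ∧ c ≤ γ.φ (2 * j + 1) + Real.pi))}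

theorem zipper_finite : γ.zipper.Finite := by
  have h : ∀ j : ℕ, {t ∈ G.tiles | γ.v (2 * j + 1) ∈ t.carrier}.Finite := fun j => by
    refine (G.locally_finite ‖γ.v (2 * j + 1)‖).subset ?_
    rintro t ⟨ht, hv⟩
    exact ⟨ht, _, hv, by simp⟩
  refine ((Set.finite_lt_nat γ.P).biUnion fun j _ => h j).subset ?_
  rintro t ⟨ht, j, hj, a, c, -, -, -, h⟩
  refine Set.mem_biUnion (x := j) hj ⟨ht, ?_⟩
  rcases h with ⟨h, -⟩ | ⟨h, -⟩ <;> rw [← h] <;>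
    exact subset_convexHull ℝ _ (by simp [Rhombus.corners])

open Classical in
/-- The restriction of the matrix `dbar` to the edges of the zipper. -/
noncomputable def dbarZip (b : G.black) (w : G.white) : ℂ :=
  if ∃ t ∈ γ.zipper, t.b = b ∧ t.w = w then G.dbar b w else 0

/-- The column with index `b'` of the matrix product of `dbarZip` and `C`. -/
noncomputable def kernelColumn (C : G.white → G.black → ℂ) (b' : G.black) : G.black →₀ ℂ :=
  Finsupp.ofSupportFinite (fun b => ∑ᶠ w : G.white, γ.dbarZip b w * C w b') (by
    have h : ((fun b : G.black => (b : ℂ)) ⁻¹' (Rhombus.b '' γ.zipper)).Finite :=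
      (γ.zipper_finite.image _).preimage Subtype.val_injective.injOn
    refine h.subset fun b hb => ?_
    by_contra hn
    refine hb (finsum_eq_zero_of_forall_eq_zero fun w => ?_)
    rw [dbarZip, if_neg, zero_mul]
    rintro ⟨t, ht, htb, -⟩
    exact hn ⟨t, ht, htb⟩)

/-- The matrix product `K` of `dbarZip` and `C`, acting on finitely supported functions on the black
vertices. -/
noncomputable def kernel (C : G.white → G.black → ℂ) : Module.End ℂ (G.black →₀ ℂ) :=
  Finsupp.linearCombination ℂ (γ.kernelColumn C)

end StraightPath

/-- The trace of an infinite matrix with index set the black vertices, as the sum of its diagonal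
entries.  It is used for matrices with finitely many nonzero rows, where the sum is finite. -/
noncomputable def trace (T : Module.End ℂ (G.black →₀ ℂ)) : ℂ :=
  ∑ᶠ b : G.black, T (Finsupp.single b 1) b

end IsoradialGraph

/-- The directions of the alternating rays: `-i e^{iθ₀}` for the first, third, … variable (index
`0`, `2`, …) and `+i e^{iθ₀}` for the second, fourth, … variable (index `1`, `3`, …). -/
noncomputable def rayDir (θ₀ : ℝ) (j : ℕ) : ℂ :=
  if Even j then -Complex.I * Complex.exp (θ₀ * Complex.I)
  else Complex.I * Complex.exp (θ₀ * Complex.I)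

/-- The cyclic integrand `∏ j, (1 - g (z j) / g (z (j + 1))) / (z j - z (j + 1))`, with indices
modulo `m`. -/
noncomputable def cyclicIntegrand (g : ℂ → ℂ) {m : ℕ} (z : Fin m → ℂ) : ℂ :=
  ∏ j : Fin m, (1 - g (z j) / g (z (finRotate m j))) / (z j - z (finRotate m j))

/-- The integrand of the multiple contour integral over the alternating rays from `0` to infinity,
pulled back along `z j = t j * rayDir θ₀ j`, `t j > 0`. -/
noncomputable def alternatingIntegrand (g : ℂ → ℂ) (θ₀ : ℝ) (m : ℕ) (t : Fin m → ℝ) : ℂ :=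
  cyclicIntegrand g (fun j => (t j : ℂ) * rayDir θ₀ j) * ∏ j : Fin m, rayDir θ₀ j

/-! The zipper kernel has finite rank. Its edges are grouped by the odd vertices `v (2 * j + 1)` of
the path. At a white one they contribute the row `C w ·` times the column of weights of the left
fan. At a black one they contribute the weighted sum of the rows `C w ·` over the right fan times a
point mass. Hence K = S R with R, S passing through ℂ^P (`kernel_eq`), and cyclicity of the trace
replaces K by the P × P matrix M = R S (`trace_pow_comp`).

The entries of M become contour integrals through Kenyon's formula: C(w, b) is 1/(2π) times the
integral of the discrete exponential g_{w→b} along the ray in the direction w - b (`cauchyKernel`).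
The discrete exponential is discrete holomorphic, the weight of an edge times g_{v→b} being
i(g_{v→l} - g_{v→r}). So sums over a fan telescope to the two bounding sides (`star_fan`), and an
entry of M is the ray integral of a symbol A_j(z) B_k(z). For j ≠ k the poles of the symbol lie
strictly on one side of the normal to e^{iθ₀}, so the ray may be turned to either normal direction
-ie^{iθ₀} or ie^{iθ₀} with the same value. On the diagonal the two directions see the two poles
under angles that differ by 2π. Thus M is the integral along the right ray and M - 1 the integral
along the left ray (`entry_eq_right`, `entry_eq_left`).

Expanding the trace of (M(M - 1))^n gives a 2n-fold integral of a cyclic product in which B_j(z)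
A_j(z') is summed over j for neighbouring variables. At each odd vertex this product is i/(z' - z)
times the change of g_{F→·}(z)/g_{F→·}(z') over two steps, so the sum telescopes to -i(1 -
g(z)/g(z'))/(z - z') (`sum_colSymbol_mul_rowSymbol`). The factor (-i)^{2n} = (-1)^n cancels the sign
between M(M - 1) and M(1 - M).

It remains to justify Kenyon's formula. For each side direction e there is a height function on the
plane that is affine on every rhombus and counts the sides e. The pole order of g_{x→y} at e is the
height difference between y and x, which also gives path independence. Its half-integer level lines
are train tracks: pseudo-lines transversal to e that cross each other only in the sense of the cross
product of their directions. Tracks separating x from y therefore cannot have nearly opposite or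
positively spanning directions, so all poles lie in a half-plane and all zeros in the opposite one
(`exists_divisor_half_plane`). Monotonicity of the heights also keeps the poles off the rays from
the points of an edge (`ray_ne`), so around a vertex the rays can be moved to a common direction.
The telescoped sum then vanishes, except at the base point, where the angles of the rhombi add up to
2π. So the formula gives a left inverse and, after exchanging the colours, a right inverse. The
half-plane also gives decay like 1/|b - w|. A decaying function annihilated by the discrete operator
vanishes by a discrete Green formula on a large disc (`eq_zero_of_decay`), so C is the candidate. -/

/-- The planar cross product of two complex numbers. -/
def cross (a b : ℂ) : ℝ := a.re * b.im - a.im * b.re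

theorem cross_eq_im (a b : ℂ) : cross a b = ((starRingEnd ℂ) a * b).im := by
  simp [cross]; ring

theorem abs_cross_le (a b : ℂ) : |cross a b| ≤ ‖a‖ * ‖b‖ := by
  rw [cross_eq_im]
  refine (Complex.abs_im_le_norm _).trans ?_
  simp

/-! ### A single rhombus in the coordinates given by its sides. -/

namespace Rhombus

variable (t : Rhombus)

/-- The side from the white corner to the right corner. -/
def er : ℂ := t.r - t.w

/-- The side from the white corner to the left corner. -/
def el : ℂ := t.l - t.w

/-- The sine of the angle at the white corner. -/
def sine : ℝ := cross t.er t.el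

theorem sine_pos : 0 < t.sine := by
  have := t.ccw
  rwa [← cross_eq_im] at this

theorem norm_er : ‖t.er‖ = 1 := t.norm_r

theorem norm_el : ‖t.el‖ = 1 := t.norm_l

theorem r_eq : t.r = t.w + t.er := by simp [er]

theorem l_eq : t.l = t.w + t.el := by simp [el]

theorem b_eq : t.b = t.w + t.er + t.el := by simp [er, el, b]; ring

/-- The first coordinate of a vector with respect to the two sides. -/
noncomputable def coA : ℂ →ₗ[ℝ] ℝ where
  toFun v := cross v t.el / t.sine
  map_add' x y := by simp [cross]; ring
  map_smul' c x := by simp [cross]; ring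

/-- The second coordinate of a vector with respect to the two sides. -/
noncomputable def coB : ℂ →ₗ[ℝ] ℝ where
  toFun v := cross t.er v / t.sine
  map_add' x y := by simp [cross]; ring
  map_smul' c x := by simp [cross]; ring

theorem coA_apply (v : ℂ) : t.coA v = cross v t.el / t.sine := rfl

theorem coB_apply (v : ℂ) : t.coB v = cross t.er v / t.sine := rfl

@[simp] theorem coA_er : t.coA t.er = 1 := div_self t.sine_pos.ne'

@[simp] theorem coB_el : t.coB t.el = 1 := div_self t.sine_pos.ne'

@[simp] theorem coA_el : t.coA t.el = 0 := by simp [coA_apply, cross]; left; ring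

@[simp] theorem coB_er : t.coB t.er = 0 := by simp [coB_apply, cross]; left; ring

theorem coA_mul (s : ℝ) (v : ℂ) : t.coA ((s : ℂ) * v) = s * t.coA v := by
  rw [← Complex.real_smul, map_smul, smul_eq_mul]

theorem coB_mul (s : ℝ) (v : ℂ) : t.coB ((s : ℂ) * v) = s * t.coB v := by
  rw [← Complex.real_smul, map_smul, smul_eq_mul]

theorem decomp (v : ℂ) : v = (t.coA v : ℂ) * t.er + (t.coB v : ℂ) * t.el := by
  have h := t.sine_pos.ne'
  rw [coA_apply, coB_apply]
  apply Complex.ext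
  · simp only [Complex.add_re, Complex.re_ofReal_mul]
    field_simp
    simp only [sine, cross]; ring
  · simp only [Complex.add_im, Complex.im_ofReal_mul]
    field_simp
    simp only [sine, cross]; ring

theorem ext_co {v v' : ℂ} (h : t.coA v = t.coA v') (h' : t.coB v = t.coB v') : v = v' := by
  rw [t.decomp v, t.decomp v', h, h']

theorem continuous_coA : Continuous t.coA := t.coA.continuous_of_finiteDimensional

theorem continuous_coB : Continuous t.coB := t.coB.continuous_of_finiteDimensional

theorem er_ne_el : t.er ≠ t.el := fun h => by
  have := t.coA_er
  rw [h, coA_el] at this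
  exact zero_ne_one this

/-- In the coordinates along the sides the rhombus is the unit square. A point of the square is
reached by convex combinations on two opposite sides, followed by one between them. -/
theorem mem_carrier {z : ℂ} : z ∈ t.carrier ↔
    t.coA (z - t.w) ∈ Set.Icc (0 : ℝ) 1 ∧ t.coB (z - t.w) ∈ Set.Icc (0 : ℝ) 1 := by
  constructor
  · intro h
    have hconv : Convex ℝ {z : ℂ | t.coA (z - t.w) ∈ Set.Icc (0 : ℝ) 1 ∧
        t.coB (z - t.w) ∈ Set.Icc (0 : ℝ) 1} := by
      intro x hx y hy a c ha hc hac
      have e : a • x + c • y - t.w = a • (x - t.w) + c • (y - t.w) := by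
        have : t.w = (a + c) • t.w := by rw [hac, one_smul]
        rw [smul_sub, smul_sub]; nth_rewrite 1 [this]; rw [add_smul]; ring
      have h1 := convex_Icc (0 : ℝ) 1 hx.1 hy.1 ha hc hac
      have h2 := convex_Icc (0 : ℝ) 1 hx.2 hy.2 ha hc hac
      simp only [Set.mem_ofPred_eq, e, map_add, map_smul]
      exact ⟨h1, h2⟩
    refine convexHull_min ?_ hconv h
    rintro x (rfl | rfl | rfl | rfl)
    · simp
    · change t.coA t.er ∈ _ ∧ t.coB t.er ∈ _
      simp
    · have : t.b - t.w = t.er + t.el := by rw [b_eq]; ring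
      simp only [Set.mem_ofPred_eq, this, map_add]
      simp
    · change t.coA t.el ∈ _ ∧ t.coB t.el ∈ _
      simp
  · rintro ⟨⟨ha0, ha1⟩, hb0, hb1⟩
    have hz := t.decomp (z - t.w)
    set a := t.coA (z - t.w)
    set c := t.coB (z - t.w)
    have hc : Convex ℝ t.carrier := convex_convexHull ℝ _
    have m : ∀ x ∈ t.corners, x ∈ t.carrier := fun x hx => subset_convexHull ℝ _ hx
    have hw := m t.w (by simp [corners])
    have hr := m t.r (by simp [corners])
    have hb := m t.b (by simp [corners])
    have hl := m t.l (by simp [corners])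
    have h1 := hc hw hr (sub_nonneg.2 ha1) ha0 (by ring)
    have h2 := hc hl hb (sub_nonneg.2 ha1) ha0 (by ring)
    have h3 := hc h1 h2 (sub_nonneg.2 hb1) hb0 (by ring)
    convert h3 using 1
    have : z = t.w + ((a : ℂ) * t.er + (c : ℂ) * t.el) := by rw [← hz]; ring
    rw [this, r_eq, b_eq, l_eq]
    simp only [Complex.real_smul]
    push_cast; ring

theorem convex_carrier : Convex ℝ t.carrier := convex_convexHull ℝ _

theorem isClosed_carrier : IsClosed t.carrier := by
  have : t.carrier = {z | t.coA (z - t.w) ∈ Set.Icc (0 : ℝ) 1} ∩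
      {z | t.coB (z - t.w) ∈ Set.Icc (0 : ℝ) 1} := by
    ext z; exact t.mem_carrier
  rw [this]
  exact (isClosed_Icc.preimage (t.continuous_coA.comp (by fun_prop : Continuous fun z => z - t.w))).inter
    (isClosed_Icc.preimage (t.continuous_coB.comp (by fun_prop : Continuous fun z => z - t.w)))

theorem mem_interior {z : ℂ} (ha : t.coA (z - t.w) ∈ Set.Ioo (0 : ℝ) 1)
    (hb : t.coB (z - t.w) ∈ Set.Ioo (0 : ℝ) 1) : z ∈ interior t.carrier := by
  have ho : IsOpen ({z | t.coA (z - t.w) ∈ Set.Ioo (0 : ℝ) 1} ∩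
      {z | t.coB (z - t.w) ∈ Set.Ioo (0 : ℝ) 1}) :=
    (isOpen_Ioo.preimage (t.continuous_coA.comp (by fun_prop : Continuous fun z => z - t.w))).inter
      (isOpen_Ioo.preimage (t.continuous_coB.comp (by fun_prop : Continuous fun z => z - t.w)))
  refine (interior_maximal ?_ ho) (Set.mem_inter ha hb)
  rintro x ⟨h1, h2⟩
  exact t.mem_carrier.2 ⟨Set.Ioo_subset_Icc_self h1, Set.Ioo_subset_Icc_self h2⟩

theorem interior_nonempty : (interior t.carrier).Nonempty := by
  refine ⟨t.w + (2⁻¹ : ℝ) * t.er + (2⁻¹ : ℝ) * t.el, t.mem_interior ?_ ?_⟩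
  all_goals
    rw [add_assoc, add_sub_cancel_left]
    simp only [map_add, coA_mul, coB_mul, coA_er, coA_el, coB_el, coB_er]
    norm_num

theorem corner_mem {x : ℂ} (h : x ∈ t.corners) : x ∈ t.carrier := subset_convexHull ℝ _ h

/-- The side of `t` with direction `e`, oriented from white to black, that starts at `A`. -/
def IsSide (A e : ℂ) : Prop :=
  (e = t.er ∧ (A = t.w ∨ A = t.l)) ∨ (e = t.el ∧ (A = t.w ∨ A = t.r))

variable {t}

/-- Turns incidence questions about sides into finite case checks on coordinates. -/
theorem IsSide.co {A e : ℂ} (h : t.IsSide A e) :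
    (t.coA e = 1 ∧ t.coB e = 0 ∧ t.coA (A - t.w) = 0 ∧ (t.coB (A - t.w) = 0 ∨ t.coB (A - t.w) = 1)) ∨
    (t.coA e = 0 ∧ t.coB e = 1 ∧ (t.coA (A - t.w) = 0 ∨ t.coA (A - t.w) = 1) ∧ t.coB (A - t.w) = 0) := by
  rcases h with ⟨rfl, rfl | rfl⟩ | ⟨rfl, rfl | rfl⟩ <;> simp [r_eq, l_eq]

theorem IsSide.norm {A e : ℂ} (h : t.IsSide A e) : ‖e‖ = 1 := by
  rcases h with ⟨rfl, _⟩ | ⟨rfl, _⟩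
  exacts [t.norm_er, t.norm_el]

theorem IsSide.mem {A e : ℂ} (h : t.IsSide A e) {s : ℝ} (h0 : 0 ≤ s) (h1 : s ≤ 1) :
    A + s * e ∈ t.carrier := by
  have e1 : A + s * e - t.w = (A - t.w) + s * e := by ring
  rw [mem_carrier, e1, map_add, map_add, coA_mul, coB_mul]
  rcases h.co with ⟨h2, h3, h4, h5 | h5⟩ | ⟨h2, h3, h4 | h4, h5⟩ <;>
    rw [h2, h3, h4, h5] <;> constructor <;> constructor <;> linarith

theorem IsSide.start_corner {A e : ℂ} (h : t.IsSide A e) : A ∈ t.corners := by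
  rcases h with ⟨_, rfl | rfl⟩ | ⟨_, rfl | rfl⟩ <;> simp [corners]

theorem IsSide.end_corner {A e : ℂ} (h : t.IsSide A e) : A + e ∈ t.corners := by
  rcases h with ⟨rfl, rfl | rfl⟩ | ⟨rfl, rfl | rfl⟩ <;> simp [corners, er, el, b]
  · right; right; left; ring
  · right; right; left; ring

theorem corner_co {x : ℂ} (h : x ∈ t.corners) :
    (t.coA (x - t.w) = 0 ∨ t.coA (x - t.w) = 1) ∧ (t.coB (x - t.w) = 0 ∨ t.coB (x - t.w) = 1) := by
  rcases h with rfl | rfl | rfl | rfl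
  · simp
  · simp [r_eq]
  · simp [b_eq, add_assoc]
  · simp [l_eq]

theorem IsSide.not_corner {A e : ℂ} (h : t.IsSide A e) {s : ℝ} (h0 : 0 < s) (h1 : s < 1) :
    A + s * e ∉ t.corners := by
  intro hc
  have := corner_co hc
  have e1 : A + s * e - t.w = (A - t.w) + s * e := by ring
  rw [e1, map_add, map_add, coA_mul, coB_mul] at this
  rcases h.co with ⟨h2, h3, h4, h5⟩ | ⟨h2, h3, h4, h5⟩ <;> rw [h2, h3] at this <;>
    rcases this with ⟨h6 | h6, h7 | h7⟩ <;> simp_all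

theorem IsSide.eq_of_open {A e A' e' : ℂ} (h : t.IsSide A e) (h' : t.IsSide A' e') {s s' : ℝ}
    (h0 : 0 < s) (h1 : s < 1) (he : A + s * e = A' + s' * e') : A = A' ∧ e = e' := by
  have e1 : (A - t.w) + s * e = (A' - t.w) + s' * e' := by linear_combination he
  have ea := congrArg t.coA e1
  have eb := congrArg t.coB e1
  simp only [map_add, coA_mul, coB_mul] at ea eb
  have key : t.coA (A - t.w) = t.coA (A' - t.w) ∧ t.coB (A - t.w) = t.coB (A' - t.w) ∧
      t.coA e = t.coA e' ∧ t.coB e = t.coB e' := by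
    rcases h.co with ⟨h2, h3, h4, h5 | h5⟩ | ⟨h2, h3, h4 | h4, h5⟩ <;>
    rcases h'.co with ⟨g2, g3, g4, g5 | g5⟩ | ⟨g2, g3, g4 | g4, g5⟩ <;>
    (have := And.intro ea eb
     rw [h2, h3, h4, h5, g2, g3, g4, g5] at this
     rw [h2, h3, h4, h5, g2, g3, g4, g5]
     -- Of the sixteen pairs of sides, the four coincident ones close by `rfl`; the others
     -- contradict 0 < s < 1.
     first
     | exact ⟨rfl, rfl, rfl, rfl⟩
     | (exfalso; linarith [this.1, this.2]))
  have := t.ext_co key.1 key.2.1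
  exact ⟨by linear_combination this, t.ext_co key.2.2.1 key.2.2.2⟩

variable (t)

/-- The part of a rhombus on a supporting line is a corner or a side. -/
theorem face_cases (f : ℂ →L[ℝ] ℝ) (u : ℝ) (hf : f ≠ 0) (hu : ∀ p ∈ t.carrier, f p ≤ u) :
    (∃ c ∈ t.corners, ∀ p ∈ t.carrier, f p = u → p = c) ∨
    (∃ A e, t.IsSide A e ∧ f e = 0 ∧ ∀ p ∈ t.carrier, f p = u →
      ∃ s : ℝ, 0 ≤ s ∧ s ≤ 1 ∧ p = A + s * e) := by
  have hfm : ∀ (s : ℝ) (v : ℂ), f ((s : ℂ) * v) = s * f v := fun s v => by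
    rw [← Complex.real_smul, map_smul, smul_eq_mul]
  have hfp : ∀ p, f p = f t.w + t.coA (p - t.w) * f t.er + t.coB (p - t.w) * f t.el := fun p => by
    rw [← hfm, ← hfm, ← map_add, ← map_add, add_assoc, ← t.decomp (p - t.w)]; congr 1; ring
  have hp : ∀ p : ℂ, p = t.w + t.coA (p - t.w) * t.er + t.coB (p - t.w) * t.el := fun p => by
    rw [add_assoc, ← t.decomp (p - t.w)]; ring
  have hb : f t.b = f t.w + f t.er + f t.el := by rw [b_eq, map_add, map_add]
  have hr : f t.r = f t.w + f t.er := by rw [r_eq, map_add]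
  have hl : f t.l = f t.w + f t.el := by rw [l_eq, map_add]
  have uw := hu t.w (t.corner_mem (by simp [corners]))
  have ur := hu t.r (t.corner_mem (by simp [corners]))
  have ul := hu t.l (t.corner_mem (by simp [corners]))
  have ub := hu t.b (t.corner_mem (by simp [corners]))
  rw [hr] at ur; rw [hl] at ul; rw [hb] at ub
  -- At a maximum of f every coordinate with a nonzero coefficient sits at an endpoint of [0, 1];
  -- the signs of f on the two sides then decide between corner and side.
  have coords : ∀ p ∈ t.carrier, f p = u →
      (0 < f t.er → t.coA (p - t.w) = 1) ∧ (f t.er < 0 → t.coA (p - t.w) = 0) ∧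
      (0 < f t.el → t.coB (p - t.w) = 1) ∧ (f t.el < 0 → t.coB (p - t.w) = 0) := by
    intro p hpc hpu
    obtain ⟨⟨a0, a1⟩, b0, b1⟩ := t.mem_carrier.1 hpc
    rw [hfp p] at hpu
    set a := t.coA (p - t.w)
    set c := t.coB (p - t.w)
    have m : ∀ x y : ℝ, 0 ≤ x → x ≤ 1 → 0 ≤ y → y ≤ 1 → f t.w + x * f t.er + y * f t.el ≤ u := by
      intro x y hx hx1 hy hy1
      have hm : t.w + x * t.er + y * t.el ∈ t.carrier := by
        rw [mem_carrier, add_assoc, add_sub_cancel_left]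
        simp [coA_mul, coB_mul, hx, hx1, hy, hy1]
      have := hu _ hm
      rwa [map_add, map_add, hfm, hfm] at this
    have m1 := m 1 c zero_le_one le_rfl b0 b1
    have m2 := m 0 c le_rfl zero_le_one b0 b1
    have m3 := m a 1 a0 a1 zero_le_one le_rfl
    have m4 := m a 0 a0 a1 le_rfl zero_le_one
    refine ⟨fun h => ?_, fun h => ?_, fun h => ?_, fun h => ?_⟩ <;> nlinarith
  rcases lt_trichotomy (f t.er) 0 with h1 | h1 | h1
  · rcases lt_trichotomy (f t.el) 0 with h2 | h2 | h2
    · left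
      refine ⟨t.w, by simp [corners], fun p hpc hpu => ?_⟩
      rw [hp p, (coords p hpc hpu).2.1 h1, (coords p hpc hpu).2.2.2 h2]; simp
    · right
      refine ⟨t.w, t.el, by simp [IsSide], h2, fun p hpc hpu => ⟨t.coB (p - t.w), ?_, ?_, ?_⟩⟩
      · exact (t.mem_carrier.1 hpc).2.1
      · exact (t.mem_carrier.1 hpc).2.2
      · nth_rewrite 1 [hp p]; rw [(coords p hpc hpu).2.1 h1]; simp
    · left
      refine ⟨t.l, by simp [corners], fun p hpc hpu => ?_⟩
      rw [hp p, (coords p hpc hpu).2.1 h1, (coords p hpc hpu).2.2.1 h2]; simp [l_eq]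
  · rcases lt_trichotomy (f t.el) 0 with h2 | h2 | h2
    · right
      refine ⟨t.w, t.er, by simp [IsSide], h1, fun p hpc hpu => ⟨t.coA (p - t.w), ?_, ?_, ?_⟩⟩
      · exact (t.mem_carrier.1 hpc).1.1
      · exact (t.mem_carrier.1 hpc).1.2
      · nth_rewrite 1 [hp p]; rw [(coords p hpc hpu).2.2.2 h2]; simp
    · exfalso
      apply hf
      refine ContinuousLinearMap.ext fun v => ?_
      rw [t.decomp v, map_add, hfm, hfm, h1, h2]; simp
    · right
      refine ⟨t.l, t.er, by simp [IsSide], h1, fun p hpc hpu => ⟨t.coA (p - t.w), ?_, ?_, ?_⟩⟩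
      · exact (t.mem_carrier.1 hpc).1.1
      · exact (t.mem_carrier.1 hpc).1.2
      · nth_rewrite 1 [hp p]; rw [(coords p hpc hpu).2.2.1 h2]; simp [l_eq]; ring
  · rcases lt_trichotomy (f t.el) 0 with h2 | h2 | h2
    · left
      refine ⟨t.r, by simp [corners], fun p hpc hpu => ?_⟩
      rw [hp p, (coords p hpc hpu).1 h1, (coords p hpc hpu).2.2.2 h2]; simp [r_eq]
    · right
      refine ⟨t.r, t.el, by simp [IsSide], h2, fun p hpc hpu => ⟨t.coB (p - t.w), ?_, ?_, ?_⟩⟩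
      · exact (t.mem_carrier.1 hpc).2.1
      · exact (t.mem_carrier.1 hpc).2.2
      · nth_rewrite 1 [hp p]; rw [(coords p hpc hpu).1 h1]; simp [r_eq]
    · left
      refine ⟨t.b, by simp [corners], fun p hpc hpu => ?_⟩
      rw [hp p, (coords p hpc hpu).1 h1, (coords p hpc hpu).2.2.1 h2]; simp [b_eq]

end Rhombus

/-! ### How the tiles of the tiling meet. -/

namespace IsoradialGraph

variable {G : IsoradialGraph}

theorem arrow_of_side {t : Rhombus} (ht : t ∈ G.tiles) {A e : ℂ} (h : t.IsSide A e) :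
    G.Arrow A (A + e) := by
  refine ⟨t, ht, ?_⟩
  rcases h with ⟨rfl, rfl | rfl⟩ | ⟨rfl, rfl | rfl⟩
  · exact Or.inl ⟨rfl, Or.inl t.r_eq.symm⟩
  · exact Or.inr ⟨Or.inr rfl, by rw [t.l_eq, t.b_eq]; ring⟩
  · exact Or.inl ⟨rfl, Or.inr t.l_eq.symm⟩
  · exact Or.inr ⟨Or.inl rfl, by rw [t.r_eq, t.b_eq]⟩

theorem Arrow.exists_side {x y : ℂ} (h : G.Arrow x y) : ∃ t ∈ G.tiles, t.IsSide x (y - x) := by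
  obtain ⟨t, ht, ⟨rfl, rfl | rfl⟩ | ⟨rfl | rfl, rfl⟩⟩ := h
  · exact ⟨t, ht, Or.inl ⟨rfl, Or.inl rfl⟩⟩
  · exact ⟨t, ht, Or.inr ⟨rfl, Or.inl rfl⟩⟩
  · exact ⟨t, ht, Or.inr ⟨by rw [t.r_eq, t.b_eq]; ring, Or.inr rfl⟩⟩
  · exact ⟨t, ht, Or.inl ⟨by rw [t.l_eq, t.b_eq]; ring, Or.inr rfl⟩⟩

theorem white_not_face {x : ℂ} (h : x ∈ G.white) : x ∉ G.face := by
  rintro ⟨t', ht', h'⟩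
  obtain ⟨t, ht, rfl⟩ := h
  have := G.white_ne_face t ht t' ht'
  rcases h' with h' | h'
  exacts [this.1 h'.symm, this.2 h'.symm]

theorem black_not_face {x : ℂ} (h : x ∈ G.black) : x ∉ G.face := by
  rintro ⟨t', ht', h'⟩
  obtain ⟨t, ht, rfl⟩ := h
  have := G.black_ne_face t ht t' ht'
  rcases h' with h' | h'
  exacts [this.1 h'.symm, this.2 h'.symm]

theorem white_not_black {x : ℂ} (h : x ∈ G.white) : x ∉ G.black := by
  rintro ⟨t', ht', h'⟩
  obtain ⟨t, ht, rfl⟩ := h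
  exact G.white_ne_black t ht t' ht' h'.symm

theorem Arrow.cases {x y : ℂ} (h : G.Arrow x y) :
    (x ∈ G.white ∧ y ∈ G.face) ∨ (x ∈ G.face ∧ y ∈ G.black) := by
  obtain ⟨t, ht, ⟨rfl, rfl | rfl⟩ | ⟨rfl | rfl, rfl⟩⟩ := h
  · exact Or.inl ⟨⟨t, ht, rfl⟩, ⟨t, ht, Or.inl rfl⟩⟩
  · exact Or.inl ⟨⟨t, ht, rfl⟩, ⟨t, ht, Or.inr rfl⟩⟩
  · exact Or.inr ⟨⟨t, ht, Or.inl rfl⟩, ⟨t, ht, rfl⟩⟩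
  · exact Or.inr ⟨⟨t, ht, Or.inr rfl⟩, ⟨t, ht, rfl⟩⟩

/-- The orientation leads from white to face to black, and these classes are disjoint. This is what
excludes antiparallel copies of one segment as sides of two tiles. -/
theorem Arrow.asymm {x y : ℂ} (h : G.Arrow x y) : ¬ G.Arrow y x := by
  intro h'
  rcases h.cases with ⟨hx, hy⟩ | ⟨hx, hy⟩ <;> rcases h'.cases with ⟨hx', hy'⟩ | ⟨hx', hy'⟩
  · exact white_not_face hx' hy
  · exact white_not_black hx hy'
  · exact white_not_black hx' hy
  · exact black_not_face hy hx'

/-- The vertices of the rhombus graph. -/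
def vertex (G : IsoradialGraph) : Set ℂ := {x | ∃ t ∈ G.tiles, x ∈ t.corners}

theorem mem_corners_of_vertex {x : ℂ} (hx : x ∈ G.vertex) {t : Rhombus} (ht : t ∈ G.tiles)
    (hxt : x ∈ t.carrier) : x ∈ t.corners := by
  obtain ⟨t', ht', h'⟩ := hx
  exact G.edge_to_edge t' ht' t ht x h' hxt

/-- Hahn–Banach for the disjoint interiors. The inequalities pass to the closed rhombi, which are
the closures of their interiors. -/
theorem separation {t t' : Rhombus} (ht : t ∈ G.tiles) (ht' : t' ∈ G.tiles) (hne : t ≠ t') :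
    ∃ (f : ℂ →L[ℝ] ℝ) (u : ℝ), f ≠ 0 ∧ (∀ p ∈ t.carrier, f p ≤ u) ∧ ∀ p ∈ t'.carrier, u ≤ f p := by
  obtain ⟨f, u, h1, h2⟩ := geometric_hahn_banach_open t.convex_carrier.interior isOpen_interior
    t'.convex_carrier.interior (G.interior_disjoint t ht t' ht' hne)
  refine ⟨f, u, ?_, ?_, ?_⟩
  · rintro rfl
    obtain ⟨x, hx⟩ := t.interior_nonempty
    obtain ⟨y, hy⟩ := t'.interior_nonempty
    have a := h1 x hx
    have c := h2 y hy
    simp at a c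
    linarith
  · intro p hp
    have hc := t.convex_carrier.closure_interior_eq_closure_of_nonempty_interior t.interior_nonempty
    rw [t.isClosed_carrier.closure_eq] at hc
    rw [← hc] at hp
    exact closure_minimal (fun x hx => (h1 x hx).le) (isClosed_le f.continuous continuous_const) hp
  · intro p hp
    have hc := t'.convex_carrier.closure_interior_eq_closure_of_nonempty_interior t'.interior_nonempty
    rw [t'.isClosed_carrier.closure_eq] at hc
    rw [← hc] at hp
    exact closure_minimal (fun x hx => h2 x hx) (isClosed_le continuous_const f.continuous) hp

/-- The kernel of a nonzero functional on the plane is a line, which contains only two unit vectors.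
-/
theorem parallel_of_kernel {f : ℂ →L[ℝ] ℝ} (hf : f ≠ 0) {a c : ℂ} (ha : f a = 0) (hc : f c = 0)
    (na : ‖a‖ = 1) (nc : ‖c‖ = 1) : c = a ∨ c = -a := by
  have ha2 : a.re ^ 2 + a.im ^ 2 = 1 := by
    have := Complex.sq_norm a
    rw [na, Complex.normSq_apply] at this; linarith
  have hc2 : c.re ^ 2 + c.im ^ 2 = 1 := by
    have := Complex.sq_norm c
    rw [nc, Complex.normSq_apply] at this; linarith
  have hcross : cross a c = 0 := by
    by_contra h
    apply hf
    refine ContinuousLinearMap.ext fun v => ?_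
    have hv : v = (cross v c / cross a c : ℝ) • a + (cross a v / cross a c : ℝ) • c := by
      apply Complex.ext <;> simp <;> field_simp <;> simp only [cross] <;> ring
    rw [hv, map_add, map_smul, map_smul, ha, hc]; simp
  have hd : c.re = a.re * (a.re * c.re + a.im * c.im) ∧ c.im = a.im * (a.re * c.re + a.im * c.im) := by
    simp only [cross] at hcross
    constructor
    · linear_combination (-c.re) * ha2 - a.im * hcross
    · linear_combination (-c.im) * ha2 + a.re * hcross
  set k := a.re * c.re + a.im * c.im
  have hk : k ^ 2 = 1 := by
    rw [hd.1, hd.2] at hc2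
    linear_combination hc2 - k ^ 2 * ha2
  have hk' : (k - 1) * (k + 1) = 0 := by linear_combination hk
  rcases mul_eq_zero.1 hk' with h | h
  · left
    have h : k = 1 := by linear_combination h
    apply Complex.ext
    · rw [hd.1, h, mul_one]
    · rw [hd.2, h, mul_one]
  · right
    have h : k = -1 := by linear_combination h
    apply Complex.ext
    · rw [hd.1, h]; simp
    · rw [hd.2, h]; simp

/-- All common points lie on the separating line, which supports both rhombi and so meets each of
them in a corner or in points of one side. If one of these is a corner, edge-to-edge makes it a
corner of both. -/
theorem contact_cases {t t' : Rhombus} (ht : t ∈ G.tiles) (ht' : t' ∈ G.tiles) (hne : t ≠ t')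
    {p : ℂ} (hp : p ∈ t.carrier) (hp' : p ∈ t'.carrier) :
    (∃ c, c ∈ t.corners ∧ c ∈ t'.corners ∧ ∀ q ∈ t.carrier, q ∈ t'.carrier → q = c) ∨
    ∃ A e A' e', t.IsSide A e ∧ t'.IsSide A' e' ∧ (e' = e ∨ e' = -e) ∧
      ∀ q ∈ t.carrier, q ∈ t'.carrier → (∃ s : ℝ, 0 ≤ s ∧ s ≤ 1 ∧ q = A + s * e) ∧
        ∃ s : ℝ, 0 ≤ s ∧ s ≤ 1 ∧ q = A' + s * e' := by
  obtain ⟨f, u, hf, h1, h2⟩ := separation ht ht' hne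
  have hfu : ∀ q ∈ t.carrier, q ∈ t'.carrier → f q = u := fun q hq hq' =>
    le_antisymm (h1 q hq) (h2 q hq')
  have hfu' : ∀ q ∈ t.carrier, q ∈ t'.carrier → (-f) q = -u := fun q hq hq' => by
    simp [hfu q hq hq']
  rcases t.face_cases f u hf h1 with ⟨c, hc, hc'⟩ | ⟨A, e, hs, he, hA⟩
  · left
    have : p = c := hc' p hp (hfu p hp hp')
    subst this
    exact ⟨p, hc, G.edge_to_edge t ht t' ht' p hc hp', fun q hq hq' => hc' q hq (hfu q hq hq')⟩
  rcases t'.face_cases (-f) (-u) (neg_ne_zero.2 hf) (fun p hp => by simpa using h2 p hp) with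
    ⟨c, hc, hc'⟩ | ⟨A', e', hs', he', hA'⟩
  · left
    have : p = c := hc' p hp' (hfu' p hp hp')
    subst this
    exact ⟨p, G.edge_to_edge t' ht' t ht p hc hp, hc, fun q hq hq' => hc' q hq' (hfu' q hq hq')⟩
  · right
    refine ⟨A, e, A', e', hs, hs', ?_, fun q hq hq' => ⟨hA q hq (hfu q hq hq'), hA' q hq' (hfu' q hq hq')⟩⟩
    exact parallel_of_kernel hf he (by simpa using he') hs.norm hs'.norm

/-- Two rhombi that meet in an inner point of a side share this side. -/
theorem isSide_of_mem {t t' : Rhombus} (ht : t ∈ G.tiles) (ht' : t' ∈ G.tiles)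
    {A e : ℂ} (hs : t.IsSide A e) {s : ℝ} (h0 : 0 < s) (h1 : s < 1)
    (hp' : A + s * e ∈ t'.carrier) : t'.IsSide A e := by
  by_cases hne : t = t'
  · rwa [← hne]
  have hp := hs.mem h0.le h1.le
  rcases contact_cases ht ht' hne hp hp' with ⟨c, hc, -, hq⟩ | ⟨A₁, e₁, A', e', hs1, hs', hee, hq⟩
  · exact absurd (hq _ hp hp' ▸ hc) (hs.not_corner h0 h1)
  obtain ⟨⟨s₁, -, -, e1⟩, s', h0', h1', e2⟩ := hq _ hp hp'
  obtain ⟨rfl, rfl⟩ := hs.eq_of_open hs1 h0 h1 e1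
  rcases hee with rfl | rfl
  -- Parallel sides on a common line: a nonzero shift would put an endpoint of one side inside the
  -- other, against edge-to-edge.
  · have hA' : A' = A + ((s - s' : ℝ) : ℂ) * e' := by push_cast; linear_combination -e2
    rcases lt_trichotomy (s - s') 0 with h | h | h
    · exfalso
      have hA : A = A' + ((s' - s : ℝ) : ℂ) * e' := by push_cast; linear_combination e2
      have := G.edge_to_edge t ht t' ht' A hs.start_corner
        (hA ▸ hs'.mem (by linarith) (by linarith))
      exact hs'.not_corner (s := s' - s) (by linarith) (by linarith) (hA ▸ this)
    · rw [h] at hA'; simp at hA'; rwa [← hA']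
    · exfalso
      have := G.edge_to_edge t' ht' t ht A' hs'.start_corner
        (hA' ▸ hs.mem (by linarith) (by linarith))
      exact hs.not_corner h (by linarith) (hA' ▸ this)
  -- Antiparallel sides: a shift is excluded as before, and coincidence would orient one edge both
  -- ways.
  · have hA' : A' + -e = A + ((s + s' - 1 : ℝ) : ℂ) * e := by push_cast; linear_combination -e2
    rcases lt_trichotomy (s + s' - 1) 0 with h | h | h
    · exfalso
      have hA : A = A' + ((s + s' : ℝ) : ℂ) * -e := by push_cast; linear_combination e2
      have := G.edge_to_edge t ht t' ht' A hs.start_corner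
        (hA ▸ hs'.mem (by linarith) (by linarith))
      exact hs'.not_corner (s := s + s') (by linarith) (by linarith) (hA ▸ this)
    · exfalso
      rw [h] at hA'
      have hA : A' = A + e := by
        have : A' + -e = A := by simpa using hA'
        linear_combination this
      have a1 := arrow_of_side ht hs
      have a2 := arrow_of_side ht' hs'
      rw [hA, add_neg_cancel_right] at a2
      exact a1.asymm a2
    · exfalso
      have := G.edge_to_edge t' ht' t ht _ hs'.end_corner
        (hA' ▸ hs.mem (by linarith) (by linarith))
      exact hs.not_corner h (by linarith) (hA' ▸ this)

/-- Two rhombi with two common points share a side in the direction of these points. -/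
theorem exists_common_side {t t' : Rhombus} (ht : t ∈ G.tiles) (ht' : t' ∈ G.tiles) (hne : t ≠ t')
    {p q : ℂ} (hp : p ∈ t.carrier) (hp' : p ∈ t'.carrier) (hq : q ∈ t.carrier)
    (hq' : q ∈ t'.carrier) (hpq : p ≠ q) :
    ∃ A e, t.IsSide A e ∧ t'.IsSide A e ∧ ∃ s : ℝ, p - q = s * e := by
  rcases contact_cases ht ht' hne hp hp' with ⟨c, hc, -, h⟩ | ⟨A, e, A', e', hs, hs', hee, h⟩
  · exact absurd ((h p hp hp').trans (h q hq hq').symm) hpq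
  obtain ⟨⟨s₁, a0, a1, e1⟩, -⟩ := h p hp hp'
  obtain ⟨⟨s₂, b0, b1, e2⟩, -⟩ := h q hq hq'
  have hs12 : s₁ ≠ s₂ := fun h => hpq (by rw [e1, e2, h])
  have hm : A + ((s₁ + s₂) / 2 : ℝ) * e ∈ t'.carrier := by
    have := t'.convex_carrier hp' hq' (show (0 : ℝ) ≤ 2⁻¹ by norm_num) (show (0 : ℝ) ≤ 2⁻¹ by norm_num)
      (by norm_num)
    convert this using 1
    rw [e1, e2]; simp only [Complex.real_smul]; push_cast; ring
  refine ⟨A, e, hs, isSide_of_mem ht ht' hs ?_ ?_ hm, s₁ - s₂, by rw [e1, e2]; push_cast; ring⟩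
  · rcases lt_or_gt_of_ne hs12 with h | h <;> linarith
  · rcases lt_or_gt_of_ne hs12 with h | h <;> linarith

/-- Two intersecting rhombi share a corner. -/
theorem exists_common_corner {t t' : Rhombus} (ht : t ∈ G.tiles) (ht' : t' ∈ G.tiles)
    {p : ℂ} (hp : p ∈ t.carrier) (hp' : p ∈ t'.carrier) :
    ∃ c, c ∈ t.corners ∧ c ∈ t'.corners := by
  by_cases hne : t = t'
  · subst hne; exact ⟨t.w, by simp [Rhombus.corners], by simp [Rhombus.corners]⟩
  rcases contact_cases ht ht' hne hp hp' with ⟨c, hc, hc', -⟩ | ⟨A, e, A', e', hs, hs', hee, h⟩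
  · exact ⟨c, hc, hc'⟩
  obtain ⟨⟨s, a0, a1, e1⟩, s', b0, b1, e2⟩ := h p hp hp'
  rcases hee with rfl | rfl
  · rcases le_total s s' with hss | hss
    · have hA : A = A' + ((s' - s : ℝ) : ℂ) * e' := by push_cast; linear_combination e2 - e1
      exact ⟨A, hs.start_corner, G.edge_to_edge t ht t' ht' A hs.start_corner
        (hA ▸ hs'.mem (by linarith) (by linarith))⟩
    · have hA : A' = A + ((s - s' : ℝ) : ℂ) * e' := by push_cast; linear_combination e1 - e2
      exact ⟨A', G.edge_to_edge t' ht' t ht A' hs'.start_corner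
        (hA ▸ hs.mem (by linarith) (by linarith)), hs'.start_corner⟩
  · rcases le_total (s + s') 1 with hss | hss
    · have hA : A = A' + ((s + s' : ℝ) : ℂ) * -e := by push_cast; linear_combination e2 - e1
      exact ⟨A, hs.start_corner, G.edge_to_edge t ht t' ht' A hs.start_corner
        (hA ▸ hs'.mem (by linarith) (by linarith))⟩
    · have hA : A' + -e = A + ((s + s' - 1 : ℝ) : ℂ) * e := by
        push_cast; linear_combination e1 - e2
      exact ⟨_, G.edge_to_edge t' ht' t ht _ hs'.end_corner
        (hA ▸ hs.mem (by linarith) (by linarith)), hs'.end_corner⟩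

/-- A ray from a point stays in one rhombus for a while. -/
theorem exists_radial (p v : ℂ) :
    ∃ t ∈ G.tiles, ∃ η : ℝ, 0 < η ∧ ∀ τ : ℝ, 0 ≤ τ → τ ≤ η → p + τ * v ∈ t.carrier := by
  have hfin := G.locally_finite (‖p‖ + ‖v‖)
  set T := {t ∈ G.tiles | (t.carrier ∩ Metric.closedBall 0 (‖p‖ + ‖v‖)).Nonempty}
  have hcov : ∀ τ : ℝ, 0 ≤ τ → τ ≤ 1 → ∃ t ∈ T, p + τ * v ∈ t.carrier := by
    intro τ h0 h1
    obtain ⟨t, ht, h⟩ := G.cover (p + τ * v)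
    refine ⟨t, ⟨ht, _, h, ?_⟩, h⟩
    rw [mem_closedBall_zero_iff]
    refine (norm_add_le _ _).trans ?_
    have : ‖(τ : ℂ) * v‖ ≤ ‖v‖ := by
      rw [norm_mul, Complex.norm_real, Real.norm_of_nonneg h0]
      exact mul_le_of_le_one_left (norm_nonneg _) h1
    linarith
  -- Pigeonhole: one of the finitely many nearby tiles meets the ray at arbitrarily small times, and
  -- convexity fills in the times between.
  have key : ∃ t ∈ T, ∀ η : ℝ, 0 < η → ∃ τ : ℝ, 0 < τ ∧ τ ≤ η ∧ p + τ * v ∈ t.carrier := by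
    by_contra hcon
    push Not at hcon
    choose! η hη hno using hcon
    have hne : hfin.toFinset.Nonempty := by
      obtain ⟨t, ht, -⟩ := hcov 0 le_rfl zero_le_one
      exact ⟨t, hfin.mem_toFinset.2 ht⟩
    obtain ⟨t₀, ht₀, hmin⟩ := hfin.toFinset.exists_min_image η hne
    have hpos : 0 < min 1 (η t₀) := lt_min one_pos (hη t₀ (hfin.mem_toFinset.1 ht₀))
    obtain ⟨t, ht, h⟩ := hcov (min 1 (η t₀)) hpos.le (min_le_left _ _)
    exact hno t ht _ hpos ((min_le_right _ _).trans (hmin t (hfin.mem_toFinset.2 ht))) h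
  obtain ⟨t, ht, h⟩ := key
  obtain ⟨η, hη, -, hmem⟩ := h 1 one_pos
  refine ⟨t, ht.1, η, hη, ?_⟩
  have hpos : ∀ τ : ℝ, 0 < τ → τ ≤ η → p + τ * v ∈ t.carrier := by
    intro τ h0 h1
    obtain ⟨τ', h0', h1', hmem'⟩ := h τ h0
    rcases h1'.eq_or_lt with rfl | hlt
    · exact hmem'
    have hd : 0 < η - τ' := by linarith
    have := t.convex_carrier hmem' hmem (show 0 ≤ (η - τ) / (η - τ') from div_nonneg (by linarith) hd.le)
      (show 0 ≤ (τ - τ') / (η - τ') from div_nonneg (by linarith) hd.le) (by field_simp; ring)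
    convert this using 1
    have hdc : (η : ℂ) - τ' ≠ 0 := by exact_mod_cast hd.ne'
    simp only [Complex.real_smul]; push_cast; field_simp; ring
  intro τ h0 h1
  rcases h0.eq_or_lt with rfl | h0
  · have hc : Filter.Tendsto (fun τ : ℝ => p + τ * v) (nhdsWithin 0 (Set.Ioi 0)) (nhds (p + (0 : ℝ) * v)) := by
      apply Filter.Tendsto.mono_left _ nhdsWithin_le_nhds
      exact (by fun_prop : Continuous fun τ : ℝ => p + τ * v).tendsto 0
    refine t.isClosed_carrier.mem_of_tendsto hc ?_
    filter_upwards [Ioo_mem_nhdsGT hη] with τ hτ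
    exact hpos τ hτ.1 hτ.2.le
  · exact hpos τ h0 h1

/-- Near a point all rhombi contain this point. -/
theorem eventually_mem_carrier (p : ℂ) :
    ∃ r : ℝ, 0 < r ∧ ∀ t ∈ G.tiles, ∀ q ∈ t.carrier, ‖q - p‖ < r → p ∈ t.carrier := by
  have hfin := G.locally_finite (‖p‖ + 1)
  set T := {t ∈ G.tiles | (t.carrier ∩ Metric.closedBall 0 (‖p‖ + 1)).Nonempty}
  have hcl : IsClosed (⋃ t ∈ {t ∈ T | p ∉ t.carrier}, t.carrier) :=
    (hfin.subset (Set.sep_subset _ _)).isClosed_biUnion fun t _ => t.isClosed_carrier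
  have hp : p ∈ (⋃ t ∈ {t ∈ T | p ∉ t.carrier}, t.carrier)ᶜ := by
    simp only [Set.mem_compl_iff, Set.mem_iUnion, not_exists]
    rintro t ⟨_, ht⟩ h
    exact ht h
  obtain ⟨r, hr, hball⟩ := Metric.isOpen_iff.1 hcl.isOpen_compl p hp
  refine ⟨min r 1, lt_min hr one_pos, fun t ht q hq hqp => ?_⟩
  by_contra hpt
  refine hball (Metric.mem_ball.2 (by rw [dist_eq_norm]; exact hqp.trans_le (min_le_left _ _))) ?_
  simp only [Set.mem_iUnion]
  refine ⟨t, ⟨⟨ht, q, hq, ?_⟩, hpt⟩, hq⟩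
  rw [mem_closedBall_zero_iff]
  have : q = p + (q - p) := by ring
  rw [this]
  refine (norm_add_le _ _).trans ?_
  have := hqp.trans_le (min_le_right r 1)
  linarith

end IsoradialGraph

/-! ### Height functions of side directions and the divisor of the discrete exponential. -/

namespace Rhombus

open Classical in
/-- The differential on the rhombus `t` of the height function that counts the sides with
direction `e`. -/
noncomputable def slope (t : Rhombus) (e : ℂ) : ℂ →ₗ[ℝ] ℝ :=
  (if t.er = e then (1 : ℝ) else 0) • t.coA + (if t.el = e then (1 : ℝ) else 0) • t.coB

open Classical in
theorem slope_apply (t : Rhombus) (e v : ℂ) : t.slope e v =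
    (if t.er = e then 1 else 0) * t.coA v + (if t.el = e then 1 else 0) * t.coB v := rfl

theorem slope_er (t : Rhombus) (v : ℂ) : t.slope t.er v = t.coA v := by
  rw [slope_apply, if_pos rfl, if_neg t.er_ne_el.symm]; ring

theorem slope_el (t : Rhombus) (v : ℂ) : t.slope t.el v = t.coB v := by
  rw [slope_apply, if_pos rfl, if_neg t.er_ne_el]; ring

theorem slope_of_ne (t : Rhombus) {e : ℂ} (h : t.er ≠ e) (h' : t.el ≠ e) (v : ℂ) :
    t.slope e v = 0 := by
  rw [slope_apply, if_neg h, if_neg h']; ring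

theorem slope_mul (t : Rhombus) (e v : ℂ) (s : ℝ) : t.slope e (s * v) = s * t.slope e v := by
  rw [← Complex.real_smul, map_smul, smul_eq_mul]

open Classical in
theorem IsSide.slope {t : Rhombus} {A e' : ℂ} (h : t.IsSide A e') (e : ℂ) :
    t.slope e e' = if e' = e then 1 else 0 := by
  rw [slope_apply]
  rcases h with ⟨rfl, -⟩ | ⟨rfl, -⟩ <;> simp

end Rhombus

namespace IsoradialGraph

variable {G : IsoradialGraph}

/-- Two tiles with two common points share a side in their direction, and on that side both
differentials depend only on whether it equals e. So the differentials glue to a closed form. -/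
theorem slope_compat {t t' : Rhombus} (ht : t ∈ G.tiles) (ht' : t' ∈ G.tiles) (e : ℂ)
    {p q : ℂ} (hp : p ∈ t.carrier) (hp' : p ∈ t'.carrier) (hq : q ∈ t.carrier)
    (hq' : q ∈ t'.carrier) : t.slope e (p - q) = t'.slope e (p - q) := by
  by_cases hne : t = t'
  · rw [hne]
  by_cases hpq : p = q
  · simp [hpq]
  obtain ⟨A, e', h, h', s, hs⟩ := exists_common_side ht ht' hne hp hp' hq hq' hpq
  rw [hs, Rhombus.slope_mul, Rhombus.slope_mul, h.slope, h'.slope]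

/-- `Φ` is a function on `B` with the prescribed differentials on the rhombi. -/
def IsPotential (G : IsoradialGraph) (e : ℂ) (B : Set ℂ) (Φ : ℂ → ℝ) : Prop :=
  ∀ t ∈ G.tiles, ∀ p ∈ t.carrier, ∀ q ∈ t.carrier, p ∈ B → q ∈ B → Φ p - Φ q = t.slope e (p - q)

theorem IsPotential.mono {e : ℂ} {B B' : Set ℂ} {Φ : ℂ → ℝ} (h : G.IsPotential e B Φ)
    (hB : B' ⊆ B) : G.IsPotential e B' Φ :=
  fun t ht p hp q hq hpB hqB => h t ht p hp q hq (hB hpB) (hB hqB)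

/-- Points near p lie in tiles that contain p, where both potentials have the same increment. So the
difference is locally constant. -/
theorem IsPotential.sub_eq {e : ℂ} {B : Set ℂ} (hB : IsPreconnected B) {Φ Ψ : ℂ → ℝ}
    (hΦ : G.IsPotential e B Φ) (hΨ : G.IsPotential e B Ψ) {p q : ℂ} (hp : p ∈ B) (hq : q ∈ B) :
    Φ p - Ψ p = Φ q - Ψ q := by
  refine hB.induction₂ (fun p q => Φ p - Ψ p = Φ q - Ψ q) (fun p hp => ?_)
    (fun _ _ _ _ _ _ h1 h2 => h1.trans h2) (fun _ _ _ _ h => h.symm) hp hq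
  obtain ⟨r, hr, h⟩ := G.eventually_mem_carrier p
  have : ∀ᶠ q in nhds p, ‖q - p‖ < r := by
    filter_upwards [Metric.ball_mem_nhds p hr] with q hq
    rwa [mem_ball_iff_norm] at hq
  filter_upwards [self_mem_nhdsWithin, nhdsWithin_le_nhds this] with q hqB hq
  obtain ⟨t, ht, hqt⟩ := G.cover q
  have hpt := h t ht q hqt hq
  have h1 := hΦ t ht p hpt q hqt hp hqB
  have h2 := hΨ t ht p hpt q hqt hp hqB
  linarith

/-- On the connected overlap the potentials differ by a constant, which is absorbed into the second
one. Convexity of the union handles tiles that meet both parts. -/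
theorem IsPotential.glue {e : ℂ} {B B' : Set ℂ} (hcB : IsClosed B) (hcB' : IsClosed B')
    (hU : Convex ℝ (B ∪ B')) (hI : IsPreconnected (B ∩ B'))
    (hΦ : ∃ Φ, G.IsPotential e B Φ) (hΨ : ∃ Ψ, G.IsPotential e B' Ψ) :
    ∃ Φ, G.IsPotential e (B ∪ B') Φ := by
  classical
  obtain ⟨Φ, hΦ⟩ := hΦ
  obtain ⟨Ψ, hΨ⟩ := hΨ
  obtain ⟨κ, hκ⟩ : ∃ κ, ∀ p ∈ B ∩ B', Φ p = Ψ p + κ := by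
    rcases (B ∩ B').eq_empty_or_nonempty with h | ⟨x, hx⟩
    · exact ⟨0, fun p hp => by simp [h] at hp⟩
    · refine ⟨Φ x - Ψ x, fun p hp => ?_⟩
      have := (hΦ.mono Set.inter_subset_left).sub_eq hI (hΨ.mono Set.inter_subset_right) hp hx
      linarith
  refine ⟨fun p => if p ∈ B then Φ p else Ψ p + κ, ?_⟩
  have hv : ∀ p ∈ B', (if p ∈ B then Φ p else Ψ p + κ) = Ψ p + κ := by
    intro p hp
    by_cases h : p ∈ B
    · rw [if_pos h, hκ p ⟨h, hp⟩]
    · rw [if_neg h]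
  have cross : ∀ t ∈ G.tiles, ∀ p ∈ t.carrier, ∀ q ∈ t.carrier, p ∈ B → q ∈ B' →
      (if p ∈ B then Φ p else Ψ p + κ) - (if q ∈ B then Φ q else Ψ q + κ) = t.slope e (p - q) := by
    intro t ht p hp q hq hpB hqB
    have hseg := (convex_segment (𝕜 := ℝ) p q).isPreconnected
    -- The segment from p to q stays in the tile and in the union; being connected, it meets the
    -- overlap, where the increment is split.
    obtain ⟨s, hs, hsB, hsB'⟩ := isPreconnected_closed_iff.1 hseg B B' hcB hcB'
      (hU.segment_subset (Or.inl hpB) (Or.inr hqB)) ⟨p, left_mem_segment ℝ p q, hpB⟩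
      ⟨q, right_mem_segment ℝ p q, hqB⟩
    have hst := t.convex_carrier.segment_subset hp hq hs
    have h1 := hΦ t ht p hp s hst hpB hsB
    have h2 := hΨ t ht s hst q hq hsB' hqB
    rw [if_pos hpB, hv q hqB]
    have h3 := hκ s ⟨hsB, hsB'⟩
    have h4 : p - q = (p - s) + (s - q) := by ring
    rw [h4, map_add, ← h1, ← h2]; linarith
  rintro t ht p hp q hq (hpB | hpB) (hqB | hqB)
  · simp only [if_pos hpB, if_pos hqB]; exact hΦ t ht p hp q hq hpB hqB
  · exact cross t ht p hp q hq hpB hqB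
  · have := cross t ht q hq p hp hqB hpB
    have h4 : p - q = -(q - p) := by ring
    rw [h4, map_neg, ← this]; simp only []; ring
  · simp only [hv p hpB, hv q hqB]
    have := hΨ t ht p hp q hq hpB hqB
    linarith

/-- In a small ball every tile contains the centre, so the differential is integrated radially from
p. -/
theorem exists_isPotential_ball (e p : ℂ) : ∃ r > 0, ∃ Φ, G.IsPotential e (Metric.ball p r) Φ := by
  classical
  obtain ⟨r, hr, h⟩ := G.eventually_mem_carrier p
  choose T hT hmem using G.cover
  refine ⟨r, hr, fun q => (T q).slope e (q - p), ?_⟩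
  intro t ht x hx y hy hxB hyB
  rw [mem_ball_iff_norm] at hxB hyB
  have hpt := h t ht x hx hxB
  have h1 := slope_compat (hT x) ht e (hmem x) hx (h _ (hT x) x (hmem x) hxB) hpt
  have h2 := slope_compat (hT y) ht e (hmem y) hy (h _ (hT y) y (hmem y) hyB) hpt
  have h4 : x - y = (x - p) - (y - p) := by ring
  simp only [h1, h2]
  rw [h4, map_sub _ (x - p)]

theorem isClosed_rect (a b c d : ℝ) : IsClosed (Set.Icc a b ×ℂ Set.Icc c d) :=
  isClosed_Icc.reProdIm isClosed_Icc

theorem convex_rect (a b c d : ℝ) : Convex ℝ (Set.Icc a b ×ℂ Set.Icc c d) :=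
  ((convex_Icc a b).linear_preimage Complex.reLm).inter
    ((convex_Icc c d).linear_preimage Complex.imLm)

theorem rect_union_left {a b b' c d : ℝ} (h : a ≤ b) (h' : b ≤ b') :
    (Set.Icc a b ×ℂ Set.Icc c d) ∪ (Set.Icc b b' ×ℂ Set.Icc c d) = Set.Icc a b' ×ℂ Set.Icc c d := by
  rw [← Set.Icc_union_Icc_eq_Icc h h']
  ext z
  simp only [Set.mem_union, Complex.mem_reProdIm]
  tauto

theorem rect_union_right {a b c d d' : ℝ} (h : c ≤ d) (h' : d ≤ d') :
    (Set.Icc a b ×ℂ Set.Icc c d) ∪ (Set.Icc a b ×ℂ Set.Icc d d') = Set.Icc a b ×ℂ Set.Icc c d' := by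
  rw [← Set.Icc_union_Icc_eq_Icc h h']
  ext z
  simp only [Set.mem_union, Complex.mem_reProdIm]
  tauto

/-- Simple connectivity in elementary form: cells below the Lebesgue number of the cover by good
balls are glued into rows, and the rows into the square. All overlaps are convex. -/
theorem exists_isPotential_rect (e : ℂ) (R : ℝ) (hR : 0 < R) :
    ∃ Φ, G.IsPotential e (Set.Icc (-R) R ×ℂ Set.Icc (-R) R) Φ := by
  have hK : IsCompact (Set.Icc (-R) R ×ℂ Set.Icc (-R) R) := isCompact_Icc.reProdIm isCompact_Icc
  choose r hr Φ hΦ using fun p => G.exists_isPotential_ball e p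
  obtain ⟨δ, hδ, hL⟩ := lebesgue_number_lemma_of_metric (c := fun p => Metric.ball p (r p)) hK
    (fun _ => Metric.isOpen_ball) (fun p _ => Set.mem_iUnion.2 ⟨p, Metric.mem_ball_self (hr p)⟩)
  obtain ⟨N, hN⟩ := exists_nat_gt (4 * R / δ)
  have hN0 : 0 < (N : ℝ) := lt_of_le_of_lt (by positivity) hN
  set h : ℝ := 2 * R / N with hh
  have hh0 : 0 < h := by positivity
  have hhδ : 2 * h < δ := by
    rw [hh]; rw [div_lt_iff₀ hδ] at hN; rw [← mul_div_assoc, div_lt_iff₀ hN0]; linarith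
  set x : ℕ → ℝ := fun i => -R + i * h with hx
  have hxs : ∀ i, x (i + 1) = x i + h := fun i => by simp only [hx]; push_cast; ring
  have hx0 : x 0 = -R := by simp [hx]
  have hxN : x N = R := by simp only [hx, hh]; field_simp; ring
  have hxm : ∀ i ≤ N, x i ≤ R := fun i hi => by
    rw [← hxN]; simp only [hx]
    have : (i : ℝ) ≤ N := by exact_mod_cast hi
    nlinarith
  have hxl : ∀ i, -R ≤ x i := fun i => by simp only [hx]; have : 0 ≤ (i : ℝ) * h := by positivity
                                          linarith
  have small : ∀ i < N, ∀ j < N,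
      ∃ Φ, G.IsPotential e (Set.Icc (x i) (x (i + 1)) ×ℂ Set.Icc (x j) (x (j + 1))) Φ := by
    intro i hi j hj
    have hmem : (⟨x i, x j⟩ : ℂ) ∈ Set.Icc (-R) R ×ℂ Set.Icc (-R) R :=
      ⟨⟨hxl i, hxm i hi.le⟩, hxl j, hxm j hj.le⟩
    obtain ⟨p, hp⟩ := hL _ hmem
    refine ⟨Φ p, (hΦ p).mono (subset_trans ?_ hp)⟩
    rintro z ⟨⟨h1, h2⟩, h3, h4⟩
    rw [mem_ball_iff_norm]
    refine (Complex.norm_le_abs_re_add_abs_im _).trans_lt ?_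
    rw [hxs] at h2 h4
    have e1 : |(z - ⟨x i, x j⟩ : ℂ).re| ≤ h := by
      rw [Complex.sub_re, abs_le]; constructor <;> simp <;> linarith
    have e2 : |(z - ⟨x i, x j⟩ : ℂ).im| ≤ h := by
      rw [Complex.sub_im, abs_le]; constructor <;> simp <;> linarith
    linarith
  have row : ∀ j < N, ∀ i, i < N →
      ∃ Φ, G.IsPotential e (Set.Icc (x 0) (x (i + 1)) ×ℂ Set.Icc (x j) (x (j + 1))) Φ := by
    intro j hj i
    induction i with
    | zero => exact fun h => small 0 h j hj
    | succ i ih =>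
      intro hi
      have hle : x 0 ≤ x (i + 1) := by rw [hx0]; exact hxl _
      have hle' : x (i + 1) ≤ x (i + 1 + 1) := by rw [hxs (i + 1)]; linarith
      have := IsPotential.glue (isClosed_rect _ _ _ _) (isClosed_rect _ _ _ _)
        (by rw [rect_union_left hle hle']; exact convex_rect _ _ _ _)
        ((convex_rect _ _ _ _).inter (convex_rect _ _ _ _)).isPreconnected
        (ih (by omega)) (small (i + 1) hi j hj)
      rwa [rect_union_left hle hle'] at this
  have all : ∀ j, j < N →
      ∃ Φ, G.IsPotential e (Set.Icc (x 0) (x N) ×ℂ Set.Icc (x 0) (x (j + 1))) Φ := by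
    have rowN : ∀ j < N, ∃ Φ, G.IsPotential e (Set.Icc (x 0) (x N) ×ℂ Set.Icc (x j) (x (j + 1))) Φ := by
      intro j hj
      have := row j hj (N - 1) (by omega)
      rwa [Nat.sub_add_cancel (by omega)] at this
    intro j
    induction j with
    | zero => exact fun h => rowN 0 h
    | succ j ih =>
      intro hj
      have hle : x 0 ≤ x (j + 1) := by rw [hx0]; exact hxl _
      have hle' : x (j + 1) ≤ x (j + 1 + 1) := by rw [hxs (j + 1)]; linarith
      have := IsPotential.glue (isClosed_rect _ _ _ _) (isClosed_rect _ _ _ _)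
        (by rw [rect_union_right hle hle']; exact convex_rect _ _ _ _)
        ((convex_rect _ _ _ _).inter (convex_rect _ _ _ _)).isPreconnected
        (ih (by omega)) (rowN (j + 1) hj)
      rwa [rect_union_right hle hle'] at this
  have hNn : 0 < N := by exact_mod_cast hN0
  have := all (N - 1) (by omega)
  rwa [Nat.sub_add_cancel (by omega), hx0, hxN] at this

/-- The height function that counts the sides with direction `e` exists on the whole plane. -/
theorem exists_isPotential (G : IsoradialGraph) (e : ℂ) : ∃ Φ, G.IsPotential e Set.univ Φ := by
  choose Φ hΦ using fun n : ℕ => G.exists_isPotential_rect e (n + 1) (by positivity)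
  set Q : ℕ → Set ℂ := fun n => Set.Icc (-((n : ℝ) + 1)) (n + 1) ×ℂ Set.Icc (-((n : ℝ) + 1)) (n + 1) with hQ
  have h0 : ∀ n, (0 : ℂ) ∈ Q n := fun n => by
    have : (0 : ℝ) ≤ n := by positivity
    refine ⟨⟨?_, ?_⟩, ?_, ?_⟩ <;> simp <;> linarith
  have hmono : ∀ m n, m ≤ n → Q m ⊆ Q n := by
    rintro m n hmn z ⟨⟨h1, h2⟩, h3, h4⟩
    have : (m : ℝ) ≤ n := by exact_mod_cast hmn
    exact ⟨⟨by linarith, by linarith⟩, by linarith, by linarith⟩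
  have hmem : ∀ z : ℂ, z ∈ Q ⌈‖z‖⌉₊ := fun z => by
    have h1 := Nat.le_ceil ‖z‖
    have h2 := abs_le.1 (Complex.abs_re_le_norm z)
    have h3 := abs_le.1 (Complex.abs_im_le_norm z)
    exact ⟨⟨by linarith, by linarith⟩, by linarith, by linarith⟩
  -- Normalised at 0, the potentials of nested squares agree, so the index may depend on the point.
  refine ⟨fun z => Φ ⌈‖z‖⌉₊ z - Φ ⌈‖z‖⌉₊ 0, fun t ht p hp q hq _ _ => ?_⟩
  set n := max ⌈‖p‖⌉₊ ⌈‖q‖⌉₊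
  have key : ∀ z : ℂ, ⌈‖z‖⌉₊ ≤ n → Φ ⌈‖z‖⌉₊ z - Φ ⌈‖z‖⌉₊ 0 = Φ n z - Φ n 0 := by
    intro z hz
    have := (hΦ ⌈‖z‖⌉₊).sub_eq (convex_rect _ _ _ _).isPreconnected ((hΦ n).mono (hmono _ _ hz))
      (hmem z) (h0 _)
    linarith
  simp only [key p (le_max_left _ _), key q (le_max_right _ _)]
  have := hΦ n t ht p hp q hq (hmono _ _ (le_max_left _ _) (hmem p))
    (hmono _ _ (le_max_right _ _) (hmem q))
  linarith

/-- The height function that counts the sides with direction `e`. -/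
noncomputable def height (G : IsoradialGraph) (e : ℂ) : ℂ → ℝ := (G.exists_isPotential e).choose

theorem height_sub {t : Rhombus} (ht : t ∈ G.tiles) (e : ℂ) {p q : ℂ} (hp : p ∈ t.carrier)
    (hq : q ∈ t.carrier) : G.height e p - G.height e q = t.slope e (p - q) :=
  (G.exists_isPotential e).choose_spec t ht p hp q hq trivial trivial

open Classical in
theorem height_arrow {x y : ℂ} (h : G.Arrow x y) (e : ℂ) :
    G.height e y - G.height e x = if y - x = e then 1 else 0 := by
  obtain ⟨t, ht, hs⟩ := h.exists_side
  have h1 := t.corner_mem hs.start_corner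
  have h2 := t.corner_mem hs.end_corner
  rw [add_sub_cancel] at h2
  rw [height_sub ht e h2 h1, hs.slope]

/-- The divisor of the discrete exponential along a path: the order of the pole at each point. -/
noncomputable def LatticePath.div {x : ℂ} : {y : ℂ} → G.LatticePath x y → (ℂ →₀ ℤ)
  | _, .refl => 0
  | _, .along (u := u) (v := v) p _ => p.div + Finsupp.single (v - u) 1
  | _, .against (u := u) (v := v) p _ => p.div - Finsupp.single (u - v) 1

/-- The pole order along a path is a height difference. It therefore depends only on the endpoints,
which is the path independence of the discrete exponential. -/
theorem LatticePath.div_apply {x y : ℂ} (p : G.LatticePath x y) (e : ℂ) :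
    (p.div e : ℝ) = G.height e y - G.height e x := by
  classical
  induction p with
  | refl => simp [div]
  | @along u v p h ih =>
    have := height_arrow h e
    simp only [div, Finsupp.add_apply, Int.cast_add, ih, Finsupp.single_apply]
    split_ifs at this ⊢ <;> push_cast <;> linarith
  | @against u v p h ih =>
    have := height_arrow h e
    simp only [div, Finsupp.sub_apply, Int.cast_sub, ih, Finsupp.single_apply]
    split_ifs at this ⊢ <;> push_cast <;> linarith

theorem nonempty_path_corner {x : ℂ} {t : Rhombus} (ht : t ∈ G.tiles) {c : ℂ} (hc : c ∈ t.corners) :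
    Nonempty (G.LatticePath x c) ↔ Nonempty (G.LatticePath x t.w) := by
  have hr : G.Arrow t.w t.r := ⟨t, ht, Or.inl ⟨rfl, Or.inl rfl⟩⟩
  have hl : G.Arrow t.w t.l := ⟨t, ht, Or.inl ⟨rfl, Or.inr rfl⟩⟩
  have hb : G.Arrow t.r t.b := ⟨t, ht, Or.inr ⟨Or.inl rfl, rfl⟩⟩
  rcases hc with rfl | rfl | rfl | rfl
  · rfl
  · exact ⟨fun ⟨p⟩ => ⟨p.against hr⟩, fun ⟨p⟩ => ⟨p.along hr⟩⟩
  · exact ⟨fun ⟨p⟩ => ⟨(p.against hb).against hr⟩, fun ⟨p⟩ => ⟨(p.along hr).along hb⟩⟩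
  · exact ⟨fun ⟨p⟩ => ⟨p.against hl⟩, fun ⟨p⟩ => ⟨p.along hl⟩⟩

/-- The rhombus graph is connected. -/
theorem nonempty_path {x y : ℂ} (hx : x ∈ G.vertex) (hy : y ∈ G.vertex) :
    Nonempty (G.LatticePath x y) := by
  have key : ∀ p q : ℂ, ∀ t ∈ G.tiles, ∀ t' ∈ G.tiles, p ∈ t.carrier → q ∈ t'.carrier →
      (Nonempty (G.LatticePath x t.w) ↔ Nonempty (G.LatticePath x t'.w)) := by
    intro p q
    refine isPreconnected_univ.induction₂ (fun p q => ∀ t ∈ G.tiles, ∀ t' ∈ G.tiles, p ∈ t.carrier →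
      q ∈ t'.carrier → (Nonempty (G.LatticePath x t.w) ↔ Nonempty (G.LatticePath x t'.w)))
      (fun p _ => ?_) ?_ ?_ (Set.mem_univ p) (Set.mem_univ q)
    · obtain ⟨r, hr, h⟩ := G.eventually_mem_carrier p
      have : ∀ᶠ q in nhds p, ‖q - p‖ < r := by
        filter_upwards [Metric.ball_mem_nhds p hr] with q hq
        rwa [mem_ball_iff_norm] at hq
      filter_upwards [nhdsWithin_le_nhds this] with q hq t ht t' ht' hpt hqt
      obtain ⟨c, hc, hc'⟩ := exists_common_corner ht ht' hpt (h t' ht' q hqt hq)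
      rw [← nonempty_path_corner ht hc, ← nonempty_path_corner ht' hc']
    · intro p q r _ _ _ h1 h2 t ht t' ht' hp hr
      obtain ⟨t₁, ht₁, hq⟩ := G.cover q
      exact (h1 t ht t₁ ht₁ hp hq).trans (h2 t₁ ht₁ t' ht' hq hr)
    · intro p q _ _ h t ht t' ht' hq hp
      exact (h t' ht' t ht hp hq).symm
  obtain ⟨t, ht, hxt⟩ := hx
  obtain ⟨t', ht', hyt⟩ := hy
  rw [nonempty_path_corner ht' hyt, ← key x y t ht t' ht' (t.corner_mem hxt) (t'.corner_mem hyt),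
    ← nonempty_path_corner ht hxt]
  exact ⟨.refl⟩

open Classical in
/-- The divisor of the discrete exponential from `x` to `y`. -/
noncomputable def divisor (G : IsoradialGraph) (x y : ℂ) : ℂ →₀ ℤ :=
  if h : Nonempty (G.LatticePath x y) then h.some.div else 0

theorem divisor_apply {x y : ℂ} (hx : x ∈ G.vertex) (hy : y ∈ G.vertex) (e : ℂ) :
    (G.divisor x y e : ℝ) = G.height e y - G.height e x := by
  rw [divisor, dif_pos (nonempty_path hx hy), LatticePath.div_apply]

theorem LatticePath.div_eq {x y : ℂ} (hx : x ∈ G.vertex) (hy : y ∈ G.vertex)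
    (p : G.LatticePath x y) : p.div = G.divisor x y := by
  ext e
  have h1 := p.div_apply e
  rw [← divisor_apply hx hy] at h1
  exact_mod_cast h1

theorem divisor_add {x y z : ℂ} (hx : x ∈ G.vertex) (hy : y ∈ G.vertex) (hz : z ∈ G.vertex) :
    G.divisor x y + G.divisor y z = G.divisor x z := by
  ext e
  have h1 := divisor_apply hx hy e
  have h2 := divisor_apply hy hz e
  have h3 := divisor_apply hx hz e
  have : ((G.divisor x y e + G.divisor y z e : ℤ) : ℝ) = G.divisor x z e := by
    push_cast; linarith
  simpa using (by exact_mod_cast this : G.divisor x y e + G.divisor y z e = G.divisor x z e)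

theorem divisor_self {x : ℂ} (hx : x ∈ G.vertex) : G.divisor x x = 0 := by
  have := divisor_add hx hx hx
  simpa using this

theorem divisor_symm {x y : ℂ} (hx : x ∈ G.vertex) (hy : y ∈ G.vertex) :
    G.divisor y x = -G.divisor x y := by
  have := divisor_add hx hy hx
  rw [divisor_self hx] at this
  exact eq_neg_of_add_eq_zero_right this

theorem Arrow.left_mem {x y : ℂ} (h : G.Arrow x y) : x ∈ G.vertex := by
  obtain ⟨t, ht, hs⟩ := h.exists_side
  exact ⟨t, ht, hs.start_corner⟩

theorem Arrow.right_mem {x y : ℂ} (h : G.Arrow x y) : y ∈ G.vertex := by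
  obtain ⟨t, ht, hs⟩ := h.exists_side
  refine ⟨t, ht, ?_⟩
  simpa using hs.end_corner

theorem Arrow.divisor {x y : ℂ} (h : G.Arrow x y) : G.divisor x y = Finsupp.single (y - x) 1 := by
  rw [← LatticePath.div_eq h.left_mem h.right_mem (LatticePath.along .refl h)]
  simp [LatticePath.div]

/-- Every step contributes its own displacement. This ties the position of the poles to the
direction of y - x and their number to its length. -/
theorem divisor_sum_mul {x y : ℂ} (hx : x ∈ G.vertex) (hy : y ∈ G.vertex) :
    (G.divisor x y).sum (fun e n => (n : ℂ) * e) = y - x := by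
  rw [divisor, dif_pos (nonempty_path hx hy)]
  generalize (nonempty_path hx hy).some = p
  clear hy
  have h0 : ∀ e : ℂ, ((0 : ℤ) : ℂ) * e = 0 := by simp
  have ha : ∀ (e : ℂ) (m n : ℤ), ((m + n : ℤ) : ℂ) * e = m * e + n * e := by
    intros; push_cast; ring
  have hs : ∀ (e : ℂ) (m n : ℤ), ((m - n : ℤ) : ℂ) * e = m * e - n * e := by
    intros; push_cast; ring
  induction p with
  | refl => simp [LatticePath.div]
  | @along u v p h ih =>
    rw [LatticePath.div, Finsupp.sum_add_index' h0 ha, ih, Finsupp.sum_single_index (by simp)]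
    push_cast; ring
  | @against u v p h ih =>
    rw [LatticePath.div, Finsupp.sum_sub_index hs, ih, Finsupp.sum_single_index (by simp)]
    push_cast; ring

open Classical in
/-- The degree of a vertex: `0` for white vertices, `1` for faces, `2` for black vertices. -/
noncomputable def deg (G : IsoradialGraph) (x : ℂ) : ℤ :=
  if x ∈ G.white then 0 else if x ∈ G.face then 1 else 2

theorem deg_white {x : ℂ} (h : x ∈ G.white) : G.deg x = 0 := by simp [deg, h]

theorem deg_face {x : ℂ} (h : x ∈ G.face) : G.deg x = 1 := by
  have : x ∉ G.white := fun h' => white_not_face h' h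
  simp [deg, h, this]

theorem deg_black {x : ℂ} (h : x ∈ G.black) : G.deg x = 2 := by
  have : x ∉ G.white := fun h' => white_not_black h' h
  have h2 : x ∉ G.face := black_not_face h
  simp [deg, h2, this]

theorem Arrow.deg {x y : ℂ} (h : G.Arrow x y) : G.deg y = G.deg x + 1 := by
  rcases h.cases with ⟨h1, h2⟩ | ⟨h1, h2⟩
  · rw [deg_white h1, deg_face h2]; rfl
  · rw [deg_face h1, deg_black h2]; rfl

/-- Each arrow raises the degree by one. The sum is the order of decay of the discrete exponential
at infinity. -/
theorem divisor_sum {x y : ℂ} (hx : x ∈ G.vertex) (hy : y ∈ G.vertex) :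
    (G.divisor x y).sum (fun _ n => n) = G.deg y - G.deg x := by
  rw [divisor, dif_pos (nonempty_path hx hy)]
  generalize (nonempty_path hx hy).some = p
  clear hy
  induction p with
  | refl => simp [LatticePath.div]
  | @along u v p h ih =>
    rw [LatticePath.div, Finsupp.sum_add_index' (fun _ => rfl) (fun _ _ _ => rfl), ih,
      Finsupp.sum_single_index rfl, h.deg]
    ring
  | @against u v p h ih =>
    rw [LatticePath.div, Finsupp.sum_sub_index (fun _ _ _ => rfl), ih,
      Finsupp.sum_single_index rfl, h.deg]
    ring

end IsoradialGraph

/-! ### Pseudo-lines and the points they separate. -/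

theorem cross_add_right (a b c : ℂ) : cross a (b + c) = cross a b + cross a c := by
  simp [cross]; ring

theorem cross_sub_right (a b c : ℂ) : cross a (b - c) = cross a b - cross a c := by
  simp [cross]; ring

theorem cross_add_left (a b c : ℂ) : cross (a + b) c = cross a c + cross b c := by
  simp [cross]; ring

theorem cross_mul_right (a b : ℂ) (r : ℝ) : cross a (r * b) = r * cross a b := by
  simp [cross]; ring

theorem cross_mul_left (a b : ℂ) (r : ℝ) : cross (r * a) b = r * cross a b := by
  simp [cross]; ring

theorem cross_neg_right (a b : ℂ) : cross a (-b) = -cross a b := by simp [cross]; ring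

theorem cross_neg_left (a b : ℂ) : cross (-a) b = -cross a b := by simp [cross]; ring

theorem cross_comm (a b : ℂ) : cross b a = -cross a b := by simp [cross]; ring

theorem cross_same (a : ℂ) : cross a a = 0 := by simp [cross]; ring

theorem re_sq_add_im_sq {a : ℂ} (h : ‖a‖ = 1) : a.re ^ 2 + a.im ^ 2 = 1 := by
  have := Complex.sq_norm a
  rw [h, Complex.normSq_apply] at this; linarith

/-- A continuous function which grows locally along a direction grows along this direction. -/
theorem le_add_mul_of_local {f : ℂ → ℝ} (hf : Continuous f) {v : ℂ}
    (h : ∀ p, ∃ η : ℝ, 0 < η ∧ ∀ τ : ℝ, 0 ≤ τ → τ ≤ η → f p ≤ f (p + τ * v)) (p : ℂ) {τ : ℝ}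
    (hτ : 0 ≤ τ) : f p ≤ f (p + τ * v) := by
  have hc : Continuous fun τ : ℝ => f (p + τ * v) := by fun_prop
  have := IsClosed.Icc_subset_of_forall_mem_nhdsWithin (a := 0) (b := τ)
    (s := {τ : ℝ | f p ≤ f (p + τ * v)})
    ((isClosed_le continuous_const hc).inter isClosed_Icc) (by simp) ?_
  · exact this ⟨hτ, le_rfl⟩
  · rintro x ⟨hx, hx'⟩
    obtain ⟨η, hη, hloc⟩ := h (p + x * v)
    filter_upwards [Ioo_mem_nhdsGT (show x < x + η by linarith)] with y hy
    have := hloc (y - x) (by linarith [hy.1]) (by linarith [hy.2])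
    refine le_trans hx (this.trans (le_of_eq ?_))
    congr 1; push_cast; ring

/-- `n` is the height above a pseudo-line which is transversal to the directions near `s`. -/
structure IsTrack (ε : ℝ) (s : ℂ) (n : ℂ → ℝ) : Prop where
  norm : ‖s‖ = 1
  cont : Continuous n
  mono : ∀ v, ‖v - s‖ ≤ ε → ∀ (p : ℂ) (τ : ℝ), 0 ≤ τ → n p ≤ n (p + τ * v)
  pos : ∀ v, ‖v - s‖ ≤ ε → ∀ (p : ℂ) (τ : ℝ), 0 < τ → n p = 0 → 0 < n (p + τ * v)
  neg : ∀ v, ‖v - s‖ ≤ ε → ∀ (p : ℂ) (τ : ℝ), 0 < τ → n p = 0 → n (p - τ * v) < 0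

namespace IsTrack

variable {ε : ℝ} {s : ℂ} {n : ℂ → ℝ}

theorem symm (h : IsTrack ε s n) : IsTrack ε (-s) (fun p => -n p) where
  norm := by rw [norm_neg, h.norm]
  cont := h.cont.neg
  mono v hv p τ hτ := by
    have hv' : ‖-v - s‖ ≤ ε := by rwa [← norm_neg, show -(-v - s) = v - -s by ring]
    have := h.mono (-v) hv' (p + τ * v) τ hτ
    rw [show p + τ * v + τ * -v = p by ring] at this
    linarith
  pos v hv p τ hτ hp := by
    have hv' : ‖-v - s‖ ≤ ε := by rwa [← norm_neg, show -(-v - s) = v - -s by ring]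
    have := h.neg (-v) hv' p τ hτ (by linarith)
    rw [show p - τ * -v = p + τ * v by ring] at this
    linarith
  neg v hv p τ hτ hp := by
    have hv' : ‖-v - s‖ ≤ ε := by rwa [← norm_neg, show -(-v - s) = v - -s by ring]
    have := h.pos (-v) hv' p τ hτ (by linarith)
    rw [show p + τ * -v = p - τ * v by ring] at this
    linarith

theorem cone (h : IsTrack ε s n) {p q : ℂ} {τ : ℝ} (hτ : 0 < τ) (hq : ‖q - p - τ * s‖ ≤ ε * τ) :
    n p ≤ n q := by
  have h0 : (τ : ℂ) ≠ 0 := by exact_mod_cast hτ.ne'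
  have := h.mono ((q - p) / τ) ?_ p τ hτ.le
  · rwa [mul_div_cancel₀ _ h0, add_sub_cancel] at this
  · rw [show (q - p) / τ - s = (q - p - τ * s) / τ by field_simp, norm_div, Complex.norm_real,
      Real.norm_of_nonneg hτ.le, div_le_iff₀ hτ]
    exact hq

theorem cone_pos (h : IsTrack ε s n) {p q : ℂ} {τ : ℝ} (hτ : 0 < τ)
    (hq : ‖q - p - τ * s‖ ≤ ε * τ) (hp : n p = 0) : 0 < n q := by
  have h0 : (τ : ℂ) ≠ 0 := by exact_mod_cast hτ.ne'
  have := h.pos ((q - p) / τ) ?_ p τ hτ hp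
  · rwa [mul_div_cancel₀ _ h0, add_sub_cancel] at this
  · rw [show (q - p) / τ - s = (q - p - τ * s) / τ by field_simp, norm_div, Complex.norm_real,
      Real.norm_of_nonneg hτ.le, div_le_iff₀ hτ]
    exact hq

theorem mono_self (h : IsTrack ε s n) (hε : 0 < ε) (p : ℂ) {τ : ℝ} (hτ : 0 ≤ τ) :
    n p ≤ n (p + τ * s) := h.mono s (by simp [hε.le]) p τ hτ

/-- Two points are joined by moving both far along s and connecting the ends. For T > ‖q - p‖/ε the
connecting segment lies in the cone above p, where n is at least its value at p. -/
theorem isPreconnected_pos (h : IsTrack ε s n) (hε : 0 < ε) : IsPreconnected {p | 0 < n p} := by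
  refine isPreconnected_of_forall_pair fun p hp q hq => ?_
  set T : ℝ := ‖q - p‖ / ε + 1 with hT
  have hT0 : 0 < T := by positivity
  have hTε : ‖q - p‖ ≤ ε * T := by rw [hT, mul_add, mul_div_cancel₀ _ hε.ne']; linarith
  have up : ∀ p, 0 < n p → segment ℝ p (p + T * s) ⊆ {p | 0 < n p} := by
    rintro p hp _ ⟨a, c, ha, hc, hac, rfl⟩
    have := h.mono_self hε p (mul_nonneg hc hT0.le)
    have e : a • p + c • (p + T * s) = p + ((c * T : ℝ) : ℂ) * s := by
      have : p = (a + c : ℝ) • p := by rw [hac, one_smul]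
      nth_rewrite 3 [this]
      simp only [Complex.real_smul]; push_cast; ring
    rw [e]
    exact hp.trans_le this
  refine ⟨segment ℝ p (p + T * s) ∪ segment ℝ (p + T * s) (q + T * s) ∪ segment ℝ q (q + T * s),
    ?_, ?_, ?_, ?_⟩
  · rintro z ((hz | hz) | hz)
    · exact up p hp hz
    · obtain ⟨a, c, ha, hc, hac, rfl⟩ := hz
      refine hp.trans_le (h.cone hT0 ?_)
      have e : a • (p + T * s) + c • (q + T * s) - p - T * s = (c : ℂ) * (q - p) := by
        have : a = 1 - c := by linarith
        rw [this]; simp only [Complex.real_smul]; push_cast; ring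
      rw [e, norm_mul, Complex.norm_real, Real.norm_of_nonneg hc]
      nlinarith [norm_nonneg (q - p)]
    · exact up q hq hz
  · exact Or.inl (Or.inl (left_mem_segment ℝ _ _))
  · exact Or.inr (left_mem_segment ℝ _ _)
  · refine IsPreconnected.union (q + T * s) (Or.inr (right_mem_segment ℝ _ _))
      (right_mem_segment ℝ _ _) (IsPreconnected.union (p + T * s) (right_mem_segment ℝ _ _)
      (left_mem_segment ℝ _ _) (convex_segment _ _).isPreconnected
      (convex_segment _ _).isPreconnected) (convex_segment _ _).isPreconnected

theorem isPreconnected_neg (h : IsTrack ε s n) (hε : 0 < ε) : IsPreconnected {p | n p < 0} := by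
  simpa using h.symm.isPreconnected_pos hε

/-- The pseudo-line crosses every line in the direction `s`. -/
theorem exists_zero (h : IsTrack ε s n) (hε : 0 < ε) {p₀ : ℂ} (hp : n p₀ = 0) (q : ℝ) :
    ∃ p, n p = 0 ∧ cross s p = q := by
  set d := q - cross s p₀ with hd
  -- Large enough that the points at ±T along s lie in the cones above and below p₀; a zero lies
  -- between them.
  set T : ℝ := |d| / ε + 1 with hT
  have hT0 : 0 < T := by positivity
  have hTε : |d| ≤ ε * T := by rw [hT, mul_add, mul_div_cancel₀ _ hε.ne']; linarith
  have hs := re_sq_add_im_sq h.norm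
  have hnorm : ‖(d : ℂ) * (Complex.I * s)‖ = |d| := by
    rw [norm_mul, norm_mul, Complex.norm_I, h.norm, Complex.norm_real]; simp
  have h1 : 0 < n (p₀ + d * (Complex.I * s) + T * s) := by
    refine h.cone_pos hT0 ?_ hp
    rw [show p₀ + d * (Complex.I * s) + T * s - p₀ - T * s = d * (Complex.I * s) by ring, hnorm]
    exact hTε
  have h2 : n (p₀ + d * (Complex.I * s) + (-T : ℝ) * s) < 0 := by
    have := h.symm.cone_pos (p := p₀) (q := p₀ + d * (Complex.I * s) + (-T : ℝ) * s) hT0 ?_ (by linarith)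
    · linarith
    · rw [show p₀ + d * (Complex.I * s) + ((-T : ℝ) : ℂ) * s - p₀ - T * -s = d * (Complex.I * s) by
        push_cast; ring, hnorm]
      exact hTε
  have hc : Continuous fun τ : ℝ => n (p₀ + d * (Complex.I * s) + τ * s) :=
    h.cont.comp (by fun_prop)
  obtain ⟨τ, -, hτ⟩ := intermediate_value_Icc (show -T ≤ T by linarith) hc.continuousOn
    (show (0 : ℝ) ∈ Set.Icc _ _ from ⟨h2.le, h1.le⟩)
  refine ⟨_, hτ, ?_⟩
  rw [cross_add_right, cross_add_right, cross_mul_right, cross_mul_right, cross_same]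
  have : cross s (Complex.I * s) = 1 := by simp [cross]; linarith
  rw [this]; linarith

/-- No zero lies in the cone of another, so the component of q - p along s is at most 1/ε times the
transversal one. The pseudo-line is a Lipschitz graph over the normal line of s. -/
theorem dist_le (h : IsTrack ε s n) (hε : 0 < ε) {p q : ℂ} (hp : n p = 0) (hq : n q = 0) :
    ‖q - p‖ ≤ (1 + 1 / ε) * |cross s q - cross s p| := by
  have hs := re_sq_add_im_sq h.norm
  set d := cross s q - cross s p with hd
  set a : ℝ := s.re * (q - p).re + s.im * (q - p).im with ha
  have hdec : q - p = a * s + d * (Complex.I * s) := by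
    rw [hd, ← cross_sub_right, ha]
    apply Complex.ext <;> simp [cross]
    · linear_combination -(q.re - p.re) * hs
    · linear_combination -(q.im - p.im) * hs
  have hnorm : ‖(d : ℂ) * (Complex.I * s)‖ = |d| := by
    rw [norm_mul, norm_mul, Complex.norm_I, h.norm, Complex.norm_real]; simp
  have key : ε * |a| ≤ |d| := by
    by_contra hcon
    push Not at hcon
    have ha0 : a ≠ 0 := by
      rintro h0
      rw [h0, abs_zero, mul_zero] at hcon
      exact absurd hcon (not_lt.2 (abs_nonneg d))
    rcases lt_or_gt_of_ne ha0 with h0 | h0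
    · have := h.cone_pos (p := q) (q := p) (τ := -a) (by linarith) ?_ hq
      · linarith
      · rw [show p - q - ((-a : ℝ) : ℂ) * s = -(d * (Complex.I * s)) by
          push_cast; linear_combination -hdec, norm_neg, hnorm]
        rw [abs_of_neg h0] at hcon; exact hcon.le
    · have := h.cone_pos (p := p) (q := q) (τ := a) h0 ?_ hp
      · linarith
      · rw [show q - p - a * s = d * (Complex.I * s) by linear_combination hdec, hnorm]
        rw [abs_of_pos h0] at hcon; exact hcon.le
  rw [hdec]
  refine (norm_add_le _ _).trans ?_
  rw [hnorm, norm_mul, h.norm, Complex.norm_real, Real.norm_eq_abs, mul_one]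
  have : |a| ≤ |d| / ε := by rw [le_div_iff₀ hε]; linarith
  have e : (1 + 1 / ε) * |d| = |d| + |d| / ε := by ring
  rw [e]; linarith

/-- A function that grows locally along a pseudo-line grows along the pseudo-line. -/
theorem le_of_local (h : IsTrack ε s n) (hε : 0 < ε) {f : ℂ → ℝ} (hf : Continuous f)
    (hloc : ∀ p, n p = 0 → ∃ (v : ℂ) (η : ℝ), 0 < η ∧ 0 < cross s v ∧
      ∀ τ : ℝ, 0 ≤ τ → τ ≤ η → n (p + τ * v) = 0 ∧ f p ≤ f (p + τ * v))
    {p q : ℂ} (hp : n p = 0) (hq : n q = 0) (hpq : cross s p ≤ cross s q) : f p ≤ f q := by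
  -- P parametrises the pseudo-line by the coordinate `cross s`; it is Lipschitz by `dist_le`, so a
  -- one-variable continuation argument applies.
  choose P hP0 hPc using fun x => h.exists_zero hε hp x
  have huniq : ∀ z, n z = 0 → P (cross s z) = z := by
    intro z hz
    have := h.dist_le hε hz (hP0 (cross s z))
    rw [hPc, sub_self, abs_zero, mul_zero] at this
    exact sub_eq_zero.1 (norm_le_zero_iff.1 this)
  have hPcont : Continuous P := by
    refine (LipschitzWith.of_dist_le_mul (K := (1 + 1 / ε).toNNReal) fun x y => ?_).continuous
    have := h.dist_le hε (hP0 y) (hP0 x)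
    rwa [hPc, hPc, ← dist_eq_norm, ← Real.dist_eq, ← Real.coe_toNNReal (1 + 1 / ε) (by positivity)]
      at this
  have hc : Continuous fun x => f (P x) := hf.comp hPcont
  have := IsClosed.Icc_subset_of_forall_mem_nhdsWithin (a := cross s p) (b := cross s q)
    (s := {x : ℝ | f p ≤ f (P x)})
    ((isClosed_le continuous_const hc).inter isClosed_Icc) (by simp [huniq p hp]) ?_
  · have := this ⟨hpq, le_rfl⟩
    simpa [huniq q hq] using this
  · rintro x ⟨hx, hx'⟩
    obtain ⟨v, η, hη, hv, hl⟩ := hloc (P x) (hP0 x)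
    filter_upwards [Ioo_mem_nhdsGT (show x < x + η * cross s v by have := mul_pos hη hv; linarith)] with y hy
    have h1 := hl ((y - x) / cross s v) (div_nonneg (by linarith [hy.1]) hv.le)
      (by rw [div_le_iff₀ hv]; linarith [hy.2])
    have h2 := huniq _ h1.1
    rw [cross_add_right, cross_mul_right, hPc, div_mul_cancel₀ _ hv.ne', add_sub_cancel] at h2
    refine le_trans hx ?_
    rw [h2]; exact h1.2

end IsTrack

theorem cross_relation (a b c : ℂ) :
    (cross b c : ℂ) * a + (cross c a : ℂ) * b + (cross a b : ℂ) * c = 0 := by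
  apply Complex.ext <;> simp [cross] <;> ring

/-- Opposite pseudo-lines that do not cross cannot separate two points in the same sense. -/
theorem IsTrack.not_opposite {ε : ℝ} {s₁ s₂ : ℂ} {n₁ n₂ : ℂ → ℝ} (hε : 0 < ε) (h₁ : IsTrack ε s₁ n₁)
    (h₂ : IsTrack ε s₂ n₂) (hs : ‖s₁ + s₂‖ < ε)
    (hc : ∀ p q, n₁ p = 0 → n₁ q = 0 → n₂ p = n₂ q) {x y : ℂ} (hx₁ : n₁ x < 0) (hx₂ : n₂ x < 0)
    (hy₁ : 0 < n₁ y) (hy₂ : 0 < n₂ y) : False := by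
  obtain ⟨p₀, hp₀⟩ : ∃ p₀, n₁ p₀ = 0 := by
    obtain ⟨p, -, hp⟩ := isPreconnected_univ.intermediate_value (Set.mem_univ x) (Set.mem_univ y)
      h₁.cont.continuousOn (show (0 : ℝ) ∈ Set.Icc _ _ from ⟨hx₁.le, hy₁.le⟩)
    exact ⟨p, hp⟩
  -- Since -s₂ is within ε of s₁, the point x - T s₂ lies in the first cone above y for this T, and
  -- y + T s₂ in the one below x.
  set T : ℝ := ‖x - y‖ / (ε - ‖s₁ + s₂‖) + 1 with hT
  have hd : 0 < ε - ‖s₁ + s₂‖ := by linarith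
  have hT0 : 0 < T := by positivity
  have hTe : ‖x - y‖ + T * ‖s₁ + s₂‖ ≤ ε * T := by
    have : ‖x - y‖ ≤ (ε - ‖s₁ + s₂‖) * T := by
      rw [hT, mul_add, mul_div_cancel₀ _ hd.ne']; linarith
    linarith
  -- The value of n₂ is constant along the first line. If it is positive, the connected set {n₂ < 0}
  -- cannot cross that line and stays in {n₁ < 0}, although it contains x - T s₂. The other case is
  -- the mirror image.
  rcases lt_or_ge 0 (n₂ p₀) with h | h
  · have hsub : {p | n₂ p < 0} ⊆ {p | n₁ p < 0} := by
      refine (h₂.isPreconnected_neg hε).subset_of_closure_inter_subset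
        (isOpen_lt h₁.cont continuous_const) ⟨x, hx₂, hx₁⟩ ?_
      rintro p ⟨hp, hp2⟩
      have : n₁ p ≤ 0 := closure_minimal (fun p hp => le_of_lt hp)
        (isClosed_le h₁.cont continuous_const) hp
      rcases this.lt_or_eq with h' | h'
      · exact h'
      · have := hc p p₀ h' hp₀
        simp only [Set.mem_ofPred_eq] at hp2
        linarith
    have hz : n₂ (x + T * -s₂) ≤ n₂ x := by
      have := h₂.symm.mono_self hε x hT0.le
      linarith
    have h1 : n₁ (x + T * -s₂) < 0 := hsub (hz.trans_lt hx₂)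
    have h2 : n₁ y ≤ n₁ (x + T * -s₂) := by
      refine h₁.cone hT0 ?_
      rw [show x + T * -s₂ - y - T * s₁ = (x - y) + -(T * (s₁ + s₂)) by ring]
      refine (norm_add_le _ _).trans ?_
      rw [norm_neg, norm_mul, Complex.norm_real, Real.norm_of_nonneg hT0.le]
      exact hTe
    linarith
  · have hsub : {p | 0 < n₂ p} ⊆ {p | 0 < n₁ p} := by
      refine (h₂.isPreconnected_pos hε).subset_of_closure_inter_subset
        (isOpen_lt continuous_const h₁.cont) ⟨y, hy₂, hy₁⟩ ?_
      rintro p ⟨hp, hp2⟩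
      have : 0 ≤ n₁ p := closure_minimal (fun p hp => le_of_lt hp)
        (isClosed_le continuous_const h₁.cont) hp
      rcases this.lt_or_eq with h' | h'
      · exact h'
      · have := hc p p₀ h'.symm hp₀
        simp only [Set.mem_ofPred_eq] at hp2
        linarith
    have hz : n₂ y ≤ n₂ (y + T * s₂) := h₂.mono_self hε y hT0.le
    have h1 : 0 < n₁ (y + T * s₂) := hsub (hy₂.trans_le hz)
    have h2 : -n₁ x ≤ -n₁ (y + T * s₂) := by
      refine h₁.symm.cone hT0 ?_
      rw [show y + T * s₂ - x - T * -s₁ = -(x - y) + (T * (s₁ + s₂)) by ring]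
      refine (norm_add_le _ _).trans ?_
      rw [norm_neg, norm_mul, Complex.norm_real, Real.norm_of_nonneg hT0.le]
      exact hTe
    linarith

/-- Three pseudo-lines with positively spanning directions, no two of which bound a triangle on
the positive side, cannot separate two points in the same sense. -/
theorem IsTrack.not_spanning_aux {ε : ℝ} {s₁ s₂ s₃ : ℂ} {n₁ n₂ n₃ : ℂ → ℝ} (hε : 0 < ε)
    (h₁ : IsTrack ε s₁ n₁) (h₂ : IsTrack ε s₂ n₂) (h₃ : IsTrack ε s₃ n₃)
    (c₁₂ : 0 < cross s₁ s₂) (c₂₃ : 0 < cross s₂ s₃) (c₃₁ : 0 < cross s₃ s₁)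
    (m₁₂ : ∀ p q, n₁ p = 0 → n₁ q = 0 → cross s₁ p ≤ cross s₁ q → n₂ p ≤ n₂ q)
    (m₂₁ : ∀ p q, n₂ p = 0 → n₂ q = 0 → cross s₂ p ≤ cross s₂ q → n₁ q ≤ n₁ p)
    (tr : ∀ p, n₁ p = 0 → n₂ p = 0 → ∀ δ > 0, ∃ q, n₁ q = 0 ∧ 0 < n₂ q ∧ ‖q - p‖ < δ)
    (A₁ : ∀ p, n₁ p = 0 → 0 < n₂ p → ¬ 0 < n₃ p) (A₂ : ∀ p, n₂ p = 0 → 0 < n₁ p → ¬ 0 < n₃ p)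
    {x y : ℂ} (hx₁ : n₁ x < 0) (hx₂ : n₂ x < 0)
    (hy₁ : 0 < n₁ y) (hy₂ : 0 < n₂ y) (hy₃ : 0 < n₃ y) : False := by
  -- The connected set {n₃ > 0} contains y and cannot leave the sector {n₁ > 0, n₂ > 0}: the open
  -- boundary arcs are excluded by `A₁` and `A₂`, and a corner of the sector is the limit of points
  -- of an excluded arc by `tr`.
  have hR : {p | 0 < n₃ p} ⊆ {p | 0 < n₁ p ∧ 0 < n₂ p} := by
    refine (h₃.isPreconnected_pos hε).subset_of_closure_inter_subset
      ((isOpen_lt continuous_const h₁.cont).inter (isOpen_lt continuous_const h₂.cont))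
      ⟨y, hy₃, hy₁, hy₂⟩ ?_
    rintro p ⟨hp, hp3⟩
    have hle : 0 ≤ n₁ p ∧ 0 ≤ n₂ p := closure_minimal (t := {p | 0 ≤ n₁ p} ∩ {p | 0 ≤ n₂ p})
      (fun p hp => ⟨le_of_lt hp.1, le_of_lt hp.2⟩)
      ((isClosed_le continuous_const h₁.cont).inter (isClosed_le continuous_const h₂.cont)) hp
    rcases hle.1.lt_or_eq with h1 | h1
    · rcases hle.2.lt_or_eq with h2 | h2
      · exact ⟨h1, h2⟩
      · exact absurd hp3 (A₂ p h2.symm h1)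
    · rcases hle.2.lt_or_eq with h2 | h2
      · exact absurd hp3 (A₁ p h1.symm h2)
      · obtain ⟨δ, hδ, hball⟩ := Metric.isOpen_iff.1 (isOpen_lt continuous_const h₃.cont) p hp3
        obtain ⟨q, hq1, hq2, hqp⟩ := tr p h1.symm h2.symm δ hδ
        exact absurd (hball (mem_ball_iff_norm.2 hqp)) (A₁ q hq1 hq2)
  have hne : ∀ {n : ℂ → ℝ}, Continuous n → n x < 0 → 0 < n y → ∃ p₀, n p₀ = 0 := by
    intro n hn hx hy
    obtain ⟨p, -, hp⟩ := isPreconnected_univ.intermediate_value (Set.mem_univ x) (Set.mem_univ y)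
      hn.continuousOn (show (0 : ℝ) ∈ Set.Icc _ _ from ⟨hx.le, hy.le⟩)
    exact ⟨p, hp⟩
  have rel := cross_relation s₁ s₂ s₃
  have h23 : (cross s₂ s₃ : ℂ) ≠ 0 := by exact_mod_cast c₂₃.ne'
  have h31 : (cross s₃ s₁ : ℂ) ≠ 0 := by exact_mod_cast c₃₁.ne'
  -- By monotonicity along the first line it suffices to treat a point p far enough back. Such a p
  -- is reached from {n₃ > 0}, where n₂ > 0 by `hR`, by moving along s₂.
  have n₂pos : ∀ p, n₁ p = 0 → 0 < n₂ p := by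
    intro p' hp'
    obtain ⟨p, hp, hpc⟩ := h₁.exists_zero hε hp' (min (cross s₁ p') (cross s₁ y))
    refine lt_of_lt_of_le ?_ (m₁₂ p p' hp hp' (hpc ▸ min_le_left _ _))
    have hs := re_sq_add_im_sq h₁.norm
    set σ : ℝ := (cross s₁ y - cross s₁ p) / cross s₃ s₁ with hσ
    have hσ0 : 0 ≤ σ := div_nonneg (by rw [hpc]; linarith [min_le_right (cross s₁ p') (cross s₁ y)]) c₃₁.le
    -- `p` lies on the line through `y + σ s₃` in the direction `s₁`
    obtain ⟨τ, hτ⟩ : ∃ τ : ℝ, p = y + σ * s₃ - τ * s₁ := by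
      have hz : cross s₁ (y + σ * s₃ - p) = 0 := by
        rw [cross_sub_right, cross_add_right, cross_mul_right, cross_comm s₃ s₁, hσ]
        field_simp; ring
      set z := y + σ * s₃ - p
      refine ⟨s₁.re * z.re + s₁.im * z.im, ?_⟩
      have : z = ((s₁.re * z.re + s₁.im * z.im : ℝ) : ℂ) * s₁ := by
        simp only [cross] at hz
        apply Complex.ext <;> simp
        · linear_combination -z.re * hs - s₁.im * hz
        · linear_combination -z.im * hs + s₁.re * hz
      rw [← this]; simp [z]
    have hy3 : ∀ σ : ℝ, 0 ≤ σ → 0 < n₃ (y + σ * s₃) := fun σ hσ =>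
      hy₃.trans_le (h₃.mono_self hε y hσ)
    have hτ0 : 0 < τ := by
      by_contra hcon
      push Not at hcon
      have h1 := (hR (hy3 σ hσ0)).1
      have h2 := h₁.mono_self hε (y + σ * s₃) (show 0 ≤ -τ by linarith)
      rw [show y + σ * s₃ + ((-τ : ℝ) : ℂ) * s₁ = p by rw [hτ]; push_cast; ring, hp] at h2
      linarith
    -- `cross_relation` expresses -s₁ as a positive combination of s₂ and s₃.
    have e : p = (y + ((σ + τ * (cross s₁ s₂ / cross s₂ s₃) : ℝ) : ℂ) * s₃) +
        ((τ * (cross s₃ s₁ / cross s₂ s₃) : ℝ) : ℂ) * s₂ := by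
      rw [hτ]; push_cast; field_simp; linear_combination -τ * rel
    have h1 := (hR (hy3 (σ + τ * (cross s₁ s₂ / cross s₂ s₃)) (by positivity))).2
    rw [e]
    exact h1.trans_le (h₂.mono_self hε _ (by positivity))
  have n₁pos : ∀ p, n₂ p = 0 → 0 < n₁ p := by
    intro p' hp'
    obtain ⟨p, hp, hpc⟩ := h₂.exists_zero hε hp' (max (cross s₂ p') (cross s₂ y))
    refine lt_of_lt_of_le ?_ (m₂₁ p' p hp' hp (hpc ▸ le_max_left _ _))
    have hs := re_sq_add_im_sq h₂.norm
    set σ : ℝ := (cross s₂ p - cross s₂ y) / cross s₂ s₃ with hσ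
    have hσ0 : 0 ≤ σ := div_nonneg (by rw [hpc]; linarith [le_max_right (cross s₂ p') (cross s₂ y)]) c₂₃.le
    obtain ⟨τ, hτ⟩ : ∃ τ : ℝ, p = y + σ * s₃ - τ * s₂ := by
      have hz : cross s₂ (y + σ * s₃ - p) = 0 := by
        rw [cross_sub_right, cross_add_right, cross_mul_right, hσ]
        field_simp; ring
      set z := y + σ * s₃ - p
      refine ⟨s₂.re * z.re + s₂.im * z.im, ?_⟩
      have : z = ((s₂.re * z.re + s₂.im * z.im : ℝ) : ℂ) * s₂ := by
        simp only [cross] at hz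
        apply Complex.ext <;> simp
        · linear_combination -z.re * hs - s₂.im * hz
        · linear_combination -z.im * hs + s₂.re * hz
      rw [← this]; simp [z]
    have hy3 : ∀ σ : ℝ, 0 ≤ σ → 0 < n₃ (y + σ * s₃) := fun σ hσ =>
      hy₃.trans_le (h₃.mono_self hε y hσ)
    have hτ0 : 0 < τ := by
      by_contra hcon
      push Not at hcon
      have h1 := (hR (hy3 σ hσ0)).2
      have h2 := h₂.mono_self hε (y + σ * s₃) (show 0 ≤ -τ by linarith)
      rw [show y + σ * s₃ + ((-τ : ℝ) : ℂ) * s₂ = p by rw [hτ]; push_cast; ring, hp] at h2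
      linarith
    have e : p = (y + ((σ + τ * (cross s₁ s₂ / cross s₃ s₁) : ℝ) : ℂ) * s₃) +
        ((τ * (cross s₂ s₃ / cross s₃ s₁) : ℝ) : ℂ) * s₁ := by
      rw [hτ]; push_cast; field_simp; linear_combination -τ * rel
    have h1 := (hR (hy3 (σ + τ * (cross s₁ s₂ / cross s₃ s₁)) (by positivity))).1
    rw [e]
    exact h1.trans_le (h₁.mono_self hε _ (by positivity))
  -- The connected set {n₁ < 0} contains x and misses the second line, on which n₁ > 0. But just
  -- below a point of the first line this would make n₂ negative, while n₂ > 0 on that line.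
  have sub : {p | n₁ p < 0} ⊆ {p | n₂ p < 0} := by
    refine (h₁.isPreconnected_neg hε).subset_of_closure_inter_subset
      (isOpen_lt h₂.cont continuous_const) ⟨x, hx₁, hx₂⟩ ?_
    rintro p ⟨hp, hp2⟩
    have : n₂ p ≤ 0 := closure_minimal (fun p hp => le_of_lt hp)
      (isClosed_le h₂.cont continuous_const) hp
    rcases this.lt_or_eq with h' | h'
    · exact h'
    · exact absurd (n₁pos p h') (not_lt.2 (le_of_lt hp2))
  obtain ⟨p, hp⟩ := hne h₁.cont hx₁ hy₁
  have hlim : Filter.Tendsto (fun τ : ℝ => n₂ (p - τ * s₁)) (nhdsWithin 0 (Set.Ioi 0)) (nhds (n₂ (p - (0 : ℝ) * s₁))) := by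
    apply Filter.Tendsto.mono_left _ nhdsWithin_le_nhds
    exact (h₂.cont.comp (by fun_prop : Continuous fun τ : ℝ => p - τ * s₁)).tendsto 0
  have := le_of_tendsto hlim (b := 0) (by
    filter_upwards [self_mem_nhdsWithin] with τ hτ
    exact (sub (h₁.neg s₁ (by simp [hε.le]) p τ hτ hp)).le)
  have h2 := n₂pos p hp
  simp at this
  linarith

/-- Three pseudo-lines with positively spanning directions cannot separate two points in the same
sense. -/
theorem IsTrack.not_spanning {ε : ℝ} {s : ZMod 3 → ℂ} {n : ZMod 3 → ℂ → ℝ} (hε : 0 < ε)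
    (h : ∀ i, IsTrack ε (s i) (n i)) (c : ∀ i, 0 < cross (s i) (s (i + 1)))
    (m : ∀ i p q, n i p = 0 → n i q = 0 → cross (s i) p ≤ cross (s i) q →
      n (i + 1) p ≤ n (i + 1) q ∧ n (i + 2) q ≤ n (i + 2) p)
    (tr : ∀ i p, n i p = 0 → n (i + 1) p = 0 → ∀ δ > 0,
      (∃ q, n i q = 0 ∧ 0 < n (i + 1) q ∧ ‖q - p‖ < δ) ∧
      (∃ q, n i q = 0 ∧ n (i + 1) q < 0 ∧ ‖q - p‖ < δ))
    {x y : ℂ} (hx : ∀ i, n i x < 0) (hy : ∀ i, 0 < n i y) : False := by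
  -- Along line i one of the other heights increases and the other decreases, so the line cannot
  -- contain both a point where both are positive and one where both are negative: `A i` or `B i`
  -- holds.
  set A : ZMod 3 → Prop := fun i => ∀ p, n i p = 0 → 0 < n (i + 1) p → ¬ 0 < n (i + 2) p with hA
  set B : ZMod 3 → Prop := fun i => ∀ p, n i p = 0 → n (i + 1) p < 0 → ¬ n (i + 2) p < 0 with hB
  have hAB : ∀ i, A i ∨ B i := by
    intro i
    by_contra hcon
    simp only [hA, hB] at hcon
    push Not at hcon
    obtain ⟨⟨p, hp, hp1, hp2⟩, q, hq, hq1, hq2⟩ := hcon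
    rcases le_total (cross (s i) p) (cross (s i) q) with hle | hle
    · have := (m i p q hp hq hle).1; linarith
    · have := (m i q p hq hp hle).2; linarith
  have e1 : ∀ i : ZMod 3, i + 1 + 1 = i + 2 := by decide
  have e2 : ∀ i : ZMod 3, i + 1 + 2 = i := by decide
  have e3 : ∀ i : ZMod 3, i + 2 + 1 = i := by decide
  have hAA : ∀ i, A i → A (i + 1) → False := by
    intro i h1 h2
    simp only [hA, e1, e2] at h1 h2
    have c2 := c (i + 1)
    have c3 := c (i + 2)
    rw [e1] at c2; rw [e3] at c3
    refine IsTrack.not_spanning_aux hε (h i) (h (i + 1)) (h (i + 2)) (c i) c2 c3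
      (fun p q hp hq hpq => (m i p q hp hq hpq).1)
      (fun p q hp hq hpq => by have := (m (i + 1) p q hp hq hpq).2; rwa [e2] at this)
      (fun p hp hq δ hδ => (tr i p hp hq δ hδ).1) h1
      (fun p hp h4 h3 => h2 p hp h3 h4) (hx i) (hx (i + 1)) (hy i) (hy (i + 1)) (hy (i + 2))
  have hBB : ∀ i, B i → B (i + 1) → False := by
    intro i h1 h2
    simp only [hB, e1, e2] at h1 h2
    have c2 := c (i + 1)
    have c3 := c (i + 2)
    rw [e1] at c2; rw [e3] at c3
    have cc : ∀ a b : ℂ, cross (-a) (-b) = cross a b := fun a b => by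
      rw [cross_neg_left, cross_neg_right, neg_neg]
    refine IsTrack.not_spanning_aux (x := y) (y := x) hε (h i).symm (h (i + 1)).symm (h (i + 2)).symm
      (by rw [cc]; exact c i) (by rw [cc]; exact c2) (by rw [cc]; exact c3) ?_ ?_ ?_ ?_ ?_ ?_ ?_ ?_ ?_ ?_
    · intro p q hp hq hpq
      rw [cross_neg_left, cross_neg_left] at hpq
      have := (m i q p (by linarith) (by linarith) (by linarith)).1
      linarith
    · intro p q hp hq hpq
      rw [cross_neg_left, cross_neg_left] at hpq
      have := (m (i + 1) q p (by linarith) (by linarith) (by linarith)).2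
      rw [e2] at this
      linarith
    · intro p hp hq δ hδ
      obtain ⟨z, hz, hz1, hz2⟩ := (tr i p (by linarith) (by linarith) δ hδ).2
      exact ⟨z, by linarith, by linarith, hz2⟩
    · intro p hp h3 h4
      exact h1 p (by linarith) (by linarith) (by linarith)
    · intro p hp h3 h4
      exact h2 p (by linarith) (by linarith) (by linarith)
    · linarith [hy i]
    · linarith [hy (i + 1)]
    · linarith [hx i]
    · linarith [hx (i + 1)]
    · linarith [hx (i + 2)]
  -- Any two of three indices are cyclically adjacent, so two alternatives of the same kind always
  -- clash.
  have a0 := hAA 0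
  have a1 := hAA 1
  have a2 := hAA 2
  have b0 := hBB 0
  have b1 := hBB 1
  have b2 := hBB 2
  simp only [show (0 : ZMod 3) + 1 = 1 by decide, show (1 : ZMod 3) + 1 = 2 by decide,
    show (2 : ZMod 3) + 1 = 0 by decide] at a0 a1 a2 b0 b1 b2
  have := hAB 0
  have := hAB 1
  have := hAB 2
  tauto

/-! ### The train tracks of the tiling as pseudo-lines, and the half-plane of poles. -/

namespace IsoradialGraph

variable {G : IsoradialGraph}

theorem Regular.exists_sine (h : G.Regular) : ∃ ε : ℝ, 0 < ε ∧ ∀ t ∈ G.tiles, 2 * ε ≤ t.sine := by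
  obtain ⟨ε, hε, h⟩ := h
  refine ⟨ε / 2, by linarith, fun t ht => ?_⟩
  have := h t ht
  rw [← cross_eq_im] at this
  rw [mul_div_cancel₀ _ two_ne_zero]
  exact this

theorem abs_slope_le {t : Rhombus} (e v : ℂ) : |t.slope e v| ≤ ‖v‖ / t.sine := by
  have ha : |t.coA v| ≤ ‖v‖ / t.sine := by
    rw [Rhombus.coA_apply, abs_div, abs_of_pos t.sine_pos]
    refine div_le_div_of_nonneg_right ((abs_cross_le _ _).trans ?_) t.sine_pos.le
    rw [t.norm_el, mul_one]
  have hb : |t.coB v| ≤ ‖v‖ / t.sine := by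
    rw [Rhombus.coB_apply, abs_div, abs_of_pos t.sine_pos]
    refine div_le_div_of_nonneg_right ((abs_cross_le _ _).trans ?_) t.sine_pos.le
    rw [t.norm_er, one_mul]
  by_cases h1 : t.er = e
  · subst h1; rwa [t.slope_er]
  by_cases h2 : t.el = e
  · subst h2; rwa [t.slope_el]
  · rw [t.slope_of_ne h1 h2, abs_zero]; exact div_nonneg (norm_nonneg _) t.sine_pos.le

theorem continuous_height {ε : ℝ} (hε : 0 < ε) (hG : ∀ t ∈ G.tiles, 2 * ε ≤ t.sine) (e : ℂ) :
    Continuous (G.height e) := by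
  rw [continuous_iff_continuousAt]
  intro p
  obtain ⟨r, hr, h⟩ := G.eventually_mem_carrier p
  rw [Metric.continuousAt_iff]
  intro δ hδ
  refine ⟨min r (δ * ε), by positivity, fun q hq => ?_⟩
  rw [dist_eq_norm] at hq
  obtain ⟨t, ht, hqt⟩ := G.cover q
  have hpt := h t ht q hqt (hq.trans_le (min_le_left _ _))
  rw [Real.dist_eq, height_sub ht e hqt hpt]
  refine (abs_slope_le e _).trans_lt ?_
  rw [div_lt_iff₀ t.sine_pos]
  have h1 := hq.trans_le (min_le_right r (δ * ε))
  have h2 := hG t ht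
  nlinarith

theorem white_mem {t : Rhombus} (ht : t ∈ G.tiles) : t.w ∈ G.vertex :=
  ⟨t, ht, by simp [Rhombus.corners]⟩

theorem black_mem {t : Rhombus} (ht : t ∈ G.tiles) : t.b ∈ G.vertex :=
  ⟨t, ht, by simp [Rhombus.corners]⟩

/-- The height above the middle of the first strip with sides `e` between `x` and the points on the
side of `σ e`. -/
noncomputable def track (G : IsoradialGraph) (x e : ℂ) (σ : ℝ) (p : ℂ) : ℝ :=
  σ * (G.height e p - G.height e x) - 1 / 2

theorem track_sub {t : Rhombus} (ht : t ∈ G.tiles) (x e : ℂ) (σ : ℝ) {p q : ℂ}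
    (hp : p ∈ t.carrier) (hq : q ∈ t.carrier) :
    G.track x e σ p - G.track x e σ q = σ * t.slope e (p - q) := by
  rw [← height_sub ht e hp hq]; simp only [track]; ring

/-- Heights of vertices differ by integers, while the track runs at a half-integer level relative to
x. -/
theorem track_ne_zero {x y : ℂ} (hx : x ∈ G.vertex) (hy : y ∈ G.vertex) (e : ℂ) {σ : ℝ}
    (hσ : σ = 1 ∨ σ = -1) {p : ℂ} {k : ℤ} (h : G.height e p = G.height e y + k) :
    G.track x e σ p ≠ 0 := by
  intro h0
  have h1 := divisor_apply hx hy e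
  have h2 : σ * ((G.divisor x y e + k : ℤ) : ℝ) = 1 / 2 := by
    push_cast; rw [h1]; rw [track, h] at h0; linarith
  rcases hσ with rfl | rfl
  · have : ((2 * (G.divisor x y e + k) : ℤ) : ℝ) = (1 : ℤ) := by push_cast at h2 ⊢; linarith
    have := Int.cast_injective this
    omega
  · have : ((2 * (G.divisor x y e + k) : ℤ) : ℝ) = (-1 : ℤ) := by push_cast at h2 ⊢; linarith
    have := Int.cast_injective this
    omega

/-- On a tile without a side e the height is constant and equals that of its vertices, so the track
cannot enter it. -/
theorem side_of_track_eq_zero {x : ℂ} (hx : x ∈ G.vertex) {e : ℂ} {σ : ℝ} (hσ : σ = 1 ∨ σ = -1)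
    {p : ℂ} (hp : G.track x e σ p = 0) {t : Rhombus} (ht : t ∈ G.tiles) (hpt : p ∈ t.carrier) :
    t.er = e ∨ t.el = e := by
  by_contra hcon
  push Not at hcon
  refine track_ne_zero hx (white_mem ht) e hσ (k := 0) ?_ hp
  have := height_sub ht e hpt (t.corner_mem (x := t.w) (by simp [Rhombus.corners]))
  rw [t.slope_of_ne hcon.1 hcon.2] at this
  simp; linarith

/-- The direction σe contributes the sine of the angle, at least 2ε, to the numerator of the slope;
the deviation of v from it changes this by at most ε. -/
theorem slope_cone {ε : ℝ} {t : Rhombus} (hG : 2 * ε ≤ t.sine) {e v : ℂ} {σ : ℝ}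
    (hσ : σ = 1 ∨ σ = -1) (hv : ‖v - σ * e‖ ≤ ε) (he : t.er = e ∨ t.el = e) (hε : 0 < ε) :
    0 < σ * t.slope e v := by
  have hσ2 : σ * σ = 1 := by rcases hσ with rfl | rfl <;> norm_num
  have hσa : |σ| = 1 := by rcases hσ with rfl | rfl <;> norm_num
  have hv' : v = σ * e + (v - σ * e) := by ring
  set d := v - σ * e
  rcases he with rfl | rfl
  · rw [t.slope_er, Rhombus.coA_apply, ← mul_div_assoc]
    apply div_pos _ t.sine_pos
    rw [hv', cross_add_left, cross_mul_left, mul_add, ← mul_assoc, hσ2]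
    have h1 := abs_cross_le d t.el
    have h2 : |σ * cross d t.el| ≤ ε := by
      rw [abs_mul, hσa, one_mul]; rw [t.norm_el, mul_one] at h1; exact h1.trans hv
    have := (abs_le.1 h2).1
    change 2 * ε ≤ cross t.er t.el at hG
    linarith
  · rw [t.slope_el, Rhombus.coB_apply, ← mul_div_assoc]
    apply div_pos _ t.sine_pos
    rw [hv', cross_add_right, cross_mul_right, mul_add, ← mul_assoc, hσ2]
    have h1 := abs_cross_le t.er d
    have h2 : |σ * cross t.er d| ≤ ε := by
      rw [abs_mul, hσa, one_mul]; rw [t.norm_er, one_mul] at h1; exact h1.trans hv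
    have := (abs_le.1 h2).1
    change 2 * ε ≤ cross t.er t.el at hG
    linarith

section Tracks

variable {ε : ℝ} (hε : 0 < ε) (hG : ∀ t ∈ G.tiles, 2 * ε ≤ t.sine)
include hε hG

/-- In the cone about σe the height increases strictly on tiles with a side e and is constant on the
others. The zero level meets only tiles of the first kind, whence strictness there. -/
theorem isTrack {x : ℂ} (hx : x ∈ G.vertex) {e : ℂ} (he : ‖e‖ = 1) {σ : ℝ}
    (hσ : σ = 1 ∨ σ = -1) : IsTrack ε (σ * e) (G.track x e σ) := by
  have hcont : Continuous (G.track x e σ) := by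
    have := continuous_height hε hG e
    unfold track; fun_prop
  have mono : ∀ v, ‖v - σ * e‖ ≤ ε → ∀ (p : ℂ) (τ : ℝ), 0 ≤ τ →
      G.track x e σ p ≤ G.track x e σ (p + τ * v) := by
    intro v hv p τ hτ
    refine le_add_mul_of_local hcont (fun p => ?_) p hτ
    obtain ⟨t, ht, η, hη, h⟩ := G.exists_radial p v
    refine ⟨η, hη, fun τ h0 h1 => ?_⟩
    have hp := h 0 le_rfl hη.le
    simp only [Complex.ofReal_zero, zero_mul, add_zero] at hp
    have := track_sub ht x e σ (h τ h0 h1) hp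
    rw [add_sub_cancel_left, Rhombus.slope_mul] at this
    have h2 : 0 ≤ σ * t.slope e v := by
      by_cases hs : t.er = e ∨ t.el = e
      · exact (slope_cone (hG t ht) hσ hv hs hε).le
      · push Not at hs; rw [t.slope_of_ne hs.1 hs.2, mul_zero]
    nlinarith
  refine ⟨?_, hcont, mono, ?_, ?_⟩
  · rw [norm_mul, he, mul_one, Complex.norm_real]
    rcases hσ with rfl | rfl <;> simp
  · intro v hv p τ hτ hp0
    obtain ⟨t, ht, η, hη, h⟩ := G.exists_radial p v
    have hp := h 0 le_rfl hη.le
    simp only [Complex.ofReal_zero, zero_mul, add_zero] at hp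
    have hpos := slope_cone (hG t ht) hσ hv (side_of_track_eq_zero hx hσ hp0 ht hp) hε
    have hτ' : 0 < min τ η := lt_min hτ hη
    have h1 := track_sub ht x e σ (h (min τ η) hτ'.le (min_le_right _ _)) hp
    rw [add_sub_cancel_left, Rhombus.slope_mul, hp0] at h1
    have h2 := mono v hv (p + (min τ η : ℝ) * v) (τ - min τ η) (by linarith [min_le_left τ η])
    rw [show p + ((min τ η : ℝ) : ℂ) * v + ((τ - min τ η : ℝ) : ℂ) * v = p + τ * v by
      push_cast; ring] at h2
    have h3 := mul_pos hτ' hpos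
    linarith
  · intro v hv p τ hτ hp0
    obtain ⟨t, ht, η, hη, h⟩ := G.exists_radial p (-v)
    have hp := h 0 le_rfl hη.le
    simp only [Complex.ofReal_zero, zero_mul, add_zero] at hp
    have hpos := slope_cone (hG t ht) hσ hv (side_of_track_eq_zero hx hσ hp0 ht hp) hε
    have hτ' : 0 < min τ η := lt_min hτ hη
    have h1 := track_sub ht x e σ (h (min τ η) hτ'.le (min_le_right _ _)) hp
    rw [add_sub_cancel_left, Rhombus.slope_mul, map_neg, hp0] at h1
    have h2 := mono v hv (p - τ * v) (τ - min τ η) (by linarith [min_le_left τ η])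
    rw [show p - τ * v + ((τ - min τ η : ℝ) : ℂ) * v = p + (min τ η : ℝ) * -v by
      push_cast; ring] at h2
    have h3 := mul_pos hτ' hpos
    linarith

/-- Along a pseudo-line another height changes only at crossings. -/
theorem exists_along_track {x : ℂ} (hx : x ∈ G.vertex) {e₁ e₂ : ℂ} (he₁ : ‖e₁‖ = 1)
    (hne : e₁ ≠ e₂) {σ₁ σ₂ : ℝ} (hσ₁ : σ₁ = 1 ∨ σ₁ = -1) (hσ₂ : σ₂ = 1 ∨ σ₂ = -1) {p : ℂ}
    (hp0 : G.track x e₁ σ₁ p = 0) :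
    ∃ (v : ℂ) (η κ : ℝ), 0 < η ∧ 2 * ε ≤ cross (σ₁ * e₁) v ∧
      (κ = 0 ∨ (κ = 1 ∧ v = σ₂ * e₂) ∨ (κ = -1 ∧ v = -(σ₂ * e₂))) ∧
      ∀ τ : ℝ, 0 ≤ τ → τ ≤ η → G.track x e₁ σ₁ (p + τ * v) = 0 ∧
        G.track x e₂ σ₂ (p + τ * v) = G.track x e₂ σ₂ p + τ * κ := by
  classical
  -- In the tile on the side i σ₁ e₁ of p the track runs parallel to the other side of the tile;
  -- that side, with the sign making its cross product with σ₁ e₁ positive, is v.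
  obtain ⟨t, ht, η, hη, h⟩ := G.exists_radial p (Complex.I * (σ₁ * e₁))
  have hp := h 0 le_rfl hη.le
  simp only [Complex.ofReal_zero, zero_mul, add_zero] at hp
  have hend := h η hη.le le_rfl
  have hs := t.sine_pos
  have hσ2 : σ₁ * σ₁ = 1 := by rcases hσ₁ with rfl | rfl <;> norm_num
  have hee := re_sq_add_im_sq he₁
  rw [Rhombus.mem_carrier] at hp hend
  rw [show p + η * (Complex.I * (σ₁ * e₁)) - t.w = (p - t.w) + η * (Complex.I * (σ₁ * e₁)) by ring,
    map_add, map_add, t.coA_mul, t.coB_mul] at hend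
  have main : ∀ (v : ℂ) (κ : ℝ) (η' : ℝ),
      (∀ τ : ℝ, 0 ≤ τ → τ ≤ η' → p + τ * v ∈ t.carrier) → t.slope e₁ v = 0 → σ₂ * t.slope e₂ v = κ →
      ∀ τ : ℝ, 0 ≤ τ → τ ≤ η' → G.track x e₁ σ₁ (p + τ * v) = 0 ∧
        G.track x e₂ σ₂ (p + τ * v) = G.track x e₂ σ₂ p + τ * κ := by
    intro v κ η' hm h1 h2 τ h0 hτ
    have hpc := t.mem_carrier.2 hp
    have t1 := track_sub ht x e₁ σ₁ (hm τ h0 hτ) hpc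
    have t2 := track_sub ht x e₂ σ₂ (hm τ h0 hτ) hpc
    rw [add_sub_cancel_left, t.slope_mul] at t1 t2
    constructor
    · rw [h1, hp0] at t1; linarith
    · rw [← h2]; linarith
  have step : ∀ {a d : ℝ}, a ∈ Set.Icc (0 : ℝ) 1 → a + η * (d / t.sine) ∈ Set.Icc (0 : ℝ) 1 →
      ∀ τ : ℝ, 0 ≤ τ → τ ≤ η / t.sine → a + τ * d ∈ Set.Icc (0 : ℝ) 1 := by
    rintro a d ⟨a0, a1⟩ ⟨b0, b1⟩ τ h0 h1
    have e : η * (d / t.sine) = η / t.sine * d := by ring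
    rw [e] at b0 b1
    rcases le_total 0 d with hd | hd
    · exact ⟨by positivity, by nlinarith⟩
    · exact ⟨by nlinarith, by nlinarith⟩
  rcases side_of_track_eq_zero hx hσ₁ hp0 ht (t.mem_carrier.2 hp) with he | he
  · have hcB : t.coB (Complex.I * (σ₁ * e₁)) = σ₁ / t.sine := by
      rw [Rhombus.coB_apply, he]
      congr 1
      simp [cross]; linear_combination σ₁ * hee
    rw [hcB] at hend
    refine ⟨σ₁ * t.el, η / t.sine, σ₂ * σ₁ * (if t.el = e₂ then 1 else 0), by positivity, ?_, ?_,
      main _ _ _ (fun τ h0 h1 => ?_) ?_ ?_⟩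
    · rw [cross_mul_left, cross_mul_right, ← mul_assoc, hσ2, one_mul, ← he]; exact hG t ht
    · split_ifs with h2
      · rw [← h2]
        rcases hσ₁ with rfl | rfl <;> rcases hσ₂ with rfl | rfl <;> norm_num
      · left; ring
    · rw [Rhombus.mem_carrier, show p + τ * (σ₁ * t.el) - t.w = (p - t.w) + τ * (σ₁ * t.el) by ring,
        map_add, map_add, t.coA_mul, t.coB_mul, t.coA_mul, t.coB_mul, t.coA_el, t.coB_el, mul_zero,
        mul_zero, add_zero, mul_one]
      exact ⟨hp.1, step hp.2 hend.2 τ h0 h1⟩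
    · rw [t.slope_mul, ← he, t.slope_er, t.coA_el, mul_zero]
    · rw [t.slope_mul, t.slope_apply, if_neg (by rw [he]; exact hne)]
      simp
  · have hcA : t.coA (Complex.I * (σ₁ * e₁)) = -σ₁ / t.sine := by
      rw [Rhombus.coA_apply, he]
      congr 1
      simp [cross]; linear_combination -σ₁ * hee
    rw [hcA] at hend
    refine ⟨(-σ₁ : ℝ) * t.er, η / t.sine, σ₂ * -σ₁ * (if t.er = e₂ then 1 else 0), by positivity, ?_, ?_,
      main _ _ _ (fun τ h0 h1 => ?_) ?_ ?_⟩
    · rw [cross_mul_left, cross_mul_right, ← mul_assoc, ← he, cross_comm t.er t.el]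
      have := hG t ht
      change 2 * ε ≤ cross t.er t.el at this
      nlinarith
    · split_ifs with h2
      · rw [← h2]
        rcases hσ₁ with rfl | rfl <;> rcases hσ₂ with rfl | rfl <;> norm_num
      · left; ring
    · rw [Rhombus.mem_carrier, show p + τ * ((-σ₁ : ℝ) * t.er) - t.w = (p - t.w) + τ * ((-σ₁ : ℝ) * t.er) by ring,
        map_add, map_add, t.coA_mul, t.coB_mul, t.coA_mul, t.coB_mul, t.coA_er, t.coB_er, mul_zero,
        mul_zero, add_zero, mul_one]
      exact ⟨step hp.1 hend.1 τ h0 h1, hp.2⟩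
    · rw [t.slope_mul, ← he, t.slope_el, t.coB_er, mul_zero]
    · rw [t.slope_mul, t.slope_apply, if_neg (show t.el ≠ e₂ by rw [he]; exact hne)]
      simp

/-- The second height can decrease only where the first track runs along -σ₂ e₂. This needs a cross
product of at least 2ε with that vector, so already cross > -2ε excludes it. Together with
`track_anti`, nearly parallel tracks have constant height along each other. -/
theorem track_mono {x : ℂ} (hx : x ∈ G.vertex) {e₁ e₂ : ℂ} (he₁ : ‖e₁‖ = 1) (he₂ : ‖e₂‖ = 1)
    (hne : e₁ ≠ e₂) {σ₁ σ₂ : ℝ} (hσ₁ : σ₁ = 1 ∨ σ₁ = -1) (hσ₂ : σ₂ = 1 ∨ σ₂ = -1)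
    (hc : -(2 * ε) < cross (σ₁ * e₁) (σ₂ * e₂)) {p q : ℂ}
    (hp : G.track x e₁ σ₁ p = 0) (hq : G.track x e₁ σ₁ q = 0)
    (hpq : cross (σ₁ * e₁) p ≤ cross (σ₁ * e₁) q) : G.track x e₂ σ₂ p ≤ G.track x e₂ σ₂ q := by
  refine (isTrack hε hG hx he₁ hσ₁).le_of_local hε (isTrack hε hG hx he₂ hσ₂).cont
    (fun p hp => ?_) hp hq hpq
  obtain ⟨v, η, κ, hη, hv, hκ, h⟩ := exists_along_track hε hG hx he₁ hne hσ₁ hσ₂ hp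
  refine ⟨v, η, hη, by linarith, fun τ h0 h1 => ⟨(h τ h0 h1).1, ?_⟩⟩
  rw [(h τ h0 h1).2]
  rcases hκ with rfl | ⟨rfl, -⟩ | ⟨-, rfl⟩
  · simp
  · linarith
  · rw [cross_neg_right] at hv; linarith

theorem track_anti {x : ℂ} (hx : x ∈ G.vertex) {e₁ e₂ : ℂ} (he₁ : ‖e₁‖ = 1) (he₂ : ‖e₂‖ = 1)
    (hne : e₁ ≠ e₂) {σ₁ σ₂ : ℝ} (hσ₁ : σ₁ = 1 ∨ σ₁ = -1) (hσ₂ : σ₂ = 1 ∨ σ₂ = -1)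
    (hc : cross (σ₁ * e₁) (σ₂ * e₂) < 2 * ε) {p q : ℂ}
    (hp : G.track x e₁ σ₁ p = 0) (hq : G.track x e₁ σ₁ q = 0)
    (hpq : cross (σ₁ * e₁) p ≤ cross (σ₁ * e₁) q) : G.track x e₂ σ₂ q ≤ G.track x e₂ σ₂ p := by
  have := (isTrack hε hG hx he₁ hσ₁).le_of_local hε (isTrack hε hG hx he₂ hσ₂).cont.neg
    (fun p hp => ?_) hp hq hpq
  · simp only [Pi.neg_apply] at this; linarith
  obtain ⟨v, η, κ, hη, hv, hκ, h⟩ := exists_along_track hε hG hx he₁ hne hσ₁ hσ₂ hp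
  refine ⟨v, η, hη, by linarith, fun τ h0 h1 => ⟨(h τ h0 h1).1, ?_⟩⟩
  simp only [Pi.neg_apply]
  rw [(h τ h0 h1).2]
  rcases hκ with rfl | ⟨-, rfl⟩ | ⟨rfl, -⟩
  · simp
  · linarith
  · linarith

omit hε hG in
-- A tile at a crossing has both sides e₁ and e₂, and the point is strictly between the two sides
-- transversal to e₂. Moving along ±e₂ keeps the first height and changes the second at unit rate.
theorem track_transversal {x : ℂ} (hx : x ∈ G.vertex) {e₁ e₂ : ℂ} (he₂ : ‖e₂‖ = 1) (hne : e₁ ≠ e₂)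
    {σ₁ σ₂ : ℝ} (hσ₁ : σ₁ = 1 ∨ σ₁ = -1) (hσ₂ : σ₂ = 1 ∨ σ₂ = -1) {p : ℂ}
    (hp1 : G.track x e₁ σ₁ p = 0) (hp2 : G.track x e₂ σ₂ p = 0) {δ : ℝ} (hδ : 0 < δ) :
    (∃ q, G.track x e₁ σ₁ q = 0 ∧ 0 < G.track x e₂ σ₂ q ∧ ‖q - p‖ < δ) ∧
    (∃ q, G.track x e₁ σ₁ q = 0 ∧ G.track x e₂ σ₂ q < 0 ∧ ‖q - p‖ < δ) := by
  obtain ⟨t, ht, hp⟩ := G.cover p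
  have s1 := side_of_track_eq_zero hx hσ₁ hp1 ht hp
  have s2 := side_of_track_eq_zero hx hσ₂ hp2 ht hp
  have hσ2 : σ₂ * σ₂ = 1 := by rcases hσ₂ with rfl | rfl <;> norm_num
  have hσa : |σ₂| = 1 := by rcases hσ₂ with rfl | rfl <;> norm_num
  have hpw := height_sub ht e₂ hp (t.corner_mem (x := t.w) (by simp [Rhombus.corners]))
  have hs0 : t.slope e₂ (p - t.w) ≠ 0 := fun h0 =>
    track_ne_zero hx (white_mem ht) e₂ hσ₂ (k := 0) (by rw [h0] at hpw; simp; linarith) hp2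
  have hs1 : t.slope e₂ (p - t.w) ≠ 1 := fun h0 =>
    track_ne_zero hx (white_mem ht) e₂ hσ₂ (k := 1) (by rw [h0] at hpw; simp; linarith) hp2
  have key : ∃ η : ℝ, 0 < η ∧ ∀ τ : ℝ, |τ| ≤ η → p + τ * e₂ ∈ t.carrier := by
    have hpc := t.mem_carrier.1 hp
    rcases s2 with rfl | rfl
    · rw [t.slope_er] at hs0 hs1
      have a0 := lt_of_le_of_ne hpc.1.1 hs0.symm
      have a1 := lt_of_le_of_ne hpc.1.2 hs1
      refine ⟨min (t.coA (p - t.w)) (1 - t.coA (p - t.w)), lt_min a0 (by linarith), fun τ hτ => ?_⟩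
      have := abs_le.1 hτ
      have m1 := min_le_left (t.coA (p - t.w)) (1 - t.coA (p - t.w))
      have m2 := min_le_right (t.coA (p - t.w)) (1 - t.coA (p - t.w))
      rw [Rhombus.mem_carrier, show p + τ * t.er - t.w = (p - t.w) + τ * t.er by ring,
        map_add, map_add, t.coA_mul, t.coB_mul, t.coA_er, t.coB_er, mul_zero, add_zero, mul_one]
      exact ⟨⟨by linarith, by linarith⟩, hpc.2⟩
    · rw [t.slope_el] at hs0 hs1
      have a0 := lt_of_le_of_ne hpc.2.1 hs0.symm
      have a1 := lt_of_le_of_ne hpc.2.2 hs1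
      refine ⟨min (t.coB (p - t.w)) (1 - t.coB (p - t.w)), lt_min a0 (by linarith), fun τ hτ => ?_⟩
      have := abs_le.1 hτ
      have m1 := min_le_left (t.coB (p - t.w)) (1 - t.coB (p - t.w))
      have m2 := min_le_right (t.coB (p - t.w)) (1 - t.coB (p - t.w))
      rw [Rhombus.mem_carrier, show p + τ * t.el - t.w = (p - t.w) + τ * t.el by ring,
        map_add, map_add, t.coA_mul, t.coB_mul, t.coA_el, t.coB_el, mul_zero, add_zero, mul_one]
      exact ⟨hpc.1, ⟨by linarith, by linarith⟩⟩
  obtain ⟨η, hη, hmem⟩ := key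
  have e12 : t.slope e₁ e₂ = 0 := by
    rcases s1 with rfl | rfl <;> rcases s2 with rfl | rfl
    · exact absurd rfl hne
    · rw [t.slope_er, t.coA_el]
    · rw [t.slope_el, t.coB_er]
    · exact absurd rfl hne
  have e22 : t.slope e₂ e₂ = 1 := by
    rcases s2 with rfl | rfl
    · rw [t.slope_er, t.coA_er]
    · rw [t.slope_el, t.coB_el]
  have val : ∀ τ : ℝ, |τ| ≤ η → G.track x e₁ σ₁ (p + (τ * σ₂ : ℝ) * e₂) = 0 ∧
      G.track x e₂ σ₂ (p + (τ * σ₂ : ℝ) * e₂) = τ := by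
    intro τ hτ
    have hm := hmem (τ * σ₂) (by rwa [abs_mul, hσa, mul_one])
    have t1 := track_sub ht x e₁ σ₁ hm hp
    have t2 := track_sub ht x e₂ σ₂ hm hp
    rw [add_sub_cancel_left, t.slope_mul, e12, hp1] at t1
    rw [add_sub_cancel_left, t.slope_mul, e22, hp2] at t2
    constructor
    · linarith
    · linear_combination t2 + τ * hσ2
  have hn : ∀ τ : ℝ, ‖p + ((τ * σ₂ : ℝ) : ℂ) * e₂ - p‖ = |τ| := by
    intro τ
    rw [add_sub_cancel_left, norm_mul, he₂, mul_one, Complex.norm_real, Real.norm_eq_abs, abs_mul,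
      hσa, mul_one]
  set τ := min η (δ / 2) with hτ
  have hτ0 : 0 < τ := lt_min hη (by linarith)
  have hτη : τ ≤ η := min_le_left _ _
  have hτδ : τ < δ := (min_le_right η (δ / 2)).trans_lt (by linarith)
  refine ⟨⟨p + (τ * σ₂ : ℝ) * e₂, (val τ (by rwa [abs_of_pos hτ0])).1, ?_, ?_⟩,
    ⟨p + ((-τ) * σ₂ : ℝ) * e₂, (val (-τ) (by rwa [abs_neg, abs_of_pos hτ0])).1, ?_, ?_⟩⟩
  · rwa [(val τ (by rwa [abs_of_pos hτ0])).2]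
  · rwa [hn, abs_of_pos hτ0]
  · rw [(val (-τ) (by rwa [abs_neg, abs_of_pos hτ0])).2]; linarith
  · rwa [hn, abs_neg, abs_of_pos hτ0]

end Tracks

/-- For unit vectors a, b with inner product c, a unit vector αb - βa lies beyond b as seen from a,
so its inner product αc - β with a is smaller than c. -/
theorem not_short_difference {c α β : ℝ} (hc : c ^ 2 < 1) (hα : 0 ≤ α) (hβ : 0 < β)
    (h1 : c ≤ α * c - β) (h2 : α ^ 2 + β ^ 2 - 2 * α * β * c = 1) : False := by
  rcases le_or_gt 0 c with h0 | h0
  · have hα1 : 1 < α := by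
      by_contra h
      push Not at h
      have := mul_le_mul_of_nonneg_right h h0
      linarith
    have h3 : β * c ≤ (α - 1) * c ^ 2 := by
      have := mul_le_mul_of_nonneg_right h1 h0
      linarith
    have h4 : (α - 1) * c ^ 2 ≤ (α - 1) * 1 := mul_le_mul_of_nonneg_left hc.le (by linarith)
    have h5 : 1 ≤ α - β * c := by linarith
    have h6 : 1 ≤ (α - β * c) ^ 2 := one_le_pow₀ h5
    have h7 : 0 < β ^ 2 * (1 - c ^ 2) := mul_pos (by positivity) (by linarith)
    linarith
  · have hc1 : -1 < c := by
      by_contra h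
      push Not at h
      nlinarith
    have hα1 : α < 1 := by
      by_contra h
      push Not at h
      have := mul_le_mul_of_nonpos_right h h0.le
      linarith
    have h3 : β ≤ (1 - α) * (-c) := by linarith
    have h4 : (1 - α) * (-c) < (1 - α) * 1 := mul_lt_mul_of_pos_left (by linarith) (by linarith)
    have h5 : (α + β) ^ 2 < 1 := by
      rw [sq_lt_one_iff_abs_lt_one, abs_of_nonneg (by linarith)]; linarith
    have h6 : 0 ≤ (α * β) * (1 + c) := mul_nonneg (mul_nonneg hα hβ.le) (by linarith)
    linarith

/-- Unit vectors without (nearly) opposite pairs and without positively spanning triples lie in a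
half-plane. -/
theorem exists_half_plane {ε : ℝ} (hε : 0 < ε) (S : Finset ℂ) (hne : S.Nonempty)
    (hn : ∀ s ∈ S, ‖s‖ = 1) (hp : ∀ s ∈ S, ∀ s' ∈ S, ε ≤ ‖s + s'‖)
    (ht : ∀ a ∈ S, ∀ b ∈ S, ∀ c ∈ S, 0 < cross a b → 0 < cross b c → ¬ 0 < cross c a) :
    ∃ u : ℂ, ‖u‖ = 1 ∧ ∀ s ∈ S, ε / 2 ≤ s.re * u.re + s.im * u.im := by
  -- The pair with the largest angle; the bisector of a and b will serve as u. Every s is αa + βb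
  -- with α, β ≥ 0, for otherwise either a, b, s span positively or s makes a larger angle with a or
  -- b. Since 1 ≤ α + β, the inner product of s with u is at least ‖a + b‖/2.
  obtain ⟨⟨a, b⟩, hab, hmin⟩ := (S ×ˢ S).exists_min_image
    (fun x => x.1.re * x.2.re + x.1.im * x.2.im) (hne.product hne)
  rw [Finset.mem_product] at hab
  obtain ⟨ha, hb⟩ := hab
  simp only at ha hb
  have hmin' : ∀ s ∈ S, ∀ s' ∈ S, a.re * b.re + a.im * b.im ≤ s.re * s'.re + s.im * s'.im :=
    fun s hs s' hs' => hmin (s, s') (Finset.mem_product.2 ⟨hs, hs'⟩)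
  clear hmin
  wlog hk : 0 ≤ cross a b generalizing a b
  · refine this b a hb ha (fun s hs s' hs' => ?_) ?_
    · have := hmin' s hs s' hs'; linarith
    · rw [cross_comm a b]; linarith
  have na := re_sq_add_im_sq (hn a ha)
  have nb := re_sq_add_im_sq (hn b hb)
  set c := a.re * b.re + a.im * b.im with hc
  have hck : c ^ 2 + cross a b ^ 2 = 1 := by
    simp only [hc, cross]; linear_combination (b.re ^ 2 + b.im ^ 2) * na + nb
  have hN2 : ‖a + b‖ ^ 2 = 2 * (1 + c) := by
    rw [Complex.sq_norm, Complex.normSq_apply]; simp only [Complex.add_re, Complex.add_im, hc]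
    linear_combination na + nb
  have hN := hp a ha b hb
  rcases hk.eq_or_lt with hk | hk
  · have hc1 : c = 1 := by
      rw [← hk] at hck
      have : (c - 1) * (c + 1) = 0 := by linear_combination hck
      rcases mul_eq_zero.1 this with h | h
      · linarith
      · nlinarith
    refine ⟨a, hn a ha, fun s hs => ?_⟩
    have h1 := hmin' s hs a ha
    have h2 : ‖a + b‖ ≤ 2 := by
      refine (norm_add_le _ _).trans ?_
      rw [hn a ha, hn b hb]; norm_num
    linarith
  · have hNpos : 0 < ‖a + b‖ := hε.trans_le hN
    refine ⟨((1 / ‖a + b‖ : ℝ) : ℂ) * (a + b), ?_, fun s hs => ?_⟩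
    · rw [norm_mul, Complex.norm_real, Real.norm_of_nonneg (by positivity)]
      field_simp
    set α := cross s b / cross a b with hα
    set β := cross a s / cross a b with hβ
    have hs : s = α * a + β * b := by
      have h := hk.ne'
      rw [hα, hβ]
      apply Complex.ext
      · simp only [Complex.add_re, Complex.re_ofReal_mul]
        field_simp
        simp only [cross]; ring
      · simp only [Complex.add_im, Complex.im_ofReal_mul]
        field_simp
        simp only [cross]; ring
    have hsre : s.re = α * a.re + β * b.re := by rw [hs]; simp
    have hsim : s.im = α * a.im + β * b.im := by rw [hs]; simp
    have hs1 : α ^ 2 + β ^ 2 + 2 * α * β * c = 1 := by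
      have := re_sq_add_im_sq (hn s ‹_›)
      rw [hsre, hsim] at this
      simp only [hc]; linear_combination this - α ^ 2 * na - β ^ 2 * nb
    have hcb : s.re * b.re + s.im * b.im = α * c + β := by
      rw [hsre, hsim]; simp only [hc]; linear_combination β * nb
    have hca : s.re * a.re + s.im * a.im = α + β * c := by
      rw [hsre, hsim]; simp only [hc]; linear_combination α * na
    have hm1 := hmin' s ‹_› b hb
    have hm2 := hmin' s ‹_› a ha
    rw [hcb] at hm1
    rw [hca] at hm2
    have hclt : c ^ 2 < 1 := by nlinarith
    have hc1 : c < 1 := by nlinarith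
    have hc2 : -1 < c := by nlinarith
    have hα0 : 0 ≤ α := by
      by_contra hneg
      push Not at hneg
      rcases lt_or_ge β 0 with h | h
      · refine ht a ha b hb s ‹_› hk ?_ ?_
        · have : cross b s = -α * cross a b := by
            rw [hs, cross_add_right, cross_mul_right, cross_mul_right, cross_same, cross_comm a b]; ring
          rw [this]; nlinarith
        · have : cross s a = -β * cross a b := by
            rw [hs, cross_add_left, cross_mul_left, cross_mul_left, cross_same, cross_comm a b]; ring
          rw [this]; nlinarith
      · exact not_short_difference (α := β) (β := -α) hclt h (by linarith) (by linarith) (by linarith)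
    have hβ0 : 0 ≤ β := by
      by_contra hneg
      push Not at hneg
      exact not_short_difference (α := α) (β := -β) hclt hα0 (by linarith) (by linarith) (by linarith)
    have hsum : 1 ≤ α + β := by
      have h0 : 0 ≤ (α * β) * (1 - c) := mul_nonneg (mul_nonneg hα0 hβ0) (by linarith)
      have h1 : 1 ≤ (α + β) ^ 2 := by linarith
      exact (one_le_sq_iff₀ (add_nonneg hα0 hβ0)).1 h1
    have e : s.re * (((1 / ‖a + b‖ : ℝ) : ℂ) * (a + b)).re + s.im * (((1 / ‖a + b‖ : ℝ) : ℂ) * (a + b)).im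
        = (α + β) * (1 + c) / ‖a + b‖ := by
      rw [Complex.re_ofReal_mul, Complex.im_ofReal_mul, Complex.add_re, Complex.add_im]
      field_simp
      linear_combination hca + hcb
    rw [e]
    have e2 : (1 + c) / ‖a + b‖ = ‖a + b‖ / 2 := by
      field_simp; linarith
    rw [mul_div_assoc, e2]
    have h0 := mul_le_mul_of_nonneg_right hsum (half_pos hNpos).le
    linarith

theorem LatticePath.norm_of_div_ne {x y : ℂ} (p : G.LatticePath x y) {e : ℂ} (h : p.div e ≠ 0) :
    ‖e‖ = 1 := by
  classical
  induction p with
  | refl => simp [div] at h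
  | @along u v p ha ih =>
    by_cases he : v - u = e
    · obtain ⟨t, ht, hs⟩ := ha.exists_side
      rw [← he]; exact hs.norm
    · apply ih
      simpa [div, Finsupp.single_apply, he] using h
  | @against u v p ha ih =>
    by_cases he : u - v = e
    · obtain ⟨t, ht, hs⟩ := ha.exists_side
      rw [← he]; exact hs.norm
    · apply ih
      simpa [div, Finsupp.single_apply, he] using h

theorem norm_of_divisor_ne {x y e : ℂ} (h : G.divisor x y e ≠ 0) : ‖e‖ = 1 := by
  unfold divisor at h
  split_ifs at h with hp
  · exact hp.some.norm_of_div_ne h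
  · simp at h

/-- The poles of the discrete exponential lie in a half-plane, and its zeros lie in the opposite
half-plane. -/
theorem exists_divisor_half_plane {ε : ℝ} (hε : 0 < ε) (hG : ∀ t ∈ G.tiles, 2 * ε ≤ t.sine)
    {x y : ℂ} (hx : x ∈ G.vertex) (hy : y ∈ G.vertex) :
    ∃ u : ℂ, ‖u‖ = 1 ∧ ∀ e, (0 < G.divisor x y e → ε / 2 ≤ e.re * u.re + e.im * u.im) ∧
      (G.divisor x y e < 0 → e.re * u.re + e.im * u.im ≤ -(ε / 2)) := by
  classical
  set D := G.divisor x y with hD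
  -- Counting a pole as e and a zero as -e makes every track separate x from y in the same sense,
  -- with x on the negative side.
  set sg : ℂ → ℝ := fun e => if 0 < D e then 1 else -1 with hsg
  have hsg1 : ∀ e, sg e = 1 ∨ sg e = -1 := fun e => by simp only [hsg]; split_ifs <;> simp
  set f : ℂ → ℂ := fun e => sg e * e with hf
  rcases D.support.eq_empty_or_nonempty with h0 | hne
  · refine ⟨1, by simp, fun e => ?_⟩
    have : D e = 0 := by rw [Finsupp.support_eq_empty.1 h0]; rfl
    rw [this]; simp
  have hnorm : ∀ e ∈ D.support, ‖e‖ = 1 := fun e he => norm_of_divisor_ne (Finsupp.mem_support_iff.1 he)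
  have htr : ∀ e ∈ D.support, IsTrack ε (f e) (G.track x e (sg e)) ∧ G.track x e (sg e) x < 0 ∧
      0 < G.track x e (sg e) y := by
    intro e he
    refine ⟨isTrack hε hG hx (hnorm e he) (hsg1 e), by simp [track], ?_⟩
    have hne := Finsupp.mem_support_iff.1 he
    rw [track, ← divisor_apply hx hy e, ← hD]
    simp only [hsg]
    split_ifs with h
    · have : (1 : ℝ) ≤ D e := by exact_mod_cast h
      linarith
    · have h' : D e ≤ -1 := by omega
      have : (D e : ℝ) ≤ -1 := by exact_mod_cast h'
      linarith
  suffices h : ∃ u : ℂ, ‖u‖ = 1 ∧ ∀ s ∈ D.support.image f, ε / 2 ≤ s.re * u.re + s.im * u.im by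
    obtain ⟨u, hu, h⟩ := h
    refine ⟨u, hu, fun e => ⟨fun he => ?_, fun he => ?_⟩⟩
    · have := h (f e) (Finset.mem_image_of_mem f (Finsupp.mem_support_iff.2 he.ne'))
      simpa [hf, hsg, he] using this
    · have := h (f e) (Finset.mem_image_of_mem f (Finsupp.mem_support_iff.2 he.ne))
      simp only [hf, hsg, if_neg he.le.not_gt] at this
      simp at this
      linarith
  refine exists_half_plane hε (D.support.image f) (hne.image f) ?_ ?_ ?_
  · intro s hs
    obtain ⟨e, he, rfl⟩ := Finset.mem_image.1 hs
    exact (htr e he).1.norm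
  · intro s hs s' hs'
    obtain ⟨e, he, rfl⟩ := Finset.mem_image.1 hs
    obtain ⟨e', he', rfl⟩ := Finset.mem_image.1 hs'
    by_contra hcon
    push Not at hcon
    have hee : e ≠ e' := by
      rintro rfl
      rw [← two_mul, norm_mul, (htr e he).1.norm] at hcon
      obtain ⟨t, ht, -⟩ := G.cover 0
      have h1 := hG t ht
      have h2 := le_of_abs_le (abs_cross_le t.er t.el)
      rw [t.norm_er, t.norm_el] at h2
      change 2 * ε ≤ cross t.er t.el at h1
      simp at hcon
      linarith
    -- Nearly opposite directions are nearly parallel, so by `track_mono` and `track_anti` each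
    -- height is constant along the other track, as `not_opposite` requires.
    have hcr : |cross (f e) (f e')| < 2 * ε := by
      have e1 : cross (f e) (f e') = cross (f e) (f e + f e') := by
        rw [cross_add_right, cross_same, zero_add]
      rw [e1]
      refine (abs_cross_le _ _).trans_lt ?_
      rw [(htr e he).1.norm, one_mul]; linarith
    have hcr' := abs_lt.1 hcr
    refine IsTrack.not_opposite hε (htr e he).1 (htr e' he').1 hcon (fun p q hp hq => ?_)
      (htr e he).2.1 (htr e' he').2.1 (htr e he).2.2 (htr e' he').2.2
    have key : ∀ p q, G.track x e (sg e) p = 0 → G.track x e (sg e) q = 0 →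
        cross (f e) p ≤ cross (f e) q → G.track x e' (sg e') p = G.track x e' (sg e') q := by
      intro p q hp hq hpq
      exact le_antisymm
        (track_mono hε hG hx (hnorm e he) (hnorm e' he') hee (hsg1 e) (hsg1 e') hcr'.1 hp hq hpq)
        (track_anti hε hG hx (hnorm e he) (hnorm e' he') hee (hsg1 e) (hsg1 e') hcr'.2 hp hq hpq)
    rcases le_total (cross (f e) p) (cross (f e) q) with hle | hle
    · exact key p q hp hq hle
    · exact (key q p hq hp hle).symm
  · intro a ha b hb c hc
    obtain ⟨e₀, he₀, rfl⟩ := Finset.mem_image.1 ha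
    obtain ⟨e₁, he₁, rfl⟩ := Finset.mem_image.1 hb
    obtain ⟨e₂, he₂, rfl⟩ := Finset.mem_image.1 hc
    intro c01 c12 c20
    set E : ZMod 3 → ℂ := ![e₀, e₁, e₂] with hE
    have all : ∀ {P : ZMod 3 → Prop}, P 0 → P 1 → P 2 → ∀ i, P i := by
      intro P h0 h1 h2 i
      fin_cases i
      exacts [h0, h1, h2]
    have hEs : ∀ i, E i ∈ D.support := all he₀ he₁ he₂
    have hc : ∀ i, 0 < cross (f (E i)) (f (E (i + 1))) := all c01 c12 c20
    have hEne : ∀ i, E i ≠ E (i + 1) := fun i h => by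
      have := hc i
      rw [h, cross_same] at this
      exact lt_irrefl _ this
    have h3 : ∀ i : ZMod 3, i + 2 + 1 = i := by decide
    have hEne2 : ∀ i, E i ≠ E (i + 2) := fun i h => by
      have := hEne (i + 2)
      rw [h3] at this
      exact this h.symm
    have hc2 : ∀ i, cross (f (E i)) (f (E (i + 2))) < 0 := fun i => by
      have := hc (i + 2)
      rw [h3] at this
      rw [cross_comm (f (E (i + 2)))]; linarith
    refine IsTrack.not_spanning (s := fun i => f (E i)) (n := fun i => G.track x (E i) (sg (E i))) hε
      (fun i => (htr _ (hEs i)).1) hc (fun i p q hp hq hpq => ⟨?_, ?_⟩)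
      (fun i p hp hq δ hδ => track_transversal hx (hnorm _ (hEs _)) (hEne i) (hsg1 _) (hsg1 _) hp hq hδ)
      (fun i => (htr _ (hEs i)).2.1) (fun i => (htr _ (hEs i)).2.2)
    · refine track_mono hε hG hx (hnorm _ (hEs _)) (hnorm _ (hEs _)) (hEne i) (hsg1 _) (hsg1 _) ?_ hp hq hpq
      have := hc i
      simp only [hf] at this
      linarith
    · refine track_anti hε hG hx (hnorm _ (hEs _)) (hnorm _ (hEs _)) (hEne2 i) (hsg1 _) (hsg1 _) ?_ hp hq hpq
      have := hc2 i
      simp only [hf] at this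
      linarith

end IsoradialGraph

/-! ### Poles and the rays from the points of an edge. -/

namespace IsoradialGraph

variable {G : IsoradialGraph}

theorem height_mono {ε : ℝ} (hε : 0 < ε) (hG : ∀ t ∈ G.tiles, 2 * ε ≤ t.sine) {e : ℂ}
    (he : ‖e‖ = 1) (p : ℂ) {τ : ℝ} (hτ : 0 ≤ τ) : G.height e p ≤ G.height e (p + τ * e) := by
  obtain ⟨t, ht, -⟩ := G.cover 0
  have := (isTrack hε hG (white_mem ht) he (σ := 1) (Or.inl rfl)).mono_self hε p hτ
  simp only [track, Complex.ofReal_one, one_mul] at this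
  linarith

/-- Moving the end of a discrete exponential along an edge, from the black to the white vertex, its
poles stay off the ray through the starting point. -/
theorem ray_ne {ε : ℝ} (hε : 0 < ε) (hG : ∀ t ∈ G.tiles, 2 * ε ≤ t.sine) {v x : ℂ}
    (hv : v ∈ G.vertex) (h : v = x ∨ G.Arrow v x) {t : Rhombus} (ht : t ∈ G.tiles) (hvw : v ≠ t.w)
    {e : ℂ} (hD : 0 < G.divisor v t.b e) {s : ℝ} (h0 : 0 ≤ s) (h1 : s ≤ 1) {τ : ℝ} (hτ : 0 < τ) :
    x ≠ t.w + s * (t.er + t.el) + τ * e := by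
  intro hx
  have he : ‖e‖ = 1 := norm_of_divisor_ne hD.ne'
  set y := t.w + s * (t.er + t.el) with hy
  have hyA : t.coA (y - t.w) = s := by
    rw [hy, add_sub_cancel_left, t.coA_mul, map_add, t.coA_er, t.coA_el]; ring
  have hyB : t.coB (y - t.w) = s := by
    rw [hy, add_sub_cancel_left, t.coB_mul, map_add, t.coB_er, t.coB_el]; ring
  have hyt : y ∈ t.carrier := t.mem_carrier.2 ⟨hyA.symm ▸ ⟨h0, h1⟩, hyB.symm ▸ ⟨h0, h1⟩⟩
  have hbt : t.b ∈ t.carrier := t.corner_mem (by simp [Rhombus.corners])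
  have hwt : t.w ∈ t.carrier := t.corner_mem (by simp [Rhombus.corners])
  have hb : G.height e v + 1 ≤ G.height e t.b := by
    have h2 := divisor_apply hv (black_mem ht) e
    have h3 : (1 : ℝ) ≤ G.divisor v t.b e := by exact_mod_cast hD
    linarith
  have hby := height_sub ht e hbt hyt
  rw [show t.b - y = ((1 - s : ℝ) : ℂ) * (t.er + t.el) by rw [hy, t.b_eq]; push_cast; ring,
    t.slope_mul] at hby
  -- The height does not decrease from y to z, so it exceeds that of y by at least 1 at b. This
  -- difference is 1 - s times 0 or 1, hence e is a side of t and y = w. Then z is a vertex inside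
  -- that side, or it lies beyond w + e and is too high.
  have aux : ∀ z ∈ G.vertex, ∀ τ : ℝ, 0 < τ → z = y + τ * e → G.height e z ≤ G.height e v →
      False := by
    intro z hz τ hτ hzy hzv
    have hm := height_mono hε hG he y hτ.le
    rw [← hzy] at hm
    have side : ∀ _ : t.IsSide t.w e, t.slope e (t.er + t.el) = 1 → False := by
      intro hs hsl
      rw [hsl] at hby
      have hs0 : s = 0 := by linarith
      have hyw : y = t.w := by rw [hy, hs0]; simp
      rw [hyw] at hzy hby hm
      rcases lt_or_ge τ 1 with h | h
      · refine hs.not_corner hτ h ?_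
        rw [← hzy]
        exact mem_corners_of_vertex hz ht (hzy ▸ hs.mem hτ.le h.le)
      · have h2 := height_arrow (arrow_of_side ht hs) e
        rw [add_sub_cancel_left, if_pos rfl] at h2
        have h3 := height_mono hε hG he (t.w + e) (sub_nonneg.2 h)
        rw [show t.w + e + ((τ - 1 : ℝ) : ℂ) * e = z by rw [hzy]; push_cast; ring] at h3
        linarith
    by_cases e1 : t.er = e
    · refine side (Or.inl ⟨e1.symm, Or.inl rfl⟩) ?_
      rw [← e1, t.slope_er, map_add, t.coA_er, t.coA_el, add_zero]
    by_cases e2 : t.el = e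
    · refine side (Or.inr ⟨e2.symm, Or.inl rfl⟩) ?_
      rw [← e2, t.slope_el, map_add, t.coB_er, t.coB_el, zero_add]
    rw [t.slope_of_ne e1 e2] at hby
    linarith
  rcases h with rfl | h
  · exact aux v hv τ hτ hx le_rfl
  have ha := height_arrow h e
  -- If x is one step e after v, the point v itself is tested. Behind y, it would put a point of the
  -- diagonal inside a side; at y, it would be w or b; ahead of y, `aux` applies to it. Otherwise x
  -- and v have equal height and `aux` applies to x.
  by_cases he' : x - v = e
  · have hvy : v = y + ((τ - 1 : ℝ) : ℂ) * e := by
      push_cast; linear_combination hx - he'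
    rcases lt_trichotomy τ 1 with h2 | rfl | h2
    · obtain ⟨t', ht', hs⟩ := h.exists_side
      rw [he'] at hs
      have hyv : y = v + ((1 - τ : ℝ) : ℂ) * e := by rw [hvy]; push_cast; ring
      have hco := (isSide_of_mem ht' ht hs (s := 1 - τ) (by linarith) (by linarith) (hyv ▸ hyt)).co
      rw [hyv, show v + ((1 - τ : ℝ) : ℂ) * e - t.w = (v - t.w) + ((1 - τ : ℝ) : ℂ) * e by ring,
        map_add, t.coA_mul] at hyA
      rw [hyv, show v + ((1 - τ : ℝ) : ℂ) * e - t.w = (v - t.w) + ((1 - τ : ℝ) : ℂ) * e by ring,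
        map_add, t.coB_mul] at hyB
      rcases hco with ⟨c1, c2, c3, c4⟩ | ⟨c1, c2, c3, c4⟩
      · rw [c1, c3] at hyA
        rw [c2] at hyB
        rcases c4 with c4 | c4 <;> rw [c4] at hyB <;> linarith
      · rw [c2, c4] at hyB
        rw [c1] at hyA
        rcases c3 with c3 | c3 <;> rw [c3] at hyA <;> linarith
    · have hvy' : v = y := by rw [hvy]; simp
      have hc := Rhombus.corner_co (mem_corners_of_vertex hv ht (hvy' ▸ hyt))
      rw [hvy', hyA] at hc
      rcases hc.1 with hs | hs
      · exact hvw (by rw [hvy', hy, hs]; simp)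
      · have : v = t.b := by rw [hvy', hy, hs, t.b_eq]; push_cast; ring
        rw [this, divisor_self (black_mem ht)] at hD
        simp at hD
    · exact aux v hv (τ - 1) (by linarith) hvy le_rfl
  · rw [if_neg he'] at ha
    exact aux x h.right_mem τ hτ hx (by linarith)

end IsoradialGraph

/-! ### Integrals along rays and turning the ray. -/

open Filter Topology MeasureTheory in
-- The substitution τ = e^x. In the logarithmic coordinate turning a ray is a vertical translation,
-- so Cauchy's theorem for rectangles applies.
theorem tendsto_integral_exp {f : ℝ → ℂ} (hf : ContinuousOn f (Set.Ioi 0))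
    (hi : IntegrableOn f (Set.Ioi 0)) :
    Tendsto (fun R : ℝ => ∫ x in -R..R, (Real.exp x : ℂ) * f (Real.exp x)) atTop
      (𝓝 (∫ x in Set.Ioi 0, f x)) := by
  have hc : AECover (volume.restrict (Set.Ioi (0 : ℝ))) atTop
      (fun R : ℝ => Set.Ioc (Real.exp (-R)) (Real.exp R)) :=
    (aecover_Ioi_of_Ioi (Real.tendsto_exp_atBot.comp tendsto_neg_atTop_atBot)).inter
      (aecover_Iic Real.tendsto_exp_atTop)
  have := hc.integral_tendsto_of_countably_generated hi
  refine this.congr' ?_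
  filter_upwards [eventually_ge_atTop 0] with R hR
  have hsub : Set.Ioc (Real.exp (-R)) (Real.exp R) ⊆ Set.Ioi 0 :=
    fun x hx => (Real.exp_pos _).trans hx.1
  rw [Measure.restrict_restrict measurableSet_Ioc, Set.inter_eq_left.2 hsub, ← intervalIntegral.integral_of_le
    (Real.exp_le_exp.2 (by linarith)), ← intervalIntegral.integral_deriv_smul_comp'
      (f' := Real.exp) (fun x _ => Real.hasDerivAt_exp x) Real.continuous_exp.continuousOn]
  · refine intervalIntegral.integral_congr fun x _ => ?_
    simp [Complex.real_smul]
  · refine hf.mono ?_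
    rintro _ ⟨x, -, rfl⟩
    exact Real.exp_pos x

/-- The integral of `h` along the ray from `0` to infinity in the direction `d`. -/
noncomputable def rayIntegral (h : ℂ → ℂ) (d : ℂ) : ℂ :=
  ∫ τ in Set.Ioi (0 : ℝ), h (τ * d) * d

/-- `d` is a direction whose ray avoids `S`. -/
def RayFree (S : Finset ℂ) (d : ℂ) : Prop := d ≠ 0 ∧ ∀ τ : ℝ, 0 < τ → (τ : ℂ) * d ∉ S

/-- Functions that are holomorphic outside a finite set of nonzero points and that decay
quadratically at infinity. -/
structure RayDecay (h : ℂ → ℂ) (S : Finset ℂ) : Prop where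
  zero_notMem : (0 : ℂ) ∉ S
  diff : ∀ z ∉ S, DifferentiableAt ℂ h z
  decay : h =O[Bornology.cobounded ℂ] fun z => (z ^ 2)⁻¹

open Filter Topology MeasureTheory in
-- A ray meets the unit circle at most once. All zeros and poles of discrete exponentials lie on
-- that circle, where the default value of division by zero breaks the algebraic identities.
theorem rayIntegral_congr {h h' : ℂ → ℂ} {d : ℂ}
    (hh : ∀ z, ‖z‖ ≠ 1 → h z = h' z) : rayIntegral h d = rayIntegral h' d := by
  refine integral_congr_ae ?_
  have : ∀ᵐ τ : ℝ, τ ≠ ‖d‖⁻¹ := by simp [ae_iff, measure_singleton]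
  filter_upwards [ae_restrict_of_ae this, ae_restrict_mem measurableSet_Ioi] with τ hτ h0
  rw [hh]
  intro h1
  rw [norm_mul, Complex.norm_real, Real.norm_of_nonneg (le_of_lt h0)] at h1
  exact hτ (eq_inv_of_mul_eq_one_left h1)

theorem rayIntegral_const_mul (c : ℂ) (h : ℂ → ℂ) (d : ℂ) :
    rayIntegral (fun z => c * h z) d = c * rayIntegral h d := by
  rw [rayIntegral, rayIntegral, ← MeasureTheory.integral_const_mul]
  simp only [mul_assoc]

theorem rayIntegral_neg (h : ℂ → ℂ) (d : ℂ) :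
    rayIntegral (fun z => h (-z)) d = -rayIntegral h (-d) := by
  rw [rayIntegral, rayIntegral, ← MeasureTheory.integral_neg]
  simp

theorem rayIntegral_scale (h : ℂ → ℂ) (d : ℂ) {c : ℝ} (hc : 0 < c) :
    rayIntegral h (c * d) = rayIntegral h d := by
  have := MeasureTheory.integral_comp_mul_left_Ioi (fun τ : ℝ => h (τ * d) * d) 0 hc
  rw [mul_zero] at this
  rw [rayIntegral, rayIntegral]
  have e : ∀ τ : ℝ, h (τ * (c * d)) * (c * d) = c * (h ((c * τ : ℝ) * d) * d) := fun τ => by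
    push_cast; rw [show (c : ℂ) * τ * d = τ * (c * d) by ring]; ring
  simp only [e]
  rw [MeasureTheory.integral_const_mul, this, Complex.real_smul, ← mul_assoc, ← Complex.ofReal_mul,
    mul_inv_cancel₀ hc.ne', Complex.ofReal_one, one_mul]

namespace RayDecay

open Filter Topology MeasureTheory

variable {h : ℂ → ℂ} {S : Finset ℂ}

theorem const_mul (hh : RayDecay h S) (c : ℂ) : RayDecay (fun z => c * h z) S :=
  ⟨hh.zero_notMem, fun z hz => (hh.diff z hz).const_mul c, hh.decay.const_mul_left c⟩

theorem continuousOn (hh : RayDecay h S) {d : ℂ} (hd : RayFree S d) :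
    ContinuousOn (fun τ : ℝ => h (τ * d) * d) (Set.Ici 0) := by
  intro τ hτ
  have h1 : (τ : ℂ) * d ∉ S := by
    rcases (show (0 : ℝ) ≤ τ from hτ).eq_or_lt with rfl | hτ
    · simpa using hh.zero_notMem
    · exact hd.2 τ hτ
  refine ContinuousAt.continuousWithinAt ?_
  have h2 : ContinuousAt (fun τ : ℝ => (τ : ℂ) * d) τ := by fun_prop
  exact (ContinuousAt.comp (f := fun τ : ℝ => (τ : ℂ) * d) (hh.diff _ h1).continuousAt h2).mul_const d

theorem integrableOn (hh : RayDecay h S) {d : ℂ} (hd : RayFree S d) :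
    IntegrableOn (fun τ : ℝ => h (τ * d) * d) (Set.Ioi 0) := by
  refine IntegrableOn.mono_set ?_ Set.Ioi_subset_Ici_self
  refine ((hh.continuousOn hd).locallyIntegrableOn measurableSet_Ici).integrableOn_of_isBigO_atTop
    (g := fun τ : ℝ => τ ^ (-2 : ℝ)) ?_ ?_
  · have ht : Tendsto (fun τ : ℝ => (τ : ℂ) * d) atTop (Bornology.cobounded ℂ) := by
      rw [← tendsto_norm_atTop_iff_cobounded]
      simp only [norm_mul, Complex.norm_real]
      exact tendsto_norm_atTop_atTop.atTop_mul_const (norm_pos_iff.2 hd.1)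
    have h1 := hh.decay.comp_tendsto ht
    refine (h1.mul (Asymptotics.isBigO_refl (fun _ : ℝ => d) atTop)).trans ?_
    refine Asymptotics.IsBigO.of_bound (‖d‖ / ‖d‖ ^ 2) ?_
    filter_upwards [eventually_gt_atTop 0] with τ hτ
    simp only [Function.comp, norm_mul, norm_inv, norm_pow, Complex.norm_real]
    rw [Real.rpow_neg hτ.le, norm_inv, show (2 : ℝ) = ((2 : ℕ) : ℝ) by norm_num, Real.rpow_natCast,
      norm_pow, mul_pow, mul_inv]
    apply le_of_eq; ring
  · exact ⟨Set.Ioi 1, Ioi_mem_atTop 1, integrableOn_Ioi_rpow_of_lt (by norm_num) one_pos⟩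

theorem tendsto_exp (hh : RayDecay h S) {d : ℂ} (hd : RayFree S d) :
    Tendsto (fun R : ℝ => ∫ x in -R..R, h (Complex.exp x * d) * (Complex.exp x * d)) atTop
      (𝓝 (rayIntegral h d)) := by
  refine (tendsto_integral_exp ((hh.continuousOn hd).mono Set.Ioi_subset_Ici_self)
    (hh.integrableOn hd)).congr fun R => intervalIntegral.integral_congr fun x _ => ?_
  simp only [Complex.ofReal_exp]
  ring

theorem tendsto_mul_zero (hh : RayDecay h S) :
    Tendsto (fun z => h z * z) (Bornology.cobounded ℂ ⊔ 𝓝 0) (𝓝 0) := by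
  refine Tendsto.sup ?_ ?_
  · have h1 : (fun z => h z * z) =O[Bornology.cobounded ℂ] fun z => z⁻¹ := by
      refine (hh.decay.mul (Asymptotics.isBigO_refl (fun z : ℂ => z) _)).congr_right fun z => ?_
      rcases eq_or_ne z 0 with rfl | hz
      · simp
      · field_simp
    exact h1.trans_tendsto tendsto_inv₀_cobounded
  · have h1 : ContinuousAt (fun z => h z * z) 0 :=
      (hh.diff 0 hh.zero_notMem).continuousAt.mul continuousAt_id
    have h2 := h1.tendsto
    rwa [mul_zero] at h2

/-- The vertical sides of the rectangle have fixed length, and the integrand h(z) z tends to 0 at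
infinity by quadratic decay and at 0 because 0 is not a pole. -/
theorem tendsto_vertical (hh : RayDecay h S) {d : ℂ} (φ : ℝ) {u : ℝ → ℝ}
    (hu : Tendsto (fun R => ‖Real.exp (u R) * ‖d‖‖) atTop (atTop ⊔ 𝓝 0)) :
    Tendsto (fun R : ℝ => ∫ y in (0 : ℝ)..φ, h (Complex.exp (u R + y * Complex.I) * d) *
      (Complex.exp (u R + y * Complex.I) * d)) atTop (𝓝 0) := by
  rw [Metric.tendsto_nhds]
  intro δ hδ
  have hk := Metric.tendsto_nhds.1 hh.tendsto_mul_zero (δ / (|φ| + 1)) (by positivity)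
  have hk' : ∀ᶠ r : ℝ in atTop ⊔ 𝓝 0, ∀ z : ℂ, ‖z‖ = r → ‖h z * z‖ < δ / (|φ| + 1) := by
    rw [eventually_sup] at hk ⊢
    obtain ⟨k1, k2⟩ := hk
    constructor
    · rw [← comap_norm_atTop, eventually_comap] at k1
      filter_upwards [k1] with r hr z hz
      simpa using hr z hz
    · obtain ⟨ρ, hρ, h2⟩ := Metric.eventually_nhds_iff.1 k2
      refine Metric.eventually_nhds_iff.2 ⟨ρ, hρ, fun r hr z hz => ?_⟩
      have : dist z 0 < ρ := by
        rw [dist_zero_right, hz]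
        rw [dist_zero_right] at hr
        exact (le_abs_self r).trans_lt hr
      simpa using h2 this
  filter_upwards [hu.eventually hk'] with R hR
  rw [dist_zero_right]
  refine (intervalIntegral.norm_integral_le_of_norm_le_const (C := δ / (|φ| + 1)) fun y _ =>
    (hR _ ?_).le).trans_lt ?_
  · rw [norm_mul, Complex.norm_exp]
    simp
  · rw [sub_zero, div_mul_eq_mul_div, div_lt_iff₀ (by positivity)]
    nlinarith [abs_nonneg φ]

/-- Cauchy's theorem for the rectangle with corners -R and R + iφ in the coordinate log(z/d); by
`hη` it contains no pole, and its vertical sides vanish in the limit. -/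
theorem rotate (hh : RayDecay h S) {d : ℂ} (hd : d ≠ 0) {η : ℝ}
    (hη : ∀ ζ : ℂ, |ζ.im| ≤ η → Complex.exp ζ * d ∉ S) {φ : ℝ} (hφ : |φ| ≤ η) :
    rayIntegral h (Complex.exp (φ * Complex.I) * d) = rayIntegral h d := by
  have free : ∀ ψ : ℝ, |ψ| ≤ η → RayFree S (Complex.exp (ψ * Complex.I) * d) := fun ψ hψ =>
    ⟨mul_ne_zero (Complex.exp_ne_zero _) hd, fun τ hτ => by
      rw [← mul_assoc, ← Complex.exp_log (x := (τ : ℂ)) (by exact_mod_cast hτ.ne'), ← Complex.exp_add]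
      refine hη _ ?_
      rw [← Complex.ofReal_log hτ.le]
      simpa using hψ⟩
  have h0 := free 0 (by simpa using (abs_nonneg φ).trans hφ)
  simp only [Complex.ofReal_zero, zero_mul, Complex.exp_zero, one_mul] at h0
  have t1 := hh.tendsto_exp h0
  have t2 := hh.tendsto_exp (free φ hφ)
  have hn := norm_pos_iff.2 hd
  have t3 := hh.tendsto_vertical (d := d) φ (u := fun R => R) (by
    refine Tendsto.mono_right ?_ le_sup_left
    exact tendsto_norm_atTop_atTop.comp (Real.tendsto_exp_atTop.atTop_mul_const hn))
  have t4 := hh.tendsto_vertical (d := d) φ (u := fun R => -R) (by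
    refine Tendsto.mono_right ?_ le_sup_right
    have := ((Real.tendsto_exp_atBot.comp tendsto_neg_atTop_atBot).mul_const ‖d‖).norm
    simpa using this)
  have key := ((t1.sub t2).add (t3.const_mul Complex.I)).sub (t4.const_mul Complex.I)
  have h2 : ∀ R : ℝ, ((∫ x in -R..R, h (Complex.exp x * d) * (Complex.exp x * d)) -
      ∫ x in -R..R, h (Complex.exp x * (Complex.exp (φ * Complex.I) * d)) *
        (Complex.exp x * (Complex.exp (φ * Complex.I) * d))) +
      Complex.I * (∫ y in (0 : ℝ)..φ, h (Complex.exp ((R : ℝ) + y * Complex.I) * d) *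
        (Complex.exp ((R : ℝ) + y * Complex.I) * d)) -
      Complex.I * (∫ y in (0 : ℝ)..φ, h (Complex.exp ((-R : ℝ) + y * Complex.I) * d) *
        (Complex.exp ((-R : ℝ) + y * Complex.I) * d)) = 0 := by
    intro R
    have := Complex.integral_boundary_rect_eq_zero_of_differentiableOn
      (fun ζ => h (Complex.exp ζ * d) * (Complex.exp ζ * d)) ((-R : ℝ) : ℂ) ((R : ℝ) + φ * Complex.I) ?_
    · simp only [Complex.ofReal_re, Complex.ofReal_im, Complex.add_re, Complex.add_im,
        Complex.re_ofReal_mul, Complex.im_ofReal_mul, Complex.I_re, Complex.I_im, mul_zero, mul_one,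
        add_zero, zero_add, Complex.ofReal_zero, zero_mul, smul_eq_mul] at this
      rw [← this]
      simp only [Complex.exp_add, mul_assoc]
    · intro ζ hζ
      rw [Complex.mem_reProdIm] at hζ
      have h3 : |ζ.im| ≤ η := by
        have := hζ.2
        simp only [Complex.ofReal_im, Complex.add_im, Complex.im_ofReal_mul, Complex.I_im,
          mul_one, zero_add] at this
        refine (?_ : |ζ.im| ≤ |φ|).trans hφ
        have h5 := Set.abs_sub_left_of_mem_uIcc this
        simpa using h5
      have h4 : DifferentiableAt ℂ (fun ζ => Complex.exp ζ * d) ζ := by fun_prop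
      exact ((DifferentiableAt.comp ζ (hh.diff _ (hη ζ h3)) h4).mul h4).differentiableWithinAt
  have := tendsto_nhds_unique key (tendsto_const_nhds.congr fun R => (h2 R).symm)
  rw [mul_zero, add_zero, sub_zero] at this
  exact (sub_eq_zero.1 this).symm

theorem exists_angle (h0 : (0 : ℂ) ∉ S) {d : ℂ} (hd : RayFree S d) :
    ∃ η : ℝ, 0 < η ∧ ∀ ζ : ℂ, |ζ.im| ≤ η → Complex.exp ζ * d ∉ S := by
  have h1 : ∀ s ∈ S, 0 < |(s / d).arg| := by
    intro s hs
    rw [abs_pos]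
    intro ha
    have h2 := Complex.norm_mul_exp_arg_mul_I (s / d)
    rw [ha, Complex.ofReal_zero, zero_mul, Complex.exp_zero, mul_one] at h2
    have hs0 : s ≠ 0 := fun h => h0 (h ▸ hs)
    refine hd.2 ‖s / d‖ (norm_pos_iff.2 (div_ne_zero hs0 hd.1)) ?_
    rwa [h2, div_mul_cancel₀ _ hd.1]
  have h2 : ∀ᶠ η : ℝ in 𝓝[>] 0, ∀ s ∈ S, η < |(s / d).arg| := by
    rw [Filter.eventually_all_finset]
    intro s hs
    exact nhdsWithin_le_nhds (eventually_lt_nhds (h1 s hs))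
  have h3 : ∀ᶠ η : ℝ in 𝓝[>] 0, 0 < η ∧ η < Real.pi :=
    Ioo_mem_nhdsGT Real.pi_pos
  obtain ⟨η, hη, hη0, hηπ⟩ := (h2.and h3).exists
  refine ⟨η, hη0, fun ζ hζ hS => ?_⟩
  have := hη _ hS
  rw [mul_div_cancel_right₀ _ hd.1] at this
  have h4 := abs_le.1 hζ
  have h5 : (Complex.exp ζ).arg = ζ.im := by
    rw [← Complex.log_im, Complex.log_exp (by linarith) (by linarith)]
  rw [h5] at this
  linarith

theorem eventually_eq (hh : RayDecay h S) {d : ℂ} (hd : RayFree S d) :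
    ∀ᶠ d' in 𝓝 d, rayIntegral h d = rayIntegral h d' := by
  obtain ⟨η, hη, H⟩ := exists_angle hh.zero_notMem hd
  have h1 : Tendsto (fun d' => Complex.log (d' / d)) (𝓝 d) (𝓝 0) := by
    have : ContinuousAt (fun d' => Complex.log (d' / d)) d := by
      refine ContinuousAt.clog (by fun_prop) ?_
      rw [div_self hd.1]; simp
    simpa [ContinuousAt, div_self hd.1] using this
  have h2 : ∀ᶠ d' in 𝓝 d, ‖Complex.log (d' / d)‖ < η := by
    simpa using (Metric.tendsto_nhds.1 h1) η hη
  filter_upwards [h2, eventually_ne_nhds hd.1] with d' h3 h4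
  set ζ := Complex.log (d' / d) with hζ
  have e : d' = (Real.exp ζ.re : ℝ) * (Complex.exp (ζ.im * Complex.I) * d) := by
    rw [← mul_assoc, Complex.ofReal_exp, ← Complex.exp_add, Complex.re_add_im, hζ,
      Complex.exp_log (div_ne_zero h4 hd.1), div_mul_cancel₀ _ hd.1]
  rw [e, rayIntegral_scale _ _ (Real.exp_pos _), hh.rotate hd.1 H]
  exact (Complex.abs_im_le_norm ζ).trans h3.le

/-- Scaling the direction changes nothing and a small rotation crosses none of the finitely many
poles, so the integral is locally constant in the direction. -/
theorem rayIntegral_eq (hh : RayDecay h S) {T : Set ℂ} (hT : IsPreconnected T)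
    (hS : ∀ d ∈ T, RayFree S d) {d d' : ℂ} (hd : d ∈ T) (hd' : d' ∈ T) :
    rayIntegral h d = rayIntegral h d' :=
  hT.induction₂ (fun d d' => rayIntegral h d = rayIntegral h d')
    (fun d hd => nhdsWithin_le_nhds (hh.eventually_eq (hS d hd)))
    (fun _ _ _ _ _ _ h1 h2 => h1.trans h2) (fun _ _ _ _ h => h.symm) hd hd'

theorem rayIntegral_eq_segment (hh : RayDecay h S) {d d' : ℂ}
    (hS : ∀ s : ℝ, 0 ≤ s → s ≤ 1 → RayFree S (d + s * (d' - d))) :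
    rayIntegral h d = rayIntegral h d' := by
  have : IsPreconnected ((fun s : ℝ => d + s * (d' - d)) '' Set.Icc 0 1) :=
    isPreconnected_Icc.image _ (by fun_prop)
  refine hh.rayIntegral_eq this ?_ ⟨0, by simp, by simp⟩ ⟨1, by simp, by simp⟩
  rintro _ ⟨s, ⟨h0, h1⟩, rfl⟩
  exact hS s h0 h1

theorem rayIntegral_sum {ι : Type*} {T : Finset ι} {f : ι → ℂ → ℂ} {d : ℂ}
    (hf : ∀ i ∈ T, ∃ S, RayDecay (f i) S ∧ RayFree S d) :
    rayIntegral (fun z => ∑ i ∈ T, f i z) d = ∑ i ∈ T, rayIntegral (f i) d := by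
  simp only [rayIntegral, Finset.sum_mul]
  refine integral_finsetSum _ fun i hi => ?_
  obtain ⟨S, h1, h2⟩ := hf i hi
  exact h1.integrableOn h2

end RayDecay

open Filter Topology Asymptotics in
theorem isTheta_sub_const (s : ℂ) : (fun z : ℂ => z - s) =Θ[Bornology.cobounded ℂ] fun z => z := by
  refine (IsLittleO.isEquivalent ?_).isTheta
  have : (fun z : ℂ => -s) =o[Bornology.cobounded ℂ] fun z : ℂ => z :=
    isLittleO_const_left.2 (Or.inr tendsto_norm_cobounded_atTop)
  refine this.congr_left fun z => ?_
  simp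

theorem eventually_cobounded_ne (s : ℂ) : ∀ᶠ z in Bornology.cobounded ℂ, z ≠ s := by
  filter_upwards [tendsto_norm_cobounded_atTop.eventually_gt_atTop ‖s‖] with z hz h
  rw [h] at hz; exact lt_irrefl _ hz

open Asymptotics in
theorem rayDecay_pole_sub {s s' : ℂ} (hs : s ≠ 0) (hs' : s' ≠ 0) :
    RayDecay (fun z => Complex.I * (1 / (z - s) - 1 / (z - s'))) {s, s'} := by
  refine ⟨by simp [hs.symm, hs'.symm], fun z hz => ?_, ?_⟩
  · simp only [Finset.mem_insert, Finset.mem_singleton, not_or] at hz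
    have h1 := sub_ne_zero.2 hz.1
    have h2 := sub_ne_zero.2 hz.2
    fun_prop (disch := assumption)
  · have h1 := ((isTheta_sub_const s).mul (isTheta_sub_const s')).inv.isBigO.const_mul_left
      (Complex.I * (s - s'))
    refine h1.congr' ?_ ?_
    · filter_upwards [eventually_cobounded_ne s, eventually_cobounded_ne s'] with z h h'
      have h1 := sub_ne_zero.2 h
      have h2 := sub_ne_zero.2 h'
      field_simp
      ring
    · filter_upwards with z
      rw [sq]

theorem rayFree_pair {a c ψ : ℝ} (ha : ψ - a ∈ Set.Ioo 0 (2 * Real.pi))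
    (hc : ψ - c ∈ Set.Ioo 0 (2 * Real.pi)) :
    RayFree {Complex.exp (c * Complex.I), Complex.exp (a * Complex.I)}
      (Complex.exp (ψ * Complex.I)) := by
  have key : ∀ x : ℝ, ψ - x ∈ Set.Ioo 0 (2 * Real.pi) → ∀ τ : ℝ, 0 < τ →
      (τ : ℂ) * Complex.exp (ψ * Complex.I) ≠ Complex.exp (x * Complex.I) := by
    intro x hx τ hτ h
    have h1 := congrArg norm h
    rw [norm_mul, Complex.norm_exp_ofReal_mul_I, Complex.norm_exp_ofReal_mul_I, mul_one,
      Complex.norm_real, Real.norm_of_nonneg hτ.le] at h1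
    rw [h1, Complex.ofReal_one, one_mul, Complex.exp_eq_exp_iff_exists_int] at h
    obtain ⟨n, hn⟩ := h
    have h2 := congrArg Complex.im hn
    simp at h2
    have h3 : ψ - x = n * (2 * Real.pi) := by linarith
    rw [h3] at hx
    have hπ := Real.pi_pos
    have h4 : (0 : ℝ) < n := by
      by_contra hcon; push Not at hcon; nlinarith [hx.1]
    have h5 : (n : ℝ) < 1 := by
      by_contra hcon; push Not at hcon; nlinarith [hx.2]
    have h6 : 0 < n := by exact_mod_cast h4
    have h7 : n < 1 := by exact_mod_cast h5
    omega
  refine ⟨Complex.exp_ne_zero _, fun τ hτ hS => ?_⟩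
  simp only [Finset.mem_insert, Finset.mem_singleton] at hS
  rcases hS with h | h
  · exact key c hc τ hτ h
  · exact key a ha τ hτ h

theorem one_sub_mul_exp_mem_slitPlane {θ : ℝ} (hθ : θ ∈ Set.Ioo 0 (2 * Real.pi)) {τ : ℝ}
    (hτ : 0 ≤ τ) {x : ℝ} (hx : 0 ≤ x) (h : 0 < x ∨ 0 < τ) :
    (x : ℂ) - τ * Complex.exp (θ * Complex.I) ∈ Complex.slitPlane := by
  rw [Complex.mem_slitPlane_iff, Complex.sub_re, Complex.sub_im, Complex.re_ofReal_mul,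
    Complex.im_ofReal_mul, Complex.exp_ofReal_mul_I_re, Complex.exp_ofReal_mul_I_im,
    Complex.ofReal_re, Complex.ofReal_im]
  by_contra hcon
  push Not at hcon
  obtain ⟨h1, h2⟩ := hcon
  rcases hτ.eq_or_lt with rfl | hτ
  · rcases h with h | h <;> linarith
  have h3 : Real.sin θ = 0 := by
    have : τ * Real.sin θ = 0 := by linarith
    exact (mul_eq_zero.1 this).resolve_left hτ.ne'
  have h4 : θ = Real.pi := by
    have h5 : Real.sin (θ - Real.pi) = 0 := by rw [Real.sin_sub_pi, h3, neg_zero]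
    have := (Real.sin_eq_zero_iff_of_lt_of_lt (by linarith [hθ.1]) (by linarith [hθ.2])).1 h5
    linarith
  rw [h4, Real.cos_pi] at h1
  linarith

open Filter Topology MeasureTheory in
/-- The poles `e^{ia}`, `e^{ic}` see the ray of direction `e^{iψ}` through the angle `c - a`. -/
theorem rayIntegral_pole_sub {a c ψ : ℝ} (ha : ψ - a ∈ Set.Ioo 0 (2 * Real.pi))
    (hc : ψ - c ∈ Set.Ioo 0 (2 * Real.pi)) :
    rayIntegral (fun z => Complex.I * (1 / (z - Complex.exp (c * Complex.I)) -
      1 / (z - Complex.exp (a * Complex.I)))) (Complex.exp (ψ * Complex.I)) = c - a := by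
  have hint := (rayDecay_pole_sub (Complex.exp_ne_zero (c * Complex.I))
    (Complex.exp_ne_zero (a * Complex.I))).integrableOn (rayFree_pair ha hc)
  -- A primitive of the pole term at e^{ix}. The principal branch is smooth along the whole ray
  -- because the argument stays in the slit plane.
  set L : ℝ → ℝ → ℂ := fun x τ =>
    Complex.log (1 - τ * Complex.exp ((ψ - x : ℝ) * Complex.I)) with hL
  have hmem : ∀ x : ℝ, ψ - x ∈ Set.Ioo 0 (2 * Real.pi) → ∀ τ : ℝ, 0 ≤ τ →
      1 - (τ : ℂ) * Complex.exp ((ψ - x : ℝ) * Complex.I) ∈ Complex.slitPlane := fun x hx τ hτ => by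
    have := one_sub_mul_exp_mem_slitPlane hx hτ zero_le_one (Or.inl one_pos)
    rwa [Complex.ofReal_one] at this
  have hderiv : ∀ x : ℝ, ψ - x ∈ Set.Ioo 0 (2 * Real.pi) → ∀ τ : ℝ, 0 ≤ τ →
      HasDerivAt (L x) (1 / (τ * Complex.exp (ψ * Complex.I) - Complex.exp (x * Complex.I)) *
        Complex.exp (ψ * Complex.I)) τ := by
    intro x hx τ hτ
    have h1 : HasDerivAt (fun τ : ℝ => 1 - (τ : ℂ) * Complex.exp ((ψ - x : ℝ) * Complex.I))
        (-Complex.exp ((ψ - x : ℝ) * Complex.I)) τ := by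
      have := ((Complex.ofRealCLM.hasDerivAt (x := τ)).mul_const
        (Complex.exp ((ψ - x : ℝ) * Complex.I))).const_sub 1
      simpa using this
    have h2 := h1.clog_real (hmem x hx τ hτ)
    convert h2 using 1
    have h3 := Complex.slitPlane_ne_zero (hmem x hx τ hτ)
    have e : Complex.exp (ψ * Complex.I) =
        Complex.exp ((ψ - x : ℝ) * Complex.I) * Complex.exp (x * Complex.I) := by
      rw [← Complex.exp_add]; congr 1; push_cast; ring
    have hx0 := Complex.exp_ne_zero (x * Complex.I)
    have e2 : τ * Complex.exp (ψ * Complex.I) - Complex.exp (x * Complex.I) =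
        -Complex.exp (x * Complex.I) * (1 - τ * Complex.exp ((ψ - x : ℝ) * Complex.I)) := by
      rw [e]; ring
    rw [e2, e]
    field_simp
  -- The growing part log τ is the same for both poles and cancels in the difference; the window (0,
  -- 2π) for ψ - x fixes the branch of the remaining constant.
  have hlim : ∀ x : ℝ, ψ - x ∈ Set.Ioo 0 (2 * Real.pi) →
      Tendsto (fun τ : ℝ => L x τ - Complex.log τ) atTop (𝓝 ((ψ - x - Real.pi : ℝ) * Complex.I)) := by
    intro x hx
    have hm : -Complex.exp ((ψ - x : ℝ) * Complex.I) ∈ Complex.slitPlane := by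
      have := one_sub_mul_exp_mem_slitPlane hx zero_le_one le_rfl (Or.inr one_pos)
      simpa using this
    have h1 : Tendsto (fun τ : ℝ => Complex.log ((τ⁻¹ : ℝ) - Complex.exp ((ψ - x : ℝ) * Complex.I)))
        atTop (𝓝 (Complex.log (-Complex.exp ((ψ - x : ℝ) * Complex.I)))) := by
      refine Tendsto.clog ?_ hm
      have := (Complex.continuous_ofReal.tendsto 0).comp tendsto_inv_atTop_zero
      simpa using this.sub_const (Complex.exp ((ψ - x : ℝ) * Complex.I))
    have h2 : Complex.log (-Complex.exp ((ψ - x : ℝ) * Complex.I)) =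
        (ψ - x - Real.pi : ℝ) * Complex.I := by
      have : -Complex.exp ((ψ - x : ℝ) * Complex.I) =
          Complex.exp ((ψ - x - Real.pi : ℝ) * Complex.I) := by
        rw [show ((ψ - x - Real.pi : ℝ) : ℂ) * Complex.I =
          (ψ - x : ℝ) * Complex.I - Real.pi * Complex.I by push_cast; ring, Complex.exp_sub,
          Complex.exp_pi_mul_I, div_neg, div_one]
      rw [this, Complex.log_exp]
      · simp; linarith [hx.1]
      · simp; linarith [hx.2]
    rw [h2] at h1
    refine h1.congr' ?_
    filter_upwards [eventually_gt_atTop 0] with τ hτ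
    have h3 : ((τ⁻¹ : ℝ) : ℂ) - Complex.exp ((ψ - x : ℝ) * Complex.I) =
        (τ⁻¹ : ℝ) * (1 - τ * Complex.exp ((ψ - x : ℝ) * Complex.I)) := by
      have : (τ : ℂ) ≠ 0 := by exact_mod_cast hτ.ne'
      push_cast
      field_simp
    rw [h3, Complex.log_ofReal_mul (inv_pos.2 hτ) (Complex.slitPlane_ne_zero (hmem x hx τ hτ.le)),
      Real.log_inv, Complex.ofReal_neg, ← Complex.ofReal_log hτ.le]
    simp only [hL]; ring
  have key := integral_Ioi_of_hasDerivAt_of_tendsto'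
    (f := fun τ => Complex.I * (L c τ - L a τ)) (a := 0)
    (m := Complex.I * ((ψ - c - Real.pi : ℝ) * Complex.I - (ψ - a - Real.pi : ℝ) * Complex.I))
    (fun τ hτ => ((hderiv c hc τ hτ).sub (hderiv a ha τ hτ)).const_mul Complex.I) ?_ ?_
  · rw [rayIntegral]
    refine Eq.trans ?_ (key.trans ?_)
    · refine integral_congr_ae (Eventually.of_forall fun τ => ?_)
      simp only; ring
    · simp [hL]
      linear_combination (a - c : ℂ) * Complex.I_sq
  · refine hint.congr_fun (fun τ _ => ?_) measurableSet_Ioi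
    simp only; ring
  · refine (((hlim c hc).sub (hlim a ha)).const_mul Complex.I).congr fun τ => ?_
    ring

/-! ### The discrete exponential as a rational function. -/

namespace IsoradialGraph

variable {G : IsoradialGraph}

/-- The discrete exponential as a rational function. -/
noncomputable def dexp (G : IsoradialGraph) (x y z : ℂ) : ℂ :=
  (G.divisor x y).prod fun e n => (z - e) ^ (-n)

/-- The poles of the discrete exponential. -/
noncomputable def poles (G : IsoradialGraph) (x y : ℂ) : Finset ℂ :=
  {e ∈ (G.divisor x y).support | 0 < G.divisor x y e}

theorem mem_poles {x y e : ℂ} : e ∈ G.poles x y ↔ 0 < G.divisor x y e := by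
  simp only [poles, Finset.mem_filter, Finsupp.mem_support_iff, and_iff_right_iff_imp]
  exact fun h => h.ne'

theorem zero_notMem_poles {x y : ℂ} : (0 : ℂ) ∉ G.poles x y := fun h => by
  have := norm_of_divisor_ne (mem_poles.1 h).ne'
  simp at this

theorem dexp_self {x : ℂ} (hx : x ∈ G.vertex) (z : ℂ) : G.dexp x x z = 1 := by
  simp [dexp, divisor_self hx]

theorem dexp_mul {x y w : ℂ} (hx : x ∈ G.vertex) (hy : y ∈ G.vertex) (hw : w ∈ G.vertex) {z : ℂ}
    (hz : ‖z‖ ≠ 1) : G.dexp x y z * G.dexp y w z = G.dexp x w z := by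
  classical
  rw [dexp, dexp, dexp, ← divisor_add hx hy hw, Finsupp.prod_add_index]
  · simp
  · intro e he m n
    have : z - e ≠ 0 := fun h => by
      rw [sub_eq_zero] at h
      rw [Finset.mem_union, Finsupp.mem_support_iff, Finsupp.mem_support_iff] at he
      rcases he with he | he <;> exact hz (h ▸ norm_of_divisor_ne he)
    rw [neg_add, zpow_add₀ this]

theorem dexp_ne_zero {x y : ℂ} {z : ℂ} (hz : ‖z‖ ≠ 1) : G.dexp x y z ≠ 0 := by
  rw [dexp, Finsupp.prod, Finset.prod_ne_zero_iff]
  intro e he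
  refine zpow_ne_zero _ fun h => ?_
  rw [sub_eq_zero] at h
  exact hz (h ▸ norm_of_divisor_ne (Finsupp.mem_support_iff.1 he))

theorem Arrow.dexp {x y : ℂ} (h : G.Arrow x y) (z : ℂ) : G.dexp x y z = 1 / (z - (y - x)) := by
  rw [IsoradialGraph.dexp, h.divisor, Finsupp.prod_single_index (by simp)]
  simp

theorem dexp_symm {x y : ℂ} (hx : x ∈ G.vertex) (hy : y ∈ G.vertex) (z : ℂ) :
    G.dexp y x z = (G.dexp x y z)⁻¹ := by
  rw [dexp, dexp, divisor_symm hx hy, Finsupp.prod, Finsupp.prod, Finsupp.support_neg,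
    ← Finset.prod_inv_distrib]
  refine Finset.prod_congr rfl fun e _ => ?_
  rw [Finsupp.neg_apply, neg_neg, zpow_neg, inv_inv]

theorem LatticePath.discreteExp_eq {x y : ℂ} (hx : x ∈ G.vertex) (p : G.LatticePath x y) {z : ℂ}
    (hz : ‖z‖ ≠ 1) : p.discreteExp z = G.dexp x y z := by
  induction p with
  | refl => rw [dexp_self hx]; rfl
  | along p h ih =>
    rw [discreteExp, ih, ← h.dexp, dexp_mul hx h.left_mem h.right_mem hz]
  | against p h ih =>
    rw [discreteExp, ih, ← dexp_mul hx h.right_mem h.left_mem hz, dexp_symm h.left_mem h.right_mem,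
      h.dexp]
    simp

theorem differentiableAt_dexp {x y z : ℂ} (hz : z ∉ G.poles x y) :
    DifferentiableAt ℂ (G.dexp x y) z := by
  unfold dexp Finsupp.prod
  refine DifferentiableAt.fun_finsetProd fun e _ => ?_
  refine DifferentiableAt.zpow (by fun_prop) ?_
  by_cases h : z = e
  · right
    rw [h, mem_poles] at hz
    omega
  · exact Or.inl (sub_ne_zero.2 h)

open Asymptotics in
theorem isTheta_dexp {x y : ℂ} (hx : x ∈ G.vertex) (hy : y ∈ G.vertex) :
    G.dexp x y =Θ[Bornology.cobounded ℂ] fun z => z ^ (-(G.deg y - G.deg x)) := by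
  have h1 : (fun z => ∏ e ∈ (G.divisor x y).support, (z - e) ^ (-(G.divisor x y e)))
      =Θ[Bornology.cobounded ℂ] fun z => ∏ e ∈ (G.divisor x y).support, z ^ (-(G.divisor x y e)) :=
    IsTheta.finsetProd fun e _ => (isTheta_sub_const e).zpow _
  refine h1.trans (Filter.EventuallyEq.isTheta ?_)
  filter_upwards [eventually_cobounded_ne 0] with z hz
  rw [← divisor_sum hx hy, Finsupp.sum, ← Finset.sum_neg_distrib]
  induction (G.divisor x y).support using Finset.cons_induction with
  | empty => simp
  | cons a s ha ih => rw [Finset.prod_cons, Finset.sum_cons, zpow_add₀ hz, ih]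

/-- Two degrees between white and black are exactly the quadratic decay that makes the ray integrals
converge and turn. -/
theorem rayDecay_dexp {x y : ℂ} (hx : x ∈ G.vertex) (hy : y ∈ G.vertex)
    (h : G.deg y = G.deg x + 2) : RayDecay (G.dexp x y) (G.poles x y) := by
  refine ⟨zero_notMem_poles, fun z hz => differentiableAt_dexp hz, ?_⟩
  refine (isTheta_dexp hx hy).isBigO.congr_right fun z => ?_
  rw [h, add_sub_cancel_left, zpow_neg]
  rfl

end IsoradialGraph

/-! ### Fans of tiles around a white vertex. -/

theorem Complex.exp_mul_I_injective {x y : ℝ} (h : exp (x * I) = exp (y * I))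
    (hxy : |x - y| < 2 * Real.pi) : x = y := by
  rw [exp_eq_exp_iff_exists_int] at h
  obtain ⟨n, hn⟩ := h
  have h2 := congrArg im hn
  simp at h2
  have h3 : x - y = n * (2 * Real.pi) := by linarith
  have hπ := Real.pi_pos
  rw [h3, abs_mul, abs_of_pos (by positivity : 0 < 2 * Real.pi)] at hxy
  have h4 : |(n : ℝ)| < 1 := by
    by_contra hcon; push Not at hcon; nlinarith
  have h5 : |n| < 1 := by exact_mod_cast h4
  rw [Int.abs_lt_one_iff] at h5
  rw [h5] at h3
  simp at h3
  linarith

theorem cross_exp (x y : ℝ) :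
    cross (Complex.exp (x * Complex.I)) (Complex.exp (y * Complex.I)) = Real.sin (y - x) := by
  rw [cross, Complex.exp_ofReal_mul_I_re, Complex.exp_ofReal_mul_I_im,
    Complex.exp_ofReal_mul_I_re, Complex.exp_ofReal_mul_I_im, Real.sin_sub]
  ring

theorem exp_add_exp (a c : ℝ) : Complex.exp (a * Complex.I) + Complex.exp (c * Complex.I) =
    (2 * Real.cos ((c - a) / 2) : ℝ) * Complex.exp (((a + c) / 2 : ℝ) * Complex.I) := by
  rw [Complex.ofReal_mul, Complex.ofReal_cos, Complex.cos]
  push_cast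
  rw [mul_div_cancel₀ _ two_ne_zero, add_mul, ← Complex.exp_add, ← Complex.exp_add, add_comm]
  congr 2 <;> ring

/-- The angle from a unit vector to a unit vector on its left. -/
theorem exists_angle_of_cross_pos {e f : ℂ} (he : ‖e‖ = 1) (hf : ‖f‖ = 1) (h : 0 < cross e f) :
    ∃ δ : ℝ, 0 < δ ∧ δ < Real.pi ∧ f = e * Complex.exp (δ * Complex.I) := by
  have he0 : e ≠ 0 := fun h => by simp [h] at he
  have hq : (f / e).im = cross e f := by
    rw [cross_eq_im, div_eq_mul_inv, Complex.inv_def, Complex.normSq_eq_norm_sq, he]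
    simp; ring
  have hpos : 0 < (f / e).im := hq ▸ h
  refine ⟨(f / e).arg, lt_of_le_of_ne (Complex.arg_nonneg_iff.2 hpos.le) fun h => ?_, ?_, ?_⟩
  · rw [(Complex.arg_eq_zero_iff.1 h.symm).2] at hpos
    exact lt_irrefl _ hpos
  · refine lt_of_le_of_ne (Complex.arg_le_pi _) fun h => ?_
    rw [Complex.arg_eq_pi_iff] at h
    rw [h.2] at hpos
    exact lt_irrefl _ hpos
  · have := Complex.norm_mul_exp_arg_mul_I (f / e)
    rw [norm_div, he, hf, div_one, Complex.ofReal_one, one_mul] at this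
    rw [this, mul_div_cancel₀ _ he0]

namespace IsoradialGraph

variable {G : IsoradialGraph}

theorem mem_carrier_of_cone (t : Rhombus) {v : ℂ} (ha : 0 ≤ t.coA v) (hb : 0 ≤ t.coB v) {ρ : ℝ}
    (h0 : 0 ≤ ρ) (h1 : ρ * (t.coA v + t.coB v) ≤ 1) : t.w + ρ * v ∈ t.carrier := by
  have h2 := mul_nonneg h0 ha
  have h3 := mul_nonneg h0 hb
  rw [t.mem_carrier, add_sub_cancel_left, t.coA_mul, t.coB_mul]
  exact ⟨⟨h2, by linarith⟩, ⟨h3, by linarith⟩⟩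

/-- A short multiple of v gives a second common point, so distinct tiles would share a side in the
direction v; but v has two positive coordinates. -/
theorem tile_eq_of_cone {t t' : Rhombus} (ht : t ∈ G.tiles) (ht' : t' ∈ G.tiles) (hw : t.w = t'.w)
    {v : ℂ} (ha : 0 < t.coA v) (hb : 0 < t.coB v) (ha' : 0 < t'.coA v) (hb' : 0 < t'.coB v) :
    t = t' := by
  by_contra hne
  set σ := t.coA v + t.coB v + (t'.coA v + t'.coB v) with hσ
  have hσ0 : 0 < σ := by positivity
  have m1 := mem_carrier_of_cone t ha.le hb.le (ρ := 1 / σ) (by positivity) (by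
    rw [one_div_mul_eq_div, div_le_one hσ0]; linarith)
  have m2 := mem_carrier_of_cone t' ha'.le hb'.le (ρ := 1 / σ) (by positivity) (by
    rw [one_div_mul_eq_div, div_le_one hσ0]; linarith)
  rw [← hw] at m2
  have hv : v ≠ 0 := fun h => by rw [h, map_zero] at ha; exact lt_irrefl _ ha
  have hwt : t.w ∈ t.carrier := t.corner_mem (by simp [Rhombus.corners])
  have hwt' : t.w ∈ t'.carrier := hw ▸ t'.corner_mem (by simp [Rhombus.corners])
  have h0 : ((1 / σ : ℝ) : ℂ) ≠ 0 := by exact_mod_cast (by positivity : (1 / σ : ℝ) ≠ 0)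
  obtain ⟨A, e, hs, -, s, hse⟩ := exists_common_side ht ht' hne m1 m2 hwt hwt' (by
    rw [Ne, add_eq_left]; exact mul_ne_zero h0 hv)
  rw [add_sub_cancel_left] at hse
  have e1 := congrArg t.coA hse
  have e2 := congrArg t.coB hse
  rw [t.coA_mul, t.coA_mul] at e1
  rw [t.coB_mul, t.coB_mul] at e2
  have p1 : 0 < 1 / σ * t.coA v := by positivity
  have p2 : 0 < 1 / σ * t.coB v := by positivity
  rcases hs.co with ⟨-, h, -⟩ | ⟨h, -⟩
  · rw [h, mul_zero] at e2; linarith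
  · rw [h, mul_zero] at e1; linarith

theorem tile_eq_of_edge {t t' : Rhombus} (ht : t ∈ G.tiles) (ht' : t' ∈ G.tiles) (hw : t.w = t'.w)
    (hb : t.b = t'.b) : t = t' := by
  have h1 : t.b - t.w = t.er + t.el := by rw [t.b_eq]; ring
  have h2 : t.b - t.w = t'.er + t'.el := by rw [hb, hw, t'.b_eq]; ring
  refine tile_eq_of_cone ht ht' hw (v := t.b - t.w) ?_ ?_ ?_ ?_
  · rw [h1, map_add]; simp
  · rw [h1, map_add]; simp
  · rw [h2, map_add]; simp
  · rw [h2, map_add]; simp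

/-- Tilting the common right side slightly to the left gives a vector strictly inside both angles; δ
is small enough to keep the first coordinate positive. -/
theorem tile_eq_of_er {t t' : Rhombus} (ht : t ∈ G.tiles) (ht' : t' ∈ G.tiles) (hw : t.w = t'.w)
    (he : t.er = t'.er) : t = t' := by
  set x := t.coA t'.el with hx
  have hy : 0 < t.coB t'.el := by
    rw [t.coB_apply, he]; exact div_pos t'.sine_pos t.sine_pos
  set δ : ℝ := 1 / (1 + |x|) with hδ
  have hδ0 : 0 < δ := by positivity
  have hδx : 0 < 1 + δ * x := by
    have h1 : δ * (1 + |x|) = 1 := by rw [hδ]; field_simp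
    have h2 := mul_le_mul_of_nonneg_left (neg_abs_le x) hδ0.le
    linarith
  refine tile_eq_of_cone ht ht' hw (v := t.er + δ * t'.el) ?_ ?_ ?_ ?_
  · rw [map_add, t.coA_mul, t.coA_er]; exact hδx
  · rw [map_add, t.coB_mul, t.coB_er, zero_add]; positivity
  · rw [he, map_add, t'.coA_mul, t'.coA_er, t'.coA_el]; norm_num
  · rw [he, map_add, t'.coB_mul, t'.coB_er, t'.coB_el]; linarith

theorem tile_eq_of_el {t t' : Rhombus} (ht : t ∈ G.tiles) (ht' : t' ∈ G.tiles) (hw : t.w = t'.w)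
    (he : t.el = t'.el) : t = t' := by
  set x := t.coB t'.er with hx
  have hy : 0 < t.coA t'.er := by
    rw [t.coA_apply, he]; exact div_pos t'.sine_pos t.sine_pos
  set δ : ℝ := 1 / (1 + |x|) with hδ
  have hδ0 : 0 < δ := by positivity
  have hδx : 0 < 1 + δ * x := by
    have h1 : δ * (1 + |x|) = 1 := by rw [hδ]; field_simp
    have h2 := mul_le_mul_of_nonneg_left (neg_abs_le x) hδ0.le
    linarith
  refine tile_eq_of_cone ht ht' hw (v := t.el + δ * t'.er) ?_ ?_ ?_ ?_
  · rw [map_add, t.coA_mul, t.coA_el, zero_add]; positivity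
  · rw [map_add, t.coB_mul, t.coB_el]; exact hδx
  · rw [he, map_add, t'.coA_mul, t'.coA_er, t'.coA_el]; linarith
  · rw [he, map_add, t'.coB_mul, t'.coB_er, t'.coB_el]; norm_num

theorem isSide_white {t : Rhombus} (ht : t ∈ G.tiles) {w e : ℂ} (hw : w ∈ G.white)
    (h : t.IsSide w e) : t.w = w ∧ (t.er = e ∨ t.el = e) := by
  rcases h with ⟨rfl, h | h⟩ | ⟨rfl, h | h⟩
  · exact ⟨h.symm, Or.inl rfl⟩
  · exact absurd (⟨t, ht, Or.inr h.symm⟩ : w ∈ G.face) (white_not_face hw)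
  · exact ⟨h.symm, Or.inr rfl⟩
  · exact absurd (⟨t, ht, Or.inl h.symm⟩ : w ∈ G.face) (white_not_face hw)

/-- The tile met when leaving the midpoint of the edge to its left has the edge as a side, and lying
on the left of e it must have e as its right side. -/
theorem exists_tile_er {w e : ℂ} (hw : w ∈ G.white) (h : G.Arrow w (w + e)) :
    ∃ t ∈ G.tiles, t.w = w ∧ t.er = e := by
  obtain ⟨t₀, ht₀, hs₀⟩ := h.exists_side
  rw [add_sub_cancel_left] at hs₀
  obtain ⟨t, ht, η, hη, hm⟩ := G.exists_radial (w + (2⁻¹ : ℝ) * e) (Complex.I * e)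
  have h0 := hm 0 le_rfl hη.le
  rw [Complex.ofReal_zero, zero_mul, add_zero] at h0
  obtain ⟨h1, h2 | h2⟩ := isSide_white ht hw (isSide_of_mem ht₀ ht hs₀ (by norm_num) (by norm_num) h0)
  · exact ⟨t, ht, h1, h2⟩
  · exfalso
    have h3 := (t.mem_carrier.1 (hm η hη.le le_rfl)).1.1
    rw [h1, show w + (2⁻¹ : ℝ) * e + η * (Complex.I * e) - w =
      (2⁻¹ : ℝ) * e + η * (Complex.I * e) by ring, map_add, t.coA_mul, t.coA_mul, ← h2, t.coA_el,
      mul_zero, zero_add, t.coA_apply] at h3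
    have h4 : cross (Complex.I * t.el) t.el = -1 := by
      have := re_sq_add_im_sq t.norm_el
      simp [cross]; linarith
    rw [h4] at h3
    have := div_pos hη t.sine_pos
    rw [mul_div_assoc', mul_neg, mul_one, neg_div] at h3
    linarith

theorem exists_tile_el {w e : ℂ} (hw : w ∈ G.white) (h : G.Arrow w (w + e)) :
    ∃ t ∈ G.tiles, t.w = w ∧ t.el = e := by
  obtain ⟨t₀, ht₀, hs₀⟩ := h.exists_side
  rw [add_sub_cancel_left] at hs₀
  obtain ⟨t, ht, η, hη, hm⟩ := G.exists_radial (w + (2⁻¹ : ℝ) * e) (-Complex.I * e)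
  have h0 := hm 0 le_rfl hη.le
  rw [Complex.ofReal_zero, zero_mul, add_zero] at h0
  obtain ⟨h1, h2 | h2⟩ := isSide_white ht hw (isSide_of_mem ht₀ ht hs₀ (by norm_num) (by norm_num) h0)
  · exfalso
    have h3 := (t.mem_carrier.1 (hm η hη.le le_rfl)).2.1
    rw [h1, show w + (2⁻¹ : ℝ) * e + η * (-Complex.I * e) - w =
      (2⁻¹ : ℝ) * e + η * (-Complex.I * e) by ring, map_add, t.coB_mul, t.coB_mul, ← h2, t.coB_er,
      mul_zero, zero_add, t.coB_apply] at h3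
    have h4 : cross t.er (-Complex.I * t.er) = -1 := by
      have := re_sq_add_im_sq t.norm_er
      simp [cross]; linarith
    rw [h4] at h3
    have := div_pos hη t.sine_pos
    rw [mul_div_assoc', mul_neg, mul_one, neg_div] at h3
    linarith
  · exact ⟨t, ht, h1, h2⟩

/-- No side of another tile points into the sector of a tile. -/
theorem not_mem_sector {t : Rhombus} (ht : t ∈ G.tiles) {e : ℂ} (h : G.Arrow t.w (t.w + e)) :
    ¬ (0 < t.coA e ∧ 0 < t.coB e) := by
  rintro ⟨ha, hb⟩
  obtain ⟨t₀, ht₀, hs₀⟩ := h.exists_side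
  rw [add_sub_cancel_left] at hs₀
  set σ := 1 + (t.coA e + t.coB e) with hσ
  have hσ1 : 1 < σ := by rw [hσ]; linarith
  have m := mem_carrier_of_cone t ha.le hb.le (ρ := 1 / σ) (by positivity) (by
    rw [one_div_mul_eq_div, div_le_one (by positivity)]; linarith)
  have hco := (isSide_of_mem ht₀ ht hs₀ (by positivity) (by
    rw [div_lt_one (by positivity)]; exact hσ1) m).co
  rcases hco with ⟨-, h, -⟩ | ⟨h, -⟩ <;> linarith

theorem not_mem_sector_angle {t : Rhombus} (ht : t ∈ G.tiles) {a c x : ℝ}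
    (ha : t.er = Complex.exp (a * Complex.I)) (hc : t.el = Complex.exp (c * Complex.I))
    (hac : c < a + Real.pi) (h : G.Arrow t.w (t.w + Complex.exp (x * Complex.I))) :
    ¬ (a < x ∧ x < c) := by
  rintro ⟨h1, h2⟩
  refine not_mem_sector ht h ⟨?_, ?_⟩
  · rw [t.coA_apply, hc, cross_exp]
    exact div_pos (Real.sin_pos_of_pos_of_lt_pi (by linarith) (by linarith)) t.sine_pos
  · rw [t.coB_apply, ha, cross_exp]
    exact div_pos (Real.sin_pos_of_pos_of_lt_pi (by linarith) (by linarith)) t.sine_pos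

theorem exists_lift_el (t : Rhombus) {a : ℝ} (ha : t.er = Complex.exp (a * Complex.I)) :
    ∃ c : ℝ, a < c ∧ c < a + Real.pi ∧ t.el = Complex.exp (c * Complex.I) := by
  obtain ⟨δ, h0, h1, h2⟩ := exists_angle_of_cross_pos t.norm_er t.norm_el t.sine_pos
  refine ⟨a + δ, by linarith, by linarith, ?_⟩
  rw [h2, ha, ← Complex.exp_add]; congr 1; push_cast; ring

theorem exists_lift_er (t : Rhombus) {c : ℝ} (hc : t.el = Complex.exp (c * Complex.I)) :
    ∃ a : ℝ, a < c ∧ c < a + Real.pi ∧ t.er = Complex.exp (a * Complex.I) := by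
  obtain ⟨δ, h0, h1, h2⟩ := exists_angle_of_cross_pos t.norm_er t.norm_el t.sine_pos
  refine ⟨c - δ, by linarith, by linarith, ?_⟩
  have h3 : t.er = t.el * Complex.exp (-(δ * Complex.I)) := by
    rw [h2, mul_assoc, ← Complex.exp_add, add_neg_cancel, Complex.exp_zero, mul_one]
  rw [h3, hc, ← Complex.exp_add]; congr 1; push_cast; ring

theorem exists_lift {e : ℂ} (he : ‖e‖ = 1) (α : ℝ) :
    ∃ x : ℝ, α ≤ x ∧ x < α + 2 * Real.pi ∧ e = Complex.exp (x * Complex.I) := by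
  have h := toIcoMod_mem_Ico Real.two_pi_pos α e.arg
  refine ⟨toIcoMod Real.two_pi_pos α e.arg, h.1, h.2, ?_⟩
  have h1 := Complex.norm_mul_exp_arg_mul_I e
  rw [he, Complex.ofReal_one, one_mul] at h1
  conv_lhs => rw [← h1]
  rw [Complex.exp_eq_exp_iff_exists_int]
  refine ⟨toIcoDiv Real.two_pi_pos α e.arg, ?_⟩
  have h2 := toIcoMod_add_toIcoDiv_zsmul Real.two_pi_pos α e.arg
  conv_lhs => rw [← h2]
  simp only [zsmul_eq_mul]
  push_cast; ring

/-- The tiles at the white vertex `w` between the directions `α` and `β`. -/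
def fanSet (G : IsoradialGraph) (w : ℂ) (α β : ℝ) : Set Rhombus :=
  {t | t ∈ G.tiles ∧ t.w = w ∧ ∃ a c : ℝ, a < c ∧ t.er = Complex.exp (a * Complex.I) ∧
    t.el = Complex.exp (c * Complex.I) ∧ α ≤ a ∧ c ≤ β}

theorem finite_tiles_at (G : IsoradialGraph) (p : ℂ) : {t ∈ G.tiles | p ∈ t.carrier}.Finite := by
  refine (G.locally_finite ‖p‖).subset ?_
  rintro t ⟨ht, h⟩
  exact ⟨ht, p, h, by simp⟩

theorem fanSet_finite (G : IsoradialGraph) (w : ℂ) (α β : ℝ) : (G.fanSet w α β).Finite := by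
  refine (G.finite_tiles_at w).subset ?_
  rintro t ⟨ht, rfl, -⟩
  exact ⟨ht, t.corner_mem (by simp [Rhombus.corners])⟩

noncomputable def fan (G : IsoradialGraph) (w : ℂ) (α β : ℝ) : Finset Rhombus :=
  (G.fanSet_finite w α β).toFinset

theorem mem_fan {w : ℂ} {α β : ℝ} {t : Rhombus} : t ∈ G.fan w α β ↔ t ∈ G.fanSet w α β :=
  Set.Finite.mem_toFinset _

theorem fan_arrow {t : Rhombus} (ht : t ∈ G.tiles) : G.Arrow t.w (t.w + t.er) ∧
    G.Arrow t.w (t.w + t.el) :=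
  ⟨arrow_of_side ht (Or.inl ⟨rfl, Or.inl rfl⟩), arrow_of_side ht (Or.inr ⟨rfl, Or.inl rfl⟩)⟩

/-- Every edge direction strictly between α and β is the left side of exactly one tile of the fan
and the right side of exactly one. So the right angles together with β are the left angles together
with α, and sums of differences telescope without ordering the tiles. -/
theorem exists_fan_lifts {w : ℂ} (hw : w ∈ G.white) {α β : ℝ} (hαβ : α < β)
    (hβ : β ≤ α + 2 * Real.pi) (ha : G.Arrow w (w + Complex.exp (α * Complex.I)))
    (hb : G.Arrow w (w + Complex.exp (β * Complex.I))) : ∃ a c : Rhombus → ℝ,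
      (∀ t ∈ G.fan w α β, t.er = Complex.exp (a t * Complex.I) ∧
        t.el = Complex.exp (c t * Complex.I) ∧ α ≤ a t ∧ a t < c t ∧ c t < a t + Real.pi ∧ c t ≤ β) ∧
      ∀ F : ℝ → ℂ, ∑ t ∈ G.fan w α β, (F (c t) - F (a t)) = F β - F α := by
  classical
  have hπ := Real.pi_pos
  have hlift : ∀ t : Rhombus, ∃ a c : ℝ, t ∈ G.fan w α β → t.er = Complex.exp (a * Complex.I) ∧
      t.el = Complex.exp (c * Complex.I) ∧ α ≤ a ∧ a < c ∧ c < a + Real.pi ∧ c ≤ β := by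
    intro t
    by_cases h : t ∈ G.fan w α β
    · obtain ⟨ht, hw, a, c, hac, ha, hc, h1, h2⟩ := mem_fan.1 h
      obtain ⟨c', k1, k2, k3⟩ := exists_lift_el t ha
      have : c = c' := by
        refine Complex.exp_mul_I_injective (hc.symm.trans k3) ?_
        rw [abs_lt]; constructor <;> linarith
      exact ⟨a, c, fun _ => ⟨ha, hc, h1, hac, this ▸ k2, h2⟩⟩
    · exact ⟨0, 0, fun h' => absurd h' h⟩
  choose a c hac using hlift
  refine ⟨a, c, hac, fun F => ?_⟩
  have inj : ∀ x y : ℝ, Complex.exp (x * Complex.I) = Complex.exp (y * Complex.I) →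
      |x - y| < 2 * Real.pi → x = y := fun x y => Complex.exp_mul_I_injective
  have ia : Set.InjOn a (G.fan w α β) := by
    intro t ht t' ht' h
    have h1 := mem_fan.1 ht
    have h2 := mem_fan.1 ht'
    exact tile_eq_of_er h1.1 h2.1 (h1.2.1.trans h2.2.1.symm)
      ((hac t ht).1.trans (h ▸ (hac t' ht').1.symm))
  have ic : Set.InjOn c (G.fan w α β) := by
    intro t ht t' ht' h
    have h1 := mem_fan.1 ht
    have h2 := mem_fan.1 ht'
    exact tile_eq_of_el h1.1 h2.1 (h1.2.1.trans h2.2.1.symm)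
      ((hac t ht).2.1.trans (h ▸ (hac t' ht').2.1.symm))
  have hL : ∀ x : ℝ, α < x → x ≤ β → G.Arrow w (w + Complex.exp (x * Complex.I)) →
      x ∈ (G.fan w α β).image c := by
    intro x h1 h2 hx
    obtain ⟨t, ht, rfl, hel⟩ := exists_tile_el hw hx
    obtain ⟨a', k1, k2, k3⟩ := exists_lift_er t hel
    have hα : α ≤ a' := by
      by_contra hcon
      push Not at hcon
      exact not_mem_sector_angle ht k3 hel k2 ha ⟨hcon, h1⟩
    have hm : t ∈ G.fan t.w α β := mem_fan.2 ⟨ht, rfl, a', x, k1, k3, hel, hα, h2⟩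
    refine Finset.mem_image.2 ⟨t, hm, ?_⟩
    have h3 := hac t hm
    refine inj _ _ (h3.2.1.symm.trans hel) ?_
    rw [abs_lt]; constructor <;> linarith
  have hR : ∀ x : ℝ, α ≤ x → x < β → G.Arrow w (w + Complex.exp (x * Complex.I)) →
      x ∈ (G.fan w α β).image a := by
    intro x h1 h2 hx
    obtain ⟨t, ht, rfl, her⟩ := exists_tile_er hw hx
    obtain ⟨c', k1, k2, k3⟩ := exists_lift_el t her
    have hβ : c' ≤ β := by
      by_contra hcon
      push Not at hcon
      exact not_mem_sector_angle ht her k3 k2 hb ⟨h2, hcon⟩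
    have hm : t ∈ G.fan t.w α β := mem_fan.2 ⟨ht, rfl, x, c', k1, her, k3, h1, hβ⟩
    refine Finset.mem_image.2 ⟨t, hm, ?_⟩
    have h3 := hac t hm
    refine inj _ _ (h3.1.symm.trans her) ?_
    rw [abs_lt]; constructor <;> linarith
  -- The whole telescoping: both sides are the set of edge directions in [α, β].
  have hset : insert β ((G.fan w α β).image a) = insert α ((G.fan w α β).image c) := by
    ext x
    simp only [Finset.mem_insert]
    constructor
    · rintro (rfl | hx)
      · exact Or.inr (hL x hαβ le_rfl hb)
      · obtain ⟨t, ht, rfl⟩ := Finset.mem_image.1 hx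
        have h3 := hac t ht
        rcases h3.2.2.1.eq_or_lt with h | h
        · exact Or.inl h.symm
        · have h4 := (mem_fan.1 ht)
          refine Or.inr (hL _ h (by linarith) ?_)
          rw [← h3.1, ← h4.2.1]; exact (fan_arrow h4.1).1
    · rintro (rfl | hx)
      · exact Or.inr (hR x le_rfl hαβ ha)
      · obtain ⟨t, ht, rfl⟩ := Finset.mem_image.1 hx
        have h3 := hac t ht
        rcases h3.2.2.2.2.2.eq_or_lt with h | h
        · exact Or.inl h
        · have h4 := (mem_fan.1 ht)
          refine Or.inr (hR _ (by linarith) h ?_)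
          rw [← h3.2.1, ← h4.2.1]; exact (fan_arrow h4.1).2
  have hβn : β ∉ (G.fan w α β).image a := fun h => by
    obtain ⟨t, ht, h⟩ := Finset.mem_image.1 h
    have := hac t ht
    linarith
  have hαn : α ∉ (G.fan w α β).image c := fun h => by
    obtain ⟨t, ht, h⟩ := Finset.mem_image.1 h
    have := hac t ht
    linarith
  have hsum : ∑ x ∈ insert β ((G.fan w α β).image a), F x =
    ∑ x ∈ insert α ((G.fan w α β).image c), F x := by rw [hset]
  rw [Finset.sum_insert hβn, Finset.sum_insert hαn, Finset.sum_image ia, Finset.sum_image ic] at hsum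
  rw [Finset.sum_sub_distrib]
  linear_combination -hsum

/-- Two edges at `w` cut the tiles at `w` into two fans. -/
theorem mem_fan_or {t : Rhombus} (ht : t ∈ G.tiles) {α β : ℝ}
    (ha : G.Arrow t.w (t.w + Complex.exp (α * Complex.I)))
    (hb : G.Arrow t.w (t.w + Complex.exp (β * Complex.I))) :
    t ∈ G.fan t.w α β ∨ t ∈ G.fan t.w β (α + 2 * Real.pi) := by
  have hα2 : Complex.exp ((α + 2 * Real.pi : ℝ) * Complex.I) = Complex.exp (α * Complex.I) := by
    push_cast; rw [add_mul, Complex.exp_add, Complex.exp_two_pi_mul_I, mul_one]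
  obtain ⟨x, h1, h2, h3⟩ := exists_lift t.norm_er α
  obtain ⟨c, k1, k2, k3⟩ := exists_lift_el t h3
  have hc : c ≤ α + 2 * Real.pi := by
    by_contra hcon
    push Not at hcon
    exact not_mem_sector_angle ht h3 k3 k2 (hα2 ▸ ha) ⟨h2, hcon⟩
  rcases lt_or_ge x β with h | h
  · left
    refine mem_fan.2 ⟨ht, rfl, x, c, k1, h3, k3, h1, ?_⟩
    by_contra hcon
    push Not at hcon
    exact not_mem_sector_angle ht h3 k3 k2 hb ⟨h, hcon⟩
  · exact Or.inr (mem_fan.2 ⟨ht, rfl, x, c, k1, h3, k3, h, hc⟩)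

end IsoradialGraph

/-! ### Decay of the candidate for the inverse. -/

open MeasureTheory in
theorem integral_one_div_one_add_mul_sq {a : ℝ} (ha : 0 < a) :
    IntegrableOn (fun τ : ℝ => 1 / (1 + a * τ) ^ 2) (Set.Ioi 0) ∧
      ∫ τ in Set.Ioi (0 : ℝ), 1 / (1 + a * τ) ^ 2 = 1 / a := by
  have hd : ∀ τ ∈ Set.Ici (0 : ℝ),
      HasDerivAt (fun τ => -(1 / a) * (1 + a * τ)⁻¹) (1 / (1 + a * τ) ^ 2) τ := by
    intro τ hτ
    have h0 : 1 + a * τ ≠ 0 := by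
      have : 0 ≤ a * τ := mul_nonneg ha.le hτ
      linarith
    have h1 : HasDerivAt (fun τ => 1 + a * τ) a τ := by
      simpa using ((hasDerivAt_id τ).const_mul a).const_add 1
    refine ((h1.inv h0).const_mul (-(1 / a))).congr_deriv ?_
    field_simp
  have hl : Filter.Tendsto (fun τ : ℝ => -(1 / a) * (1 + a * τ)⁻¹) Filter.atTop (nhds 0) := by
    have : Filter.Tendsto (fun τ : ℝ => 1 + a * τ) Filter.atTop Filter.atTop :=
      Filter.tendsto_atTop_add_const_left _ _ (Filter.tendsto_id.const_mul_atTop ha)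
    simpa using this.inv_tendsto_atTop.const_mul (-(1 / a))
  have hp : ∀ τ ∈ Set.Ioi (0 : ℝ), 0 ≤ 1 / (1 + a * τ) ^ 2 := fun τ _ => by positivity
  refine ⟨integrableOn_Ioi_deriv_of_nonneg' hd hp hl, ?_⟩
  rw [integral_Ioi_of_hasDerivAt_of_nonneg' hd hp hl]
  simp

def dot (a b : ℂ) : ℝ := a.re * b.re + a.im * b.im

theorem dot_add_left (a b c : ℂ) : dot (a + b) c = dot a c + dot b c := by simp [dot]; ring

theorem dot_sub_left (a b c : ℂ) : dot (a - b) c = dot a c - dot b c := by simp [dot]; ring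

theorem dot_neg_left (a c : ℂ) : dot (-a) c = -dot a c := by simp [dot]; ring

theorem dot_mul_left (r : ℝ) (a c : ℂ) : dot (r * a) c = r * dot a c := by simp [dot]; ring

theorem dot_self {u : ℂ} (hu : ‖u‖ = 1) : dot u u = 1 := by
  have := re_sq_add_im_sq hu
  simp only [dot]; linarith

theorem dot_sum_left {ι : Type*} (s : Finset ι) (f : ι → ℂ) (u : ℂ) :
    dot (∑ i ∈ s, f i) u = ∑ i ∈ s, dot (f i) u := by
  simp [dot, Finset.sum_mul, Finset.sum_add_distrib]

theorem rayFree_of_dot {S : Finset ℂ} {u d : ℂ} (hd : dot d u < 0) (hS : ∀ s ∈ S, 0 ≤ dot s u) :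
    RayFree S d := by
  refine ⟨fun h => by simp [h, dot] at hd, fun τ hτ hs => ?_⟩
  have := hS _ hs
  rw [dot_mul_left] at this
  nlinarith

namespace RayDecay

theorem rayIntegral_eq_of_dot {h : ℂ → ℂ} {S : Finset ℂ} (hh : RayDecay h S) {u d d' : ℂ}
    (hd : dot d u < 0) (hd' : dot d' u < 0) (hS : ∀ s ∈ S, 0 ≤ dot s u) :
    rayIntegral h d = rayIntegral h d' := by
  refine hh.rayIntegral_eq_segment fun s h0 h1 => rayFree_of_dot ?_ hS
  rw [dot_add_left, dot_mul_left, dot_sub_left]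
  rcases h0.eq_or_lt with rfl | h0
  · linarith
  · have e : dot d u + s * (dot d' u - dot d u) = (1 - s) * dot d u + s * dot d' u := by ring
    rw [e]
    have h2 := mul_nonpos_of_nonneg_of_nonpos (sub_nonneg.2 h1) hd.le
    have h3 := mul_neg_of_pos_of_neg h0 hd'
    linarith

end RayDecay

theorem norm_sub_sq_on_ray {e u : ℂ} (he : ‖e‖ = 1) (hu : ‖u‖ = 1) (τ : ℝ) :
    ‖τ * -u - e‖ ^ 2 = 1 + τ ^ 2 + 2 * τ * dot e u := by
  rw [Complex.sq_norm, Complex.normSq_apply]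
  simp only [Complex.sub_re, Complex.sub_im, Complex.re_ofReal_mul, Complex.im_ofReal_mul,
    Complex.neg_re, Complex.neg_im, dot]
  linear_combination τ ^ 2 * re_sq_add_im_sq hu + re_sq_add_im_sq he

/-- Bernoulli's inequality for (1 + s/r)^m trades the high power for a rational bound that can be
integrated explicitly. It is used with r = 1 + τ² and s = ετ. -/
theorem pow_div_pow_le {r s : ℝ} (hr : 0 < r) (hs : 0 ≤ s) {m q : ℕ} (hq : 4 * m ≤ q) :
    r ^ q / (r + s) ^ (q + 2) ≤ (r / (r + m * s) ^ 2) ^ 2 := by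
  have hrs : 0 < r + s := by linarith
  have hms : 0 < r + m * s := by positivity
  have h1 : (r + m * s) / r ≤ ((r + s) / r) ^ m := by
    have := one_add_mul_le_pow (a := s / r) (by have : 0 ≤ s / r := by positivity
                                                linarith) m
    rw [add_div, div_self hr.ne', mul_div_assoc, add_div, div_self hr.ne']
    exact this
  have h2 : ((r + m * s) / r) ^ 4 ≤ ((r + s) / r) ^ (4 * m) := by
    rw [mul_comm 4 m, pow_mul]
    exact pow_le_pow_left₀ (by positivity) h1 4
  have h3 : (r / (r + s)) ^ (4 * m) ≤ (r / (r + m * s)) ^ 4 := by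
    rw [← inv_div, ← inv_div (r + m * s), inv_pow, inv_pow]
    exact inv_anti₀ (by positivity) h2
  have h4 : (r / (r + s)) ^ q ≤ (r / (r + s)) ^ (4 * m) :=
    pow_le_pow_of_le_one (by positivity) ((div_le_one hrs).2 (by linarith)) hq
  have h5 : 1 / (r + s) ^ 2 ≤ 1 / r ^ 2 :=
    one_div_le_one_div_of_le (by positivity) (pow_le_pow_left₀ hr.le (by linarith) 2)
  calc r ^ q / (r + s) ^ (q + 2) = (r / (r + s)) ^ q * (1 / (r + s) ^ 2) := by
        rw [pow_add, div_pow]; field_simp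
    _ ≤ (r / (r + m * s)) ^ 4 * (1 / r ^ 2) :=
        mul_le_mul (h4.trans h3) h5 (by positivity) (by positivity)
    _ = (r / (r + m * s) ^ 2) ^ 2 := by field_simp

/-- The product (1 + aτ)(1 + τ/a) equals 1 + τ² + (a + 1/a)τ. Splitting the numerator separates the
mass near τ = 0 from the mass near infinity. -/
theorem le_two_terms {a τ A : ℝ} (ha : 0 < a) (hτ : 0 ≤ τ) (hA : a + 1 / a ≤ A) :
    (1 + τ ^ 2) / (1 + τ ^ 2 + A * τ) ^ 2 ≤
      1 / (1 + a * τ) ^ 2 + 1 / a ^ 2 * (1 / (1 + 1 / a * τ) ^ 2) := by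
  have h1 : (1 + a * τ) * (1 + 1 / a * τ) ≤ 1 + τ ^ 2 + A * τ := by
    have e : (1 + a * τ) * (1 + 1 / a * τ) = 1 + τ ^ 2 + (a + 1 / a) * τ := by
      field_simp; ring
    rw [e]
    have := mul_le_mul_of_nonneg_right hA hτ
    linarith
  have p1 : 0 < 1 + a * τ := by positivity
  have p2 : 1 ≤ 1 + 1 / a * τ := by
    have : 0 ≤ 1 / a * τ := by positivity
    linarith
  have p2' : 0 < 1 + 1 / a * τ := by linarith
  have h2 : (1 + τ ^ 2) / (1 + τ ^ 2 + A * τ) ^ 2 ≤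
      (1 + τ ^ 2) / ((1 + a * τ) * (1 + 1 / a * τ)) ^ 2 :=
    div_le_div_of_nonneg_left (by positivity) (by positivity) (pow_le_pow_left₀ (by positivity) h1 2)
  refine h2.trans ?_
  rw [add_div]
  refine add_le_add ?_ ?_
  · refine one_div_le_one_div_of_le (by positivity) ?_
    rw [mul_pow]
    have := one_le_pow₀ p2 (n := 2)
    nlinarith [sq_nonneg (1 + a * τ)]
  · rw [mul_pow, div_mul_div_comm, one_mul, div_le_div_iff₀ (by positivity) (by positivity)]
    have h3 : (a * τ) ^ 2 ≤ (1 + a * τ) ^ 2 := pow_le_pow_left₀ (by positivity) (by linarith) 2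
    have h4 := mul_le_mul_of_nonneg_right h3 (sq_nonneg (1 + 1 / a * τ))
    linarith

namespace IsoradialGraph

variable {G : IsoradialGraph}

/-- The half-plane containing the poles also contains the direction from `x` to `y`. -/
theorem exists_poles_half_plane {ε : ℝ} (hε : 0 < ε) (hG : ∀ t ∈ G.tiles, 2 * ε ≤ t.sine)
    {x y : ℂ} (hx : x ∈ G.vertex) (hy : y ∈ G.vertex) (hxy : x ≠ y) :
    ∃ u : ℂ, ‖u‖ = 1 ∧ dot (x - y) u < 0 ∧ ∀ e, (0 < G.divisor x y e → ε / 2 ≤ dot e u) ∧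
      (G.divisor x y e < 0 → dot e u ≤ -(ε / 2)) := by
  obtain ⟨u, hu, h⟩ := exists_divisor_half_plane hε hG hx hy
  refine ⟨u, hu, ?_, h⟩
  have h1 := divisor_sum_mul hx hy
  -- The vector y - x is the sum of the terms n e, and each of them has a positive u-component,
  -- whether it comes from a pole or from a zero.
  have hpos : ∀ e ∈ (G.divisor x y).support, 0 < (G.divisor x y e : ℝ) * dot e u := by
    intro e he
    rcases lt_or_gt_of_ne (Finsupp.mem_support_iff.1 he) with hlt | hgt
    · have h2 := (h e).2 hlt
      have h3 : (G.divisor x y e : ℝ) < 0 := by exact_mod_cast hlt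
      change dot e u ≤ _ at h2
      exact mul_pos_of_neg_of_neg h3 (by linarith)
    · have h2 := (h e).1 hgt
      have h3 : (0 : ℝ) < G.divisor x y e := by exact_mod_cast hgt
      change _ ≤ dot e u at h2
      exact mul_pos h3 (by linarith)
  have hne : (G.divisor x y).support.Nonempty := by
    rw [Finset.nonempty_iff_ne_empty]
    intro h0
    rw [Finsupp.sum, h0, Finset.sum_empty] at h1
    exact hxy (sub_eq_zero.1 h1.symm).symm
  have h2 := Finset.sum_pos hpos hne
  rw [← neg_sub, dot_neg_left, ← h1, Finsupp.sum, dot_sum_left]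
  have h3 : ∀ e, dot ((G.divisor x y e : ℂ) * e) u = (G.divisor x y e : ℝ) * dot e u := fun e => by
    rw [← dot_mul_left]; simp
  simp only [h3]
  linarith

/-- The candidate for the inverse of `dbar`. -/
noncomputable def cauchyKernel (G : IsoradialGraph) (w b : ℂ) : ℂ :=
  1 / (2 * Real.pi) * rayIntegral (G.dexp w b) (w - b)

/-- On the ray opposite to u, |z - e|² = 1 + τ² + 2τ⟨e, u⟩. This is at least 1 + τ² + ετ at poles
and at most 1 + τ² at zeros. -/
theorem norm_dexp_sq_le {ε : ℝ} (hε : 0 < ε) {x y u : ℂ} (hu : ‖u‖ = 1)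
    (h : ∀ e, (0 < G.divisor x y e → ε / 2 ≤ dot e u) ∧
      (G.divisor x y e < 0 → dot e u ≤ -(ε / 2))) {τ : ℝ} (hτ : 0 < τ) :
    ‖G.dexp x y (τ * -u)‖ ^ 2 ≤
      (1 + τ ^ 2) ^ (∑ e ∈ (G.divisor x y).support, (-G.divisor x y e).toNat) /
      (1 + τ ^ 2 + ε * τ) ^ (∑ e ∈ (G.divisor x y).support, (G.divisor x y e).toNat) := by
  rw [dexp, Finsupp.prod, norm_prod, ← Finset.prod_pow, ← Finset.prod_pow_eq_pow_sum,
    ← Finset.prod_pow_eq_pow_sum, ← Finset.prod_div_distrib]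
  refine Finset.prod_le_prod (fun _ _ => by positivity) fun e he => ?_
  have hne := Finsupp.mem_support_iff.1 he
  have hX := norm_sub_sq_on_ray (norm_of_divisor_ne hne) hu τ
  rw [norm_zpow, ← zpow_natCast, zpow_comm, zpow_natCast, hX]
  rcases lt_or_gt_of_ne hne with hlt | hgt
  · have h2 := (h e).2 hlt
    have e1 : (G.divisor x y e).toNat = 0 := Int.toNat_eq_zero.2 hlt.le
    have e2 : -G.divisor x y e = (-G.divisor x y e).toNat := (Int.toNat_of_nonneg (by omega)).symm
    rw [e1, pow_zero, div_one, e2, zpow_natCast, Int.toNat_natCast]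
    refine pow_le_pow_left₀ ?_ ?_ _
    · rw [← hX]; positivity
    · have := mul_nonneg hτ.le (by linarith : 0 ≤ -dot e u)
      linarith
  · have h2 := (h e).1 hgt
    have e1 : (-G.divisor x y e).toNat = 0 := Int.toNat_eq_zero.2 (by omega)
    have e2 : G.divisor x y e = (G.divisor x y e).toNat := (Int.toNat_of_nonneg (by omega)).symm
    rw [e1, pow_zero, zpow_neg, e2, zpow_natCast, Int.toNat_natCast, one_div]
    refine inv_anti₀ (by positivity) (pow_le_pow_left₀ (by positivity) ?_ _)
    have := mul_le_mul_of_nonneg_left h2 hτ.le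
    linarith

/-- There are two more poles than zeros, and y - x is a sum of as many unit vectors as there are
zeros and poles. So the number of factors grows linearly with the distance. -/
theorem divisor_total {x y : ℂ} (hx : x ∈ G.vertex) (hy : y ∈ G.vertex)
    (hd : G.deg y = G.deg x + 2) :
    ∑ e ∈ (G.divisor x y).support, (G.divisor x y e).toNat =
      ∑ e ∈ (G.divisor x y).support, (-G.divisor x y e).toNat + 2 ∧
    ‖y - x‖ ≤ 2 * ((∑ e ∈ (G.divisor x y).support, (-G.divisor x y e).toNat : ℕ) : ℝ) + 2 := by
  have h1 := divisor_sum hx hy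
  rw [hd, add_sub_cancel_left, Finsupp.sum] at h1
  have h2 : ∑ e ∈ (G.divisor x y).support, (G.divisor x y e).toNat =
      ∑ e ∈ (G.divisor x y).support, (-G.divisor x y e).toNat + 2 := by
    have : ((∑ e ∈ (G.divisor x y).support, (G.divisor x y e).toNat : ℕ) : ℤ) -
        ((∑ e ∈ (G.divisor x y).support, (-G.divisor x y e).toNat : ℕ) : ℤ) = 2 := by
      rw [← h1]
      push_cast
      rw [← Finset.sum_sub_distrib]
      exact Finset.sum_congr rfl fun e _ => Int.toNat_sub_toNat_neg _
    omega
  refine ⟨h2, ?_⟩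
  have h3 : ‖y - x‖ ≤ ((∑ e ∈ (G.divisor x y).support, (G.divisor x y e).toNat : ℕ) : ℝ) +
      ((∑ e ∈ (G.divisor x y).support, (-G.divisor x y e).toNat : ℕ) : ℝ) := by
    rw [← divisor_sum_mul hx hy, Finsupp.sum]
    refine (norm_sum_le _ _).trans ?_
    push_cast
    rw [← Finset.sum_add_distrib]
    refine Finset.sum_le_sum fun e he => ?_
    rw [norm_mul, norm_of_divisor_ne (Finsupp.mem_support_iff.1 he), mul_one, Complex.norm_intCast]
    have h4 : |G.divisor x y e| = (G.divisor x y e).toNat + (-G.divisor x y e).toNat := by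
      rcases le_total 0 (G.divisor x y e) with h | h
      · rw [abs_of_nonneg h]; omega
      · rw [abs_of_nonpos h]; omega
    have h5 : (|G.divisor x y e| : ℝ) = ((|G.divisor x y e| : ℤ) : ℝ) := by push_cast; rfl
    rw [h5, h4]; push_cast; rfl
  rw [h2] at h3
  push_cast at h3 ⊢
  linarith

open MeasureTheory in
-- The ray is turned to -u, away from all poles. The many factors make the integrand small except
-- near 0 and infinity, and both ends contribute O(1/|y - x|).
theorem norm_cauchyKernel_le {ε : ℝ} (hε : 0 < ε) (hG : ∀ t ∈ G.tiles, 2 * ε ≤ t.sine)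
    {x y : ℂ} (hx : x ∈ G.vertex) (hy : y ∈ G.vertex) (hd : G.deg y = G.deg x + 2)
    (h20 : 20 ≤ ‖y - x‖) (h32 : 32 / ε ≤ ‖y - x‖) :
    ‖G.cauchyKernel x y‖ ≤ 64 / ε / ‖y - x‖ := by
  have hxy : x ≠ y := by
    rintro rfl
    rw [sub_self, norm_zero] at h20
    norm_num at h20
  obtain ⟨u, hu, h1, h2⟩ := exists_poles_half_plane hε hG hx hy hxy
  have hS : ∀ s ∈ G.poles x y, 0 ≤ dot s u := fun s hs => by
    have := (h2 s).1 (mem_poles.1 hs)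
    linarith
  have hu0 : dot (-u) u < 0 := by rw [dot_neg_left, dot_self hu]; norm_num
  have hdec := rayDecay_dexp hx hy hd
  obtain ⟨t1, t2⟩ := divisor_total hx hy hd
  have hb := fun τ hτ => norm_dexp_sq_le hε hu h2 (τ := τ) hτ
  rw [t1] at hb
  set q := ∑ e ∈ (G.divisor x y).support, (-G.divisor x y e).toNat with hq
  set m := q / 4 with hm
  have hm1 : 4 * m ≤ q := Nat.mul_div_le q 4
  have hm2 : (q : ℝ) ≤ 4 * m + 3 := by
    have : q ≤ 4 * m + 3 := by omega
    exact_mod_cast this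
  have hmN : ‖y - x‖ / 16 ≤ m := by linarith
  -- Chosen with a ≥ 1, so that a + 1/a ≤ 2a = mε, the coefficient produced by `pow_div_pow_le`.
  set a := m * ε / 2 with ha
  have ha1 : ‖y - x‖ * ε / 32 ≤ a := by
    have := mul_le_mul_of_nonneg_right hmN hε.le
    rw [ha]; linarith
  have ha2 : 1 ≤ a := by
    have := mul_le_mul_of_nonneg_right h32 hε.le
    rw [div_mul_cancel₀ _ hε.ne'] at this
    linarith
  have ha0 : 0 < a := by linarith
  have hA : a + 1 / a ≤ m * ε := by
    have : 1 / a ≤ a := by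
      rw [div_le_iff₀ ha0]; nlinarith
    linarith
  obtain ⟨i1, i2⟩ := integral_one_div_one_add_mul_sq ha0
  obtain ⟨i3, i4⟩ := integral_one_div_one_add_mul_sq (a := 1 / a) (by positivity)
  have bound : ‖rayIntegral (G.dexp x y) (-u)‖ ≤ ∫ τ in Set.Ioi (0 : ℝ),
      (1 / (1 + a * τ) ^ 2 + 1 / a ^ 2 * (1 / (1 + 1 / a * τ) ^ 2)) := by
    refine norm_integral_le_of_norm_le (i1.add (i3.const_mul _)) ?_
    filter_upwards [ae_restrict_mem measurableSet_Ioi] with τ hτ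
    have hτ' : (0 : ℝ) < τ := hτ
    rw [norm_mul, norm_neg, hu, mul_one]
    refine le_trans ?_ (le_two_terms ha0 hτ'.le hA)
    have h3 := (hb τ hτ).trans (pow_div_pow_le (by positivity) (by positivity) hm1)
    rw [mul_assoc (m : ℝ) ε τ]
    exact le_of_sq_le_sq h3 (by positivity)
  rw [integral_add i1 (i3.const_mul _), integral_const_mul, i2, i4] at bound
  have e1 : 1 / a + 1 / a ^ 2 * (1 / (1 / a)) = 2 / a := by field_simp; norm_num
  rw [e1] at bound
  rw [cauchyKernel, hdec.rayIntegral_eq_of_dot h1 hu0 hS, norm_mul]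
  have hπ : ‖(1 / (2 * Real.pi) : ℂ)‖ ≤ 1 := by
    have h3 := Real.pi_gt_three
    rw [norm_div, norm_one, norm_mul, Complex.norm_real, Real.norm_of_nonneg Real.pi_pos.le]
    rw [div_le_one (by simp; positivity)]
    simp; linarith
  have hN : 0 < ‖y - x‖ := by linarith
  calc ‖(1 / (2 * Real.pi) : ℂ)‖ * ‖rayIntegral (G.dexp x y) (-u)‖ ≤ 1 * (2 / a) :=
        mul_le_mul hπ bound (norm_nonneg _) zero_le_one
    _ ≤ 64 / ε / ‖y - x‖ := by
        rw [one_mul, div_div, div_le_div_iff₀ ha0 (by positivity)]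
        linarith

end IsoradialGraph

/-! ### The candidate is a left inverse. -/

/-- The entry of the discrete operator at the edge of the tile. -/
noncomputable def Rhombus.weight (t : Rhombus) : ℂ := Complex.I * (t.el - t.er)

namespace IsoradialGraph

variable {G : IsoradialGraph}

theorem dbar_tile {t : Rhombus} (ht : t ∈ G.tiles) (hb : t.b ∈ G.black) (hw : t.w ∈ G.white) :
    G.dbar ⟨t.b, hb⟩ ⟨t.w, hw⟩ = t.weight := by
  have h : ∃ t' ∈ G.tiles, t'.b = t.b ∧ t'.w = t.w := ⟨t, ht, rfl, rfl⟩
  rw [dbar, dif_pos h]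
  have : h.choose = t := tile_eq_of_edge h.choose_spec.1 ht h.choose_spec.2.2 h.choose_spec.2.1
  rw [this]; rfl

theorem deg_black_white {t : Rhombus} (ht : t ∈ G.tiles) {w : ℂ} (hw : w ∈ G.white) :
    G.deg t.b = G.deg w + 2 := by
  rw [deg_black ⟨t, ht, rfl⟩, deg_white hw]; rfl

theorem white_vertex {w : ℂ} (hw : w ∈ G.white) : w ∈ G.vertex := by
  obtain ⟨t, ht, rfl⟩ := hw; exact white_mem ht

theorem black_vertex {b : ℂ} (hb : b ∈ G.black) : b ∈ G.vertex := by
  obtain ⟨t, ht, rfl⟩ := hb; exact black_mem ht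

theorem face_vertex {f : ℂ} (hf : f ∈ G.face) : f ∈ G.vertex := by
  obtain ⟨t, ht, rfl | rfl⟩ := hf <;> exact ⟨t, ht, by simp [Rhombus.corners]⟩

/-- Discrete holomorphicity: stepping back from b to the left or right corner multiplies by z -
`t.er` or z - `t.el`, and the difference of these factors is `t.el` - `t.er`. -/
theorem weight_mul_dexp {v : ℂ} (hv : v ∈ G.vertex) {t : Rhombus} (ht : t ∈ G.tiles) {z : ℂ}
    (hz : ‖z‖ ≠ 1) : t.weight * G.dexp v t.b z =
      Complex.I * (G.dexp v (t.w + t.el) z - G.dexp v (t.w + t.er) z) := by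
  have a1 : G.Arrow (t.w + t.el) t.b := ⟨t, ht, Or.inr ⟨Or.inr t.l_eq.symm, rfl⟩⟩
  have a2 : G.Arrow (t.w + t.er) t.b := ⟨t, ht, Or.inr ⟨Or.inl t.r_eq.symm, rfl⟩⟩
  have hne : ∀ e : ℂ, ‖e‖ = 1 → z - e ≠ 0 := fun e he h => hz ((sub_eq_zero.1 h) ▸ he)
  have h1 := hne _ t.norm_er
  have h2 := hne _ t.norm_el
  have e1 : G.dexp v (t.w + t.el) z = G.dexp v t.b z * (z - t.er) := by
    rw [← dexp_mul hv a1.left_mem a1.right_mem hz, a1.dexp,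
      show t.b - (t.w + t.el) = t.er by rw [t.b_eq]; ring]
    field_simp
  have e2 : G.dexp v (t.w + t.er) z = G.dexp v t.b z * (z - t.el) := by
    rw [← dexp_mul hv a2.left_mem a2.right_mem hz, a2.dexp,
      show t.b - (t.w + t.er) = t.el by rw [t.b_eq]; ring]
    field_simp
  rw [e1, e2, Rhombus.weight]; ring

theorem star_fan {v w : ℂ} (hv : v ∈ G.vertex) (hw : w ∈ G.white) {α β : ℝ} (hαβ : α < β)
    (hβ : β ≤ α + 2 * Real.pi) (ha : G.Arrow w (w + Complex.exp (α * Complex.I)))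
    (hb : G.Arrow w (w + Complex.exp (β * Complex.I))) {z : ℂ} (hz : ‖z‖ ≠ 1) :
    ∑ t ∈ G.fan w α β, t.weight * G.dexp v t.b z =
      Complex.I * (G.dexp v (w + Complex.exp (β * Complex.I)) z -
        G.dexp v (w + Complex.exp (α * Complex.I)) z) := by
  obtain ⟨a, c, hac, hF⟩ := exists_fan_lifts hw hαβ hβ ha hb
  have := hF (fun x => Complex.I * G.dexp v (w + Complex.exp (x * Complex.I)) z)
  rw [mul_sub, ← this]
  refine Finset.sum_congr rfl fun t ht => ?_
  have h1 := mem_fan.1 ht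
  have h2 := hac t ht
  rw [weight_mul_dexp hv h1.1 hz, h1.2.1, h2.1, h2.2.1]; ring

section

variable {ε : ℝ} (hε : 0 < ε) (hG : ∀ t ∈ G.tiles, 2 * ε ≤ t.sine)
include hε hG

/-- The rays towards a point from the points of an edge. -/
theorem rayFree_edge {S : Finset ℂ} {x : ℂ} {t : Rhombus} (ht : t ∈ G.tiles) (hx : x ∈ G.vertex)
    (hS : ∀ e ∈ S, ∃ v ∈ G.vertex, (v = x ∨ G.Arrow v x) ∧ v ≠ t.w ∧ e ∈ G.poles v t.b)
    (hxw : x ≠ t.w) (hxb : x ≠ t.b) {s : ℝ} (h0 : 0 ≤ s) (h1 : s ≤ 1) :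
    RayFree S (x - (t.w + s * (t.er + t.el))) := by
  have hco : t.coA (t.w + s * (t.er + t.el) - t.w) = s ∧
      t.coB (t.w + s * (t.er + t.el) - t.w) = s := by
    rw [add_sub_cancel_left, t.coA_mul, t.coB_mul, map_add, map_add]; simp
  refine ⟨fun h => ?_, fun τ hτ hs => ?_⟩
  · rw [sub_eq_zero] at h
    have hmem : x ∈ t.carrier := by
      rw [t.mem_carrier, h, hco.1, hco.2]; exact ⟨⟨h0, h1⟩, ⟨h0, h1⟩⟩
    have hc := Rhombus.corner_co (mem_corners_of_vertex hx ht hmem)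
    rw [h, hco.1] at hc
    rcases hc.1 with hs | hs
    · rw [hs] at h; apply hxw; simpa using h
    · rw [hs] at h; apply hxb; rw [h, t.b_eq]; push_cast; ring
  · obtain ⟨v, hv, hvx, hvw, he⟩ := hS _ hs
    refine ray_ne hε hG hv hvx ht hvw (mem_poles.1 he) h0 h1 (inv_pos.2 hτ) ?_
    have : (τ : ℂ) ≠ 0 := by exact_mod_cast hτ.ne'
    push_cast
    field_simp
    ring

/-- As the base point slides along the edge from w to b, the ray towards x meets no pole
(`rayFree_edge`). This brings the integrals for all edges at w to one common ray, where the symbols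
telescope. -/
theorem rayIntegral_edge_move {h : ℂ → ℂ} {S : Finset ℂ} (hh : RayDecay h S) {x : ℂ} {t : Rhombus}
    (ht : t ∈ G.tiles) (hx : x ∈ G.vertex)
    (hS : ∀ e ∈ S, ∃ v ∈ G.vertex, (v = x ∨ G.Arrow v x) ∧ v ≠ t.w ∧ e ∈ G.poles v t.b)
    (hxw : x ≠ t.w) (hxb : x ≠ t.b) :
    rayIntegral h (x - t.b) = rayIntegral h (x - t.w) ∧ RayFree S (x - t.w) := by
  have hf := fun s h0 h1 => rayFree_edge hε hG ht hx hS hxw hxb (s := s) h0 h1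
  refine ⟨(hh.rayIntegral_eq_segment fun s h0 h1 => ?_).symm, ?_⟩
  · have := hf s h0 h1
    rw [show x - (t.w + s * (t.er + t.el)) = x - t.w + s * (x - t.b - (x - t.w)) by
      rw [t.b_eq]; ring] at this
    exact this
  · simpa using hf 0 le_rfl zero_le_one

omit hε hG in
theorem sum_fan_rayIntegral {w d : ℂ} {α β : ℝ} {h : Rhombus → ℂ → ℂ} {k : ℂ → ℂ}
    (hh : ∀ t ∈ G.fan w α β, ∃ S, RayDecay (h t) S ∧ RayFree S d)
    (hk : ∀ z, ‖z‖ ≠ 1 → ∑ t ∈ G.fan w α β, t.weight * h t z = k z) :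
    ∑ t ∈ G.fan w α β, t.weight * rayIntegral (h t) d = rayIntegral k d := by
  rw [← rayIntegral_congr hk, RayDecay.rayIntegral_sum (f := fun t z => t.weight * h t z)]
  · exact Finset.sum_congr rfl fun t _ => (rayIntegral_const_mul _ _ _).symm
  · intro t ht
    obtain ⟨S, h1, h2⟩ := hh t ht
    exact ⟨S, h1.const_mul _, h2⟩

theorem sum_fan_dexp {x w : ℂ} (hx : x ∈ G.white) (hw : w ∈ G.white) (hxw : x ≠ w) {α β : ℝ}
    (hαβ : α < β) (hβ : β ≤ α + 2 * Real.pi) (ha : G.Arrow w (w + Complex.exp (α * Complex.I)))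
    (hb : G.Arrow w (w + Complex.exp (β * Complex.I))) :
    ∑ t ∈ G.fan w α β, t.weight * rayIntegral (G.dexp x t.b) (x - t.b) =
      rayIntegral (fun z => Complex.I * (G.dexp x (w + Complex.exp (β * Complex.I)) z -
        G.dexp x (w + Complex.exp (α * Complex.I)) z)) (x - w) := by
  have hxv := white_vertex hx
  have key : ∀ t ∈ G.fan w α β, RayDecay (G.dexp x t.b) (G.poles x t.b) ∧
      rayIntegral (G.dexp x t.b) (x - t.b) = rayIntegral (G.dexp x t.b) (x - w) ∧
        RayFree (G.poles x t.b) (x - w) := by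
    intro t ht
    obtain ⟨ht', rfl, -⟩ := mem_fan.1 ht
    have h1 := rayDecay_dexp hxv (black_mem ht') (deg_black_white ht' hx)
    refine ⟨h1, rayIntegral_edge_move hε hG h1 ht' hxv
      (fun e he => ⟨x, hxv, Or.inl rfl, hxw, he⟩) hxw ?_⟩
    rintro rfl
    exact white_not_black hx ⟨t, ht', rfl⟩
  rw [← sum_fan_rayIntegral (h := fun t => G.dexp x t.b)
    (fun t ht => ⟨_, (key t ht).1, (key t ht).2.2⟩) fun z hz => star_fan hxv hw hαβ hβ ha hb hz]
  exact Finset.sum_congr rfl fun t ht => by rw [(key t ht).2.1]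

end

/-- The ray bisecting the complement of the angle of a tile at its white vertex. -/
theorem rayIntegral_white_corner {t : Rhombus} {a c : ℝ}
    (ha : t.er = Complex.exp (a * Complex.I)) (hc : t.el = Complex.exp (c * Complex.I))
    (hac : a < c) (hca : c < a + Real.pi) (h : ℂ → ℂ) :
    rayIntegral h (t.w - t.b) = rayIntegral h (Complex.exp (((a + c) / 2 + Real.pi : ℝ) * Complex.I)) := by
  have hcos : 0 < Real.cos ((c - a) / 2) := Real.cos_pos_of_mem_Ioo ⟨by linarith, by linarith⟩
  have e : t.w - t.b = ((2 * Real.cos ((c - a) / 2) : ℝ) : ℂ) *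
      Complex.exp (((a + c) / 2 + Real.pi : ℝ) * Complex.I) := by
    rw [Complex.ofReal_add, add_mul, Complex.exp_add, Complex.exp_pi_mul_I, ← mul_assoc,
      ← exp_add_exp, ← ha, ← hc, t.b_eq]
    ring
  rw [e, rayIntegral_scale _ _ (by positivity)]

/-- The weighted symbol is the difference of two simple poles at the sides, and its integral is the
angle of the tile at w. These angles add up over a fan, to 2π for the full one. -/
theorem weight_mul_rayIntegral {t : Rhombus} (ht : t ∈ G.tiles) {a c : ℝ}
    (ha : t.er = Complex.exp (a * Complex.I)) (hc : t.el = Complex.exp (c * Complex.I))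
    (hac : a < c) (hca : c < a + Real.pi) :
    t.weight * rayIntegral (G.dexp t.w t.b) (t.w - t.b) = c - a := by
  rw [rayIntegral_white_corner ha hc hac hca, ← rayIntegral_const_mul,
    ← rayIntegral_pole_sub (a := a) (c := c) (ψ := (a + c) / 2 + Real.pi)
      ⟨by linarith, by linarith⟩ ⟨by linarith, by linarith⟩]
  refine rayIntegral_congr fun z hz => ?_
  rw [weight_mul_dexp (white_mem ht) ht hz, (fan_arrow ht).1.dexp, (fan_arrow ht).2.dexp,
    add_sub_cancel_left, add_sub_cancel_left, ha, hc]

theorem sum_fan_dexp_self {w : ℂ} (hw : w ∈ G.white) {α β : ℝ}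
    (hαβ : α < β) (hβ : β ≤ α + 2 * Real.pi) (ha : G.Arrow w (w + Complex.exp (α * Complex.I)))
    (hb : G.Arrow w (w + Complex.exp (β * Complex.I))) :
    ∑ t ∈ G.fan w α β, t.weight * rayIntegral (G.dexp w t.b) (w - t.b) = β - α := by
  obtain ⟨a, c, hac, hF⟩ := exists_fan_lifts hw hαβ hβ ha hb
  rw [← hF (fun x => x)]
  refine Finset.sum_congr rfl fun t ht => ?_
  obtain ⟨h1, rfl, -⟩ := mem_fan.1 ht
  have h2 := hac t ht
  exact weight_mul_rayIntegral h1 h2.1 h2.2.1 h2.2.2.2.1 h2.2.2.2.2.1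

theorem exists_full_fan {w : ℂ} (hw : w ∈ G.white) :
    ∃ α : ℝ, G.Arrow w (w + Complex.exp (α * Complex.I)) ∧
      G.Arrow w (w + Complex.exp ((α + 2 * Real.pi : ℝ) * Complex.I)) ∧
      ∀ t ∈ G.tiles, t.w = w → t ∈ G.fan w α (α + 2 * Real.pi) := by
  obtain ⟨t, ht, rfl⟩ := hw
  obtain ⟨α, -, -, h⟩ := exists_lift t.norm_er 0
  have h1 := (fan_arrow ht).1
  have h2 : Complex.exp ((α + 2 * Real.pi : ℝ) * Complex.I) = t.er := by
    rw [h]; push_cast; rw [add_mul, Complex.exp_add, Complex.exp_two_pi_mul_I, mul_one]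
  refine ⟨α, h ▸ h1, h2 ▸ h1, fun t' ht' hw => ?_⟩
  rw [← hw] at h1 ⊢
  rcases mem_fan_or ht' (α := α) (β := α + 2 * Real.pi) (h ▸ h1) (h2 ▸ h1) with h3 | h3
  · exact h3
  · obtain ⟨-, -, a, c, hac, -, -, k1, k2⟩ := mem_fan.1 h3
    linarith

/-- The candidate is a left inverse of the discrete operator. -/
theorem sum_cauchyKernel_mul_weight {ε : ℝ} (hε : 0 < ε) (hG : ∀ t ∈ G.tiles, 2 * ε ≤ t.sine)
    {x w : ℂ} (hx : x ∈ G.white) (hw : w ∈ G.white) {T : Finset Rhombus}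
    (hT : ∀ t, t ∈ T ↔ t ∈ G.tiles ∧ t.w = w) :
    ∑ t ∈ T, t.weight * G.cauchyKernel x t.b = if x = w then 1 else 0 := by
  obtain ⟨α, h1, h2, h3⟩ := exists_full_fan hw
  have hTf : T = G.fan w α (α + 2 * Real.pi) := by
    ext t
    rw [hT]
    exact ⟨fun h => h3 t h.1 h.2, fun h => ⟨(mem_fan.1 h).1, (mem_fan.1 h).2.1⟩⟩
  have hπ := Real.pi_pos
  have h4 : α < α + 2 * Real.pi := by linarith
  simp only [cauchyKernel, mul_left_comm _ (1 / (2 * (Real.pi : ℂ)))]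
  rw [← Finset.mul_sum, hTf]
  have hπ' : (Real.pi : ℂ) ≠ 0 := by exact_mod_cast hπ.ne'
  split_ifs with hxw
  · subst hxw
    rw [sum_fan_dexp_self hx h4 le_rfl h1 h2]
    push_cast
    field_simp
    ring
  · rw [sum_fan_dexp hε hG hx hw hxw h4 le_rfl h1 h2]
    have : Complex.exp ((α + 2 * Real.pi : ℝ) * Complex.I) = Complex.exp (α * Complex.I) := by
      push_cast; rw [add_mul, Complex.exp_add, Complex.exp_two_pi_mul_I, mul_one]
    rw [this]
    simp [rayIntegral]

end IsoradialGraph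

/-! ### Exchange of the colours, the right inverse and fans at black vertices. -/

namespace Rhombus

/-- The rhombus with the two colours exchanged. -/
def swap (t : Rhombus) : Rhombus where
  w := t.b
  r := t.l
  l := t.r
  norm_r := by rw [← norm_neg, show -(t.l - t.b) = t.r - t.w by simp [b]; ring]; exact t.norm_r
  norm_l := by rw [← norm_neg, show -(t.r - t.b) = t.l - t.w by simp [b]; ring]; exact t.norm_l
  ccw := by
    have := t.ccw
    rw [show t.l - t.b = -(t.r - t.w) by simp [b]; ring,
      show t.r - t.b = -(t.l - t.w) by simp [b]; ring]
    rwa [map_neg, neg_mul_neg]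

@[simp] theorem swap_w (t : Rhombus) : t.swap.w = t.b := rfl
@[simp] theorem swap_r (t : Rhombus) : t.swap.r = t.l := rfl
@[simp] theorem swap_l (t : Rhombus) : t.swap.l = t.r := rfl
@[simp] theorem swap_b (t : Rhombus) : t.swap.b = t.w := by simp [b, swap]; ring
@[simp] theorem swap_swap (t : Rhombus) : t.swap.swap = t := by ext1 <;> simp
@[simp] theorem swap_er (t : Rhombus) : t.swap.er = -t.er := by simp [er, b]; ring
@[simp] theorem swap_el (t : Rhombus) : t.swap.el = -t.el := by simp [el, b]; ring
@[simp] theorem swap_weight (t : Rhombus) : t.swap.weight = -t.weight := by simp [weight]; ring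

theorem swap_injective : Function.Injective swap := fun t t' h => by
  rw [← t.swap_swap, h, t'.swap_swap]

theorem corners_swap (t : Rhombus) : t.swap.corners = t.corners := by
  ext x
  simp only [corners, swap_w, swap_r, swap_l, swap_b, Set.mem_insert_iff, Set.mem_singleton_iff]
  tauto

theorem carrier_swap (t : Rhombus) : t.swap.carrier = t.carrier := by
  rw [carrier, corners_swap, carrier]

theorem sine_swap (t : Rhombus) : t.swap.sine = t.sine := by
  simp [sine, cross_neg_left, cross_neg_right]

end Rhombus

namespace IsoradialGraph

/-- The graph with the two colours exchanged. -/
def swap (G : IsoradialGraph) : IsoradialGraph where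
  tiles := {t | t.swap ∈ G.tiles}
  cover z := by
    obtain ⟨t, ht, h⟩ := G.cover z
    exact ⟨t.swap, by simpa using ht, by rwa [t.carrier_swap]⟩
  interior_disjoint t ht t' ht' h := by
    rw [← t.carrier_swap, ← t'.carrier_swap]
    exact G.interior_disjoint _ ht _ ht' (Rhombus.swap_injective.ne h)
  edge_to_edge t ht t' ht' x hx hx' := by
    rw [← Rhombus.corners_swap] at hx ⊢
    rw [← Rhombus.carrier_swap] at hx'
    exact G.edge_to_edge _ ht _ ht' x hx hx'
  locally_finite R := by
    refine ((G.locally_finite R).image Rhombus.swap).subset ?_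
    rintro t ⟨ht, h⟩
    exact ⟨t.swap, ⟨ht, by rwa [t.carrier_swap]⟩, t.swap_swap⟩
  white_ne_black t ht t' ht' := by simpa using (G.white_ne_black _ ht' _ ht).symm
  white_ne_face t ht t' ht' := by simpa [and_comm] using G.black_ne_face _ ht _ ht'
  black_ne_face t ht t' ht' := by simpa [and_comm] using G.white_ne_face _ ht _ ht'

variable {G : IsoradialGraph}

theorem mem_swap_tiles {t : Rhombus} : t ∈ G.swap.tiles ↔ t.swap ∈ G.tiles := Iff.rfl

theorem swap_mem_swap_tiles {t : Rhombus} : t.swap ∈ G.swap.tiles ↔ t ∈ G.tiles := by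
  rw [mem_swap_tiles, t.swap_swap]

theorem mem_swap_white {x : ℂ} : x ∈ G.swap.white ↔ x ∈ G.black := by
  constructor
  · rintro ⟨t, ht, rfl⟩; exact ⟨t.swap, ht, by simp⟩
  · rintro ⟨t, ht, rfl⟩; exact ⟨t.swap, swap_mem_swap_tiles.2 ht, by simp⟩

theorem mem_swap_vertex {x : ℂ} : x ∈ G.swap.vertex ↔ x ∈ G.vertex := by
  constructor
  · rintro ⟨t, ht, h⟩; exact ⟨t.swap, ht, by rwa [t.corners_swap]⟩
  · rintro ⟨t, ht, h⟩; exact ⟨t.swap, swap_mem_swap_tiles.2 ht, by rwa [t.corners_swap]⟩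

theorem swap_arrow {x y : ℂ} : G.swap.Arrow x y ↔ G.Arrow y x := by
  constructor
  · rintro ⟨t, ht, ⟨rfl, h⟩ | ⟨h, rfl⟩⟩
    · exact ⟨t.swap, ht, Or.inr ⟨by simpa [or_comm] using h, by simp⟩⟩
    · exact ⟨t.swap, ht, Or.inl ⟨by simp, by simpa [or_comm] using h⟩⟩
  · rintro ⟨t, ht, ⟨rfl, h⟩ | ⟨h, rfl⟩⟩
    · exact ⟨t.swap, swap_mem_swap_tiles.2 ht, Or.inr ⟨by simpa [or_comm] using h, by simp⟩⟩
    · exact ⟨t.swap, swap_mem_swap_tiles.2 ht, Or.inl ⟨by simp, by simpa [or_comm] using h⟩⟩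

/-- Exchanging the colours reverses the arrows and negates the oriented sides. Each factor z - e
becomes -((-z) - e), giving one sign per unit of degree. -/
theorem dexp_swap {x y : ℂ} (hx : x ∈ G.vertex) (hy : y ∈ G.vertex) {z : ℂ} (hz : ‖z‖ ≠ 1) :
    G.swap.dexp x y z = (-1) ^ (G.deg y - G.deg x) * G.dexp y x (-z) := by
  have hz' : ‖-z‖ ≠ 1 := by rwa [norm_neg]
  have hn : (-1 : ℂ) ≠ 0 := by norm_num
  have step : ∀ {u v : ℂ}, G.Arrow u v → G.swap.dexp u v z = -G.dexp v u (-z) := by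
    intro u v h
    rw [dexp_symm (mem_swap_vertex.2 h.right_mem) (mem_swap_vertex.2 h.left_mem),
      (swap_arrow.2 h).dexp, dexp_symm h.left_mem h.right_mem, h.dexp]
    simp
    ring
  obtain ⟨p⟩ := nonempty_path hx hy
  clear hy
  induction p with
  | refl => simp [dexp_self hx, dexp_self (mem_swap_vertex.2 hx)]
  | @along u v p h ih =>
    rw [← dexp_mul (mem_swap_vertex.2 hx) (mem_swap_vertex.2 h.left_mem)
      (mem_swap_vertex.2 h.right_mem) hz, ih, step h,
      ← dexp_mul h.right_mem h.left_mem hx hz', h.deg,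
      show G.deg u + 1 - G.deg x = (G.deg u - G.deg x) + 1 by ring, zpow_add₀ hn, zpow_one]
    ring
  | @against u v p h ih =>
    have e : G.swap.dexp u v z = -G.dexp v u (-z) := by
      rw [dexp_symm (mem_swap_vertex.2 h.left_mem) (mem_swap_vertex.2 h.right_mem), step h,
        dexp_symm h.left_mem h.right_mem, inv_neg, inv_inv]
    rw [← dexp_mul (mem_swap_vertex.2 hx) (mem_swap_vertex.2 h.right_mem)
      (mem_swap_vertex.2 h.left_mem) hz, ih, e, ← dexp_mul h.left_mem h.right_mem hx hz', h.deg,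
      show G.deg v + 1 - G.deg x = (G.deg v - G.deg x) + 1 by ring, zpow_add₀ hn, zpow_one]
    ring

theorem rayIntegral_dexp_swap {w b d : ℂ} (hw : w ∈ G.white) (hb : b ∈ G.black) :
    rayIntegral (G.swap.dexp b w) d = -rayIntegral (G.dexp w b) (-d) := by
  rw [← rayIntegral_neg]
  refine rayIntegral_congr fun z hz => ?_
  rw [dexp_swap (black_vertex hb) (white_vertex hw) hz, deg_white hw, deg_black hb]
  norm_num

theorem swap_exists_sine {ε : ℝ} (hG : ∀ t ∈ G.tiles, 2 * ε ≤ t.sine) :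
    ∀ t ∈ G.swap.tiles, 2 * ε ≤ t.sine := fun t ht => t.sine_swap ▸ hG _ ht

/-- The candidate is a right inverse of the discrete operator. -/
theorem sum_weight_mul_cauchyKernel {ε : ℝ} (hε : 0 < ε) (hG : ∀ t ∈ G.tiles, 2 * ε ≤ t.sine)
    {b b' : ℂ} (hb : b ∈ G.black) (hb' : b' ∈ G.black) {T : Finset Rhombus}
    (hT : ∀ t, t ∈ T ↔ t ∈ G.tiles ∧ t.b = b) :
    ∑ t ∈ T, t.weight * G.cauchyKernel t.w b' = if b = b' then 1 else 0 := by
  have h := sum_cauchyKernel_mul_weight hε (swap_exists_sine hG) (mem_swap_white.2 hb')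
    (mem_swap_white.2 hb) (T := T.map ⟨_, Rhombus.swap_injective⟩) (fun t => by
      rw [Finset.mem_map]
      constructor
      · rintro ⟨t, ht, rfl⟩
        have := (hT t).1 ht
        exact ⟨swap_mem_swap_tiles.2 this.1, this.2⟩
      · rintro ⟨ht, h⟩
        refine ⟨t.swap, (hT _).2 ⟨ht, by simpa using h⟩, t.swap_swap⟩)
  rw [Finset.sum_map] at h
  simp only [@eq_comm _ b', Function.Embedding.coeFn_mk] at h
  rw [← h]
  refine Finset.sum_congr rfl fun t ht => ?_
  have h1 := ((hT t).1 ht).1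
  rw [Rhombus.swap_weight, Rhombus.swap_b, cauchyKernel, cauchyKernel,
    rayIntegral_dexp_swap ⟨t, h1, rfl⟩ hb', neg_sub]
  ring

/-- The tiles at the black vertex `b` whose sides, directed towards `b`, lie between the directions
`α` and `β`. -/
noncomputable def blackFan (G : IsoradialGraph) (b : ℂ) (α β : ℝ) : Finset Rhombus :=
  (G.swap.fan b (α + Real.pi) (β + Real.pi)).map ⟨_, Rhombus.swap_injective⟩

theorem exp_add_pi (x : ℝ) :
    Complex.exp ((x + Real.pi : ℝ) * Complex.I) = -Complex.exp (x * Complex.I) := by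
  push_cast; rw [add_mul, Complex.exp_add, Complex.exp_pi_mul_I]; ring

theorem mem_blackFan {b : ℂ} {α β : ℝ} {t : Rhombus} : t ∈ G.blackFan b α β ↔ t ∈ G.tiles ∧
    t.b = b ∧ ∃ a c : ℝ, a < c ∧ t.er = Complex.exp (a * Complex.I) ∧
      t.el = Complex.exp (c * Complex.I) ∧ α ≤ a ∧ c ≤ β := by
  rw [blackFan, Finset.mem_map]
  constructor
  · rintro ⟨t, ht, rfl⟩
    obtain ⟨h1, h2, a, c, h3, h4, h5, h6, h7⟩ := mem_fan.1 ht
    refine ⟨h1, by simpa using h2, a - Real.pi, c - Real.pi, by linarith, ?_, ?_, by linarith,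
      by linarith⟩
    · have e := exp_add_pi (a - Real.pi)
      rw [sub_add_cancel] at e
      rw [Function.Embedding.coeFn_mk, Rhombus.swap_er, h4, e, neg_neg]
    · have e := exp_add_pi (c - Real.pi)
      rw [sub_add_cancel] at e
      rw [Function.Embedding.coeFn_mk, Rhombus.swap_el, h5, e, neg_neg]
  · rintro ⟨h1, h2, a, c, h3, h4, h5, h6, h7⟩
    refine ⟨t.swap, mem_fan.2 ⟨swap_mem_swap_tiles.2 h1, h2, a + Real.pi, c + Real.pi,
      by linarith, ?_, ?_, by linarith, by linarith⟩, t.swap_swap⟩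
    · rw [exp_add_pi, Rhombus.swap_er, h4]
    · rw [exp_add_pi, Rhombus.swap_el, h5]

theorem sum_blackFan {b : ℂ} {α β : ℝ} (f : Rhombus → ℂ) :
    ∑ t ∈ G.blackFan b α β, f t =
      ∑ t ∈ G.swap.fan b (α + Real.pi) (β + Real.pi), f t.swap := by
  rw [blackFan, Finset.sum_map]; rfl

section BlackStar

variable {b : ℂ} (hb : b ∈ G.black) {α β : ℝ} (hαβ : α < β) (hβ : β ≤ α + 2 * Real.pi)
  (h₁ : G.Arrow (b - Complex.exp (α * Complex.I)) b)
  (h₂ : G.Arrow (b - Complex.exp (β * Complex.I)) b)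
include hb hαβ hβ h₁ h₂

theorem star_blackFan {y : ℂ} (hy : y ∈ G.vertex) {z : ℂ} (hz : ‖z‖ ≠ 1) :
    ∑ t ∈ G.blackFan b α β, t.weight * G.dexp t.w y z =
      Complex.I * (G.dexp (b - Complex.exp (β * Complex.I)) y z -
        G.dexp (b - Complex.exp (α * Complex.I)) y z) := by
  have hz' : ‖-z‖ ≠ 1 := by rwa [norm_neg]
  have := star_fan (G := G.swap) (mem_swap_vertex.2 hy) (mem_swap_white.2 hb)
    (α := α + Real.pi) (β := β + Real.pi) (by linarith) (by linarith)
    (by rw [swap_arrow, exp_add_pi, ← sub_eq_add_neg]; exact h₁)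
    (by rw [swap_arrow, exp_add_pi, ← sub_eq_add_neg]; exact h₂) hz'
  rw [exp_add_pi, exp_add_pi, ← sub_eq_add_neg, ← sub_eq_add_neg, dexp_swap hy h₁.left_mem hz',
    dexp_swap hy h₂.left_mem hz', neg_neg] at this
  have d1 := h₁.deg
  have d2 := h₂.deg
  rw [deg_black hb] at d1 d2
  rw [show G.deg (b - Complex.exp (α * Complex.I)) = 1 by linarith,
    show G.deg (b - Complex.exp (β * Complex.I)) = 1 by linarith] at this
  have hn : (-1 : ℂ) ≠ 0 := by norm_num
  have hm : ((-1 : ℂ)) ^ (1 - G.deg y) ≠ 0 := zpow_ne_zero _ hn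
  rw [sum_blackFan]
  have e : ∑ t ∈ G.swap.fan b (α + Real.pi) (β + Real.pi), t.weight * G.swap.dexp y t.b (-z) =
      (-1) ^ (1 - G.deg y) * ∑ t ∈ G.swap.fan b (α + Real.pi) (β + Real.pi),
        t.swap.weight * G.dexp t.swap.w y z := by
    rw [Finset.mul_sum]
    refine Finset.sum_congr rfl fun t ht => ?_
    have ht' : t.swap ∈ G.tiles := (mem_fan.1 ht).1
    have hw : t.b ∈ G.white := ⟨t.swap, ht', by simp⟩
    rw [dexp_swap hy (white_vertex hw) hz', deg_white hw, neg_neg, zpow_sub₀ hn, zpow_sub₀ hn,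
      Rhombus.swap_weight, Rhombus.swap_w]
    simp
    ring
  rw [e] at this
  apply mul_left_cancel₀ hm
  rw [this]; ring

theorem sum_blackFan_dexp {ε : ℝ} (hε : 0 < ε) (hG : ∀ t ∈ G.tiles, 2 * ε ≤ t.sine)
    {b' : ℂ} (hb' : b' ∈ G.black) (hne : b' ≠ b) :
    ∑ t ∈ G.blackFan b α β, t.weight * rayIntegral (G.dexp t.w b') (t.w - b') =
      rayIntegral (fun z => Complex.I * (G.dexp (b - Complex.exp (β * Complex.I)) b' z -
        G.dexp (b - Complex.exp (α * Complex.I)) b' z)) (b - b') := by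
  have := sum_fan_dexp hε (swap_exists_sine hG) (mem_swap_white.2 hb') (mem_swap_white.2 hb) hne
    (α := α + Real.pi) (β := β + Real.pi) (by linarith) (by linarith)
    (by rw [swap_arrow, exp_add_pi, ← sub_eq_add_neg]; exact h₁)
    (by rw [swap_arrow, exp_add_pi, ← sub_eq_add_neg]; exact h₂)
  rw [exp_add_pi, exp_add_pi, ← sub_eq_add_neg, ← sub_eq_add_neg] at this
  rw [sum_blackFan]
  refine Eq.trans (Finset.sum_congr rfl fun t ht => ?_) (this.trans ?_)
  · have ht' : t.swap ∈ G.tiles := (mem_fan.1 ht).1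
    have hw : t.b ∈ G.white := ⟨t.swap, ht', by simp⟩
    rw [rayIntegral_dexp_swap hw hb', Rhombus.swap_weight, Rhombus.swap_w, neg_sub]
    ring
  · set H : ℂ → ℂ := fun z => Complex.I * (G.dexp (b - Complex.exp (β * Complex.I)) b' z -
      G.dexp (b - Complex.exp (α * Complex.I)) b' z) with hH
    have e : rayIntegral (fun z => Complex.I *
        (G.swap.dexp b' (b - Complex.exp (β * Complex.I)) z -
          G.swap.dexp b' (b - Complex.exp (α * Complex.I)) z)) (b' - b) =
        rayIntegral (fun z => -1 * H (-z)) (b' - b) := by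
      refine rayIntegral_congr fun z hz => ?_
      have d1 := h₁.deg
      have d2 := h₂.deg
      rw [deg_black hb] at d1 d2
      rw [dexp_swap (black_vertex hb') h₁.left_mem hz, dexp_swap (black_vertex hb') h₂.left_mem hz,
        deg_black hb', show G.deg (b - Complex.exp (α * Complex.I)) = 1 by linarith,
        show G.deg (b - Complex.exp (β * Complex.I)) = 1 by linarith]
      simp only [hH]
      norm_num
      ring
    rw [e, rayIntegral_const_mul, rayIntegral_neg, neg_sub]
    ring

theorem sum_blackFan_dexp_self :
    ∑ t ∈ G.blackFan b α β, t.weight * rayIntegral (G.dexp t.w b) (t.w - b) = β - α := by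
  have := sum_fan_dexp_self (mem_swap_white.2 hb)
    (α := α + Real.pi) (β := β + Real.pi) (by linarith) (by linarith)
    (by rw [swap_arrow, exp_add_pi, ← sub_eq_add_neg]; exact h₁)
    (by rw [swap_arrow, exp_add_pi, ← sub_eq_add_neg]; exact h₂)
  rw [sum_blackFan]
  refine Eq.trans (Finset.sum_congr rfl fun t ht => ?_) (this.trans ?_)
  · have ht' : t.swap ∈ G.tiles := (mem_fan.1 ht).1
    have hw : t.b ∈ G.white := ⟨t.swap, ht', by simp⟩
    rw [rayIntegral_dexp_swap hw hb, Rhombus.swap_weight, Rhombus.swap_w, neg_sub]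
    ring
  · push_cast; ring

end BlackStar

end IsoradialGraph

/-! ### Uniqueness of the inverse. -/

theorem finsum_eq_sum_of_injective {ι α M : Type*} [AddCommMonoid M] [Fintype ι] {p : ι → α}
    (hp : Function.Injective p) (F : α → M) (h : ∀ a, F a ≠ 0 → ∃ i, p i = a) :
    ∑ᶠ a, F a = ∑ i, F (p i) := by
  classical
  rw [finsum_eq_sum_of_support_subset F (s := Finset.univ.image p) (fun a ha => by
    obtain ⟨i, rfl⟩ := h a ha; simp), Finset.sum_image hp.injOn]

namespace Rhombus

theorem ball_subset_interior (t : Rhombus) {ε : ℝ} (h : 2 * ε ≤ t.sine) :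
    Metric.ball (t.w + (2⁻¹ : ℝ) * (t.er + t.el)) ε ⊆ interior t.carrier := by
  intro z hz
  rw [mem_ball_iff_norm] at hz
  set v := z - (t.w + (2⁻¹ : ℝ) * (t.er + t.el)) with hv
  have hzw : z - t.w = (2⁻¹ : ℝ) * (t.er + t.el) + v := by rw [hv]; ring
  have hs := t.sine_pos
  have ha : |t.coA v| < 1 / 2 := by
    rw [coA_apply, abs_div, abs_of_pos hs, div_lt_iff₀ hs]
    have := abs_cross_le v t.el
    rw [t.norm_el] at this; linarith
  have hb : |t.coB v| < 1 / 2 := by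
    rw [coB_apply, abs_div, abs_of_pos hs, div_lt_iff₀ hs]
    have := abs_cross_le t.er v
    rw [t.norm_er] at this; linarith
  have ha' := abs_lt.1 ha
  have hb' := abs_lt.1 hb
  refine t.mem_interior ?_ ?_
  · rw [hzw, map_add, coA_mul, map_add, coA_er, coA_el]; constructor <;> norm_num <;> linarith
  · rw [hzw, map_add, coB_mul, map_add, coB_er, coB_el]; constructor <;> norm_num <;> linarith

theorem norm_b_sub_w (t : Rhombus) : ‖t.b - t.w‖ ≤ 2 := by
  rw [show t.b - t.w = t.er + t.el by rw [t.b_eq]; ring]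
  refine (norm_add_le _ _).trans ?_
  rw [t.norm_er, t.norm_el]; norm_num

theorem norm_weight_le (t : Rhombus) : ‖t.weight‖ ≤ 2 := by
  rw [weight, norm_mul, Complex.norm_I, one_mul]
  refine (norm_sub_le _ _).trans ?_
  rw [t.norm_er, t.norm_el]; norm_num

end Rhombus

namespace IsoradialGraph

variable {G : IsoradialGraph}

open MeasureTheory in
/-- The number of tiles in an annulus is bounded by its area. -/
theorem card_tiles_annulus {ε : ℝ} (hε : 0 < ε) (hε1 : ε ≤ 1) (hG : ∀ t ∈ G.tiles, 2 * ε ≤ t.sine)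
    {R L : ℝ} (hR : 2 ≤ R) (hL : 0 ≤ L) {T : Finset Rhombus} (hT : ∀ t ∈ T, t ∈ G.tiles)
    (hw : ∀ t ∈ T, R ≤ ‖t.w‖ ∧ ‖t.w‖ ≤ R + L) :
    T.card * ε ^ 2 ≤ (2 * R + L) * (L + 4) := by
  set c : Rhombus → ℂ := fun t => t.w + (2⁻¹ : ℝ) * (t.er + t.el) with hc
  have hdisj : (T : Set Rhombus).PairwiseDisjoint fun t => Metric.ball (c t) ε := by
    intro t ht t' ht' hne
    exact (G.interior_disjoint t (hT t ht) t' (hT t' ht') hne).mono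
      (t.ball_subset_interior (hG t (hT t ht))) (t'.ball_subset_interior (hG t' (hT t' ht')))
  -- The margin 2 is half a diagonal, at most 1, plus the radius ε ≤ 1.
  have hsub : (⋃ t ∈ T, Metric.ball (c t) ε) ⊆ Metric.ball 0 (R + L + 2) \ Metric.ball 0 (R - 2) := by
    intro z hz
    simp only [Set.mem_iUnion] at hz
    obtain ⟨t, ht, hz⟩ := hz
    rw [mem_ball_iff_norm] at hz
    have h1 : ‖(2⁻¹ : ℝ) * (t.er + t.el)‖ ≤ 1 := by
      rw [norm_mul, Complex.norm_real]
      have := norm_add_le t.er t.el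
      rw [t.norm_er, t.norm_el] at this
      norm_num; linarith
    have h2 : ‖z - t.w‖ < 2 := by
      rw [show z - t.w = (z - c t) + (2⁻¹ : ℝ) * (t.er + t.el) by simp only [hc]; ring]
      exact (norm_add_le _ _).trans_lt (by linarith)
    have h3 := hw t ht
    have h4 := norm_sub_norm_le z t.w
    have h5 := norm_sub_norm_le t.w z
    rw [norm_sub_rev] at h5
    constructor
    · rw [mem_ball_zero_iff]; linarith
    · rw [mem_ball_zero_iff]; linarith
  have hvol := measure_mono (μ := volume) hsub
  rw [measure_biUnion_finset hdisj fun t _ => measurableSet_ball,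
    measure_sdiff (Metric.ball_subset_ball (by linarith)) measurableSet_ball.nullMeasurableSet
      measure_ball_lt_top.ne] at hvol
  simp only [Complex.volume_ball, Finset.sum_const, nsmul_eq_mul] at hvol
  have hπ : (NNReal.pi : ENNReal) = ENNReal.ofReal Real.pi := by
    rw [ENNReal.ofReal, ← NNReal.coe_real_pi, Real.toNNReal_coe]
  have e : ∀ r : ℝ, 0 ≤ r → ENNReal.ofReal r ^ 2 * (NNReal.pi : ENNReal) =
      ENNReal.ofReal (r ^ 2 * Real.pi) := fun r hr => by
    rw [ENNReal.ofReal_mul (by positivity), ENNReal.ofReal_pow hr, hπ]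
  rw [e _ hε.le, e _ (by linarith), e _ (by linarith), ← ENNReal.ofReal_natCast,
    ← ENNReal.ofReal_mul (by positivity), ← ENNReal.ofReal_sub _ (by positivity),
    ENNReal.ofReal_le_ofReal_iff] at hvol
  · have h1 : (T.card * ε ^ 2) * Real.pi ≤ ((2 * R + L) * (L + 4)) * Real.pi := by linarith
    exact le_of_mul_le_mul_right h1 Real.pi_pos
  · have : (R - 2) ^ 2 ≤ (R + L + 2) ^ 2 := pow_le_pow_left₀ (by linarith) (by linarith) 2
    have := mul_le_mul_of_nonneg_right this Real.pi_pos.le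
    linarith

theorem finite_tiles_black (G : IsoradialGraph) (R : ℝ) : {t ∈ G.tiles | ‖t.b‖ ≤ R}.Finite := by
  refine (G.locally_finite R).subset ?_
  rintro t ⟨ht, h⟩
  exact ⟨ht, t.b, t.corner_mem (by simp [Rhombus.corners]), by simpa using h⟩

/-- A decaying function on the black vertices annihilated by the discrete operator vanishes. -/
theorem eq_zero_of_decay {ε : ℝ} (hε : 0 < ε) (hε1 : ε ≤ 1) (hG : ∀ t ∈ G.tiles, 2 * ε ≤ t.sine)
    {f : ℂ → ℂ} (hf : ∀ δ : ℝ, 0 < δ → ∃ R : ℝ, ∀ b ∈ G.black, R ≤ ‖b‖ → ‖f b‖ ≤ δ)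
    (h0 : ∀ w ∈ G.white, ∀ T : Finset Rhombus, (∀ t, t ∈ T ↔ t ∈ G.tiles ∧ t.w = w) →
      ∑ t ∈ T, f t.b * t.weight = 0) {b₀ : ℂ} (hb₀ : b₀ ∈ G.black) : f b₀ = 0 := by
  classical
  -- The constant is the product of 16R/ε² boundary tiles, the bound 2δ for f times a weight, and
  -- the bound 256/(εR) for the kernel; the radius cancels.
  have bound : ∀ δ : ℝ, 0 < δ → ‖f b₀‖ ≤ δ * (8192 / ε ^ 3) := by
    intro δ hδ
    obtain ⟨R₁, hR₁⟩ := hf δ hδ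
    obtain ⟨R, hR⟩ : ∃ R : ℝ, R₁ + 4 ≤ R ∧ 4 + 2 * ‖b₀‖ ≤ R ∧ ‖b₀‖ + 22 ≤ R ∧
        ‖b₀‖ + 32 / ε + 2 ≤ R ∧ 4 ≤ R :=
      ⟨max (max (R₁ + 4) (4 + 2 * ‖b₀‖)) (max (max (‖b₀‖ + 22) (‖b₀‖ + 32 / ε + 2)) 4), by simp, by simp,
        by simp, by simp, by simp⟩
    obtain ⟨r1, r2, r3, r4, r5⟩ := hR
    set T := (G.finite_tiles_black R).toFinset with hT
    have memT : ∀ t, t ∈ T ↔ t ∈ G.tiles ∧ ‖t.b‖ ≤ R := fun t => Set.Finite.mem_toFinset _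
    -- Discrete Green formula. Summed by black vertices, the right-inverse property leaves f b₀;
    -- summed by white vertices, complete stars vanish by `h0` and only a boundary annulus remains.
    set F : Rhombus → ℂ := fun t => f t.b * t.weight * G.cauchyKernel t.w b₀ with hF
    have sum1 : ∑ t ∈ T, F t = f b₀ := by
      rw [← Finset.sum_fiberwise_of_maps_to (t := insert b₀ (T.image Rhombus.b)) (g := Rhombus.b)
        fun t ht => Finset.mem_insert_of_mem (Finset.mem_image_of_mem _ ht)]
      rw [Finset.sum_eq_single b₀]
      · have h1 : ∀ t, t ∈ T.filter (fun t => t.b = b₀) ↔ t ∈ G.tiles ∧ t.b = b₀ := fun t => by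
          rw [Finset.mem_filter, memT]
          constructor
          · rintro ⟨⟨h1, -⟩, h2⟩; exact ⟨h1, h2⟩
          · rintro ⟨h1, h2⟩; exact ⟨⟨h1, by rw [h2]; linarith [norm_nonneg b₀]⟩, h2⟩
        have := sum_weight_mul_cauchyKernel hε hG hb₀ hb₀ h1
        rw [if_pos rfl] at this
        rw [← mul_one (f b₀), ← this, Finset.mul_sum]
        refine Finset.sum_congr rfl fun t ht => ?_
        simp only [hF]
        rw [((h1 t).1 ht).2, mul_assoc]
      · intro b hb hne
        rw [Finset.mem_insert] at hb
        obtain ⟨t₀, ht₀, rfl⟩ := Finset.mem_image.1 (hb.resolve_left hne)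
        have ht₀' := (memT t₀).1 ht₀
        have h1 : ∀ t, t ∈ T.filter (fun t => t.b = t₀.b) ↔ t ∈ G.tiles ∧ t.b = t₀.b := fun t => by
          rw [Finset.mem_filter, memT]
          constructor
          · rintro ⟨⟨h1, -⟩, h2⟩; exact ⟨h1, h2⟩
          · rintro ⟨h1, h2⟩; exact ⟨⟨h1, by rw [h2]; exact ht₀'.2⟩, h2⟩
        have := sum_weight_mul_cauchyKernel hε hG ⟨t₀, ht₀'.1, rfl⟩ hb₀ h1
        rw [if_neg hne] at this
        rw [← mul_zero (f t₀.b), ← this, Finset.mul_sum]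
        refine Finset.sum_congr rfl fun t ht => ?_
        simp only [hF]
        rw [((h1 t).1 ht).2, mul_assoc]
      · intro h; exact absurd (Finset.mem_insert_self _ _) h
    have sum2 : ∑ t ∈ T.filter (fun t => ‖t.w‖ ≤ R - 2), F t = 0 := by
      rw [← Finset.sum_fiberwise_of_maps_to
        (t := (T.filter (fun t => ‖t.w‖ ≤ R - 2)).image Rhombus.w) (g := Rhombus.w)
        fun t ht => Finset.mem_image_of_mem _ ht]
      refine Finset.sum_eq_zero fun w hw => ?_
      obtain ⟨t₀, ht₀, rfl⟩ := Finset.mem_image.1 hw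
      rw [Finset.mem_filter, memT] at ht₀
      -- Diagonals have length at most 2, so a white vertex within R - 2 has all its tiles in T.
      have h1 : ∀ t, t ∈ (T.filter (fun t => ‖t.w‖ ≤ R - 2)).filter (fun t => t.w = t₀.w) ↔
          t ∈ G.tiles ∧ t.w = t₀.w := fun t => by
        rw [Finset.mem_filter, Finset.mem_filter, memT]
        constructor
        · rintro ⟨⟨⟨h1, -⟩, -⟩, h2⟩; exact ⟨h1, h2⟩
        · rintro ⟨h1, h2⟩
          refine ⟨⟨⟨h1, ?_⟩, by rw [h2]; exact ht₀.2⟩, h2⟩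
          have h3 := norm_sub_norm_le t.b t.w
          have h4 := t.norm_b_sub_w
          rw [h2] at h3 h4
          linarith [ht₀.2]
      have := h0 t₀.w ⟨t₀, ht₀.1.1, rfl⟩ _ h1
      rw [← zero_mul (G.cauchyKernel t₀.w b₀), ← this, Finset.sum_mul]
      refine Finset.sum_congr rfl fun t ht => ?_
      simp only [hF]
      rw [((h1 t).1 ht).2]
    rw [← Finset.sum_filter_add_sum_filter_not T (fun t => ‖t.w‖ ≤ R - 2), sum2, zero_add] at sum1
    set B := T.filter (fun t => ¬‖t.w‖ ≤ R - 2) with hB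
    have memB : ∀ t ∈ B, t ∈ G.tiles ∧ ‖t.b‖ ≤ R ∧ R - 2 ≤ ‖t.w‖ := fun t ht => by
      rw [hB, Finset.mem_filter, memT] at ht
      exact ⟨ht.1.1, ht.1.2, (not_le.1 ht.2).le⟩
    have hcard := card_tiles_annulus hε hε1 hG (R := R - 2) (L := 4) (by linarith) (by norm_num)
      (T := B) (fun t ht => (memB t ht).1) fun t ht => ⟨(memB t ht).2.2, by
        have h3 := norm_sub_norm_le t.w t.b
        rw [norm_sub_rev] at h3
        have h4 := t.norm_b_sub_w
        linarith [(memB t ht).2.1]⟩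
    have hterm : ∀ t ∈ B, ‖F t‖ ≤ δ * 2 * (256 / ε / R) := by
      intro t ht
      obtain ⟨h1, h2, h3⟩ := memB t ht
      have h4 := norm_sub_norm_le t.w b₀
      rw [norm_sub_rev] at h4
      have h6 := norm_sub_norm_le t.w t.b
      rw [norm_sub_rev] at h6
      have h7 := t.norm_b_sub_w
      have hk := norm_cauchyKernel_le hε hG (white_mem h1) (black_vertex hb₀)
        (by rw [deg_black hb₀, deg_white ⟨t, h1, rfl⟩]; rfl) (by linarith) (by linarith)
      have hk2 : 64 / ε / ‖b₀ - t.w‖ ≤ 256 / ε / R := by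
        rw [div_div, div_div, div_le_div_iff₀ (mul_pos hε (by linarith)) (mul_pos hε (by linarith))]
        have : R ≤ 4 * ‖b₀ - t.w‖ := by linarith
        have := mul_le_mul_of_nonneg_left this hε.le
        linarith
      simp only [hF]
      rw [norm_mul, norm_mul]
      exact mul_le_mul (mul_le_mul (hR₁ _ ⟨t, h1, rfl⟩ (by linarith)) t.norm_weight_le
        (norm_nonneg _) hδ.le) (hk.trans hk2) (norm_nonneg _) (by positivity)
    rw [← sum1]
    refine (norm_sum_le _ _).trans ((Finset.sum_le_card_nsmul _ _ _ hterm).trans ?_)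
    rw [nsmul_eq_mul]
    have hR0 : 0 < R := by linarith
    have e : (B.card : ℝ) * (δ * 2 * (256 / ε / R)) = B.card * ε ^ 2 * (δ * 512 / ε ^ 3 / R) := by
      field_simp; ring
    rw [e]
    have hc2 : (B.card : ℝ) * ε ^ 2 ≤ 8 * R * 2 := by linarith
    refine (mul_le_mul_of_nonneg_right hc2 (by positivity)).trans (le_of_eq ?_)
    field_simp; norm_num
  by_contra hne
  have hpos := norm_pos_iff.2 hne
  have hc : 0 < 8192 / ε ^ 3 := by positivity
  have := bound (‖f b₀‖ / (8192 / ε ^ 3) / 2) (by positivity)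
  have e : ‖f b₀‖ / (8192 / ε ^ 3) / 2 * (8192 / ε ^ 3) = ‖f b₀‖ / 2 := by field_simp
  linarith

end IsoradialGraph

namespace IsoradialGraph

variable {G : IsoradialGraph}

theorem finsum_white_eq {b : ℂ} {T : Finset Rhombus} (hT : ∀ t ∈ T, t ∈ G.tiles ∧ t.b = b)
    {Φ : G.white → ℂ} {Ψ : Rhombus → ℂ} (hΨ : ∀ t ∈ T, ∀ hw : t.w ∈ G.white, Φ ⟨t.w, hw⟩ = Ψ t)
    (h : ∀ w : G.white, Φ w ≠ 0 → ∃ t ∈ T, t.w = w) : ∑ᶠ w, Φ w = ∑ t ∈ T, Ψ t := by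
  have hw : ∀ t : T, t.1.w ∈ G.white := fun t => ⟨t, (hT t t.2).1, rfl⟩
  rw [finsum_eq_sum_of_injective (p := fun t : T => (⟨t.1.w, hw t⟩ : G.white)), ← T.sum_coe_sort]
  · exact Finset.sum_congr rfl fun t _ => hΨ t t.2 _
  · intro t t' htt
    have h1 : t.1.w = t'.1.w := congrArg Subtype.val htt
    have h2 := hT t t.2
    have h3 := hT t' t'.2
    exact Subtype.ext (tile_eq_of_edge h2.1 h3.1 h1 (h2.2.trans h3.2.symm))
  · intro w hw'
    obtain ⟨t, ht, e⟩ := h w hw'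
    exact ⟨⟨t, ht⟩, Subtype.ext e⟩

theorem finsum_black_eq {w : ℂ} {T : Finset Rhombus} (hT : ∀ t ∈ T, t ∈ G.tiles ∧ t.w = w)
    {Φ : G.black → ℂ} {Ψ : Rhombus → ℂ} (hΨ : ∀ t ∈ T, ∀ hb : t.b ∈ G.black, Φ ⟨t.b, hb⟩ = Ψ t)
    (h : ∀ b : G.black, Φ b ≠ 0 → ∃ t ∈ T, t.b = b) : ∑ᶠ b, Φ b = ∑ t ∈ T, Ψ t := by
  have hb : ∀ t : T, t.1.b ∈ G.black := fun t => ⟨t, (hT t t.2).1, rfl⟩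
  rw [finsum_eq_sum_of_injective (p := fun t : T => (⟨t.1.b, hb t⟩ : G.black)), ← T.sum_coe_sort]
  · exact Finset.sum_congr rfl fun t _ => hΨ t t.2 _
  · intro t t' htt
    have h1 : t.1.b = t'.1.b := congrArg Subtype.val htt
    have h2 := hT t t.2
    have h3 := hT t' t'.2
    exact Subtype.ext (tile_eq_of_edge h2.1 h3.1 (h2.2.trans h3.2.symm) h1)
  · intro b hb'
    obtain ⟨t, ht, e⟩ := h b hb'
    exact ⟨⟨t, ht⟩, Subtype.ext e⟩

theorem exists_tile_of_dbar_ne_zero {b : G.black} {w : G.white} (h : G.dbar b w ≠ 0) :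
    ∃ t ∈ G.tiles, t.b = b ∧ t.w = w := by
  by_contra hn
  exact h (dif_neg hn)

/-- The inverse is given by the contour integral. -/
theorem IsInverse.eq_cauchyKernel (hG : G.Regular) {C : G.white → G.black → ℂ}
    (hC : G.IsInverse C) (w : G.white) (b : G.black) : C w b = G.cauchyKernel w b := by
  classical
  obtain ⟨ε₀, hε₀, hG₀⟩ := hG.exists_sine
  obtain ⟨ε, hε, hε1, hG'⟩ : ∃ ε : ℝ, 0 < ε ∧ ε ≤ 1 ∧ ∀ t ∈ G.tiles, 2 * ε ≤ t.sine :=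
    ⟨min ε₀ 1, lt_min hε₀ one_pos, min_le_right _ _, fun t ht =>
      (mul_le_mul_of_nonneg_left (min_le_left _ _) (by norm_num)).trans (hG₀ t ht)⟩
  -- Both rows decay at infinity and both satisfy the left-inverse relations, so their difference
  -- satisfies the hypotheses of `eq_zero_of_decay`.
  set f : ℂ → ℂ := fun x => if h : x ∈ G.black then C w ⟨x, h⟩ - G.cauchyKernel w x else 0 with hf
  have hfb : ∀ x (h : x ∈ G.black), f x = C w ⟨x, h⟩ - G.cauchyKernel w x := fun x h => dif_pos h
  suffices f b = 0 by
    rw [hfb b b.2] at this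
    exact sub_eq_zero.1 this
  refine eq_zero_of_decay hε hε1 hG' ?_ ?_ b.2
  · intro δ hδ
    have h1 := hC.decay w
    rw [Metric.tendsto_nhds] at h1
    have h2 := h1 (δ / 2) (half_pos hδ)
    rw [Filter.eventually_comap, ← Metric.cobounded_eq_cocompact, ← comap_norm_atTop,
      Filter.eventually_comap, Filter.eventually_atTop] at h2
    obtain ⟨R, hR⟩ := h2
    refine ⟨max R (‖(w : ℂ)‖ + max (max 20 (32 / ε)) (64 / ε / (δ / 2))), fun x hx hRx => ?_⟩
    have h3 := hR ‖x‖ ((le_max_left _ _).trans hRx) x rfl ⟨x, hx⟩ rfl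
    rw [dist_zero_right] at h3
    have h4 := (le_max_right _ _).trans hRx
    have h5 := norm_sub_norm_le x w
    have h6 : max (max 20 (32 / ε)) (64 / ε / (δ / 2)) ≤ ‖x - w‖ := by linarith
    have h7 : 64 / ε / (δ / 2) ≤ ‖x - w‖ := (le_max_right _ _).trans h6
    have h8 : 20 ≤ ‖x - w‖ := (le_max_left _ _).trans ((le_max_left _ _).trans h6)
    have h9 : 32 / ε ≤ ‖x - w‖ := (le_max_right _ _).trans ((le_max_left _ _).trans h6)
    have h10 := norm_cauchyKernel_le hε hG' (white_vertex w.2) (black_vertex hx)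
      (by rw [deg_black hx, deg_white w.2]; rfl) h8 h9
    have h11 : 64 / ε / ‖x - w‖ ≤ δ / 2 := by
      rw [div_le_iff₀ (half_pos hδ)] at h7
      rw [div_le_iff₀ (by linarith)]
      linarith
    rw [hfb x hx]
    exact (norm_sub_le _ _).trans (by linarith)
  · intro w' hw' T hT
    have h1 := hC.mul_dbar w ⟨w', hw'⟩
    rw [finsum_black_eq (T := T) (Ψ := fun t => (f t.b + G.cauchyKernel w t.b) * t.weight)
      (fun t ht => (hT t).1 ht)] at h1
    · have h2 := sum_cauchyKernel_mul_weight hε hG' w.2 hw' hT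
      simp only [add_mul, Finset.sum_add_distrib] at h1
      rw [show ∑ t ∈ T, G.cauchyKernel w t.b * t.weight = ∑ t ∈ T, t.weight * G.cauchyKernel w t.b
        from Finset.sum_congr rfl fun _ _ => mul_comm _ _, h2] at h1
      simpa [Subtype.ext_iff] using h1
    · intro t ht hb
      obtain ⟨h2, h3⟩ := (hT t).1 ht
      subst h3
      rw [hfb _ hb, dbar_tile h2 hb hw']
      ring
    · intro b' hb'
      obtain ⟨t, ht, e1, e2⟩ := exists_tile_of_dbar_ne_zero (right_ne_zero_of_mul hb')
      exact ⟨t, (hT t).2 ⟨ht, e2⟩, e1⟩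

end IsoradialGraph

/-! ### The straight path: signs of divisors and disjointness of the fans. -/

theorem dot_exp (x y : ℝ) :
    dot (Complex.exp (x * Complex.I)) (Complex.exp (y * Complex.I)) = Real.cos (x - y) := by
  rw [dot, Complex.exp_ofReal_mul_I_re, Complex.exp_ofReal_mul_I_im, Complex.exp_ofReal_mul_I_re,
    Complex.exp_ofReal_mul_I_im, Real.cos_sub]

theorem Complex.exists_int_of_exp_eq {x y : ℝ} (h : exp (x * I) = exp (y * I)) :
    ∃ n : ℤ, x = y + n * (2 * Real.pi) := by
  rw [Complex.exp_eq_exp_iff_exists_int] at h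
  obtain ⟨n, hn⟩ := h
  refine ⟨n, ?_⟩
  have := congrArg Complex.im hn
  simpa using this

theorem Complex.add_two_pi_le_of_exp_eq {x y : ℝ} (h : exp (x * I) = exp (y * I)) (hxy : y < x) :
    y + 2 * Real.pi ≤ x := by
  obtain ⟨n, hn⟩ := exists_int_of_exp_eq h
  have hπ := Real.pi_pos
  have h1 : (0 : ℝ) < n := by
    by_contra hc
    have := mul_nonpos_of_nonpos_of_nonneg (not_lt.1 hc) (by linarith : 0 ≤ 2 * Real.pi)
    linarith
  have h2 : (1 : ℝ) ≤ n := by exact_mod_cast (by exact_mod_cast h1 : 0 < n)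
  have := mul_le_mul_of_nonneg_right h2 (by linarith : 0 ≤ 2 * Real.pi)
  linarith

namespace IsoradialGraph

variable {G : IsoradialGraph}

theorem divisor_edge {t : Rhombus} (ht : t ∈ G.tiles) :
    G.divisor t.w t.b = Finsupp.single t.er 1 + Finsupp.single t.el 1 := by
  have h1 := (fan_arrow ht).1
  have h2 : G.Arrow (t.w + t.er) t.b := ⟨t, ht, Or.inr ⟨Or.inl t.r_eq.symm, rfl⟩⟩
  rw [← divisor_add h1.left_mem h1.right_mem h2.right_mem, h1.divisor, h2.divisor]
  congr 2
  · ring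
  · rw [t.b_eq]; ring

namespace StraightPath

variable {θ₀ : ℝ} {F F' : ℂ} (γ : G.StraightPath θ₀ F F')

theorem vertex_mem {j : ℕ} (hj : j ≤ 2 * γ.P) : γ.v j ∈ G.vertex := by
  rcases hj.lt_or_eq with h | rfl
  · rcases γ.adj j h with h | h
    exacts [h.left_mem, h.right_mem]
  · exact face_vertex (γ.isFace γ.P le_rfl)

theorem dot_step {j : ℕ} (hj : j < 2 * γ.P) :
    0 < dot (γ.v (j + 1) - γ.v j) (Complex.exp (θ₀ * Complex.I)) := by
  rw [γ.step j hj, dot_exp]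
  have := γ.angle j hj
  exact Real.cos_pos_of_mem_Ioo ⟨by linarith, by linarith⟩

theorem dot_pos {i j : ℕ} (hij : i < j) (hj : j ≤ 2 * γ.P) :
    0 < dot (γ.v j - γ.v i) (Complex.exp (θ₀ * Complex.I)) := by
  induction j, hij using Nat.le_induction with
  | base => exact γ.dot_step (by omega)
  | succ j hij ih =>
    have h1 := ih (by omega)
    have h2 := γ.dot_step (j := j) (by omega)
    rw [show γ.v (j + 1) - γ.v i = (γ.v (j + 1) - γ.v j) + (γ.v j - γ.v i) by ring, dot_add_left]
    linarith

theorem v_ne {i j : ℕ} (hij : i ≠ j) (hi : i ≤ 2 * γ.P) (hj : j ≤ 2 * γ.P) : γ.v i ≠ γ.v j := by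
  intro h
  rcases hij.lt_or_gt with h1 | h1
  · have := γ.dot_pos h1 hj
    rw [h, sub_self] at this
    simp [dot] at this
  · have := γ.dot_pos h1 hi
    rw [h, sub_self] at this
    simp [dot] at this

/-- A step along an arrow is a pole at the step, on the positive side of the normal to e^{iθ₀}; a
step against an arrow is a zero at minus the step, on the negative side. Hence nothing cancels along
the path, and all its poles stay in one open half-plane. -/
theorem divisor_step {j : ℕ} (hj : j < 2 * γ.P) (e : ℂ) :
    (0 ≤ dot e (Complex.exp (θ₀ * Complex.I)) → 0 ≤ G.divisor (γ.v j) (γ.v (j + 1)) e) ∧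
      (dot e (Complex.exp (θ₀ * Complex.I)) ≤ 0 → G.divisor (γ.v j) (γ.v (j + 1)) e ≤ 0) := by
  have h0 := γ.dot_step hj
  rcases γ.adj j hj with h | h
  · rw [h.divisor]
    refine ⟨fun _ => by rw [Finsupp.single_apply]; split_ifs <;> norm_num, fun h1 => ?_⟩
    rw [Finsupp.single_eq_of_ne]
    rintro rfl
    linarith
  · rw [divisor_symm h.left_mem h.right_mem, h.divisor, Finsupp.neg_apply]
    refine ⟨fun h1 => ?_, fun _ => by rw [Finsupp.single_apply]; split_ifs <;> norm_num⟩
    rw [Finsupp.single_eq_of_ne, neg_zero]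
    rintro rfl
    rw [← neg_sub, dot_neg_left] at h1
    linarith

theorem divisor_sign {i j : ℕ} (hij : i ≤ j) (hj : j ≤ 2 * γ.P) (e : ℂ) :
    (0 ≤ dot e (Complex.exp (θ₀ * Complex.I)) → 0 ≤ G.divisor (γ.v i) (γ.v j) e) ∧
      (dot e (Complex.exp (θ₀ * Complex.I)) ≤ 0 → G.divisor (γ.v i) (γ.v j) e ≤ 0) := by
  induction j, hij using Nat.le_induction with
  | base => simp [divisor_self (γ.vertex_mem hj)]
  | succ j hij ih =>
    have h1 := ih (by omega)
    have h2 := γ.divisor_step (j := j) (by omega) e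
    rw [← divisor_add (γ.vertex_mem (by omega)) (γ.vertex_mem (by omega : j ≤ 2 * γ.P))
      (γ.vertex_mem hj), Finsupp.add_apply]
    exact ⟨fun h => add_nonneg (h1.1 h) (h2.1 h), fun h => add_nonpos (h1.2 h) (h2.2 h)⟩

theorem dot_pos_of_mem_poles {i j : ℕ} (hij : i ≤ j) (hj : j ≤ 2 * γ.P) {e : ℂ}
    (he : e ∈ G.poles (γ.v i) (γ.v j)) : 0 < dot e (Complex.exp (θ₀ * Complex.I)) := by
  by_contra h
  have := (γ.divisor_sign hij hj e).2 (not_lt.1 h)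
  have := mem_poles.1 he
  omega

theorem dot_neg_of_mem_poles {i j : ℕ} (hij : i ≤ j) (hj : j ≤ 2 * γ.P) {e : ℂ}
    (he : e ∈ G.poles (γ.v j) (γ.v i)) : dot e (Complex.exp (θ₀ * Complex.I)) < 0 := by
  by_contra h
  have h1 := (γ.divisor_sign hij hj e).1 (not_lt.1 h)
  have h2 := mem_poles.1 he
  rw [divisor_symm (γ.vertex_mem (hij.trans hj)) (γ.vertex_mem hj), Finsupp.neg_apply] at h2
  omega

/-- The step contributes to the divisor of the path without cancellation. -/
theorem divisor_le_of_mem {i j k : ℕ} (hij : i ≤ j) (hjk : j < k) (hk : k ≤ 2 * γ.P) (e : ℂ) :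
    (0 ≤ dot e (Complex.exp (θ₀ * Complex.I)) →
      G.divisor (γ.v j) (γ.v (j + 1)) e ≤ G.divisor (γ.v i) (γ.v k) e) ∧
    (dot e (Complex.exp (θ₀ * Complex.I)) ≤ 0 →
      G.divisor (γ.v i) (γ.v k) e ≤ G.divisor (γ.v j) (γ.v (j + 1)) e) := by
  have h1 := γ.divisor_sign hij (by omega) e
  have h2 := γ.divisor_sign (i := j + 1) hjk hk e
  rw [← divisor_add (γ.vertex_mem (by omega)) (γ.vertex_mem (by omega : j ≤ 2 * γ.P))
      (γ.vertex_mem hk), ← divisor_add (γ.vertex_mem (by omega))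
      (γ.vertex_mem (by omega : j + 1 ≤ 2 * γ.P)) (γ.vertex_mem hk)]
  simp only [Finsupp.add_apply]
  exact ⟨fun h => by linarith [h1.1 h, h2.1 h], fun h => by linarith [h1.2 h, h2.2 h]⟩

theorem color {j : ℕ} (hj : j < γ.P) :
    (γ.v (2 * j + 1) ∈ G.white ∧ G.Arrow (γ.v (2 * j + 1)) (γ.v (2 * j)) ∧
      G.Arrow (γ.v (2 * j + 1)) (γ.v (2 * j + 2))) ∨
    (γ.v (2 * j + 1) ∈ G.black ∧ G.Arrow (γ.v (2 * j)) (γ.v (2 * j + 1)) ∧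
      G.Arrow (γ.v (2 * j + 2)) (γ.v (2 * j + 1))) := by
  have f1 := γ.isFace j hj.le
  have f2 := γ.isFace (j + 1) hj
  rw [show 2 * (j + 1) = 2 * j + 2 by ring] at f2
  have hb : ∀ {x y}, x ∈ G.face → G.Arrow x y → y ∈ G.black := fun hx h =>
    h.cases.elim (fun h => absurd hx (white_not_face h.1)) fun h => h.2
  have hw : ∀ {x y}, x ∈ G.face → G.Arrow y x → y ∈ G.white := fun hx h =>
    h.cases.elim (fun h => h.1) fun h => absurd hx (black_not_face h.2)
  rcases γ.adj (2 * j) (by omega) with h | h <;>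
    rcases γ.adj (2 * j + 1) (by omega) with h' | h'
  · exact absurd (hb f1 h) (white_not_black (hw f2 h'))
  · exact Or.inr ⟨hb f1 h, h, h'⟩
  · exact Or.inl ⟨hw f1 h, h, h'⟩
  · exact absurd (hb f2 h') (white_not_black (hw f1 h))

theorem v_even {j : ℕ} (hj : j < γ.P) :
    γ.v (2 * j) = γ.v (2 * j + 1) - Complex.exp (γ.φ (2 * j) * Complex.I) := by
  rw [← γ.step _ (by omega)]; ring

theorem v_even_add_two {j : ℕ} (hj : j < γ.P) :
    γ.v (2 * j + 2) = γ.v (2 * j + 1) + Complex.exp (γ.φ (2 * j + 1) * Complex.I) := by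
  rw [← γ.step _ (by omega)]; ring

theorem abs_angle_sub_lt {i j : ℕ} (hi : i < 2 * γ.P) (hj : j < 2 * γ.P) :
    |γ.φ i - γ.φ j| < Real.pi := by
  have h1 := γ.angle i hi
  have h2 := γ.angle j hj
  rw [abs_lt]; constructor <;> linarith

/-- An edge from an earlier white to a later black vertex of the path. -/
theorem steps_of_edge {t : Rhombus} (ht : t ∈ G.tiles) {m n : ℕ} (hmn : m < n) (hn : n ≤ 2 * γ.P)
    (hw : t.w = γ.v m) (hb : t.b = γ.v n) : n = m + 2 ∧
      ((t.er = Complex.exp (γ.φ m * Complex.I) ∧ t.el = Complex.exp (γ.φ (m + 1) * Complex.I)) ∨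
      (t.el = Complex.exp (γ.φ m * Complex.I) ∧ t.er = Complex.exp (γ.φ (m + 1) * Complex.I))) := by
  have hD := divisor_edge ht
  rw [hw, hb] at hD
  have hD0 : ∀ e, 0 ≤ G.divisor (γ.v m) (γ.v n) e := fun e => by
    rw [hD, Finsupp.add_apply, Finsupp.single_apply, Finsupp.single_apply]
    split_ifs <;> norm_num
  -- The divisor of an edge from white to black has no negative part, and steps do not cancel, so
  -- every step follows the orientation; the degrees then leave room for exactly two steps.
  have al : ∀ j, m ≤ j → j < n → G.Arrow (γ.v j) (γ.v (j + 1)) := by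
    intro j h1 h2
    refine (γ.adj j (by omega)).resolve_right fun h => ?_
    have h3 := γ.dot_step (j := j) (by omega)
    have h4 := (γ.divisor_le_of_mem h1 h2 hn (γ.v j - γ.v (j + 1))).2 (by
      rw [← neg_sub, dot_neg_left]; linarith)
    rw [divisor_symm h.left_mem h.right_mem, h.divisor, Finsupp.neg_apply,
      Finsupp.single_eq_same] at h4
    linarith [hD0 (γ.v j - γ.v (j + 1))]
  have hdeg : ∀ j, m ≤ j → j ≤ n → G.deg (γ.v j) = G.deg (γ.v m) + (j - m : ℤ) := by
    intro j h1
    induction j, h1 using Nat.le_induction with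
    | base => simp
    | succ j h1 ih =>
      intro h2
      rw [(al j h1 (by omega)).deg, ih (by omega)]
      push_cast; ring
  have h1 := hdeg n hmn.le le_rfl
  rw [← hw, ← hb, deg_white ⟨t, ht, rfl⟩, deg_black ⟨t, ht, rfl⟩] at h1
  have h2 : n = m + 2 := by omega
  subst h2
  have s1 := γ.step m (by omega)
  have s2 := γ.step (m + 1) (by omega)
  refine ⟨rfl, ?_⟩
  have h3 := (γ.divisor_le_of_mem le_rfl hmn hn (γ.v (m + 1) - γ.v m)).1
    (γ.dot_step (by omega)).le
  rw [(al m le_rfl hmn).divisor, Finsupp.single_eq_same, hD, Finsupp.add_apply] at h3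
  have h4 : t.er + t.el = (γ.v (m + 1) - γ.v m) + (γ.v (m + 1 + 1) - γ.v (m + 1)) := by
    rw [show γ.v (m + 1 + 1) = γ.v (m + 2) from rfl, ← hb, t.b_eq, ← hw]; ring
  rw [← s1, ← s2]
  by_cases h5 : t.er = γ.v (m + 1) - γ.v m
  · exact Or.inl ⟨h5, by rw [h5] at h4; exact add_left_cancel h4⟩
  · rw [Finsupp.single_eq_of_ne (Ne.symm h5), zero_add, Finsupp.single_apply] at h3
    have h6 : t.el = γ.v (m + 1) - γ.v m := by
      by_contra h
      rw [if_neg h] at h3; norm_num at h3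
    exact Or.inr ⟨h6, by rw [h6, add_comm] at h4; exact add_left_cancel h4⟩

/-- An edge from a later white to an earlier black vertex of the path. -/
theorem steps_of_edge' {t : Rhombus} (ht : t ∈ G.tiles) {m n : ℕ} (hmn : m < n) (hn : n ≤ 2 * γ.P)
    (hw : t.w = γ.v n) (hb : t.b = γ.v m) : n = m + 2 ∧
      ((t.er = -Complex.exp (γ.φ m * Complex.I) ∧ t.el = -Complex.exp (γ.φ (m + 1) * Complex.I)) ∨
      (t.el = -Complex.exp (γ.φ m * Complex.I) ∧
        t.er = -Complex.exp (γ.φ (m + 1) * Complex.I))) := by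
  have hD := divisor_edge ht
  rw [divisor_symm (black_mem ht) (white_mem ht), hw, hb, neg_eq_iff_eq_neg] at hD
  have hD0 : ∀ e, G.divisor (γ.v m) (γ.v n) e ≤ 0 := fun e => by
    rw [hD, Finsupp.neg_apply, Finsupp.add_apply, Finsupp.single_apply, Finsupp.single_apply]
    split_ifs <;> norm_num
  have al : ∀ j, m ≤ j → j < n → G.Arrow (γ.v (j + 1)) (γ.v j) := by
    intro j h1 h2
    refine (γ.adj j (by omega)).resolve_left fun h => ?_
    have h3 := γ.dot_step (j := j) (by omega)
    have h4 := (γ.divisor_le_of_mem h1 h2 hn (γ.v (j + 1) - γ.v j)).1 h3.le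
    rw [h.divisor, Finsupp.single_eq_same] at h4
    linarith [hD0 (γ.v (j + 1) - γ.v j)]
  have hdeg : ∀ j, m ≤ j → j ≤ n → G.deg (γ.v j) = G.deg (γ.v m) - (j - m : ℤ) := by
    intro j h1
    induction j, h1 using Nat.le_induction with
    | base => simp
    | succ j h1 ih =>
      intro h2
      have := (al j h1 (by omega)).deg
      rw [ih (by omega)] at this
      push_cast; linarith
  have h1 := hdeg n hmn.le le_rfl
  rw [← hw, ← hb, deg_white ⟨t, ht, rfl⟩, deg_black ⟨t, ht, rfl⟩] at h1
  have h2 : n = m + 2 := by omega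
  subst h2
  have s1 := γ.step m (by omega)
  have s2 := γ.step (m + 1) (by omega)
  refine ⟨rfl, ?_⟩
  have a1 := al m le_rfl hmn
  have h3 := (γ.divisor_le_of_mem le_rfl hmn hn (γ.v m - γ.v (m + 1))).2 (by
    rw [← neg_sub, dot_neg_left]; linarith [γ.dot_step (j := m) (by omega)])
  rw [divisor_symm a1.left_mem a1.right_mem, a1.divisor, Finsupp.neg_apply,
    Finsupp.single_eq_same, hD, Finsupp.neg_apply, neg_le_neg_iff, Finsupp.add_apply] at h3
  have h4 : t.er + t.el = (γ.v m - γ.v (m + 1)) + (γ.v (m + 1) - γ.v (m + 1 + 1)) := by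
    rw [show γ.v (m + 1 + 1) = γ.v (m + 2) from rfl, ← hw, ← hb, t.b_eq]; ring
  rw [← s1, ← s2, neg_sub, neg_sub]
  by_cases h5 : t.er = γ.v m - γ.v (m + 1)
  · exact Or.inl ⟨h5, by rw [h5] at h4; exact add_left_cancel h4⟩
  · rw [Finsupp.single_eq_of_ne (Ne.symm h5), zero_add, Finsupp.single_apply] at h3
    have h6 : t.el = γ.v m - γ.v (m + 1) := by
      by_contra h
      rw [if_neg h] at h3; norm_num at h3
    exact Or.inr ⟨h6, by rw [h6, add_comm] at h4; exact add_left_cancel h4⟩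

/-- The left edges at a white and the right edges at a black vertex of the path are distinct. -/
theorem fan_disjoint_blackFan {j k : ℕ} (hj : j < γ.P) (hk : k < γ.P) {t : Rhombus}
    (h₁ : t ∈ G.fan (γ.v (2 * k + 1)) (γ.φ (2 * k + 1)) (γ.φ (2 * k) + Real.pi))
    (h₂ : t ∈ G.blackFan (γ.v (2 * j + 1)) (γ.φ (2 * j)) (γ.φ (2 * j + 1) + Real.pi)) : False := by
  obtain ⟨ht, hw, a, c, hac, ha, hc, h3, h4⟩ := mem_fan.1 h₁
  obtain ⟨-, hb, a', c', hac', ha', hc', h3', h4'⟩ := mem_blackFan.1 h₂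
  have hπ := Real.pi_pos
  have hne : k ≠ j := by
    rintro rfl
    exact G.white_ne_black t ht t ht (hw.trans hb.symm)
  rcases hne.lt_or_gt with hlt | hlt
  -- A common tile joins two path vertices, so its sides are two consecutive steps. In either order
  -- one angle lift is then off by 2π from a path angle, too much for the window of the fan.
  · obtain ⟨e, ⟨h5, h6⟩ | ⟨h5, h6⟩⟩ := γ.steps_of_edge ht (by omega) (by omega) hw hb
    · have e' : 2 * k + 1 + 1 = 2 * j := by omega
      rw [e'] at h6
      have h7 := Complex.add_two_pi_le_of_exp_eq (hc'.symm.trans h6) (by linarith)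
      have h8 := abs_lt.1 (γ.abs_angle_sub_lt (i := 2 * j) (j := 2 * j + 1) (by omega) (by omega))
      linarith [h8.1]
    · have h7 := Complex.add_two_pi_le_of_exp_eq (hc.symm.trans h5) (by linarith)
      have h8 := abs_lt.1 (γ.abs_angle_sub_lt (i := 2 * k) (j := 2 * k + 1) (by omega) (by omega))
      linarith [h8.2]
  · obtain ⟨e, ⟨h5, h6⟩ | ⟨h5, h6⟩⟩ := γ.steps_of_edge' ht (by omega) (by omega) hw hb
    · rw [← exp_add_pi] at h5
      have h7 := Complex.add_two_pi_le_of_exp_eq (h5.symm.trans ha') (by linarith)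
      have h8 := abs_lt.1 (γ.abs_angle_sub_lt (i := 2 * j) (j := 2 * j + 1) (by omega) (by omega))
      linarith [h8.1]
    · rw [← exp_add_pi, show 2 * j + 1 + 1 = 2 * k by omega] at h6
      have h7 := Complex.add_two_pi_le_of_exp_eq (h6.symm.trans ha) (by linarith)
      have h8 := abs_lt.1 (γ.abs_angle_sub_lt (i := 2 * k) (j := 2 * k + 1) (by omega) (by omega))
      linarith [h8.2]

end StraightPath

end IsoradialGraph

/-! ### Matrix elements of the kernel on the path as ray integrals. -/

open Asymptotics in
/-- The ray may be turned until it is orthogonal to a direction separating it from the poles. -/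
theorem RayDecay.rayIntegral_eq_of_dot_pos {h : ℂ → ℂ} {S : Finset ℂ} (hh : RayDecay h S)
    {u d d' : ℂ} (hd : dot d u < 0) (hd' : dot d' u = 0) (hd0 : d' ≠ 0)
    (hS : ∀ s ∈ S, 0 < dot s u) : rayIntegral h d = rayIntegral h d' := by
  refine hh.rayIntegral_eq_segment fun s h0 h1 => ?_
  have e : dot (d + s * (d' - d)) u = (1 - s) * dot d u := by
    rw [dot_add_left, dot_mul_left, dot_sub_left, hd']; ring
  refine ⟨fun h => ?_, fun τ hτ hs => ?_⟩
  · rcases h1.lt_or_eq with h1 | rfl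
    · rw [h] at e
      have : (1 - s) * dot d u < 0 := mul_neg_of_pos_of_neg (by linarith) hd
      simp [dot] at e
      rcases e with e | e
      · linarith
      · simp only [dot] at hd; linarith
    · apply hd0; rw [← h]; push_cast; ring
  · have h2 := hS _ hs
    rw [dot_mul_left, e] at h2
    have h3 : (1 - s) * dot d u ≤ 0 := mul_nonpos_of_nonneg_of_nonpos (by linarith) hd.le
    have := mul_nonpos_of_nonneg_of_nonpos hτ.le h3
    linarith

namespace IsoradialGraph

variable {G : IsoradialGraph}

namespace StraightPath

variable {θ₀ : ℝ} {F F' : ℂ} (γ : G.StraightPath θ₀ F F')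

/-- The tiles of the zipper at a white vertex of the path. -/
noncomputable def leftFan (j : ℕ) : Finset Rhombus :=
  G.fan (γ.v (2 * j + 1)) (γ.φ (2 * j + 1)) (γ.φ (2 * j) + Real.pi)

/-- The tiles of the zipper at a black vertex of the path. -/
noncomputable def rightFan (j : ℕ) : Finset Rhombus :=
  G.blackFan (γ.v (2 * j + 1)) (γ.φ (2 * j)) (γ.φ (2 * j + 1) + Real.pi)

open Classical in
/-- The left factor of the matrix elements of the kernel in the spectral variable. -/
noncomputable def rowSymbol (j : ℕ) (y z : ℂ) : ℂ :=
  if γ.v (2 * j + 1) ∈ G.white then G.dexp (γ.v (2 * j + 1)) y z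
  else Complex.I * (G.dexp (γ.v (2 * j + 2)) y z - G.dexp (γ.v (2 * j)) y z)

open Classical in
noncomputable def rowPoles (j : ℕ) (y : ℂ) : Finset ℂ :=
  if γ.v (2 * j + 1) ∈ G.white then G.poles (γ.v (2 * j + 1)) y
  else G.poles (γ.v (2 * j + 2)) y ∪ G.poles (γ.v (2 * j)) y

open Classical in
/-- The matrix elements of the kernel in the spectral variable. -/
noncomputable def pairSymbol (j k : ℕ) (z : ℂ) : ℂ :=
  if γ.v (2 * k + 1) ∈ G.white then
    Complex.I * (γ.rowSymbol j (γ.v (2 * k)) z - γ.rowSymbol j (γ.v (2 * k + 2)) z)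
  else γ.rowSymbol j (γ.v (2 * k + 1)) z

open Classical in
-- All three vertices around the odd vertex k are admitted whatever its colour; the superset still
-- lies off the normal line of the path.
noncomputable def pairPoles (j k : ℕ) : Finset ℂ :=
  (Finset.range 3).biUnion fun i => γ.rowPoles j (γ.v (2 * k + i))

open Classical in
/-- The functional of the factorized kernel, applied to a point mass. -/
noncomputable def row (j : ℕ) (b : ℂ) : ℂ :=
  if γ.v (2 * j + 1) ∈ G.white then G.cauchyKernel (γ.v (2 * j + 1)) b
  else ∑ t ∈ γ.rightFan j, t.weight * G.cauchyKernel t.w b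

open Classical in
/-- The matrix elements of the kernel on the path. -/
noncomputable def entry (j k : ℕ) : ℂ :=
  if γ.v (2 * k + 1) ∈ G.white then ∑ t ∈ γ.leftFan k, t.weight * γ.row j t.b
  else γ.row j (γ.v (2 * k + 1))

section

variable {γ} {j : ℕ} (hj : j < γ.P) (hw : γ.v (2 * j + 1) ∈ G.white)
include hj hw

theorem arrow_white : G.Arrow (γ.v (2 * j + 1)) (γ.v (2 * j)) ∧
    G.Arrow (γ.v (2 * j + 1)) (γ.v (2 * j + 2)) :=
  (γ.color hj).elim (fun h => h.2) fun h => absurd h.1 (white_not_black hw)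

omit hw in
theorem left_lt : γ.φ (2 * j + 1) < γ.φ (2 * j) + Real.pi ∧
    γ.φ (2 * j) + Real.pi ≤ γ.φ (2 * j + 1) + 2 * Real.pi := by
  have := abs_lt.1 (γ.abs_angle_sub_lt (i := 2 * j) (j := 2 * j + 1) (by omega) (by omega))
  constructor <;> linarith

theorem left_arrows :
    γ.v (2 * j) = γ.v (2 * j + 1) + Complex.exp ((γ.φ (2 * j) + Real.pi : ℝ) * Complex.I) ∧
    G.Arrow (γ.v (2 * j + 1)) (γ.v (2 * j + 1) + Complex.exp (γ.φ (2 * j + 1) * Complex.I)) ∧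
    G.Arrow (γ.v (2 * j + 1))
      (γ.v (2 * j + 1) + Complex.exp ((γ.φ (2 * j) + Real.pi : ℝ) * Complex.I)) := by
  have e1 : γ.v (2 * j) =
      γ.v (2 * j + 1) + Complex.exp ((γ.φ (2 * j) + Real.pi : ℝ) * Complex.I) := by
    rw [exp_add_pi, γ.v_even hj]; ring
  have h := arrow_white hj hw
  exact ⟨e1, γ.v_even_add_two hj ▸ h.2, e1 ▸ h.1⟩

theorem star_leftFan {x z : ℂ} (hx : x ∈ G.vertex) (hz : ‖z‖ ≠ 1) :
    ∑ t ∈ γ.leftFan j, t.weight * G.dexp x t.b z =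
      Complex.I * (G.dexp x (γ.v (2 * j)) z - G.dexp x (γ.v (2 * j + 2)) z) := by
  have h1 := left_arrows hj hw
  have h2 := left_lt hj
  rw [leftFan, star_fan hx hw h2.1 h2.2 h1.2.1 h1.2.2 hz, ← h1.1, ← γ.v_even_add_two hj]

end

section

variable {γ} {j : ℕ} (hj : j < γ.P) (hw : γ.v (2 * j + 1) ∉ G.white)
include hj hw

theorem black_of_not_white : γ.v (2 * j + 1) ∈ G.black :=
  (γ.color hj).elim (fun h => absurd h.1 hw) fun h => h.1

theorem arrow_black : G.Arrow (γ.v (2 * j)) (γ.v (2 * j + 1)) ∧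
    G.Arrow (γ.v (2 * j + 2)) (γ.v (2 * j + 1)) :=
  (γ.color hj).elim (fun h => absurd h.1 hw) fun h => h.2

omit hw in
theorem right_lt : γ.φ (2 * j) < γ.φ (2 * j + 1) + Real.pi ∧
    γ.φ (2 * j + 1) + Real.pi ≤ γ.φ (2 * j) + 2 * Real.pi := by
  have := abs_lt.1 (γ.abs_angle_sub_lt (i := 2 * j) (j := 2 * j + 1) (by omega) (by omega))
  constructor <;> linarith

theorem right_arrows : γ.v (2 * j + 2) =
      γ.v (2 * j + 1) - Complex.exp ((γ.φ (2 * j + 1) + Real.pi : ℝ) * Complex.I) ∧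
    G.Arrow (γ.v (2 * j + 1) - Complex.exp (γ.φ (2 * j) * Complex.I)) (γ.v (2 * j + 1)) ∧
    G.Arrow (γ.v (2 * j + 1) - Complex.exp ((γ.φ (2 * j + 1) + Real.pi : ℝ) * Complex.I))
      (γ.v (2 * j + 1)) := by
  have e1 : γ.v (2 * j + 2) =
      γ.v (2 * j + 1) - Complex.exp ((γ.φ (2 * j + 1) + Real.pi : ℝ) * Complex.I) := by
    rw [exp_add_pi, γ.v_even_add_two hj]; ring
  have h := arrow_black hj hw
  exact ⟨e1, γ.v_even hj ▸ h.1, e1 ▸ h.2⟩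

theorem star_rightFan {y z : ℂ} (hy : y ∈ G.vertex) (hz : ‖z‖ ≠ 1) :
    ∑ t ∈ γ.rightFan j, t.weight * G.dexp t.w y z = γ.rowSymbol j y z := by
  have h1 := right_arrows hj hw
  have h2 := right_lt hj
  rw [rightFan, star_blackFan (black_of_not_white hj hw) h2.1 h2.2 h1.2.1 h1.2.2 hy hz, ← h1.1,
    ← γ.v_even hj, rowSymbol, if_neg hw]

theorem rowSymbol_self : γ.rowSymbol j (γ.v (2 * j + 1)) = fun z => Complex.I *
    (1 / (z - Complex.exp ((γ.φ (2 * j + 1) + Real.pi : ℝ) * Complex.I)) -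
      1 / (z - Complex.exp (γ.φ (2 * j) * Complex.I))) := by
  funext z
  have h1 := right_arrows hj hw
  have h2 := arrow_black hj hw
  rw [rowSymbol, if_neg hw, h2.1.dexp, h2.2.dexp, h1.1, γ.v_even hj, sub_sub_cancel, sub_sub_cancel]

theorem row_self : γ.row j (γ.v (2 * j + 1)) =
    1 / (2 * Real.pi) * ((γ.φ (2 * j + 1) + Real.pi : ℝ) - γ.φ (2 * j)) := by
  have h1 := right_arrows hj hw
  have h2 := right_lt hj
  rw [row, if_neg hw, ← sum_blackFan_dexp_self (black_of_not_white hj hw) h2.1 h2.2 h1.2.1 h1.2.2,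
    Finset.mul_sum]
  refine Finset.sum_congr rfl fun t _ => ?_
  rw [cauchyKernel]; ring

end

/-- At a black path vertex the rays of the right fan are moved to that vertex and the symbols
telescope. At b equal to this vertex the common ray would have no direction. -/
theorem row_eq {ε : ℝ} (hε : 0 < ε) (hG : ∀ t ∈ G.tiles, 2 * ε ≤ t.sine) {j : ℕ} (hj : j < γ.P)
    {b : ℂ} (hb : b ∈ G.black) (hne : b ≠ γ.v (2 * j + 1)) :
    γ.row j b = 1 / (2 * Real.pi) * rayIntegral (γ.rowSymbol j b) (γ.v (2 * j + 1) - b) := by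
  by_cases hw : γ.v (2 * j + 1) ∈ G.white
  · rw [row, if_pos hw, cauchyKernel]
    congr 1
    refine rayIntegral_congr fun z _ => ?_
    rw [rowSymbol, if_pos hw]
  · have h1 := right_arrows hj hw
    have h2 := right_lt hj
    have h3 := sum_blackFan_dexp (black_of_not_white hj hw) h2.1 h2.2 h1.2.1 h1.2.2 hε hG hb hne
    rw [row, if_neg hw]
    rw [← h1.1, ← γ.v_even hj] at h3
    rw [show γ.rowSymbol j b = fun z => Complex.I *
      (G.dexp (γ.v (2 * j + 2)) b z - G.dexp (γ.v (2 * j)) b z) from funext fun z => by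
        rw [rowSymbol, if_neg hw], ← h3, Finset.mul_sum]
    refine Finset.sum_congr rfl fun t _ => ?_
    rw [cauchyKernel]; ring

variable {γ} in
theorem mem_rowPoles {j : ℕ} {y e : ℂ} (h : e ∈ γ.rowPoles j y) :
    (γ.v (2 * j + 1) ∈ G.white ∧ e ∈ G.poles (γ.v (2 * j + 1)) y) ∨
      (γ.v (2 * j + 1) ∉ G.white ∧
        (e ∈ G.poles (γ.v (2 * j + 2)) y ∨ e ∈ G.poles (γ.v (2 * j)) y)) := by
  rw [rowPoles] at h
  split_ifs at h with hw
  · exact Or.inl ⟨hw, h⟩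
  · exact Or.inr ⟨hw, Finset.mem_union.1 h⟩

theorem zero_notMem_rowPoles {j : ℕ} {y : ℂ} : (0 : ℂ) ∉ γ.rowPoles j y := fun h => by
  rcases mem_rowPoles h with ⟨-, h⟩ | ⟨-, h | h⟩ <;> exact zero_notMem_poles h

theorem differentiableAt_rowSymbol {j : ℕ} {y z : ℂ} (hz : z ∉ γ.rowPoles j y) :
    DifferentiableAt ℂ (γ.rowSymbol j y) z := by
  rw [rowPoles] at hz
  unfold rowSymbol
  split_ifs at hz ⊢ with hw
  · exact differentiableAt_dexp hz
  · rw [Finset.mem_union, not_or] at hz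
    exact ((differentiableAt_dexp hz.1).sub (differentiableAt_dexp hz.2)).const_mul _

open Asymptotics in
-- In the black case the two terms, running from faces to b, decay only like 1/z each. The quadratic
-- decay is seen on the sum over the fan before telescoping.
theorem isBigO_rowSymbol {j : ℕ} (hj : j < γ.P) {b : ℂ} (hb : b ∈ G.black) :
    γ.rowSymbol j b =O[Bornology.cobounded ℂ] fun z => (z ^ 2)⁻¹ := by
  have hbv := black_vertex hb
  by_cases hw : γ.v (2 * j + 1) ∈ G.white
  · rw [show γ.rowSymbol j b = G.dexp (γ.v (2 * j + 1)) b from funext fun z => by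
      rw [rowSymbol, if_pos hw]]
    exact (rayDecay_dexp (white_vertex hw) hbv (by rw [deg_black hb, deg_white hw]; rfl)).decay
  · refine IsBigO.congr' (f₁ := fun z => ∑ t ∈ γ.rightFan j, t.weight * G.dexp t.w b z)
      (IsBigO.fun_sum fun t ht => IsBigO.const_mul_left ?_ _) ?_ Filter.EventuallyEq.rfl
    · have ht' := (mem_blackFan.1 ht).1
      exact (rayDecay_dexp (white_mem ht') hbv
        (by rw [deg_black hb, deg_white ⟨t, ht', rfl⟩]; rfl)).decay
    · filter_upwards [tendsto_norm_cobounded_atTop.eventually_ne_atTop 1] with z hz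
      exact star_rightFan hj hw hbv hz

theorem rayDecay_rowSymbol {j : ℕ} (hj : j < γ.P) {b : ℂ} (hb : b ∈ G.black) :
    RayDecay (γ.rowSymbol j b) (γ.rowPoles j b) :=
  ⟨γ.zero_notMem_rowPoles, fun _ hz => γ.differentiableAt_rowSymbol hz, γ.isBigO_rowSymbol hj hb⟩

variable {γ} in
theorem sum_leftFan_rowSymbol {j k : ℕ} (hj : j < γ.P) (hk : k < γ.P)
    (hw : γ.v (2 * k + 1) ∈ G.white) {z : ℂ} (hz : ‖z‖ ≠ 1) :
    ∑ t ∈ γ.leftFan k, t.weight * γ.rowSymbol j t.b z = γ.pairSymbol j k z := by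
  rw [pairSymbol, if_pos hw]
  unfold rowSymbol
  split_ifs with h
  · exact star_leftFan hk hw (white_vertex h) hz
  · have h1 := star_leftFan hk hw (γ.vertex_mem (by omega : 2 * j + 2 ≤ 2 * γ.P)) hz
    have h2 := star_leftFan hk hw (γ.vertex_mem (by omega : 2 * j ≤ 2 * γ.P)) hz
    rw [show Complex.I * (Complex.I * (G.dexp (γ.v (2 * j + 2)) (γ.v (2 * k)) z -
        G.dexp (γ.v (2 * j)) (γ.v (2 * k)) z) - Complex.I * (G.dexp (γ.v (2 * j + 2))
        (γ.v (2 * k + 2)) z - G.dexp (γ.v (2 * j)) (γ.v (2 * k + 2)) z)) =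
      Complex.I * (Complex.I * (G.dexp (γ.v (2 * j + 2)) (γ.v (2 * k)) z -
        G.dexp (γ.v (2 * j + 2)) (γ.v (2 * k + 2)) z) - Complex.I * (G.dexp (γ.v (2 * j))
        (γ.v (2 * k)) z - G.dexp (γ.v (2 * j)) (γ.v (2 * k + 2)) z)) by ring, ← h1, ← h2,
      ← Finset.sum_sub_distrib, Finset.mul_sum]
    exact Finset.sum_congr rfl fun t _ => by ring

theorem mem_pairPoles {j k : ℕ} {e : ℂ} (h : e ∈ γ.pairPoles j k) :
    ∃ i < 3, ∃ i' < 3, e ∈ G.poles (γ.v (2 * j + i)) (γ.v (2 * k + i')) := by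
  rw [pairPoles, Finset.mem_biUnion] at h
  obtain ⟨i', hi', h⟩ := h
  rw [Finset.mem_range] at hi'
  rcases mem_rowPoles h with ⟨-, h⟩ | ⟨-, h | h⟩
  · exact ⟨1, by norm_num, i', hi', h⟩
  · exact ⟨2, by norm_num, i', hi', h⟩
  · exact ⟨0, by norm_num, i', hi', h⟩

open Asymptotics in
theorem rayDecay_pairSymbol {j k : ℕ} (hj : j < γ.P) (hk : k < γ.P) :
    RayDecay (γ.pairSymbol j k) (γ.pairPoles j k) := by
  refine ⟨fun h => ?_, fun z hz => ?_, ?_⟩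
  · obtain ⟨i, -, i', -, h⟩ := γ.mem_pairPoles h
    exact zero_notMem_poles h
  · simp only [pairPoles, Finset.mem_biUnion, not_exists, not_and, Finset.mem_range] at hz
    have h0 := γ.differentiableAt_rowSymbol (hz 0 (by norm_num))
    have h1 := γ.differentiableAt_rowSymbol (hz 1 (by norm_num))
    have h2 := γ.differentiableAt_rowSymbol (hz 2 (by norm_num))
    unfold pairSymbol
    split_ifs
    · exact (h0.sub h2).const_mul _
    · exact h1
  · by_cases hw : γ.v (2 * k + 1) ∈ G.white
    · refine IsBigO.congr' (f₁ := fun z => ∑ t ∈ γ.leftFan k, t.weight * γ.rowSymbol j t.b z)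
        (IsBigO.fun_sum fun t ht => IsBigO.const_mul_left
          (γ.isBigO_rowSymbol hj ⟨t, (mem_fan.1 ht).1, rfl⟩) _) ?_ Filter.EventuallyEq.rfl
      filter_upwards [tendsto_norm_cobounded_atTop.eventually_ne_atTop 1] with z hz
      exact sum_leftFan_rowSymbol hj hk hw hz
    · rw [show γ.pairSymbol j k = γ.rowSymbol j (γ.v (2 * k + 1)) from funext fun z => by
        rw [pairSymbol, if_neg hw]]
      exact γ.isBigO_rowSymbol hj (black_of_not_white hk hw)

/-- An edge of the zipper at a white vertex, seen from another odd vertex of the path. -/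
theorem row_edge {ε : ℝ} (hε : 0 < ε) (hG : ∀ t ∈ G.tiles, 2 * ε ≤ t.sine) {j k : ℕ}
    (hj : j < γ.P) (hk : k < γ.P) (hjk : j ≠ k) {t : Rhombus} (ht : t ∈ γ.leftFan k) :
    γ.row j t.b = 1 / (2 * Real.pi) *
        rayIntegral (γ.rowSymbol j t.b) (γ.v (2 * j + 1) - γ.v (2 * k + 1)) ∧
      ∃ S, RayDecay (γ.rowSymbol j t.b) S ∧ RayFree S (γ.v (2 * j + 1) - γ.v (2 * k + 1)) := by
  obtain ⟨ht', hwt, -⟩ := mem_fan.1 ht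
  have hb : t.b ∈ G.black := ⟨t, ht', rfl⟩
  by_cases hne : t.b = γ.v (2 * j + 1)
  · have hw : γ.v (2 * j + 1) ∉ G.white := fun h => white_not_black h (hne ▸ hb)
    have h1 := right_arrows hj hw
    have h2 := right_lt hj
    -- The edge ends at the black path vertex itself. Since it is not in the right fan, it lies in
    -- the complementary sector, and its diagonal sees the two poles of the symbol under the angle
    -- of the right fan, which is the value of `row_self`.
    obtain ⟨a, c, hac, ha, hc, h3, h4⟩ : ∃ a c : ℝ, a < c ∧ t.er = Complex.exp (a * Complex.I) ∧
        t.el = Complex.exp (c * Complex.I) ∧ γ.φ (2 * j + 1) + Real.pi ≤ a ∧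
        c ≤ γ.φ (2 * j) + 2 * Real.pi := by
      have hsw : t.swap ∈ G.swap.tiles := swap_mem_swap_tiles.2 ht'
      have h5 := mem_fan_or hsw (α := γ.φ (2 * j) + Real.pi)
        (β := γ.φ (2 * j + 1) + Real.pi + Real.pi)
        (by rw [swap_arrow, Rhombus.swap_w, hne, exp_add_pi, ← sub_eq_add_neg]; exact h1.2.1)
        (by rw [swap_arrow, Rhombus.swap_w, hne, exp_add_pi, ← sub_eq_add_neg]; exact h1.2.2)
      rw [Rhombus.swap_w, hne] at h5
      rcases h5 with h5 | h5
      · have h6 : t ∈ γ.rightFan j := by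
          rw [rightFan, blackFan]
          exact Finset.mem_map.2 ⟨t.swap, h5, t.swap_swap⟩
        exact (γ.fan_disjoint_blackFan hj hk ht h6).elim
      · have h6 : t ∈ G.blackFan (γ.v (2 * j + 1)) (γ.φ (2 * j + 1) + Real.pi)
            (γ.φ (2 * j) + 2 * Real.pi) := by
          rw [blackFan]
          refine Finset.mem_map.2 ⟨t.swap, ?_, t.swap_swap⟩
          rw [show γ.φ (2 * j) + 2 * Real.pi + Real.pi = γ.φ (2 * j) + Real.pi + 2 * Real.pi by ring]
          exact h5
        exact (mem_blackFan.1 h6).2.2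
    have hπ := Real.pi_pos
    have hca : c < a + Real.pi := by
      have h5 := t.sine_pos
      rw [Rhombus.sine, ha, hc, cross_exp] at h5
      by_contra hn
      have h6 := Real.sin_nonneg_of_nonneg_of_le_pi (x := c - a - Real.pi) (by linarith)
        (by linarith)
      rw [Real.sin_sub_pi] at h6
      linarith
    have hcos : 0 < Real.cos ((c - a) / 2) := Real.cos_pos_of_mem_Ioo ⟨by linarith, by linarith⟩
    have e : γ.v (2 * j + 1) - γ.v (2 * k + 1) = ((2 * Real.cos ((c - a) / 2) : ℝ) : ℂ) *
        Complex.exp (((a + c) / 2 : ℝ) * Complex.I) := by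
      rw [← hne, ← hwt, t.b_eq, ← exp_add_exp, ← ha, ← hc]; ring
    have m1 : (a + c) / 2 - γ.φ (2 * j) ∈ Set.Ioo 0 (2 * Real.pi) := ⟨by linarith, by linarith⟩
    have m2 : (a + c) / 2 - (γ.φ (2 * j + 1) + Real.pi) ∈ Set.Ioo 0 (2 * Real.pi) :=
      ⟨by linarith, by linarith⟩
    rw [hne, rowSymbol_self hj hw]
    refine ⟨?_, _, rayDecay_pole_sub (Complex.exp_ne_zero _) (Complex.exp_ne_zero _), ?_⟩
    · rw [e, rayIntegral_scale _ _ (by positivity), rayIntegral_pole_sub m1 m2, row_self hj hw]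
    · have h7 := rayFree_pair m1 m2
      rw [e]
      refine ⟨mul_ne_zero (by exact_mod_cast (by positivity : (2 * Real.cos ((c - a) / 2)) ≠ 0)) h7.1,
        fun τ hτ => ?_⟩
      rw [← mul_assoc, ← Complex.ofReal_mul]
      exact h7.2 _ (by positivity)
  -- Every pole belongs to a discrete exponential from the path vertex or from a face with an arrow
  -- to it, the two cases allowed in `ray_ne`.
  · have hS : ∀ e ∈ γ.rowPoles j t.b, ∃ v ∈ G.vertex,
        (v = γ.v (2 * j + 1) ∨ G.Arrow v (γ.v (2 * j + 1))) ∧ v ≠ t.w ∧ e ∈ G.poles v t.b := by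
      intro e he
      rcases mem_rowPoles he with ⟨hw, he⟩ | ⟨hw, he | he⟩
      · exact ⟨_, white_vertex hw, Or.inl rfl,
          hwt ▸ γ.v_ne (by omega) (by omega) (by omega), he⟩
      · exact ⟨_, γ.vertex_mem (by omega), Or.inr (arrow_black hj hw).2,
          hwt ▸ γ.v_ne (by omega) (by omega) (by omega), he⟩
      · exact ⟨_, γ.vertex_mem (by omega), Or.inr (arrow_black hj hw).1,
          hwt ▸ γ.v_ne (by omega) (by omega) (by omega), he⟩
    have h1 := rayIntegral_edge_move hε hG (γ.rayDecay_rowSymbol hj hb) ht'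
      (γ.vertex_mem (by omega)) hS (hwt ▸ γ.v_ne (by omega) (by omega) (by omega)) (Ne.symm hne)
    rw [hwt] at h1
    exact ⟨by rw [γ.row_eq hε hG hj hb hne, h1.1], _, γ.rayDecay_rowSymbol hj hb, h1.2⟩

theorem entry_eq_of_ne {ε : ℝ} (hε : 0 < ε) (hG : ∀ t ∈ G.tiles, 2 * ε ≤ t.sine) {j k : ℕ}
    (hj : j < γ.P) (hk : k < γ.P) (hjk : j ≠ k) : γ.entry j k = 1 / (2 * Real.pi) *
      rayIntegral (γ.pairSymbol j k) (γ.v (2 * j + 1) - γ.v (2 * k + 1)) := by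
  by_cases hw : γ.v (2 * k + 1) ∈ G.white
  · rw [entry, if_pos hw, ← sum_fan_rayIntegral
      (fun t ht => (γ.row_edge hε hG hj hk hjk (t := t) ht).2)
      fun z hz => sum_leftFan_rowSymbol hj hk hw hz, Finset.mul_sum]
    refine Finset.sum_congr rfl fun t ht => ?_
    rw [(γ.row_edge hε hG hj hk hjk ht).1]; ring
  · rw [entry, if_neg hw, γ.row_eq hε hG hj (black_of_not_white hk hw)
      (γ.v_ne (by omega) (by omega) (by omega))]
    congr 2
    funext z
    rw [pairSymbol, if_neg hw]

/-- For j < k all poles have positive e^{iθ₀}-component while the ray direction has a negative one,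
and for j > k the signs are reversed. So the ray can be turned to either normal direction, and off
the diagonal the two normals give the same value. -/
theorem entry_eq_of_dot {ε : ℝ} (hε : 0 < ε) (hG : ∀ t ∈ G.tiles, 2 * ε ≤ t.sine) {j k : ℕ}
    (hj : j < γ.P) (hk : k < γ.P) (hjk : j ≠ k) {d : ℂ} (hd : d ≠ 0)
    (hd0 : dot d (Complex.exp (θ₀ * Complex.I)) = 0) : γ.entry j k = 1 / (2 * Real.pi) *
      rayIntegral (γ.pairSymbol j k) d := by
  rw [γ.entry_eq_of_ne hε hG hj hk hjk]
  congr 1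
  have hneg : ∀ a u : ℂ, dot a (-u) = -dot a u := fun a u => by simp [dot]; ring
  rcases hjk.lt_or_gt with h | h
  · refine (γ.rayDecay_pairSymbol hj hk).rayIntegral_eq_of_dot_pos
      (u := Complex.exp (θ₀ * Complex.I)) ?_ hd0 hd fun s hs => ?_
    · have := γ.dot_pos (i := 2 * j + 1) (j := 2 * k + 1) (by omega) (by omega)
      rw [← neg_sub, dot_neg_left]; linarith
    · obtain ⟨i, hi, i', hi', hs⟩ := γ.mem_pairPoles hs
      exact γ.dot_pos_of_mem_poles (by omega) (by omega) hs
  · refine (γ.rayDecay_pairSymbol hj hk).rayIntegral_eq_of_dot_pos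
      (u := -Complex.exp (θ₀ * Complex.I)) ?_ (by rw [hneg, hd0, neg_zero]) hd fun s hs => ?_
    · have := γ.dot_pos (i := 2 * k + 1) (j := 2 * j + 1) (by omega) (by omega)
      rw [hneg]; linarith
    · obtain ⟨i, hi, i', hi', hs⟩ := γ.mem_pairPoles hs
      have := γ.dot_neg_of_mem_poles (by omega) (by omega) hs
      rw [hneg]; linarith

/-- On the diagonal both colours give one pole at a step and one at a reversed step, and the entry
is the angle of the fan divided by 2π. -/
theorem pairSymbol_self {j : ℕ} (hj : j < γ.P) : ∃ φ₁ φ₂ : ℝ,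
    (θ₀ - Real.pi / 2 < φ₁ ∧ φ₁ < θ₀ + Real.pi / 2) ∧
    (θ₀ - Real.pi / 2 < φ₂ ∧ φ₂ < θ₀ + Real.pi / 2) ∧
    (γ.pairSymbol j j = fun z => Complex.I *
      (1 / (z - Complex.exp ((φ₁ + Real.pi : ℝ) * Complex.I)) -
        1 / (z - Complex.exp (φ₂ * Complex.I)))) ∧
    γ.entry j j = 1 / (2 * Real.pi) * ((φ₁ + Real.pi : ℝ) - φ₂) := by
  by_cases hw : γ.v (2 * j + 1) ∈ G.white
  · refine ⟨γ.φ (2 * j), γ.φ (2 * j + 1), γ.angle _ (by omega), γ.angle _ (by omega), ?_, ?_⟩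
    · funext z
      have h1 := left_arrows hj hw
      have h2 := arrow_white hj hw
      simp only [pairSymbol, rowSymbol, if_pos hw]
      rw [h2.1.dexp, h2.2.dexp, h1.1, γ.v_even_add_two hj, add_sub_cancel_left, add_sub_cancel_left]
    · have h1 := left_arrows hj hw
      have h2 := left_lt hj
      rw [entry, if_pos hw, ← sum_fan_dexp_self hw h2.1 h2.2 h1.2.1 h1.2.2, Finset.mul_sum]
      refine Finset.sum_congr rfl fun t _ => ?_
      rw [row, if_pos hw, cauchyKernel]; ring
  · refine ⟨γ.φ (2 * j + 1), γ.φ (2 * j), γ.angle _ (by omega), γ.angle _ (by omega), ?_, ?_⟩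
    · rw [← rowSymbol_self hj hw]
      funext z
      rw [pairSymbol, if_neg hw]
    · rw [entry, if_neg hw, row_self hj hw]

theorem neg_I_mul_exp (θ : ℝ) : -Complex.I * Complex.exp (θ * Complex.I) =
    Complex.exp ((θ + 3 * Real.pi / 2 : ℝ) * Complex.I) := by
  have h : Complex.exp ((3 * Real.pi / 2 : ℝ) * Complex.I) = -Complex.I := by
    rw [show (3 * Real.pi / 2 : ℝ) = Real.pi / 2 + Real.pi by ring, exp_add_pi]
    push_cast
    rw [Complex.exp_pi_div_two_mul_I]
  rw [Complex.ofReal_add, add_mul, Complex.exp_add, h, mul_comm]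

theorem I_mul_exp (θ : ℝ) : Complex.I * Complex.exp (θ * Complex.I) =
    Complex.exp ((θ + Real.pi / 2 : ℝ) * Complex.I) := by
  push_cast
  rw [add_mul, Complex.exp_add, Complex.exp_pi_div_two_mul_I, mul_comm]

theorem rayFree_pairPoles {j k : ℕ} (hj : j < γ.P) (hk : k < γ.P) {d : ℂ} (hd : d ≠ 0)
    (hd0 : dot d (Complex.exp (θ₀ * Complex.I)) = 0) : RayFree (γ.pairPoles j k) d := by
  refine ⟨hd, fun τ _ h => ?_⟩
  obtain ⟨i, hi, i', hi', hs⟩ := γ.mem_pairPoles h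
  have h0 : dot (τ * d) (Complex.exp (θ₀ * Complex.I)) = 0 := by rw [dot_mul_left, hd0, mul_zero]
  rcases le_total (2 * j + i) (2 * k + i') with h1 | h1
  · exact (γ.dot_pos_of_mem_poles h1 (by omega) hs).ne' h0
  · exact (γ.dot_neg_of_mem_poles h1 (by omega) hs).ne h0

theorem dot_right (θ : ℝ) :
    dot (-Complex.I * Complex.exp (θ * Complex.I)) (Complex.exp (θ * Complex.I)) = 0 := by
  rw [neg_I_mul_exp, dot_exp, show θ + 3 * Real.pi / 2 - θ = Real.pi / 2 + Real.pi by ring,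
    Real.cos_add_pi, Real.cos_pi_div_two, neg_zero]

theorem dot_left (θ : ℝ) :
    dot (Complex.I * Complex.exp (θ * Complex.I)) (Complex.exp (θ * Complex.I)) = 0 := by
  rw [I_mul_exp, dot_exp, add_sub_cancel_left, Real.cos_pi_div_two]

section

variable {ε : ℝ} (hε : 0 < ε) (hG : ∀ t ∈ G.tiles, 2 * ε ≤ t.sine) {j k : ℕ} (hj : j < γ.P)
  (hk : k < γ.P)
include hε hG hj hk

/-- The matrix elements as integrals along the ray to the right of the path. -/
theorem entry_eq_right : γ.entry j k = 1 / (2 * Real.pi) *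
    rayIntegral (γ.pairSymbol j k) (-Complex.I * Complex.exp (θ₀ * Complex.I)) := by
  have hπ := Real.pi_pos
  by_cases hjk : j = k
  · subst hjk
    obtain ⟨φ₁, φ₂, h1, h2, h3, h4⟩ := γ.pairSymbol_self hj
    rw [h3, h4, neg_I_mul_exp, rayIntegral_pole_sub ⟨by linarith, by linarith⟩
      ⟨by linarith, by linarith⟩]
  · exact γ.entry_eq_of_dot hε hG hj hk hjk
      (mul_ne_zero (neg_ne_zero.2 Complex.I_ne_zero) (Complex.exp_ne_zero _)) (dot_right θ₀)

/-- The matrix elements as integrals along the ray to the left of the path. -/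
theorem entry_eq_left : γ.entry j k - (if j = k then 1 else 0) = 1 / (2 * Real.pi) *
    rayIntegral (γ.pairSymbol j k) (Complex.I * Complex.exp (θ₀ * Complex.I)) := by
  have hπ := Real.pi_pos
  by_cases hjk : j = k
  · subst hjk
    obtain ⟨φ₁, φ₂, h1, h2, h3, h4⟩ := γ.pairSymbol_self hj
    have e : ∀ x : ℝ, Complex.exp (x * Complex.I) =
        Complex.exp ((x + 2 * Real.pi : ℝ) * Complex.I) := fun x => by
      push_cast; rw [add_mul, Complex.exp_add, Complex.exp_two_pi_mul_I, mul_one]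
    -- Lifting the ray and the pole φ₂ by 2π brings both differences into (0, 2π). The integral is
    -- then the fan angle minus 2π, which accounts for the subtracted 1.
    rw [h3, h4, I_mul_exp, e (θ₀ + Real.pi / 2), e φ₂, rayIntegral_pole_sub
      ⟨by linarith, by linarith⟩ ⟨by linarith, by linarith⟩, if_pos rfl]
    have hπ' : (Real.pi : ℂ) ≠ 0 := by exact_mod_cast hπ.ne'
    push_cast
    field_simp
    ring
  · rw [if_neg hjk, sub_zero]
    exact γ.entry_eq_of_dot hε hG hj hk hjk
      (mul_ne_zero Complex.I_ne_zero (Complex.exp_ne_zero _)) (dot_left θ₀)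

end

end StraightPath

end IsoradialGraph

/-! ### Factorization of the symbols and of the kernel; traces. -/

namespace IsoradialGraph

variable {G : IsoradialGraph}

namespace StraightPath

variable {θ₀ : ℝ} {F F' : ℂ} (γ : G.StraightPath θ₀ F F')

open Classical in
/-- The right factor of the matrix elements of the kernel in the spectral variable. -/
noncomputable def colSymbol (k : ℕ) (x z : ℂ) : ℂ :=
  if γ.v (2 * k + 1) ∈ G.white then
    Complex.I * (G.dexp x (γ.v (2 * k)) z - G.dexp x (γ.v (2 * k + 2)) z)
  else G.dexp x (γ.v (2 * k + 1)) z

include γ in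
theorem start_vertex : F ∈ G.vertex := by
  have := γ.vertex_mem (Nat.zero_le _)
  rwa [γ.start] at this

theorem rowSymbol_mul {j : ℕ} (hj : j < γ.P) {y z : ℂ} (hy : y ∈ G.vertex) (hz : ‖z‖ ≠ 1) :
    γ.rowSymbol j y z = γ.rowSymbol j F z * G.dexp F y z := by
  have hF := γ.start_vertex
  unfold rowSymbol
  split_ifs
  · exact (dexp_mul (γ.vertex_mem (by omega)) hF hy hz).symm
  · rw [← dexp_mul (γ.vertex_mem (by omega : 2 * j + 2 ≤ 2 * γ.P)) hF hy hz,
      ← dexp_mul (γ.vertex_mem (by omega : 2 * j ≤ 2 * γ.P)) hF hy hz]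
    ring

/-- Routing both discrete exponentials through F makes the matrix of symbols of rank one at every z.
-/
theorem pairSymbol_eq {j k : ℕ} (hj : j < γ.P) (hk : k < γ.P) {z : ℂ} (hz : ‖z‖ ≠ 1) :
    γ.pairSymbol j k z = γ.rowSymbol j F z * γ.colSymbol k F z := by
  unfold pairSymbol colSymbol
  split_ifs
  · rw [γ.rowSymbol_mul hj (γ.vertex_mem (by omega)) hz,
      γ.rowSymbol_mul hj (γ.vertex_mem (by omega : 2 * k + 2 ≤ 2 * γ.P)) hz]
    ring
  · rw [γ.rowSymbol_mul hj (γ.vertex_mem (by omega)) hz]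

/-- An identity of Christoffel–Darboux type: the product at one odd vertex is the increment, over
the two steps there, of the ratio of the discrete exponentials at z and z'. Its sum over j
telescopes from F to F'. -/
theorem colSymbol_mul_rowSymbol {j : ℕ} (hj : j < γ.P) {z z' : ℂ} (hz : ‖z‖ ≠ 1) (hz' : ‖z'‖ ≠ 1)
    (hzz : z ≠ z') : γ.colSymbol j F z * γ.rowSymbol j F z' = Complex.I / (z' - z) *
      (G.dexp F (γ.v (2 * j)) z / G.dexp F (γ.v (2 * j)) z' -
        G.dexp F (γ.v (2 * (j + 1))) z / G.dexp F (γ.v (2 * (j + 1))) z') := by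
  have hF := γ.start_vertex
  have hv : ∀ i, i ≤ 2 * γ.P → γ.v i ∈ G.vertex := fun i hi => γ.vertex_mem hi
  have hsub : z' - z ≠ 0 := sub_ne_zero.2 hzz.symm
  have hstep : ∀ {x y ζ : ℂ}, ‖ζ‖ ≠ 1 → G.Arrow x y → ζ - (y - x) ≠ 0 := by
    intro x y ζ hζ h h0
    obtain ⟨t, -, hs⟩ := h.exists_side
    rw [sub_eq_zero] at h0
    exact hζ (h0 ▸ hs.norm)
  have hE : ∀ {x y ζ : ℂ}, ‖ζ‖ ≠ 1 → G.Arrow x y →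
      G.dexp F y ζ = G.dexp F x ζ / (ζ - (y - x)) := by
    intro x y ζ hζ h
    rw [← dexp_mul hF h.left_mem h.right_mem hζ, h.dexp]; ring
  rw [show 2 * (j + 1) = 2 * j + 2 by ring]
  unfold colSymbol rowSymbol
  split_ifs with hw
  · obtain ⟨h1, h2⟩ := arrow_white hj hw
    have n1 := hstep hz h1
    have n2 := hstep hz h2
    have n1' := hstep hz' h1
    have n2' := hstep hz' h2
    have n3 := dexp_ne_zero (G := G) (x := F) (y := γ.v (2 * j + 1)) hz'
    rw [dexp_symm hF h1.left_mem, hE hz h1, hE hz h2, hE hz' h1, hE hz' h2]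
    field_simp
    ring
  · obtain ⟨h1, h2⟩ := arrow_black hj hw
    have n1 := hstep hz h1
    have n2 := hstep hz h2
    have n1' := hstep hz' h1
    have n2' := hstep hz' h2
    have n3 := dexp_ne_zero (G := G) (x := F) (y := γ.v (2 * j + 1)) hz'
    have e : ∀ {x y ζ : ℂ}, ‖ζ‖ ≠ 1 → G.Arrow x y →
        G.dexp F x ζ = G.dexp F y ζ * (ζ - (y - x)) := fun hζ h => by
      rw [hE hζ h, div_mul_cancel₀ _ (hstep hζ h)]
    rw [dexp_symm hF h1.left_mem, dexp_symm hF h2.left_mem, e hz h1, e hz h2, e hz' h1, e hz' h2]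
    field_simp
    ring

/-- The pairing of the two factors at different spectral parameters. -/
theorem sum_colSymbol_mul_rowSymbol {z z' : ℂ} (hz : ‖z‖ ≠ 1) (hz' : ‖z'‖ ≠ 1) (hzz : z ≠ z') :
    ∑ j : Fin γ.P, γ.colSymbol j F z * γ.rowSymbol j F z' =
      -Complex.I * ((1 - G.dexp F F' z / G.dexp F F' z') / (z - z')) := by
  rw [Fin.sum_univ_eq_sum_range (fun j => γ.colSymbol j F z * γ.rowSymbol j F z') γ.P,
    Finset.sum_congr rfl fun j hj => γ.colSymbol_mul_rowSymbol (Finset.mem_range.1 hj) hz hz' hzz,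
    ← Finset.mul_sum, Finset.sum_range_sub' (fun j => G.dexp F (γ.v (2 * j)) z /
      G.dexp F (γ.v (2 * j)) z'), mul_zero, γ.start, γ.finish, dexp_self γ.start_vertex,
    dexp_self γ.start_vertex, ← neg_sub z z']
  rw [div_neg]
  ring

open Classical in
/-- The tiles of the zipper at an odd vertex of the path. -/
noncomputable def zipperFan (j : ℕ) : Finset Rhombus :=
  if γ.v (2 * j + 1) ∈ G.white then γ.leftFan j else γ.rightFan j

open Classical in
noncomputable def zipperFinset : Finset Rhombus :=
  (Finset.range γ.P).biUnion γ.zipperFan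

theorem mem_zipperFinset {t : Rhombus} : t ∈ γ.zipperFinset ↔ t ∈ γ.zipper := by
  classical
  rw [zipperFinset, Finset.mem_biUnion]
  constructor
  · rintro ⟨j, hj, h⟩
    rw [Finset.mem_range] at hj
    rw [zipperFan] at h
    split_ifs at h with hw
    · obtain ⟨h1, h2, a, c, h3, h4, h5, h6, h7⟩ := mem_fan.1 h
      exact ⟨h1, j, hj, a, c, h3, h4, h5, Or.inl ⟨h2, h6, h7⟩⟩
    · obtain ⟨h1, h2, a, c, h3, h4, h5, h6, h7⟩ := mem_blackFan.1 h
      exact ⟨h1, j, hj, a, c, h3, h4, h5, Or.inr ⟨h2, h6, h7⟩⟩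
  · rintro ⟨h1, j, hj, a, c, h3, h4, h5, ⟨h2, h6, h7⟩ | ⟨h2, h6, h7⟩⟩
    · have hw : γ.v (2 * j + 1) ∈ G.white := ⟨t, h1, h2⟩
      refine ⟨j, Finset.mem_range.2 hj, ?_⟩
      rw [zipperFan, if_pos hw]
      exact mem_fan.2 ⟨h1, h2, a, c, h3, h4, h5, h6, h7⟩
    · have hw : γ.v (2 * j + 1) ∉ G.white := fun h => white_not_black h ⟨t, h1, h2⟩
      refine ⟨j, Finset.mem_range.2 hj, ?_⟩
      rw [zipperFan, if_neg hw]
      exact mem_blackFan.2 ⟨h1, h2, a, c, h3, h4, h5, h6, h7⟩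

theorem zipperFan_disjoint :
    (Finset.range γ.P : Set ℕ).PairwiseDisjoint γ.zipperFan := by
  intro j hj k hk hjk
  rw [Finset.coe_range, Set.mem_Iio] at hj hk
  rw [Function.onFun, Finset.disjoint_left]
  intro t h h'
  rw [zipperFan] at h h'
  have hne := γ.v_ne (i := 2 * j + 1) (j := 2 * k + 1) (by omega) (by omega) (by omega)
  split_ifs at h h'
  · exact hne ((mem_fan.1 h).2.1.symm.trans (mem_fan.1 h').2.1)
  · exact γ.fan_disjoint_blackFan hk hj h h'
  · exact γ.fan_disjoint_blackFan hj hk h' h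
  · exact hne ((mem_blackFan.1 h).2.1.symm.trans (mem_blackFan.1 h').2.1)

open Classical in
/-- The columns of the factorized kernel. -/
noncomputable def col (j : Fin γ.P) : G.black →₀ ℂ :=
  if h : γ.v (2 * j + 1) ∈ G.white then
    ∑ t : γ.leftFan j, Finsupp.single ⟨t.1.b, t.1, (mem_fan.1 t.2).1, rfl⟩ t.1.weight
  else Finsupp.single ⟨γ.v (2 * j + 1), black_of_not_white j.2 h⟩ 1

/-- The zipper is the disjoint union of the fans at the odd vertices. A left fan has a common white
end and a right fan a common black end, so each contributes a matrix of rank one. -/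
theorem kernelColumn_apply (hG : G.Regular) {C : G.white → G.black → ℂ} (hC : G.IsInverse C)
    (b' : G.black) : γ.kernelColumn C b' = ∑ j : Fin γ.P, γ.row j b' • γ.col j := by
  classical
  ext b
  change ∑ᶠ w : G.white, γ.dbarZip b w * C w b' = _
  rw [finsum_white_eq (G := G) (b := b) (Φ := fun w => γ.dbarZip b w * C w b')
    (T := γ.zipperFinset.filter fun t => t.b = b) (Ψ := fun t => t.weight * G.cauchyKernel t.w b')]
  · rw [Finset.sum_filter, zipperFinset, Finset.sum_biUnion γ.zipperFan_disjoint,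
      ← Fin.sum_univ_eq_sum_range (fun j => ∑ t ∈ γ.zipperFan j,
        if t.b = b then t.weight * G.cauchyKernel t.w b' else 0), Finsupp.finsetSum_apply]
    refine Finset.sum_congr rfl fun j _ => ?_
    rw [Finsupp.smul_apply, smul_eq_mul, zipperFan, row, col]
    split_ifs with hw
    · rw [Finsupp.finsetSum_apply, ← (γ.leftFan j).sum_coe_sort, Finset.mul_sum]
      refine Finset.sum_congr rfl fun t _ => ?_
      rw [Finsupp.single_apply, (mem_fan.1 t.2).2.1]
      simp only [Subtype.ext_iff, mul_ite, mul_zero]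
      congr 1
      ring
    · rw [Finsupp.single_apply, Finset.sum_mul]
      refine Finset.sum_congr rfl fun t ht => ?_
      rw [(mem_blackFan.1 ht).2.1]
      simp only [Subtype.ext_iff, mul_ite, mul_zero, mul_one]
  · intro t ht
    rw [Finset.mem_filter, mem_zipperFinset] at ht
    exact ⟨ht.1.1, ht.2⟩
  · intro t ht hw
    rw [Finset.mem_filter, mem_zipperFinset] at ht
    obtain ⟨h1, h2⟩ := ht
    have hb : t.b ∈ G.black := ⟨t, h1.1, rfl⟩
    obtain rfl : b = ⟨t.b, hb⟩ := Subtype.ext h2.symm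
    rw [dbarZip, if_pos ⟨t, h1, rfl, rfl⟩, dbar_tile h1.1 hb hw, hC.eq_cauchyKernel hG]
  · intro w hw
    have h1 := left_ne_zero_of_mul hw
    rw [dbarZip] at h1
    split_ifs at h1 with h2
    · obtain ⟨t, ht, h3, h4⟩ := h2
      exact ⟨t, Finset.mem_filter.2 ⟨γ.mem_zipperFinset.2 ht, h3⟩, h4⟩
    · exact absurd rfl h1

/-- The kernel factors through the functions on the path: the first factor. -/
noncomputable def analysisMap : (G.black →₀ ℂ) →ₗ[ℂ] (Fin γ.P → ℂ) :=
  Finsupp.linearCombination ℂ fun b : G.black => fun j : Fin γ.P => γ.row j b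

/-- The kernel factors through the functions on the path: the second factor. -/
noncomputable def synthesisMap : (Fin γ.P → ℂ) →ₗ[ℂ] (G.black →₀ ℂ) :=
  Fintype.linearCombination ℂ γ.col

theorem kernel_eq (hG : G.Regular) {C : G.white → G.black → ℂ} (hC : G.IsInverse C) :
    γ.kernel C = γ.synthesisMap ∘ₗ γ.analysisMap := by
  refine Finsupp.lhom_ext' fun b => LinearMap.ext_ring ?_
  simp only [LinearMap.comp_apply, Finsupp.lsingle_apply, kernel, analysisMap, synthesisMap,
    Finsupp.linearCombination_single, one_smul, Fintype.linearCombination_apply]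
  exact γ.kernelColumn_apply hG hC b

/-- The matrix of the kernel on the path. -/
noncomputable def pathMatrix : Matrix (Fin γ.P) (Fin γ.P) ℂ := fun j k => γ.entry j k

theorem analysisMap_comp_synthesisMap :
    γ.analysisMap ∘ₗ γ.synthesisMap = Matrix.toLin' γ.pathMatrix := by
  refine LinearMap.pi_ext' fun k => LinearMap.ext_ring ?_
  funext j
  rw [LinearMap.comp_apply, LinearMap.comp_apply, LinearMap.comp_apply, LinearMap.coe_single,
    Matrix.toLin'_apply, Matrix.mulVec_single_one, synthesisMap,
    Fintype.linearCombination_apply_single, one_smul, Matrix.col_apply, pathMatrix, entry, col]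
  split_ifs with hw
  · rw [map_sum, Finset.sum_apply, ← (γ.leftFan k).sum_coe_sort]
    refine Finset.sum_congr rfl fun t _ => ?_
    rw [analysisMap, Finsupp.linearCombination_single, Pi.smul_apply, smul_eq_mul]
  · rw [analysisMap, Finsupp.linearCombination_single, one_smul]

end StraightPath

/-- The range of S is supported in one finite set U, so the diagonal sum is finite and tr SR = tr RS
is an exchange of sums. -/
theorem trace_comp {ι : Type*} [Fintype ι] [DecidableEq ι] (S : (ι → ℂ) →ₗ[ℂ] (G.black →₀ ℂ))
    (R : (G.black →₀ ℂ) →ₗ[ℂ] (ι → ℂ)) :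
    IsoradialGraph.trace (S ∘ₗ R) = LinearMap.trace ℂ (ι → ℂ) (R ∘ₗ S) := by
  classical
  have h1 : ∀ x : ι → ℂ, S x = ∑ i, x i • S (Pi.single i 1) := fun x => by
    conv_lhs => rw [pi_eq_sum_univ' x]
    rw [map_sum]
    exact Finset.sum_congr rfl fun i _ => by rw [map_smul]
  set U : Finset G.black := Finset.univ.biUnion fun i : ι => (S (Pi.single i 1)).support with hU
  have h2 : ∀ i, R (S (Pi.single i 1)) i =
      ∑ b ∈ U, S (Pi.single i 1) b * R (Finsupp.single b 1) i := fun i => by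
    have h3 : S (Pi.single i 1) = ∑ b ∈ U, S (Pi.single i 1) b • Finsupp.single b 1 := by
      conv_lhs => rw [← (S (Pi.single i 1)).sum_single]
      rw [Finsupp.sum_of_support_subset _ (s := U)
        (Finset.subset_biUnion_of_mem (fun i : ι => (S (Pi.single i 1)).support) (Finset.mem_univ i))
        _ fun _ _ => Finsupp.single_zero _]
      simp
    conv_lhs => rw [h3]
    rw [map_sum, Finset.sum_apply]
    simp only [map_smul, Pi.smul_apply, smul_eq_mul]
  rw [IsoradialGraph.trace, LinearMap.trace_eq_matrix_trace ℂ (Pi.basisFun ℂ ι), Matrix.trace,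
    finsum_eq_sum_of_support_subset _ (s := U)]
  · have e : ∀ i, Matrix.diag (LinearMap.toMatrix (Pi.basisFun ℂ ι) (Pi.basisFun ℂ ι) (R ∘ₗ S)) i =
        R (S (Pi.single i 1)) i := fun i => by
      simp
    simp only [e, h2]
    rw [Finset.sum_comm]
    refine Finset.sum_congr rfl fun b _ => ?_
    rw [LinearMap.comp_apply, h1, Finsupp.finsetSum_apply]
    exact Finset.sum_congr rfl fun i _ => by rw [Finsupp.smul_apply, smul_eq_mul, mul_comm]
  · intro b hb
    rw [Function.mem_support, LinearMap.comp_apply, h1, Finsupp.finsetSum_apply] at hb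
    obtain ⟨i, -, hi⟩ := Finset.exists_ne_zero_of_sum_ne_zero hb
    rw [Finsupp.smul_apply] at hi
    rw [hU, Finset.coe_biUnion]
    exact Set.mem_biUnion (Finset.mem_coe.2 (Finset.mem_univ i))
      (Finsupp.mem_support_iff.2 (right_ne_zero_of_mul hi))

/-- Cyclicity of the trace for powers of a map through a finite-dimensional space. -/
theorem trace_pow_comp {ι : Type*} [Fintype ι] [DecidableEq ι]
    (S : (ι → ℂ) →ₗ[ℂ] (G.black →₀ ℂ)) (R : (G.black →₀ ℂ) →ₗ[ℂ] (ι → ℂ))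
    (Y : Module.End ℂ (ι → ℂ)) {n : ℕ} (hn : 1 ≤ n) :
    IsoradialGraph.trace ((S ∘ₗ Y ∘ₗ R : Module.End ℂ (G.black →₀ ℂ)) ^ n) =
      LinearMap.trace ℂ (ι → ℂ) (((R ∘ₗ S) * Y) ^ n) := by
  have key : ∀ m : ℕ, (S ∘ₗ Y ∘ₗ R : Module.End ℂ (G.black →₀ ℂ)) ^ (m + 1) =
      (S ∘ₗ Y) ∘ₗ ((((R ∘ₗ S) * Y) ^ m : Module.End ℂ (ι → ℂ)) ∘ₗ R) := by
    intro m
    induction m with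
    | zero => rw [zero_add, pow_one, pow_zero]; rfl
    | succ m ih =>
      rw [pow_succ', ih, pow_succ']
      rfl
  obtain ⟨m, rfl⟩ := Nat.exists_eq_add_of_le' hn
  rw [key, trace_comp, pow_succ]
  rfl

end IsoradialGraph

/-! ### From the trace to the multiple integral. -/

theorem List.prod_ofFn_apply {ι : Type*} [Fintype ι] [DecidableEq ι] {m : ℕ}
    (X : Fin (m + 1) → Matrix ι ι ℂ) (a b : ι) : (List.ofFn X).prod a b =
      ∑ g : Fin m → ι, ∏ i : Fin (m + 1),
        X i ((Fin.cons a g : Fin (m + 1) → ι) i) ((Fin.snoc g b : Fin (m + 1) → ι) i) := by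
  induction m generalizing a with
  | zero => simp [Fin.snoc]
  | succ m ih =>
    rw [List.ofFn_succ, List.prod_cons, Matrix.mul_apply]
    simp only [ih]
    rw [← (Fin.consEquiv fun _ : Fin (m + 1) => ι).sum_comp, Fintype.sum_prod_type]
    refine Finset.sum_congr rfl fun c _ => ?_
    rw [Finset.mul_sum]
    refine Finset.sum_congr rfl fun g _ => ?_
    rw [Fin.prod_univ_succ (n := m + 1)]
    change _ = X 0 a ((Fin.snoc (Fin.cons c g : Fin (m + 1) → ι) b : Fin (m + 2) → ι) 0) *
      ∏ i : Fin (m + 1), X i.succ ((Fin.cons c g : Fin (m + 1) → ι) i)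
        ((Fin.snoc (Fin.cons c g : Fin (m + 1) → ι) b : Fin (m + 2) → ι) i.succ)
    rw [← Fin.cons_snoc_eq_snoc_cons]
    rfl

/-- The trace of a product of matrices as a sum over closed paths of indices. -/
theorem Matrix.trace_prod_ofFn {ι : Type*} [Fintype ι] [DecidableEq ι] {m : ℕ}
    (hm : m ≠ 0) (X : Fin m → Matrix ι ι ℂ) : Matrix.trace (List.ofFn X).prod =
      ∑ f : Fin m → ι, ∏ i, X i (f i) (f (finRotate _ i)) := by
  obtain ⟨m, rfl⟩ := Nat.exists_eq_succ_of_ne_zero hm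
  rw [Matrix.trace, ← (Fin.consEquiv fun _ : Fin (m + 1) => ι).sum_comp, Fintype.sum_prod_type]
  refine Finset.sum_congr rfl fun a _ => ?_
  rw [Matrix.diag_apply, List.prod_ofFn_apply]
  refine Finset.sum_congr rfl fun g _ => Finset.prod_congr rfl fun i _ => ?_
  rw [Fin.snoc_eq_cons_rotate]
  rfl

theorem List.prod_ofFn_alternating {M : Type*} [Monoid M] (x y : M) (n : ℕ) :
    (List.ofFn fun i : Fin (2 * n) => if Even (i : ℕ) then x else y).prod = (x * y) ^ n := by
  induction n with
  | zero => simp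
  | succ n ih =>
    change (List.ofFn fun i : Fin (2 * n + 1 + 1) => if Even (i : ℕ) then x else y).prod = _
    rw [List.ofFn_succ, List.ofFn_succ, List.prod_cons, List.prod_cons, pow_succ', ← ih,
      ← mul_assoc]
    simp [Nat.even_add_one]

open MeasureTheory

/-- A trace of a product of matrices of integrals is a multiple integral. -/
theorem sum_prod_integral {ι : Type*} [Fintype ι] {m : ℕ} (s : Fin m → ι → ι → ℝ → ℂ)
    (hs : ∀ i a b, IntegrableOn (s i a b) (Set.Ioi 0)) (r : Fin m → Fin m) :
    IntegrableOn (fun t : Fin m → ℝ => ∑ f : Fin m → ι, ∏ i, s i (f i) (f (r i)) (t i))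
        (Set.univ.pi fun _ => Set.Ioi 0) ∧
      ∑ f : Fin m → ι, ∏ i, ∫ t in Set.Ioi 0, s i (f i) (f (r i)) t =
        ∫ t in Set.univ.pi fun _ => Set.Ioi 0, ∑ f : Fin m → ι, ∏ i, s i (f i) (f (r i)) (t i) := by
  have hμ : (volume : Measure (Fin m → ℝ)).restrict (Set.univ.pi fun _ => Set.Ioi 0) =
      Measure.pi fun _ => (volume : Measure ℝ).restrict (Set.Ioi 0) := by
    rw [volume_pi, Measure.restrict_pi_pi]
  have h1 : ∀ f : Fin m → ι, Integrable (fun t : Fin m → ℝ => ∏ i, s i (f i) (f (r i)) (t i))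
      (Measure.pi fun _ => (volume : Measure ℝ).restrict (Set.Ioi 0)) := fun f =>
    Integrable.fintype_prod fun i => hs i (f i) (f (r i))
  rw [IntegrableOn, hμ]
  refine ⟨integrable_finsetSum _ fun f _ => h1 f, ?_⟩
  rw [integral_finsetSum _ fun f _ => h1 f]
  exact Finset.sum_congr rfl fun f _ => (integral_fintype_prod_eq_prod _).symm

theorem ae_forall_ne (m : ℕ) (x : ℝ) : ∀ᵐ t : Fin m → ℝ, ∀ i, t i ≠ x := by
  rw [ae_all_iff]
  intro i
  rw [volume_pi]
  exact Measure.ae_eval_ne (μ := fun _ : Fin m => (volume : Measure ℝ)) i x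

/-- Rearranging a cyclic sum of products of factorized matrix elements. -/
theorem sum_prod_cyclic {ι : Type*} [Fintype ι] [DecidableEq ι] {m : ℕ} (A B : Fin m → ι → ℂ)
    (r : Equiv.Perm (Fin m)) : ∑ f : Fin m → ι, ∏ i, (A i (f i) * B i (f (r i))) =
      ∏ i, ∑ a, B i a * A (r i) a := by
  rw [Finset.prod_univ_sum, Fintype.piFinset_univ,
    ← (r.arrowCongr (Equiv.refl ι)).sum_comp]
  refine Finset.sum_congr rfl fun f _ => ?_
  rw [Finset.prod_mul_distrib, Finset.prod_mul_distrib, mul_comm,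
    ← Equiv.prod_comp r fun i => A i ((r.arrowCongr (Equiv.refl ι)) f i)]
  simp

theorem rayDir_even {θ : ℝ} {j : ℕ} (h : Even j) :
    rayDir θ j = -Complex.I * Complex.exp (θ * Complex.I) := if_pos h

theorem rayDir_odd {θ : ℝ} {j : ℕ} (h : ¬Even j) :
    rayDir θ j = Complex.I * Complex.exp (θ * Complex.I) := if_neg h

theorem norm_rayDir (θ : ℝ) (j : ℕ) : ‖rayDir θ j‖ = 1 := by
  unfold rayDir
  split_ifs <;> simp [Complex.norm_exp_ofReal_mul_I]

/-- The number of variables is even, so the direction flips also from the last to the first one.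
Cyclic neighbours lie on opposite rays, and no denominator vanishes. -/
theorem rayDir_finRotate (θ : ℝ) {n : ℕ} (j : Fin (2 * n)) :
    rayDir θ (finRotate _ j) = -rayDir θ j := by
  have h : Even ((finRotate _ j : Fin (2 * n)) : ℕ) ↔ ¬Even (j : ℕ) := by
    obtain ⟨k, rfl⟩ : ∃ k, n = k + 1 := ⟨n - 1, by have := j.2; omega⟩
    change Even ((finRotate (2 * k + 1 + 1) j : Fin (2 * k + 1 + 1)) : ℕ) ↔ _
    rw [coe_finRotate]
    split_ifs with hj
    · rw [hj, Fin.val_last]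
      simp
    · rw [Nat.even_add_one]
  by_cases hj : Even (j : ℕ)
  · rw [rayDir_even hj, rayDir_odd (fun h' => h.1 h' hj)]; ring
  · rw [rayDir_odd hj, rayDir_even (h.2 hj)]; ring

namespace IsoradialGraph

variable {G : IsoradialGraph} {θ₀ : ℝ} {F F' : ℂ}

namespace StraightPath

variable (γ : G.StraightPath θ₀ F F')

theorem rayFree_rayDir {j k : ℕ} (hj : j < γ.P) (hk : k < γ.P) (i : ℕ) :
    RayFree (γ.pairPoles j k) (rayDir θ₀ i) := by
  have h0 : rayDir θ₀ i ≠ 0 := norm_ne_zero_iff.1 (by rw [norm_rayDir]; norm_num)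
  refine γ.rayFree_pairPoles hj hk h0 ?_
  by_cases h : Even i
  · rw [rayDir_even h, dot_right]
  · rw [rayDir_odd h, dot_left]

/-- The trace as a multiple integral of the matrix elements. -/
theorem trace_eq_integral (hG : G.Regular) (p : G.LatticePath F F') {n : ℕ} (hn : 1 ≤ n) :
    IntegrableOn (alternatingIntegrand p.discreteExp θ₀ (2 * n))
        (Set.univ.pi fun _ => Set.Ioi (0 : ℝ)) ∧
      Matrix.trace ((γ.pathMatrix * (1 - γ.pathMatrix)) ^ n) =
        1 / (2 * (Real.pi : ℂ)) ^ (2 * n) *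
          ∫ t in Set.univ.pi fun _ => Set.Ioi (0 : ℝ),
            alternatingIntegrand p.discreteExp θ₀ (2 * n) t := by
  obtain ⟨ε, hε, hG'⟩ := hG.exists_sine
  set s : Fin (2 * n) → Fin γ.P → Fin γ.P → ℝ → ℂ := fun i j k t =>
    γ.pairSymbol j k (t * rayDir θ₀ i) * rayDir θ₀ i with hs
  have hint : ∀ i j k, IntegrableOn (s i j k) (Set.Ioi 0) := fun i j k =>
    (γ.rayDecay_pairSymbol j.2 k.2).integrableOn (γ.rayFree_rayDir j.2 k.2 i)
  obtain ⟨h1, h2⟩ := sum_prod_integral s hint (finRotate (2 * n))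
  -- Only almost everywhere: the factorizations of the symbols need |z| ≠ 1, that is, no t i equal
  -- to 1.
  have hae : ∀ᵐ t ∂(volume : Measure (Fin (2 * n) → ℝ)).restrict
      (Set.univ.pi fun _ => Set.Ioi (0 : ℝ)),
      ∑ f : Fin (2 * n) → Fin γ.P, ∏ i, s i (f i) (f (finRotate (2 * n) i)) (t i) =
        (-1) ^ n * alternatingIntegrand p.discreteExp θ₀ (2 * n) t := by
    filter_upwards [ae_restrict_of_ae (ae_forall_ne (2 * n) 1),
      ae_restrict_mem (MeasurableSet.univ_pi fun _ => measurableSet_Ioi)] with t ht ht0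
    simp only [Set.mem_pi, Set.mem_univ, true_implies, Set.mem_Ioi] at ht0
    set z : Fin (2 * n) → ℂ := fun j => (t j : ℂ) * rayDir θ₀ j with hz
    have hz1 : ∀ j, ‖z j‖ ≠ 1 := fun j => by
      rw [hz]
      simp only [norm_mul, norm_rayDir, Complex.norm_real, mul_one, Real.norm_eq_abs,
        abs_of_pos (ht0 j)]
      exact ht j
    have hzz : ∀ j, z j ≠ z (finRotate _ j) := fun j h => by
      simp only [hz, rayDir_finRotate] at h
      have h0 : rayDir θ₀ j ≠ 0 := norm_ne_zero_iff.1 (by rw [norm_rayDir]; norm_num)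
      rw [mul_neg, ← neg_mul] at h
      have h3 := mul_right_cancel₀ h0 h
      have h4 : t j = -t (finRotate _ j) := by exact_mod_cast h3
      linarith [ht0 j, ht0 (finRotate _ j)]
    have e1 : ∀ f : Fin (2 * n) → Fin γ.P, ∏ i, s i (f i) (f (finRotate (2 * n) i)) (t i) =
        (∏ i, (γ.rowSymbol (f i) F (z i) * γ.colSymbol (f (finRotate (2 * n) i)) F (z i))) *
          ∏ i : Fin (2 * n), rayDir θ₀ i := fun f => by
      rw [← Finset.prod_mul_distrib]
      exact Finset.prod_congr rfl fun i _ => by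
        rw [← γ.pairSymbol_eq (f i).2 (f (finRotate _ i)).2 (hz1 i)]
    simp only [e1]
    -- The sum over index cycles factors into pairings of neighbouring variables, each of which
    -- telescopes; the 2n factors -i give (-1)^n.
    rw [← Finset.sum_mul, sum_prod_cyclic (fun i (j : Fin γ.P) => γ.rowSymbol j F (z i))
      (fun i (j : Fin γ.P) => γ.colSymbol j F (z i)) (finRotate (2 * n)),
      Finset.prod_congr rfl fun i _ =>
        γ.sum_colSymbol_mul_rowSymbol (hz1 i) (hz1 (finRotate _ i)) (hzz i),
      Finset.prod_mul_distrib, Finset.prod_const, Finset.card_univ, Fintype.card_fin, pow_mul,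
      neg_sq, Complex.I_sq, alternatingIntegrand, cyclicIntegrand, mul_assoc]
    congr 2
    refine Finset.prod_congr rfl fun i _ => ?_
    have g1 := p.discreteExp_eq γ.start_vertex (hz1 i)
    have g2 := p.discreteExp_eq γ.start_vertex (hz1 (finRotate _ i))
    simp only [hz] at g1 g2
    rw [g1, g2]
  have hsq : ((-1 : ℂ) ^ n) * (-1) ^ n = 1 := by rw [← mul_pow]; norm_num
  refine ⟨?_, ?_⟩
  · refine (h1.const_mul ((-1) ^ n)).congr ?_
    filter_upwards [hae] with t ht
    rw [ht, ← mul_assoc, hsq, one_mul]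
  · have hM : (γ.pathMatrix * (1 - γ.pathMatrix)) ^ n =
        ((-1 : ℂ) ^ n) • (γ.pathMatrix * (γ.pathMatrix - 1)) ^ n := by
      rw [← smul_pow, neg_one_smul, ← mul_neg, neg_sub]
    -- Even factors are M, on the right ray, and odd factors are M - 1, on the left ray; this is why
    -- the rays alternate.
    have hX : ∀ (i : Fin (2 * n)) (a b : Fin γ.P),
        (if Even (i : ℕ) then γ.pathMatrix else γ.pathMatrix - 1) a b =
          1 / (2 * (Real.pi : ℂ)) * ∫ t in Set.Ioi 0, s i a b t := by
      intro i a b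
      by_cases hi : Even (i : ℕ)
      · rw [if_pos hi]
        simp only [hs, rayDir_even hi]
        exact γ.entry_eq_right hε hG' a.2 b.2
      · rw [if_neg hi]
        simp only [hs, rayDir_odd hi]
        rw [Matrix.sub_apply, Matrix.one_apply]
        have := γ.entry_eq_left hε hG' a.2 b.2
        simp only [← Fin.ext_iff] at this
        exact this
    rw [hM, ← List.prod_ofFn_alternating, Matrix.trace_smul, Matrix.trace_prod_ofFn (by omega)]
    simp only [hX, Finset.prod_mul_distrib, Finset.prod_const, Finset.card_univ, Fintype.card_fin]
    rw [← Finset.mul_sum, h2, integral_congr_ae hae, integral_const_mul, smul_eq_mul,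
      one_div_pow]
    linear_combination (1 / (2 * (Real.pi : ℂ)) ^ (2 * n) *
          ∫ t in Set.univ.pi fun _ => Set.Ioi (0 : ℝ),
            alternatingIntegrand p.discreteExp θ₀ (2 * n) t) * hsq

end StraightPath

end IsoradialGraph

theorem proposition2 (G : IsoradialGraph) (hG : G.Regular)
    (C : G.white → G.black → ℂ) (hC : G.IsInverse C)
    (θ₀ : ℝ) (F F' : ℂ) (γ : G.StraightPath θ₀ F F')
    (p : G.LatticePath F F') (n : ℕ) (hn : 1 ≤ n) :
    IsoradialGraph.trace ((γ.kernel C * (1 - γ.kernel C)) ^ n) =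
        ∑ j ∈ Finset.range (n + 1), (-1 : ℂ) ^ (n - j) * (n.choose j : ℂ) *
          IsoradialGraph.trace (γ.kernel C ^ (2 * n - j)) ∧
      MeasureTheory.IntegrableOn (alternatingIntegrand p.discreteExp θ₀ (2 * n))
        (Set.univ.pi fun _ => Set.Ioi (0 : ℝ)) ∧
      IsoradialGraph.trace ((γ.kernel C * (1 - γ.kernel C)) ^ n) =
        1 / (2 * (Real.pi : ℂ)) ^ (2 * n) *
          ∫ t in Set.univ.pi fun _ => Set.Ioi (0 : ℝ),
            alternatingIntegrand p.discreteExp θ₀ (2 * n) t := by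
  set M := γ.pathMatrix with hM
  set N : Module.End ℂ (Fin γ.P → ℂ) := Matrix.toLinAlgEquiv' M with hN
  have hK := γ.kernel_eq hG hC
  have hRS : γ.analysisMap ∘ₗ γ.synthesisMap = N := γ.analysisMap_comp_synthesisMap
  have hpow : ∀ m, 1 ≤ m → IsoradialGraph.trace (γ.kernel C ^ m) =
      LinearMap.trace ℂ (Fin γ.P → ℂ) (N ^ m) := fun m hm => by
    have := IsoradialGraph.trace_pow_comp γ.synthesisMap γ.analysisMap 1 hm
    rw [hRS, mul_one] at this
    rw [← this, hK]
    rfl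
  -- With K = SR one has K(1 - K) = S(1 - RS)R, again a map through the finite-dimensional space.
  have hK1 : IsoradialGraph.trace ((γ.kernel C * (1 - γ.kernel C)) ^ n) =
      LinearMap.trace ℂ (Fin γ.P → ℂ) ((N * (1 - N)) ^ n) := by
    have := IsoradialGraph.trace_pow_comp γ.synthesisMap γ.analysisMap (1 - N) hn
    rw [hRS] at this
    rw [← this]
    congr 2
    rw [hK, ← hRS]
    refine LinearMap.ext fun x => ?_
    change γ.synthesisMap (γ.analysisMap (x - γ.synthesisMap (γ.analysisMap x))) =
      γ.synthesisMap (γ.analysisMap x - γ.analysisMap (γ.synthesisMap (γ.analysisMap x)))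
    rw [map_sub γ.analysisMap]
  obtain ⟨h1, h2⟩ := γ.trace_eq_integral hG p hn
  refine ⟨?_, h1, ?_⟩
  · rw [hK1, ((Commute.one_right N).sub_right (Commute.refl N)).mul_pow, sub_eq_add_neg,
      (Commute.one_left (-N)).add_pow, Finset.mul_sum, map_sum]
    refine Finset.sum_congr rfl fun j hj => ?_
    have hj' := Finset.mem_range.1 hj
    have key : N ^ n * (1 ^ j * (-N) ^ (n - j) * (n.choose j : Module.End ℂ (Fin γ.P → ℂ))) =
        ((-1 : ℂ) ^ (n - j) * (n.choose j : ℂ)) • N ^ (2 * n - j) := by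
      rw [one_pow, one_mul, ← neg_one_smul ℂ N, smul_pow, ← map_natCast (algebraMap ℂ _),
        ← Algebra.commutes, ← Algebra.smul_def, smul_smul, mul_smul_comm, ← pow_add,
        show n + (n - j) = 2 * n - j by omega, mul_comm]
    -- The exponent 2n - j is at least n ≥ 1, as `hpow` requires: cyclicity of the trace says
    -- nothing about the zeroth power.
    rw [hpow _ (by omega), key, map_smul, smul_eq_mul]
  · rw [hK1, ← h2, hN, ← map_one Matrix.toLinAlgEquiv', ← map_sub, ← map_mul, ← map_pow]
    exact Matrix.trace_toLin'_eq _
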